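/- **Setting.** Let $N\in\{2,3\}$ and let $\Omega\subset\mathbb R^N$ be a nonempty bounded convex polyhedral domain, $\mu>0$. A mesh $\mathcal T_h$ is a conforming subdivision of $\overline\Omega$ into nondegenerate triangles ($N=2$) or tetrahedra ($N=3$) such that each cell has at least one vertex inside $\Omega$; $\mathcal N_h$ is its set of nodes and $\phi_z$ ($z\in\mathcal N_h$) are the continuous, cellwise affine shape functions, $\phi_z(z')=\delta_{zz'}$. The mesh is *quasi-uniform* with constant $\rho>0$ at mesh size $h>0$ if every cell has diameter at most $h\,\mathrm{diam}\,\Omega$ and contains a ball of diameter $\rho h\,\mathrm{diam}\,\Omega$, and *weakly acute* if $\int_\Omega\nabla\phi_z\cdot\nabla\phi_{z'}\,dx\le 0$ for all nodes $z\ne z'$. Let $\mathcal I_h f=\sum_z f(z)\phi_z$ be the nodal interpolation, $(\cdot,\cdot)_2$ the $L^2(\Omega)$ inner product and $(f,g)_h=\sum_z f(z)\cdot g(z)\int_\Omega\phi_z\,dx$. Let $\mathrm{CG}_h$ be the space of continuous, cellwise affine functions $\overline\Omega\to\mathbb R^N$, $\mathrm{CG}_{h,0}$ the subspace with zero values on $\partial\Omega$,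 and $V_h$ the space of continuous, cellwise quadratic functions $v:\overline\Omega\to\mathbb R^N$ with $v=0$ on $\partial\Omega$ and $(\nabla\cdot v,q)_2=0$ for every continuous, cellwise affine $q$ with $\int_\Omega q\,dx=0$. For $f\in\mathrm{CG}_h$ the discrete Laplacian $\Delta_hf\in\mathrm{CG}_{h,0}$ is defined by $$(-\Delta_h f,b)_h=(\nabla f,\nabla b)_2\qquad\text{for all } b\in\mathrm{CG}_{h,0}.$$ For $N=2$, cross products are taken in $\mathbb R^3$ after padding the vectors by zero. $H^1_{0,\sigma}(\Omega)$ is the $H^1(\Omega)$-closure of the smooth, compactly supported, divergence-free vector fields. **Scheme.** Let $v_0\in H^1_{0,\sigma}(\Omega)$ and $d_0\in H^2(\Omega;\mathbb R^N)$, taken as its continuous representative on $\overline\Omega$, with $|d_0|=1$ a.e. in $\Omega$, and let $k>0$. Let $v^0$ be the $L^2(\Omega)$ projection of $v_0$ onto $V_h$ and $d^0=\mathcal I_hd_0$. A solution of the projection scheme for $1\le j\le n$ consists of $v^j\in V_h$ and $\tilde d^j\in\mathcal I_hd_0+\mathrm{CG}_{h,0}$ such that for all $a\in V_h$, $c\in\mathrm{CG}_{h,0}$,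 with $D_tv^j=k^{-1}(v^j-v^{j-1})$, $$(D_tv^j,a)_2+\mu(\nabla v^j,\nabla a)_2+((v^{j-1}\cdot\nabla)v^j,a)_2+\tfrac12((\nabla\cdot v^{j-1})v^j,a)_2-\big([\nabla d^{j-1}]^T\big(d^{j-1}\times\mathcal I_h(d^{j-1}\times\Delta_h\tilde d^j)\big),a\big)_2=0,$$ $$\tfrac1k(\tilde d^j-d^{j-1},c)_h+\big(d^{j-1}\times[\nabla d^{j-1}v^j],\mathcal I_h(d^{j-1}\times c)\big)_2-\big(d^{j-1}\times\Delta_h\tilde d^j,d^{j-1}\times c\big)_h=0,$$ and $d^j=\mathcal I_h\big(\tilde d^j/|\tilde d^j|\big)$. **Lemma (a priori estimates).** Let $\Omega,\mu,\rho$ be as above and $E_0\in\mathbb R$. There is a constant $C>0$, depending only on $N,\Omega,\mu,\rho,E_0$, such that the following holds for all $k,h>0$, all weakly acute meshes that are quasi-uniform with constant $\rho$ at mesh size $h$, all data $v_0,d_0$ as above with $\frac12\|v^0\|_{L^2}^2+\frac12\|\nabla d^0\|_{L^2}^2\le E_0$, all $n\ge1$ and all solutions of the scheme for $1\le j\le n$: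 1. (discrete energy-dissipation inequality) $$\tfrac12\|v^n\|_{L^2}^2+\tfrac12\|\nabla\tilde d^n\|_{L^2}^2+k\sum_{j=1}^n\mu\|\nabla v^j\|_{L^2}^2+k\sum_{j=1}^n\|\mathcal I_h[d^{j-1}\times\Delta_h\tilde d^j]\|_{L^2}^2+\tfrac12\sum_{j=1}^n\|\nabla[\tilde d^j-d^{j-1}]\|_{L^2}^2+\tfrac{k^2}2\sum_{j=1}^n\|D_tv^j\|_{L^2}^2\le\tfrac12\|v^0\|_{L^2}^2+\tfrac12\|\nabla d^0\|_{L^2}^2;$$ 2. $\|\nabla d^n\|_{L^2}^2\le\|\nabla\tilde d^n\|_{L^2}^2$; 3. $|d^n(z)|=1$ for all $z\in\mathcal N_h$; 4. $$k\sum_{j=1}^n\|k^{-1}(\tilde d^j-d^{j-1})\|_{L^{3/2}(\Omega)}^2\le C,\qquad k\sum_{j=1}^n\|k^{-1}(d^j-d^{j-1})\|_{L^{3/2}(\Omega)}^2\le C,\qquad k\sum_{j=1}^n\|D_tv^j\|_{(H^1_{0,\sigma}(\Omega)\cap H^2(\Omega))^*}^2\le C,$$ where the last norm is that of the functional $w\mapsto(D_tv^j,w)_2$,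 and $H^1_{0,\sigma}(\Omega)\cap H^2(\Omega)$ carries the $H^2(\Omega)$ norm. -/

import Mathlib

open MeasureTheory Set
open scoped ENNReal

noncomputable section

namespace NematicFEM

/-- `ℝ^N` with the Euclidean norm. -/
abbrev Pt (N : ℕ) : Type := EuclideanSpace ℝ (Fin N)

/-- The `i`-th unit vector of `ℝ^N`. -/
def unit {N : ℕ} (i : Fin N) : Pt N := EuclideanSpace.single i (1 : ℝ)

/-- A bounded convex polyhedral domain: a nonempty bounded convex open set whose closure is the
convex hull of finitely many points. -/
structure IsConvexPolyhedralDomain {N : ℕ} (Ω : Set (Pt N)) : Prop where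
  isOpen : IsOpen Ω
  nonempty : Ω.Nonempty
  convex : Convex ℝ Ω
  bounded : Bornology.IsBounded Ω
  polyhedral : ∃ s : Finset (Pt N), closure Ω = convexHull ℝ (s : Set (Pt N))

/-! ### Lebesgue and Sobolev spaces on `Ω` -/

section Sobolev

variable {N : ℕ} {F : Type*} [NormedAddCommGroup F] [NormedSpace ℝ F]

/-- Smooth functions with compact support inside `Ω`. -/
def IsTestFunction (Ω : Set (Pt N)) (φ : Pt N → F) : Prop :=
  ContDiff ℝ (⊤ : ℕ∞) φ ∧ HasCompactSupport φ ∧ tsupport φ ⊆ Ω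

/-- `G` is the weak gradient of `f` on `Ω`, both being square integrable;
`G x e` is the weak derivative in direction `e`. -/
def HasWeakGradient (Ω : Set (Pt N)) (f : Pt N → F) (G : Pt N → (Pt N →L[ℝ] F)) : Prop :=
  MemLp f 2 (volume.restrict Ω) ∧ MemLp G 2 (volume.restrict Ω) ∧
    ∀ φ : Pt N → ℝ, IsTestFunction Ω φ → ∀ e : Pt N,
      ∫ x in Ω, (fderiv ℝ φ x e) • f x = - ∫ x in Ω, φ x • G x e

/-- `f ∈ H²(Ω)` with weak gradient `G` and weak Hessian `H`. -/
def HasWeakHessian (Ω : Set (Pt N)) (f : Pt N → F) (G : Pt N → (Pt N →L[ℝ] F))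
    (H : Pt N → (Pt N →L[ℝ] (Pt N →L[ℝ] F))) : Prop :=
  HasWeakGradient Ω f G ∧ HasWeakGradient Ω G H

/-- `f ∈ H²(Ω)`. -/
def MemH2 (Ω : Set (Pt N)) (f : Pt N → F) : Prop :=
  ∃ G H, HasWeakHessian Ω f G H

/-- The `H²(Ω)` norm of a function with weak gradient `G` and weak Hessian `H`. -/
def h2Norm (Ω : Set (Pt N)) (f : Pt N → F) (G : Pt N → (Pt N →L[ℝ] F))
    (H : Pt N → (Pt N →L[ℝ] (Pt N →L[ℝ] F))) : ℝ :=
  Real.sqrt ((∫ x in Ω, ‖f x‖ ^ 2) + (∑ i, ∫ x in Ω, ‖G x (unit i)‖ ^ 2)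
    + ∑ i, ∑ j, ∫ x in Ω, ‖H x (unit i) (unit j)‖ ^ 2)

/-- The divergence (pointwise, through the Fréchet derivative). -/
def divergence (v : Pt N → Pt N) (x : Pt N) : ℝ := ∑ i, (fderiv ℝ v x (unit i)) i

/-- `f ∈ H¹_{0,σ}(Ω)`: the closure in `H¹(Ω)` of the smooth, solenoidal, compactly supported vector
fields. -/
def MemH10Sigma (Ω : Set (Pt N)) (f : Pt N → Pt N) : Prop :=
  ∃ G : Pt N → (Pt N →L[ℝ] Pt N), HasWeakGradient Ω f G ∧
    ∀ ε : ℝ≥0∞, 0 < ε → ∃ φ : Pt N → Pt N, IsTestFunction Ω φ ∧ (∀ x, divergence φ x = 0) ∧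
      eLpNorm (fun x => φ x - f x) 2 (volume.restrict Ω) < ε ∧
      eLpNorm (fun x => fderiv ℝ φ x - G x) 2 (volume.restrict Ω) < ε

/-- The norm in the dual space of `H¹_{0,σ}(Ω) ∩ H²(Ω)` (normed by the `H²` norm) of the functional
`w ↦ (f, w)_2`. -/
def dualH2Norm (Ω : Set (Pt N)) (f : Pt N → Pt N) : ℝ≥0∞ :=
  ⨆ (w : Pt N → Pt N) (G : Pt N → (Pt N →L[ℝ] Pt N))
    (H : Pt N → (Pt N →L[ℝ] (Pt N →L[ℝ] Pt N)))
    (_ : MemH10Sigma Ω w ∧ HasWeakHessian Ω w G H ∧ h2Norm Ω w G H ≤ 1),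
    ENNReal.ofReal |∫ x in Ω, inner ℝ (f x) (w x)|

/-- The `L²(Ω)` inner product. -/
def l2Inner {V : Type*} [NormedAddCommGroup V] [InnerProductSpace ℝ V]
    (Ω : Set (Pt N)) (f g : Pt N → V) : ℝ :=
  ∫ x in Ω, inner ℝ (f x) (g x)

/-- `(∇f, ∇g)_2`, with the Frobenius product of the gradients. The gradient is the classical one,
which for continuous, piecewise polynomial functions exists almost everywhere and is the weak one. -/
def gradInner {V : Type*} [NormedAddCommGroup V] [InnerProductSpace ℝ V]
    (Ω : Set (Pt N)) (f g : Pt N → V) : ℝ :=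
  ∫ x in Ω, ∑ i, inner ℝ (fderiv ℝ f x (unit i)) (fderiv ℝ g x (unit i))

end Sobolev

/-! ### Cross products in two and three dimensions -/

/-- The embedding of `ℝ^N`, `N = 2, 3`, into `ℝ^3` (padding by zero). -/
def toThree {N : ℕ} (v : Pt N) : Pt 3 :=
  WithLp.toLp 2 (fun i : Fin 3 => if h : (i : ℕ) < N then v ⟨i, h⟩ else 0)

/-- The cross product of two vectors of `ℝ^3`. -/
def cross3 (a b : Pt 3) : Pt 3 := WithLp.toLp 2 (crossProduct a.ofLp b.ofLp)

/-- The cross product of two vectors of `ℝ^N`, `N = 2, 3`, as a vector of `ℝ^3`. -/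
def cross {N : ℕ} (a b : Pt N) : Pt 3 := cross3 (toThree a) (toThree b)

/-! ### Meshes -/

/-- A conforming subdivision of (the closure of) `Ω` into nondegenerate simplices, each given by its
set of vertices, such that every cell has a node in the interior of the domain. -/
structure Mesh {N : ℕ} (Ω : Set (Pt N)) where
  /-- the cells, given by their sets of vertices -/
  cells : Finset (Finset (Pt N))
  card_cell : ∀ T ∈ cells, T.card = N + 1
  indep : ∀ T ∈ cells, AffineIndependent ℝ ((↑) : T → Pt N)
  conforming : ∀ T ∈ cells, ∀ T' ∈ cells,
    convexHull ℝ (T : Set (Pt N)) ∩ convexHull ℝ (T' : Set (Pt N))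
      ⊆ convexHull ℝ ((T : Set (Pt N)) ∩ (T' : Set (Pt N)))
  cover : ⋃ T ∈ cells, convexHull ℝ (T : Set (Pt N)) = closure Ω
  interior_node : ∀ T ∈ cells, ∃ z ∈ T, z ∈ Ω

namespace Mesh

variable {N : ℕ} {Ω : Set (Pt N)} (𝒯 : Mesh Ω)

open Classical in
/-- The nodes of the mesh. -/
def nodes : Finset (Pt N) := 𝒯.cells.biUnion id

/-- `w` gives the barycentric coordinates of `x` with respect to the vertices of a cell that
contains `x`, and is zero at all other points. -/
def IsBarycentric (x : Pt N) (w : Pt N → ℝ) : Prop :=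
  ∃ T ∈ 𝒯.cells, (∀ y, 0 ≤ w y) ∧ (∀ y, y ∉ T → w y = 0) ∧
    ∑ y ∈ T, w y = 1 ∧ ∑ y ∈ T, w y • y = x

open Classical in
/-- The Lagrangian shape function `φ_z`: continuous, affine on every cell, equal to `1` at `z` and to
`0` at all other nodes. In a conforming mesh the barycentric coordinates of a point do not depend
on the cell. Outside the closed domain the value is irrelevant (and zero). -/
def hat (z x : Pt N) : ℝ :=
  if hx : ∃ w, 𝒯.IsBarycentric x w then Classical.choose hx z else 0

/-- The nodal interpolation `I_h^1`. -/
def interp {V : Type*} [AddCommGroup V] [Module ℝ V] (f : Pt N → V) (x : Pt N) : V :=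
  ∑ z ∈ 𝒯.nodes, 𝒯.hat z x • f z

/-- The mass-lumped inner product `(f, g)_h`. -/
def lumped {V : Type*} [NormedAddCommGroup V] [InnerProductSpace ℝ V] (f g : Pt N → V) : ℝ :=
  ∑ z ∈ 𝒯.nodes, inner ℝ (f z) (g z) * ∫ x in Ω, 𝒯.hat z x

/-- Quasi-uniformity with constant `ρ` at mesh size `h`: every cell has diameter at most
`h · diam Ω` and contains a ball of diameter `ρ · h · diam Ω`. -/
def IsQuasiUniform (ρ h : ℝ) : Prop :=
  ∀ T ∈ 𝒯.cells, Metric.diam (convexHull ℝ (T : Set (Pt N))) ≤ h * Metric.diam Ω ∧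
    ∃ x : Pt N, Metric.closedBall x (ρ * h * Metric.diam Ω / 2) ⊆ convexHull ℝ (T : Set (Pt N))

/-- Weakly acute meshes. -/
def IsWeaklyAcute : Prop :=
  ∀ z ∈ 𝒯.nodes, ∀ z' ∈ 𝒯.nodes, z ≠ z' → gradInner Ω (𝒯.hat z) (𝒯.hat z') ≤ 0

/-! ### Finite element spaces

Finite element functions are represented by functions on `ℝ^N`; only their values on the closure
of `Ω` matter. -/

/-- Continuous functions on the closed domain whose restriction to each cell is a polynomial of
degree at most `r`. -/
def IsPiecewisePoly (r : ℕ) (q : Pt N → ℝ) : Prop :=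
  ContinuousOn q (closure Ω) ∧ ∀ T ∈ 𝒯.cells, ∃ p : MvPolynomial (Fin N) ℝ,
    p.totalDegree ≤ r ∧
      ∀ x ∈ convexHull ℝ (T : Set (Pt N)), q x = MvPolynomial.eval (fun i => x i) p

/-- The director space `[CG_h^1]^N`. -/
def MemCG (d : Pt N → Pt N) : Prop := ∀ i, 𝒯.IsPiecewisePoly 1 (fun x => d x i)

/-- The director space with homogeneous boundary values `[CG_{h,0}^1]^N`. -/
def MemCG0 (d : Pt N → Pt N) : Prop := 𝒯.MemCG d ∧ ∀ x ∈ frontier Ω, d x = 0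

/-- The pressure space `M_h`. -/
def MemPressure (q : Pt N → ℝ) : Prop := 𝒯.IsPiecewisePoly 1 q ∧ ∫ x in Ω, q x = 0

/-- The space `V_h` of discretely divergence-free Taylor--Hood velocities. -/
def MemVelocity (v : Pt N → Pt N) : Prop :=
  (∀ i, 𝒯.IsPiecewisePoly 2 (fun x => v x i)) ∧ (∀ x ∈ frontier Ω, v x = 0) ∧
    ∀ q, 𝒯.MemPressure q → ∫ x in Ω, divergence v x * q x = 0

/-- `v = Q_h f`, the `L²` projection of `f` onto `V_h`. -/
def IsVelocityProjection (f v : Pt N → Pt N) : Prop :=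
  𝒯.MemVelocity v ∧ ∀ a, 𝒯.MemVelocity a → l2Inner Ω v a = l2Inner Ω f a

/-- `L = Δ_h f`, the mass-lumped discrete Laplacian: `L ∈ [CG_{h,0}^1]^N` and
`(-L, b)_h = (∇f, ∇b)_2` for all `b ∈ [CG_{h,0}^1]^N`. -/
def IsDiscreteLaplacian (f L : Pt N → Pt N) : Prop :=
  𝒯.MemCG0 L ∧ ∀ b, 𝒯.MemCG0 b → 𝒯.lumped (fun x => - L x) b = gradInner Ω f b

/-! ### The projection scheme -/

/-- The momentum equation of one time step, tested with `a`. Here `v₀, d₀` are the old velocity and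
director, `v` is the new velocity and `L` the discrete Laplacian of the new, not yet normalized
director. In the last term `[∇d₀]ᵀ` has been moved to the test function, `[∇d₀] a` being the
directional derivative of `d₀` along `a`. -/
def MomentumEq (μ k : ℝ) (v₀ d₀ v L a : Pt N → Pt N) : Prop :=
  l2Inner Ω (fun x => k⁻¹ • (v x - v₀ x)) a + μ * gradInner Ω v a
    + l2Inner Ω (fun x => fderiv ℝ v x (v₀ x)) a
    + 1 / 2 * l2Inner Ω (fun x => divergence v₀ x • v x) a
    - l2Inner Ω (fun x => cross3 (toThree (d₀ x)) (𝒯.interp (fun y => cross (d₀ y) (L y)) x))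
        (fun x => toThree (fderiv ℝ d₀ x (a x))) = 0

/-- The director equation of one time step, tested with `c`; `dt` is the new, not yet normalized
director and `L` its discrete Laplacian. -/
def DirectorEq (k : ℝ) (d₀ v dt L c : Pt N → Pt N) : Prop :=
  1 / k * 𝒯.lumped (fun x => dt x - d₀ x) c
    + l2Inner Ω (fun x => cross (d₀ x) (fderiv ℝ d₀ x (v x)))
        (𝒯.interp (fun y => cross (d₀ y) (c y)))
    - 𝒯.lumped (fun x => cross (d₀ x) (L x)) (fun x => cross (d₀ x) (c x)) = 0

/-- `(v^j, dt^j, d^j)`, `1 ≤ j ≤ n`, is a solution of the first `n` steps of the projection scheme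
with viscosity `μ`, time-step size `k` and initial data `vInit, dInit`. `dt^j` is the director before
and `d^j` the director after the nodal normalization, and `L^j` is the discrete Laplacian of
`dt^j`. The values `dt^0` and `L^0` play no role. -/
structure IsSchemeSolution (μ k : ℝ) (vInit dInit : Pt N → Pt N) (n : ℕ)
    (v dt d L : ℕ → Pt N → Pt N) : Prop where
  initial_velocity : 𝒯.IsVelocityProjection vInit (v 0)
  initial_director : d 0 = 𝒯.interp dInit
  velocity_mem : ∀ j < n, 𝒯.MemVelocity (v (j + 1))
  director_mem : ∀ j < n, 𝒯.MemCG0 (fun x => dt (j + 1) x - 𝒯.interp dInit x)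
  laplacian : ∀ j < n, 𝒯.IsDiscreteLaplacian (dt (j + 1)) (L (j + 1))
  momentum : ∀ j < n, ∀ a, 𝒯.MemVelocity a →
    𝒯.MomentumEq μ k (v j) (d j) (v (j + 1)) (L (j + 1)) a
  director : ∀ j < n, ∀ c, 𝒯.MemCG0 c →
    𝒯.DirectorEq k (d j) (v (j + 1)) (dt (j + 1)) (L (j + 1)) c
  projection : ∀ j < n, d (j + 1) = 𝒯.interp (fun x => ‖dt (j + 1) x‖⁻¹ • dt (j + 1) x)

end Mesh

end NematicFEM

end

open NematicFEM

open scoped NNReal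

set_option linter.unusedSectionVars false

noncomputable section

namespace NematicFEM

/-! ### Barycentric coordinates and shape functions. -/

namespace Mesh

variable {N : ℕ} {Ω : Set (Pt N)} (𝒯 : Mesh Ω)

/-! Energy law. The momentum equation is tested with `v^j` and the director equation with `Δ_h
d̃^j`. Convection drops out because its discrete form is skew-symmetric, the two coupling terms
cancel by the antisymmetry of the triple product, and the mass-lumped Laplacian turns the time
difference of the director into Dirichlet energies (`step_energy`). Consecutive steps can be chained
because normalization does not raise the Dirichlet energy. This has three ingredients. Testing with
the value `d^{j-1}(z)` at a single node shows that the increment at `z` is orthogonal to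
`d^{j-1}(z)`, so that `|d̃^j(z)| ≥ 1` (`one_le_norm_director`); normalization is 1-Lipschitz outside
the open unit ball (`norm_normalize_sub_le`); and on a weakly acute mesh the Dirichlet energy is a
combination of squared nodal differences with nonnegative weights (`gradInner_interp_le`).

Director rate (`director_rate_le`). With `f = d̃^j - d^{j-1}` the nodal test function `|f|^{-1/2} f`
produces the lumped sum of `|f|^{3/2}`. The transport term is estimated by Hölder's inequality with
`∇d ∈ L²`, `v ∈ L⁶` and the test function in `L³`, the elastic term by the dissipation. The bound
concerns nodal values, so it passes to the normalized director, which is nodally no farther from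
`d^{j-1}` than `d̃^j`.

Velocity rate (`velocity_rate_le`). A field `w` in `H¹_{0,σ} ∩ H²` is not an admissible test
function, and no stability of the projection onto `V_h` is used. Instead the test function may
depend on the functional: for `f = D_t v` in `V_h`, `exists_test_function` constructs `a` in `V_h`
with `(f, a) = (f, w)` that is bounded in `L^∞` and `W^{1,4}`. It has the form `a = P + b₀ + s f`.
Here `P` is a nodal interpolant of a smooth approximation of `w`, with boundary nodes set to zero
(`exists_interp`); `b₀` consists of quadratic edge bubbles and restores the discrete divergence
constraint (`exists_quadratic_correction`); the multiple `s f` restores the pairing with `f`. If the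
cells contain balls of radius `r`, then `w - P` is of order `r²` in `L²`, hence so are both
corrections, and inverse estimates (`inverse_estimates`) bound them in the stronger norms.

The analytic background is derived by elementary means: the embedding `H¹₀ ⊂ L⁶` through
mollification, `H¹ ⊂ L⁴` and pointwise `H²` bounds through integrals along rays in the convex
domain, and the smallness of boundary values, instead of a trace theorem, through a Poincaré
inequality near boundary points. -/

lemma weights_unique {T : Finset (Pt N)} (hT : AffineIndependent ℝ ((↑) : T → Pt N))
    {w w' : Pt N → ℝ} (h1 : ∑ y ∈ T, w y = ∑ y ∈ T, w' y)
    (h2 : ∑ y ∈ T, w y • y = ∑ y ∈ T, w' y • y) : ∀ y ∈ T, w y = w' y := by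
  intro y hy
  have := hT.eq_zero_of_sum_eq_zero_subtype (w := fun y => w y - w' y)
    (by simp [Finset.sum_sub_distrib, h1])
    (by simp [sub_smul, Finset.sum_sub_distrib, h2]) y hy
  linarith [this]

lemma exists_weights {T : Finset (Pt N)} {x : Pt N} (hx : x ∈ convexHull ℝ (T : Set (Pt N))) :
    ∃ w : Pt N → ℝ, (∀ y, 0 ≤ w y) ∧ (∀ y, y ∉ T → w y = 0) ∧
      ∑ y ∈ T, w y = 1 ∧ ∑ y ∈ T, w y • y = x := by
  classical
  obtain ⟨w, h0, h1, h2⟩ := Finset.mem_convexHull'.1 hx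
  refine ⟨fun y => if y ∈ T then w y else 0, fun y => ?_, fun y hy => by simp [hy], ?_, ?_⟩
  · by_cases hy : y ∈ T <;> simp [hy, h0]
  · rw [← h1]; exact Finset.sum_congr rfl fun y hy => by simp [hy]
  · rw [← h2]; exact Finset.sum_congr rfl fun y hy => by simp [hy]

/-- By conformity a point of two cells lies in the convex hull of their common vertices. Weights
carried by these vertices are admissible for either cell, and affine independence makes both systems
of coordinates equal to them. Hence the choice made in `hat` is immaterial. -/
lemma weights_eq_of_cells {T T' : Finset (Pt N)} (hT : T ∈ 𝒯.cells) (hT' : T' ∈ 𝒯.cells)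
    {x : Pt N} {w w' : Pt N → ℝ}
    (hw : (∀ y, 0 ≤ w y) ∧ (∀ y, y ∉ T → w y = 0) ∧ ∑ y ∈ T, w y = 1 ∧ ∑ y ∈ T, w y • y = x)
    (hw' : (∀ y, 0 ≤ w' y) ∧ (∀ y, y ∉ T' → w' y = 0) ∧
      ∑ y ∈ T', w' y = 1 ∧ ∑ y ∈ T', w' y • y = x) : w = w' := by
  classical
  have hx : x ∈ convexHull ℝ (T : Set (Pt N)) :=
    Finset.mem_convexHull'.2 ⟨w, fun y _ => hw.1 y, hw.2.2.1, hw.2.2.2⟩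
  have hx' : x ∈ convexHull ℝ (T' : Set (Pt N)) :=
    Finset.mem_convexHull'.2 ⟨w', fun y _ => hw'.1 y, hw'.2.2.1, hw'.2.2.2⟩
  have h := 𝒯.conforming T hT T' hT' ⟨hx, hx'⟩
  rw [← Finset.coe_inter] at h
  obtain ⟨u, -, u0, u1, u2⟩ := exists_weights h
  have key : ∀ {S : Finset (Pt N)} {w : Pt N → ℝ}, AffineIndependent ℝ ((↑) : S → Pt N) →
      T ∩ T' ⊆ S → (∀ y, y ∉ S → w y = 0) → ∑ y ∈ S, w y = 1 → ∑ y ∈ S, w y • y = x →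
      w = u := by
    intro S w hS hsub w0 w1 w2
    have e1 : ∑ y ∈ S, u y = 1 := by
      rw [← u1]; exact (Finset.sum_subset hsub fun y _ hy => u0 y hy).symm
    have e2 : ∑ y ∈ S, u y • y = x := by
      rw [← u2]; exact (Finset.sum_subset hsub fun y _ hy => by simp [u0 y hy]).symm
    funext y
    by_cases hy : y ∈ S
    · exact weights_unique hS (w1.trans e1.symm) (w2.trans e2.symm) y hy
    · rw [w0 y hy, u0 y fun h => hy (hsub h)]
  rw [key (𝒯.indep T hT) Finset.inter_subset_left hw.2.1 hw.2.2.1 hw.2.2.2,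
    key (𝒯.indep T' hT') Finset.inter_subset_right hw'.2.1 hw'.2.2.1 hw'.2.2.2]

variable {𝒯}

/-- Any cell containing the point may be used to compute `hat`; the later properties of the shape
functions all come from this one. -/
lemma hat_spec {T : Finset (Pt N)} (hT : T ∈ 𝒯.cells) {x : Pt N}
    (hx : x ∈ convexHull ℝ (T : Set (Pt N))) :
    (∀ y, 0 ≤ 𝒯.hat y x) ∧ (∀ y, y ∉ T → 𝒯.hat y x = 0) ∧
      ∑ y ∈ T, 𝒯.hat y x = 1 ∧ ∑ y ∈ T, 𝒯.hat y x • y = x := by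
  obtain ⟨w, hw⟩ := exists_weights hx
  have hex : ∃ w, 𝒯.IsBarycentric x w := ⟨w, T, hT, hw⟩
  have e : (fun z => 𝒯.hat z x) = w := by
    obtain ⟨T', hT', hw'⟩ := Classical.choose_spec hex
    rw [← 𝒯.weights_eq_of_cells hT' hT hw' hw]
    funext z
    simp [hat, hex]
  have e' : ∀ z, 𝒯.hat z x = w z := fun z => congrFun e z
  simpa only [e'] using hw

lemma cell_subset {T : Finset (Pt N)} (hT : T ∈ 𝒯.cells) :
    convexHull ℝ (T : Set (Pt N)) ⊆ closure Ω := by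
  rw [← 𝒯.cover]; exact fun x hx => mem_iUnion₂.2 ⟨T, hT, hx⟩

lemma exists_cell {x : Pt N} (hx : x ∈ closure Ω) :
    ∃ T ∈ 𝒯.cells, x ∈ convexHull ℝ (T : Set (Pt N)) := by
  rw [← 𝒯.cover] at hx; simpa using hx

lemma mem_nodes {z : Pt N} : z ∈ 𝒯.nodes ↔ ∃ T ∈ 𝒯.cells, z ∈ T := by
  simp [nodes]

lemma mem_nodes_of_mem {T : Finset (Pt N)} (hT : T ∈ 𝒯.cells) {z : Pt N} (hz : z ∈ T) :
    z ∈ 𝒯.nodes := mem_nodes.2 ⟨T, hT, hz⟩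

lemma vertex_mem {T : Finset (Pt N)} {z : Pt N} (hz : z ∈ T) :
    z ∈ convexHull ℝ (T : Set (Pt N)) := subset_convexHull ℝ _ hz

lemma node_mem_closure {z : Pt N} (hz : z ∈ 𝒯.nodes) : z ∈ closure Ω := by
  obtain ⟨T, hT, h⟩ := mem_nodes.1 hz
  exact cell_subset hT (vertex_mem h)

lemma hat_nonneg (z : Pt N) {x : Pt N} (hx : x ∈ closure Ω) : 0 ≤ 𝒯.hat z x := by
  obtain ⟨T, hT, h⟩ := 𝒯.exists_cell hx
  exact (hat_spec hT h).1 z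

lemma sum_cell_eq_sum_nodes {V : Type*} [AddCommGroup V] [Module ℝ V] {T : Finset (Pt N)}
    (hT : T ∈ 𝒯.cells) {x : Pt N} (hx : x ∈ convexHull ℝ (T : Set (Pt N))) (f : Pt N → V) :
    ∑ z ∈ 𝒯.nodes, 𝒯.hat z x • f z = ∑ z ∈ T, 𝒯.hat z x • f z :=
  (Finset.sum_subset (fun _ hz => mem_nodes_of_mem hT hz)
    fun z _ hz => by rw [(hat_spec hT hx).2.1 z hz, zero_smul]).symm

lemma interp_eq {V : Type*} [AddCommGroup V] [Module ℝ V] {T : Finset (Pt N)}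
    (hT : T ∈ 𝒯.cells) {x : Pt N} (hx : x ∈ convexHull ℝ (T : Set (Pt N))) (f : Pt N → V) :
    𝒯.interp f x = ∑ z ∈ T, 𝒯.hat z x • f z := sum_cell_eq_sum_nodes hT hx f

lemma sum_hat {x : Pt N} (hx : x ∈ closure Ω) : ∑ z ∈ 𝒯.nodes, 𝒯.hat z x = 1 := by
  obtain ⟨T, hT, h⟩ := 𝒯.exists_cell hx
  have := sum_cell_eq_sum_nodes hT h (fun _ => (1 : ℝ))
  simp only [smul_eq_mul, mul_one] at this
  rw [this, (hat_spec hT h).2.2.1]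

lemma hat_le_one (z : Pt N) {x : Pt N} (hx : x ∈ closure Ω) : 𝒯.hat z x ≤ 1 := by
  obtain ⟨T, hT, h⟩ := 𝒯.exists_cell hx
  by_cases hz : z ∈ T
  · rw [← (hat_spec hT h).2.2.1]
    exact Finset.single_le_sum (f := fun z => 𝒯.hat z x) (fun y _ => (hat_spec hT h).1 y) hz
  · rw [(hat_spec hT h).2.1 z hz]; exact zero_le_one

lemma hat_node {z z' : Pt N} (hz' : z' ∈ 𝒯.nodes) [Decidable (z = z')] :
    𝒯.hat z z' = if z = z' then 1 else 0 := by
  classical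
  obtain ⟨T, hT, h⟩ := mem_nodes.1 hz'
  have hs := hat_spec hT (vertex_mem h)
  have := weights_unique (𝒯.indep T hT) (w := fun z => 𝒯.hat z z')
    (w' := fun z => if z = z' then 1 else 0) (by simp [hs.2.2.1, h]) (by simp [hs.2.2.2, h])
  by_cases hz : z ∈ T
  · have h1 := this z hz
    rw [h1]; split_ifs <;> rfl
  · rw [hs.2.1 z hz, if_neg]; rintro rfl; exact hz h

lemma interp_node {V : Type*} [AddCommGroup V] [Module ℝ V] (f : Pt N → V) {z : Pt N}
    (hz : z ∈ 𝒯.nodes) : 𝒯.interp f z = f z := by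
  classical
  rw [interp, Finset.sum_eq_single z]
  · rw [hat_node hz]; simp
  · intro b _ hb; rw [hat_node hz]; simp [hb]
  · exact fun h => absurd hz h

/-- The hat functions are affine on every cell. -/
lemma hat_affine {T : Finset (Pt N)} (hT : T ∈ 𝒯.cells) (z : Pt N) :
    ∃ (c : ℝ) (A : Pt N →L[ℝ] ℝ), ∀ x ∈ convexHull ℝ (T : Set (Pt N)), 𝒯.hat z x = c + A x := by
  classical
  by_cases hz : z ∈ T
  -- The `N + 1` independent vertices form an affine basis, and on the cell the shape function is
  -- the corresponding affine coordinate.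
  · have hspan : affineSpan ℝ (range ((↑) : T → Pt N)) = ⊤ := by
      rw [(𝒯.indep T hT).affineSpan_eq_top_iff_card_eq_finrank_add_one]
      simp [𝒯.card_cell T hT]
    let b : AffineBasis T ℝ (Pt N) := ⟨_, 𝒯.indep T hT, hspan⟩
    have hb : ∀ i : T, b i = i := fun i => rfl
    have hrange : range b = (T : Set (Pt N)) := by
      ext y; simp [hb]
    refine ⟨b.coord ⟨z, hz⟩ 0, (b.coord ⟨z, hz⟩).linear.toContinuousLinearMap, fun x hx => ?_⟩
    have h1 := hat_spec hT hx
    have h2 : ∑ i : T, b.coord i x = 1 := b.sum_coord_apply_eq_one x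
    have h3 : ∑ i : T, b.coord i x • b i = x := b.linear_combination_coord_eq_self x
    have e := weights_unique (𝒯.indep T hT) (w := fun z => 𝒯.hat z x)
      (w' := fun y => if h : y ∈ T then b.coord ⟨y, h⟩ x else 0)
      (by
        rw [h1.2.2.1, ← Finset.sum_coe_sort, ← h2]
        exact Finset.sum_congr rfl fun i _ => by simp)
      (by
        rw [h1.2.2.2, ← Finset.sum_coe_sort]
        conv_lhs => rw [← h3]
        exact Finset.sum_congr rfl fun i _ => by simp [hb]) z hz
    simp only [hz, dite_true] at e
    rw [e]
    have := (b.coord ⟨z, hz⟩).map_vadd 0 x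
    simp only [vadd_eq_add, add_zero] at this
    rw [this]; simp [add_comm]
  · exact ⟨0, 0, fun x hx => by simp [(hat_spec hT hx).2.1 z hz]⟩

lemma isCompact_cell (T : Finset (Pt N)) : IsCompact (convexHull ℝ (T : Set (Pt N))) :=
  T.finite_toSet.isCompact_convexHull ℝ

lemma continuousOn_of_cells {F : Type*} [TopologicalSpace F] {f : Pt N → F}
    (h : ∀ T ∈ 𝒯.cells, ContinuousOn f (convexHull ℝ (T : Set (Pt N)))) :
    ContinuousOn f (closure Ω) := by
  rw [← 𝒯.cover]
  have e : (⋃ T ∈ 𝒯.cells, convexHull ℝ (T : Set (Pt N)))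
      = ⋃ T : 𝒯.cells, convexHull ℝ ((T : Finset (Pt N)) : Set (Pt N)) := by
    ext; simp
  rw [e]
  exact (locallyFinite_of_finite _).continuousOn_iUnion
    (fun T => (isCompact_cell T.1).isClosed) fun T => h T.1 T.2

lemma continuousOn_hat (z : Pt N) : ContinuousOn (𝒯.hat z) (closure Ω) := by
  refine continuousOn_of_cells (𝒯 := 𝒯) fun T hT => ?_
  obtain ⟨c, A, h⟩ := 𝒯.hat_affine hT z
  exact ContinuousOn.congr (by fun_prop) h

/-- An affine function on a cell is determined by its values at the vertices. -/
lemma sum_hat_affine {V : Type*} [NormedAddCommGroup V] [NormedSpace ℝ V] {T : Finset (Pt N)}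
    (hT : T ∈ 𝒯.cells) {x : Pt N} (hx : x ∈ convexHull ℝ (T : Set (Pt N))) (c : V)
    (A : Pt N →L[ℝ] V) : ∑ z ∈ T, 𝒯.hat z x • (c + A z) = c + A x := by
  have h := hat_spec hT hx
  simp_rw [smul_add, Finset.sum_add_distrib, ← Finset.sum_smul, h.2.2.1, one_smul]
  conv_rhs => rw [← h.2.2.2, map_sum]
  simp

/-- At a boundary point only the hat functions of boundary nodes do not vanish. -/
lemma hat_eq_zero_of_frontier (hΩ : IsConvexPolyhedralDomain Ω) {x z : Pt N}
    (hx : x ∈ frontier Ω) (hz : z ∈ Ω) : 𝒯.hat z x = 0 := by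
  have hxc : x ∈ closure Ω := frontier_subset_closure hx
  by_contra hne
  obtain ⟨T, hT, h⟩ := 𝒯.exists_cell hxc
  have hs := hat_spec hT h
  have hzT : z ∈ T := by by_contra h'; exact hne (hs.2.1 z h')
  set a := 𝒯.hat z x
  have ha0 : 0 < a := lt_of_le_of_ne (hs.1 z) (Ne.symm hne)
  have ha1 : a ≤ 1 := hat_le_one z hxc
  have hnot : x ∉ Ω := by
    rw [hΩ.isOpen.frontier_eq] at hx; exact hx.2
  classical
  have e1 : ∑ y ∈ T.erase z, 𝒯.hat y x = 1 - a := by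
    rw [← hs.2.2.1, ← Finset.add_sum_erase T _ hzT]; simp [a]
  have e2 : x = a • z + ∑ y ∈ T.erase z, 𝒯.hat y x • y := by
    rw [Finset.add_sum_erase T (fun y => 𝒯.hat y x • y) hzT, hs.2.2.2]
  -- Weight `1` would make the boundary point equal to `z`. Otherwise it is a convex combination,
  -- with positive weight on `z`, of an interior point and a point of the closure, hence an interior
  -- point of the convex set.
  rcases ha1.eq_or_lt with h1 | h1
  · have : ∀ y ∈ T.erase z, 𝒯.hat y x = 0 := by
      rw [h1, sub_self] at e1
      exact (Finset.sum_eq_zero_iff_of_nonneg fun y _ => hs.1 y).1 e1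
    rw [Finset.sum_congr rfl (fun y hy => by rw [this y hy, zero_smul]), h1] at e2
    simp at e2
    exact hnot (e2 ▸ hz)
  · have hy : (T.erase z).centerMass (fun y => 𝒯.hat y x) id ∈ closure Ω := by
      refine hΩ.convex.closure.centerMass_mem (fun y _ => hs.1 y) (by rw [e1]; linarith) ?_
      intro y hy
      exact cell_subset hT (vertex_mem (Finset.mem_of_mem_erase hy))
    have e3 : x = a • z + (1 - a) • (T.erase z).centerMass (fun y => 𝒯.hat y x) id := by
      rw [Finset.centerMass, e1, smul_smul, mul_inv_cancel₀ (by linarith), one_smul]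
      exact e2
    have := hΩ.convex.combo_interior_closure_mem_interior (x := z)
      (by rwa [hΩ.isOpen.interior_eq]) hy ha0 (by linarith : 0 ≤ 1 - a) (by ring)
    rw [hΩ.isOpen.interior_eq, ← e3] at this
    exact hnot this

end Mesh

/-! ### Lipschitz functions on the closed domain -/

section Lip

variable {N : ℕ} {Ω : Set (Pt N)} {F : Type*} [NormedAddCommGroup F] [NormedSpace ℝ F]
  {G : Type*} [NormedAddCommGroup G] [NormedSpace ℝ G]
  {H : Type*} [NormedAddCommGroup H] [NormedSpace ℝ H]

/-- Lipschitz continuity on the closed domain. -/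
def IsLip (Ω : Set (Pt N)) (f : Pt N → F) : Prop := ∃ K : ℝ≥0, LipschitzOnWith K f (closure Ω)

lemma isLip_of_le {f : Pt N → F} (K : ℝ)
    (h : ∀ x ∈ closure Ω, ∀ y ∈ closure Ω, ‖f x - f y‖ ≤ K * ‖x - y‖) : IsLip Ω f :=
  ⟨K.toNNReal, LipschitzOnWith.of_dist_le_mul fun x hx y hy => by
    rw [dist_eq_norm, dist_eq_norm]
    exact (h x hx y hy).trans (by gcongr; exact Real.le_coe_toNNReal K)⟩

lemma IsLip.exists_le {f : Pt N → F} (h : IsLip Ω f) : ∃ K : ℝ, 0 ≤ K ∧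
    ∀ x ∈ closure Ω, ∀ y ∈ closure Ω, ‖f x - f y‖ ≤ K * ‖x - y‖ := by
  obtain ⟨K, hK⟩ := h
  exact ⟨K, K.2, fun x hx y hy => by simpa [dist_eq_norm] using hK.dist_le_mul x hx y hy⟩

lemma IsLip.continuousOn {f : Pt N → F} (h : IsLip Ω f) : ContinuousOn f (closure Ω) := by
  obtain ⟨K, hK⟩ := h; exact hK.continuousOn

lemma IsLip.bounded (hb : Bornology.IsBounded Ω) {f : Pt N → F} (h : IsLip Ω f) :
    ∃ M : ℝ, 0 ≤ M ∧ ∀ x ∈ closure Ω, ‖f x‖ ≤ M := by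
  have hc : IsCompact (closure Ω) := hb.isCompact_closure
  obtain ⟨M, hM⟩ := hc.exists_bound_of_continuousOn h.continuousOn
  exact ⟨max M 0, le_max_right _ _, fun x hx => (hM x hx).trans (le_max_left _ _)⟩

lemma isLip_const (c : F) : IsLip Ω (fun _ => c) := isLip_of_le 0 (by simp)

lemma IsLip.add {f g : Pt N → F} (hf : IsLip Ω f) (hg : IsLip Ω g) :
    IsLip Ω (fun x => f x + g x) := by
  obtain ⟨K, -, hK⟩ := hf.exists_le
  obtain ⟨K', -, hK'⟩ := hg.exists_le
  refine isLip_of_le (K + K') fun x hx y hy => ?_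
  rw [add_sub_add_comm, add_mul]
  exact (norm_add_le _ _).trans (add_le_add (hK x hx y hy) (hK' x hx y hy))

lemma IsLip.clm_comp (A : F →L[ℝ] G) {f : Pt N → F} (hf : IsLip Ω f) :
    IsLip Ω (fun x => A (f x)) := by
  obtain ⟨K, hK0, hK⟩ := hf.exists_le
  refine isLip_of_le (‖A‖ * K) fun x hx y hy => ?_
  rw [← map_sub, mul_assoc]
  exact (A.le_opNorm _).trans (by gcongr; exact hK x hx y hy)

lemma IsLip.bilin (hb : Bornology.IsBounded Ω) (B : F →L[ℝ] G →L[ℝ] H) {f : Pt N → F}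
    {g : Pt N → G} (hf : IsLip Ω f) (hg : IsLip Ω g) : IsLip Ω (fun x => B (f x) (g x)) := by
  obtain ⟨K, hK0, hK⟩ := hf.exists_le
  obtain ⟨K', hK0', hK'⟩ := hg.exists_le
  obtain ⟨M, hM0, hM⟩ := hf.bounded hb
  obtain ⟨M', hM0', hM'⟩ := hg.bounded hb
  refine isLip_of_le (‖B‖ * (M * K') + ‖B‖ * (K * M')) fun x hx y hy => ?_
  have : B (f x) (g x) - B (f y) (g y) = B (f x) (g x - g y) + B (f x - f y) (g y) := by
    simp
  rw [this]
  refine (norm_add_le _ _).trans ?_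
  have h1 := (B.le_opNorm₂ (f x) (g x - g y))
  have h2 := (B.le_opNorm₂ (f x - f y) (g y))
  have h3 : ‖B‖ * ‖f x‖ * ‖g x - g y‖ ≤ ‖B‖ * M * (K' * ‖x - y‖) := by
    gcongr
    · exact hM x hx
    · exact hK' x hx y hy
  have h4 : ‖B‖ * ‖f x - f y‖ * ‖g y‖ ≤ ‖B‖ * (K * ‖x - y‖) * M' := by
    gcongr
    · exact hK x hx y hy
    · exact hM' y hy
  nlinarith

lemma IsLip.neg {f : Pt N → F} (hf : IsLip Ω f) : IsLip Ω (fun x => -f x) :=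
  hf.clm_comp (-ContinuousLinearMap.id ℝ F)

lemma IsLip.sub {f g : Pt N → F} (hf : IsLip Ω f) (hg : IsLip Ω g) :
    IsLip Ω (fun x => f x - g x) := by
  simpa [sub_eq_add_neg] using hf.add hg.neg

lemma IsLip.const_smul (c : ℝ) {f : Pt N → F} (hf : IsLip Ω f) : IsLip Ω (fun x => c • f x) :=
  hf.clm_comp (c • ContinuousLinearMap.id ℝ F)

lemma IsLip.smul (hb : Bornology.IsBounded Ω) {f : Pt N → ℝ} {g : Pt N → F} (hf : IsLip Ω f)
    (hg : IsLip Ω g) : IsLip Ω (fun x => f x • g x) :=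
  hf.bilin hb (ContinuousLinearMap.lsmul ℝ ℝ) hg

lemma IsLip.mul (hb : Bornology.IsBounded Ω) {f g : Pt N → ℝ} (hf : IsLip Ω f)
    (hg : IsLip Ω g) : IsLip Ω (fun x => f x * g x) := hf.smul hb hg

lemma IsLip.inner (hb : Bornology.IsBounded Ω) {V : Type*} [NormedAddCommGroup V]
    [InnerProductSpace ℝ V] {f g : Pt N → V} (hf : IsLip Ω f) (hg : IsLip Ω g) :
    IsLip Ω (fun x => inner ℝ (f x) (g x)) :=
  hf.bilin hb (innerSL ℝ) hg

lemma isLip_sum {ι : Type*} (s : Finset ι) {f : ι → Pt N → F} (h : ∀ i ∈ s, IsLip Ω (f i)) :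
    IsLip Ω (fun x => ∑ i ∈ s, f i x) := by
  classical
  induction s using Finset.induction_on with
  | empty => simpa using isLip_const (Ω := Ω) (0 : F)
  | insert a s ha ih =>
    simp_rw [Finset.sum_insert ha]
    exact (h a (Finset.mem_insert_self _ _)).add
      (ih fun i hi => h i (Finset.mem_insert_of_mem hi))

/-- A Lipschitz function on a compact cover by finitely many closed sets of a convex set is
Lipschitz with the same constant. -/
lemma isLip_of_cells (hconv : Convex ℝ Ω) (𝒯 : Mesh Ω) {f : Pt N → F}
    (hf : ContinuousOn f (closure Ω))
    (h : ∀ T ∈ 𝒯.cells, ∃ K : ℝ, ∀ x ∈ convexHull ℝ (T : Set (Pt N)),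
      ∀ y ∈ convexHull ℝ (T : Set (Pt N)), ‖f x - f y‖ ≤ K * ‖x - y‖) : IsLip Ω f := by
  classical
  choose! K hK using h
  -- Any common upper bound of the cell constants serves; the `K T` are not known to be nonnegative,
  -- whence the absolute values.
  set M : ℝ := ∑ T ∈ 𝒯.cells, |K T|
  have hM : ∀ T ∈ 𝒯.cells, K T ≤ M := fun T hT =>
    (le_abs_self _).trans (Finset.single_le_sum (f := fun T => |K T|) (fun _ _ => abs_nonneg _) hT)
  refine isLip_of_le M fun x hx y hy => ?_
  set ℓ : ℝ → Pt N := fun t => y + t • (x - y) with hℓ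
  have hmem : ∀ t ∈ Icc (0 : ℝ) 1, ℓ t ∈ closure Ω := fun t ht => by
    have := hconv.closure hy hx (sub_nonneg.2 ht.2) ht.1 (by ring)
    convert this using 1
    simp [hℓ]; module
  have hℓc : Continuous ℓ := by fun_prop
  have hsub : ∀ s t, ‖ℓ s - ℓ t‖ = |s - t| * ‖x - y‖ := fun s t => by
    rw [← Real.norm_eq_abs, ← norm_smul]; congr 1; simp [hℓ]; module
  have hgc : ContinuousOn (fun t => f (ℓ t) - f y) (Icc 0 1) :=
    (hf.comp hℓc.continuousOn hmem).sub continuousOn_const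
  -- A mean value inequality along the segment in Dini form. It asks only that right difference
  -- quotients be small arbitrarily close to `t`, so the way in which the segment crosses the cells
  -- does not matter.
  have key := image_le_of_liminf_slope_right_le_deriv_boundary (a := 0) (b := 1)
    (f := fun t => ‖f (ℓ t) - f y‖) (B := fun t => (M * ‖x - y‖) * t)
    (B' := fun _ => M * ‖x - y‖) hgc.norm (by simp [hℓ]) (by fun_prop)
    (fun t _ => by simpa using ((hasDerivAt_id t).const_mul (M * ‖x - y‖)).hasDerivWithinAt)
    (by
      intro t ht r hr
      -- some cell contains points of the segment arbitrarily close to `ℓ t` from the right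
      have hev : ∀ᶠ s in nhdsWithin t (Ioi t), ∃ T ∈ 𝒯.cells,
          ℓ s ∈ convexHull ℝ (T : Set (Pt N)) := by
        filter_upwards [Ioo_mem_nhdsGT ht.2] with s hs
        exact 𝒯.exists_cell (hmem s ⟨ht.1.trans hs.1.le, hs.2.le⟩)
      have hfr : ∃ T ∈ 𝒯.cells, ∃ᶠ s in nhdsWithin t (Ioi t),
          ℓ s ∈ convexHull ℝ (T : Set (Pt N)) := by
        by_contra hcon
        push Not at hcon
        have : ∀ᶠ s in nhdsWithin t (Ioi t), ∀ T ∈ 𝒯.cells,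
            ℓ s ∉ convexHull ℝ (T : Set (Pt N)) :=
          (Filter.eventually_all_finset _).2 fun T hT => by
            simpa using hcon T hT
        obtain ⟨s, ⟨T, hT, h1⟩, h2⟩ := (hev.and this).exists
        exact h2 T hT h1
      obtain ⟨T, hT, hfreq⟩ := hfr
      -- Cells are closed: one that is met arbitrarily close to the right of `t` also contains `ℓ
      -- t`, so its Lipschitz bound applies to both points.
      have htT : ℓ t ∈ convexHull ℝ (T : Set (Pt N)) := by
        have : t ∈ closure {s | ℓ s ∈ convexHull ℝ (T : Set (Pt N))} :=
          mem_closure_iff_frequently.2 (hfreq.filter_mono nhdsWithin_le_nhds)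
        rwa [IsClosed.closure_eq] at this
        exact (Mesh.isCompact_cell T).isClosed.preimage hℓc
      refine (hfreq.and_eventually self_mem_nhdsWithin).mono fun s hs => ?_
      have hst : 0 < s - t := sub_pos.2 hs.2
      rw [slope_def_field]
      refine lt_of_le_of_lt ?_ hr
      rw [div_le_iff₀ hst]
      have h1 := hK T hT _ hs.1 _ htT
      have h2 : ‖f (ℓ s) - f y‖ - ‖f (ℓ t) - f y‖ ≤ ‖f (ℓ s) - f (ℓ t)‖ := by
        have := norm_sub_norm_le (f (ℓ s) - f y) (f (ℓ t) - f y)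
        rwa [sub_sub_sub_cancel_right] at this
      rw [hsub, abs_of_pos hst] at h1
      have h3 : K T * ((s - t) * ‖x - y‖) ≤ M * ((s - t) * ‖x - y‖) := by
        gcongr; exact hM T hT
      linarith)
  have := key (right_mem_Icc.2 zero_le_one)
  simpa [hℓ] using this

end Lip

/-! ### Piecewise polynomial functions -/

section Poly

variable {N : ℕ}

lemma eval_monomial_affine (m : Fin N →₀ ℕ) (hm : m.degree ≤ 1) :
    ∃ (c : ℝ) (A : Pt N →L[ℝ] ℝ), ∀ x : Pt N,
      MvPolynomial.eval (fun i => x i) (MvPolynomial.monomial m (1 : ℝ)) = c + A x := by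
  rcases Nat.le_one_iff_eq_zero_or_eq_one.1 hm with h | h
  · rw [Finsupp.degree_eq_zero_iff] at h
    exact ⟨1, 0, fun x => by simp [h]⟩
  · obtain ⟨i, rfl⟩ : ∃ i, m = Finsupp.single i 1 := by
      have h0 : m ≠ 0 := by rintro rfl; simp at h
      obtain ⟨i, hi⟩ := Finsupp.ne_iff.1 h0
      have hi1 : Finsupp.single i 1 ≤ m := by
        rw [Finsupp.single_le_iff]; exact Nat.one_le_iff_ne_zero.2 hi
      obtain ⟨m', rfl⟩ := exists_add_of_le hi1
      rw [map_add, Finsupp.degree_single, Nat.add_eq_left, Finsupp.degree_eq_zero_iff] at h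
      exact ⟨i, by rw [h, add_zero]⟩
    exact ⟨0, EuclideanSpace.proj i, fun x => by simp [MvPolynomial.eval_monomial]⟩

/-- Splitting off one variable leaves an affine monomial; the product with that variable gives the
linear and the bilinear part. Symmetry of `B` is never needed. -/
lemma eval_monomial_quadratic (m : Fin N →₀ ℕ) (hm : m.degree ≤ 2) :
    ∃ (c : ℝ) (A : Pt N →L[ℝ] ℝ) (B : Pt N →L[ℝ] Pt N →L[ℝ] ℝ), ∀ x : Pt N,
      MvPolynomial.eval (fun i => x i) (MvPolynomial.monomial m (1 : ℝ)) = c + A x + B x x := by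
  by_cases h0 : m = 0
  · exact ⟨1, 0, 0, fun x => by simp [h0]⟩
  obtain ⟨i, hi⟩ := Finsupp.ne_iff.1 h0
  have hi1 : Finsupp.single i 1 ≤ m := by
    rw [Finsupp.single_le_iff]; exact Nat.one_le_iff_ne_zero.2 hi
  obtain ⟨m', rfl⟩ := exists_add_of_le hi1
  obtain ⟨c, A, h⟩ := eval_monomial_affine m' (by
    rw [map_add, Finsupp.degree_single] at hm; omega)
  refine ⟨0, c • EuclideanSpace.proj i,
    (ContinuousLinearMap.lsmul ℝ ℝ ∘L EuclideanSpace.proj i).bilinearComp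
      (ContinuousLinearMap.id ℝ _) A, fun x => ?_⟩
  have : (MvPolynomial.monomial (Finsupp.single i 1 + m') (1 : ℝ))
      = MvPolynomial.X i * MvPolynomial.monomial m' 1 := by
    rw [MvPolynomial.X, MvPolynomial.monomial_mul, one_mul]
  rw [this, map_mul, h, MvPolynomial.eval_X]
  simp
  ring

lemma eval_affine {p : MvPolynomial (Fin N) ℝ} (hp : p.totalDegree ≤ 1) :
    ∃ (c : ℝ) (A : Pt N →L[ℝ] ℝ), ∀ x : Pt N,
      MvPolynomial.eval (fun i => x i) p = c + A x := by
  -- Monomials outside the support receive dummy values, so that `choose` yields total functions of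
  -- `m`.
  have h : ∀ m : Fin N →₀ ℕ, ∃ (c : ℝ) (A : Pt N →L[ℝ] ℝ), m ∈ p.support → ∀ x : Pt N,
      MvPolynomial.eval (fun i => x i) (MvPolynomial.monomial m (1 : ℝ)) = c + A x := by
    intro m
    by_cases hm : m ∈ p.support
    · obtain ⟨c, A, h⟩ := eval_monomial_affine m
        (le_trans (MvPolynomial.le_totalDegree hm) hp)
      exact ⟨c, A, fun _ => h⟩
    · exact ⟨0, 0, fun h => absurd h hm⟩
  choose c A h using h
  refine ⟨∑ m ∈ p.support, p.coeff m * c m, ∑ m ∈ p.support, p.coeff m • A m, fun x => ?_⟩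
  conv_lhs => rw [p.as_sum, map_sum]
  rw [sum_apply, ← Finset.sum_add_distrib]
  refine Finset.sum_congr rfl fun m hm => ?_
  have : MvPolynomial.monomial m (p.coeff m)
      = MvPolynomial.C (p.coeff m) * MvPolynomial.monomial m 1 := by
    rw [MvPolynomial.C_mul_monomial, mul_one]
  rw [this, map_mul, h m hm, MvPolynomial.eval_C]
  simp; ring

lemma eval_quadratic {p : MvPolynomial (Fin N) ℝ} (hp : p.totalDegree ≤ 2) :
    ∃ (c : ℝ) (A : Pt N →L[ℝ] ℝ) (B : Pt N →L[ℝ] Pt N →L[ℝ] ℝ), ∀ x : Pt N,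
      MvPolynomial.eval (fun i => x i) p = c + A x + B x x := by
  have h : ∀ m : Fin N →₀ ℕ, ∃ (c : ℝ) (A : Pt N →L[ℝ] ℝ) (B : Pt N →L[ℝ] Pt N →L[ℝ] ℝ),
      m ∈ p.support → ∀ x : Pt N,
      MvPolynomial.eval (fun i => x i) (MvPolynomial.monomial m (1 : ℝ)) = c + A x + B x x := by
    intro m
    by_cases hm : m ∈ p.support
    · obtain ⟨c, A, B, h⟩ := eval_monomial_quadratic m
        (le_trans (MvPolynomial.le_totalDegree hm) hp)
      exact ⟨c, A, B, fun _ => h⟩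
    · exact ⟨0, 0, 0, fun h => absurd h hm⟩
  choose c A B h using h
  refine ⟨∑ m ∈ p.support, p.coeff m * c m, ∑ m ∈ p.support, p.coeff m • A m,
    ∑ m ∈ p.support, p.coeff m • B m, fun x => ?_⟩
  conv_lhs => rw [p.as_sum, map_sum]
  rw [sum_apply, sum_apply, sum_apply,
    ← Finset.sum_add_distrib, ← Finset.sum_add_distrib]
  refine Finset.sum_congr rfl fun m hm => ?_
  have : MvPolynomial.monomial m (p.coeff m)
      = MvPolynomial.C (p.coeff m) * MvPolynomial.monomial m 1 := by
    rw [MvPolynomial.C_mul_monomial, mul_one]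
  rw [this, map_mul, h m hm, MvPolynomial.eval_C]
  simp; ring

lemma exists_poly_affine (c : ℝ) (A : Pt N →L[ℝ] ℝ) : ∃ p : MvPolynomial (Fin N) ℝ,
    p.totalDegree ≤ 1 ∧ ∀ x : Pt N, MvPolynomial.eval (fun i => x i) p = c + A x := by
  refine ⟨MvPolynomial.C c + ∑ i, MvPolynomial.C (A (unit i)) * MvPolynomial.X i, ?_, fun x => ?_⟩
  · refine (MvPolynomial.totalDegree_add _ _).trans (max_le (by simp) ?_)
    refine (MvPolynomial.totalDegree_finsetSum _ _).trans (Finset.sup_le fun i _ => ?_)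
    refine (MvPolynomial.totalDegree_mul _ _).trans ?_
    simp [MvPolynomial.totalDegree_X]
  · have hx : x = ∑ i, x i • unit i := by
      ext j; simp [unit, Finset.sum_apply, Pi.single_apply]
    conv_rhs => rw [hx, map_sum]
    simp [mul_comm]

namespace Mesh

variable {Ω : Set (Pt N)} {𝒯 : Mesh Ω}

/-- A polynomial of degree two is Lipschitz on each compact cell, and `isLip_of_cells` glues these
bounds by convexity. -/
lemma IsPiecewisePoly.isLip (hconv : Convex ℝ Ω) {r : ℕ} (hr : r ≤ 2) {q : Pt N → ℝ}
    (h : 𝒯.IsPiecewisePoly r q) : IsLip Ω q := by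
  refine isLip_of_cells hconv 𝒯 h.1 fun T hT => ?_
  obtain ⟨p, hp, hq⟩ := h.2 T hT
  obtain ⟨c, A, B, hAB⟩ := eval_quadratic (hp.trans hr)
  obtain ⟨M, hM⟩ := (isCompact_cell T).isBounded.exists_norm_le
  refine ⟨‖A‖ + ‖B‖ * (M + M), fun x hx y hy => ?_⟩
  rw [hq x hx, hq y hy, hAB, hAB]
  have e : c + A x + B x x - (c + A y + B y y) = A (x - y) + B x (x - y) + B (x - y) y := by
    simp; ring
  rw [e]
  refine (norm_add₃_le).trans ?_
  have h1 := A.le_opNorm (x - y)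
  have h2 := (B.le_opNorm₂ x (x - y)).trans
    (by gcongr; exact hM x hx : _ ≤ ‖B‖ * M * ‖x - y‖)
  have h3 := (B.le_opNorm₂ (x - y) y).trans
    (by gcongr; exact hM y hy : _ ≤ ‖B‖ * ‖x - y‖ * M)
  nlinarith

lemma isPiecewisePoly_hat (z : Pt N) : 𝒯.IsPiecewisePoly 1 (𝒯.hat z) := by
  refine ⟨continuousOn_hat z, fun T hT => ?_⟩
  obtain ⟨c, A, h⟩ := 𝒯.hat_affine hT z
  obtain ⟨p, hp, hpe⟩ := exists_poly_affine c A
  exact ⟨p, hp, fun x hx => by rw [h x hx, hpe]⟩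

lemma isLip_hat (hconv : Convex ℝ Ω) (z : Pt N) : IsLip Ω (𝒯.hat z) :=
  (isPiecewisePoly_hat z).isLip hconv one_le_two

lemma isLip_interp (hconv : Convex ℝ Ω) {V : Type*} [NormedAddCommGroup V] [NormedSpace ℝ V]
    (f : Pt N → V) : IsLip Ω (𝒯.interp f) := by
  refine isLip_sum _ fun z _ => ?_
  exact (isLip_hat hconv z).clm_comp ((ContinuousLinearMap.id ℝ ℝ).smulRight (f z))

lemma isLip_of_components {f : Pt N → Pt N} (h : ∀ i, IsLip Ω (fun x => f x i)) : IsLip Ω f := by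
  have : f = fun x => ∑ i, ((ContinuousLinearMap.id ℝ ℝ).smulRight (unit i)) (f x i) := by
    funext x; ext j; simp [unit, Pi.single_apply]
  rw [this]
  exact isLip_sum _ fun i _ => (h i).clm_comp _

lemma MemCG.isLip (hconv : Convex ℝ Ω) {d : Pt N → Pt N} (h : 𝒯.MemCG d) : IsLip Ω d :=
  isLip_of_components fun i => (h i).isLip hconv one_le_two

lemma MemVelocity.isLip (hconv : Convex ℝ Ω) {v : Pt N → Pt N} (h : 𝒯.MemVelocity v) :
    IsLip Ω v :=
  isLip_of_components fun i => (h.1 i).isLip hconv le_rfl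

lemma IsPiecewisePoly.eq_interp {q : Pt N → ℝ} (h : 𝒯.IsPiecewisePoly 1 q) {x : Pt N}
    (hx : x ∈ closure Ω) : 𝒯.interp q x = q x := by
  obtain ⟨T, hT, hxT⟩ := 𝒯.exists_cell hx
  obtain ⟨p, hp, hq⟩ := h.2 T hT
  obtain ⟨c, A, hA⟩ := eval_affine hp
  rw [interp_eq hT hxT, hq x hxT, hA, ← sum_hat_affine hT hxT c A]
  exact Finset.sum_congr rfl fun z hz => by rw [hq z (vertex_mem hz), hA]

lemma interp_apply (f : Pt N → Pt N) (x : Pt N) (i : Fin N) :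
    𝒯.interp f x i = 𝒯.interp (fun y => f y i) x := by
  simp [interp]

lemma MemCG.eq_interp {d : Pt N → Pt N} (h : 𝒯.MemCG d) {x : Pt N}
    (hx : x ∈ closure Ω) : 𝒯.interp d x = d x := by
  ext i; rw [interp_apply]; exact (h i).eq_interp hx

lemma isPiecewisePoly_interp (f : Pt N → ℝ) : 𝒯.IsPiecewisePoly 1 (𝒯.interp f) := by
  refine ⟨?_, fun T hT => ?_⟩
  · exact continuousOn_finsetSum _ fun z _ => (continuousOn_hat z).smul continuousOn_const
  · choose c A hA using fun z => 𝒯.hat_affine hT z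
    obtain ⟨p, hp, hpe⟩ := exists_poly_affine (∑ z ∈ 𝒯.nodes, f z * c z)
      (∑ z ∈ 𝒯.nodes, f z • A z)
    refine ⟨p, hp, fun x hx => ?_⟩
    rw [hpe, sum_apply, ← Finset.sum_add_distrib]
    refine Finset.sum_congr rfl fun z _ => ?_
    rw [hA z x hx]; simp; ring

lemma memCG_interp (f : Pt N → Pt N) : 𝒯.MemCG (𝒯.interp f) := fun i => by
  simp_rw [interp_apply]; exact isPiecewisePoly_interp _

/-- At a boundary point the shape functions of interior nodes vanish, and the boundary nodes carry
the value zero. -/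
lemma interp_frontier_eq_zero (hΩ : IsConvexPolyhedralDomain Ω) {V : Type*} [NormedAddCommGroup V]
    [NormedSpace ℝ V] {f : Pt N → V} (hf : ∀ z ∈ 𝒯.nodes, z ∈ frontier Ω → f z = 0)
    {x : Pt N} (hx : x ∈ frontier Ω) : 𝒯.interp f x = 0 := by
  refine Finset.sum_eq_zero fun z hz => ?_
  by_cases h : z ∈ Ω
  · rw [hat_eq_zero_of_frontier hΩ hx h, zero_smul]
  · rw [hf z hz, smul_zero]
    rw [hΩ.isOpen.frontier_eq]
    exact ⟨node_mem_closure hz, h⟩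

lemma memCG0_interp (hΩ : IsConvexPolyhedralDomain Ω) {f : Pt N → Pt N}
    (hf : ∀ z ∈ 𝒯.nodes, z ∈ frontier Ω → f z = 0) : 𝒯.MemCG0 (𝒯.interp f) :=
  ⟨memCG_interp f, fun _ hx => interp_frontier_eq_zero hΩ hf hx⟩

lemma IsPiecewisePoly.sub {r : ℕ} {q q' : Pt N → ℝ} (h : 𝒯.IsPiecewisePoly r q)
    (h' : 𝒯.IsPiecewisePoly r q') : 𝒯.IsPiecewisePoly r (fun x => q x - q' x) := by
  refine ⟨h.1.sub h'.1, fun T hT => ?_⟩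
  obtain ⟨p, hp, e⟩ := h.2 T hT
  obtain ⟨p', hp', e'⟩ := h'.2 T hT
  exact ⟨p - p', (MvPolynomial.totalDegree_sub _ _).trans (max_le hp hp'),
    fun x hx => by simp only [e x hx, e' x hx, map_sub]⟩

lemma MemCG.sub {d d' : Pt N → Pt N} (h : 𝒯.MemCG d) (h' : 𝒯.MemCG d') :
    𝒯.MemCG (fun x => d x - d' x) := fun i => (h i).sub (h' i)

end Mesh

end Poly

/-! ### Bounded measurable functions on the domain -/

section BM

variable {N : ℕ} {Ω : Set (Pt N)} {F : Type*} [NormedAddCommGroup F] [NormedSpace ℝ F]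
  {G : Type*} [NormedAddCommGroup G] [NormedSpace ℝ G]
  {H : Type*} [NormedAddCommGroup H] [NormedSpace ℝ H]

/-- Bounded measurable functions. -/
def BM (Ω : Set (Pt N)) (f : Pt N → F) : Prop :=
  AEStronglyMeasurable f (volume.restrict Ω) ∧ ∃ M : ℝ, 0 ≤ M ∧ ∀ x ∈ Ω, ‖f x‖ ≤ M

lemma bm_of_le {f : Pt N → F} (hm : AEStronglyMeasurable f (volume.restrict Ω)) (M : ℝ)
    (h : ∀ x ∈ Ω, ‖f x‖ ≤ M) : BM Ω f :=
  ⟨hm, max M 0, le_max_right _ _, fun x hx => (h x hx).trans (le_max_left _ _)⟩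

lemma BM.memLp (hΩ : IsConvexPolyhedralDomain Ω) {f : Pt N → F} (hf : BM Ω f) (p : ℝ≥0∞) :
    MemLp f p (volume.restrict Ω) := by
  have : IsFiniteMeasure (volume.restrict Ω) :=
    ⟨by rw [Measure.restrict_apply_univ]; exact hΩ.bounded.measure_lt_top⟩
  obtain ⟨hm, M, -, hM⟩ := hf
  exact MemLp.of_bound hm M ((ae_restrict_iff' hΩ.isOpen.measurableSet).2 (.of_forall hM))

lemma BM.integrable (hΩ : IsConvexPolyhedralDomain Ω) {f : Pt N → F} (hf : BM Ω f) :
    IntegrableOn f Ω := memLp_one_iff_integrable.1 (hf.memLp hΩ 1)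

lemma BM.add {f g : Pt N → F} (hf : BM Ω f) (hg : BM Ω g) : BM Ω (fun x => f x + g x) := by
  obtain ⟨hm, M, -, hM⟩ := hf
  obtain ⟨hm', M', -, hM'⟩ := hg
  exact bm_of_le (hm.add hm') (M + M') fun x hx =>
    (norm_add_le _ _).trans (add_le_add (hM x hx) (hM' x hx))

lemma BM.clm_comp (A : F →L[ℝ] G) {f : Pt N → F} (hf : BM Ω f) : BM Ω (fun x => A (f x)) := by
  obtain ⟨hm, M, -, hM⟩ := hf
  exact bm_of_le (A.continuous.comp_aestronglyMeasurable hm) (‖A‖ * M) fun x hx =>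
    (A.le_opNorm _).trans (by gcongr; exact hM x hx)

lemma BM.bilin (B : F →L[ℝ] G →L[ℝ] H) {f : Pt N → F} {g : Pt N → G} (hf : BM Ω f)
    (hg : BM Ω g) : BM Ω (fun x => B (f x) (g x)) := by
  obtain ⟨hm, M, h0, hM⟩ := hf
  obtain ⟨hm', M', h0', hM'⟩ := hg
  exact bm_of_le (B.aestronglyMeasurable_comp₂ hm hm') (‖B‖ * M * M') fun x hx =>
    (B.le_opNorm₂ _ _).trans (by gcongr; exacts [hM x hx, hM' x hx])

lemma BM.neg {f : Pt N → F} (hf : BM Ω f) : BM Ω (fun x => -f x) :=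
  hf.clm_comp (-ContinuousLinearMap.id ℝ F)

lemma BM.sub {f g : Pt N → F} (hf : BM Ω f) (hg : BM Ω g) : BM Ω (fun x => f x - g x) := by
  simpa [sub_eq_add_neg] using hf.add hg.neg

lemma BM.const_smul (c : ℝ) {f : Pt N → F} (hf : BM Ω f) : BM Ω (fun x => c • f x) :=
  hf.clm_comp (c • ContinuousLinearMap.id ℝ F)

lemma BM.smul {f : Pt N → ℝ} {g : Pt N → F} (hf : BM Ω f) (hg : BM Ω g) :
    BM Ω (fun x => f x • g x) := hf.bilin (ContinuousLinearMap.lsmul ℝ ℝ) hg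

lemma BM.mul {f g : Pt N → ℝ} (hf : BM Ω f) (hg : BM Ω g) : BM Ω (fun x => f x * g x) :=
  hf.smul hg

lemma BM.inner {V : Type*} [NormedAddCommGroup V] [InnerProductSpace ℝ V] {f g : Pt N → V}
    (hf : BM Ω f) (hg : BM Ω g) : BM Ω (fun x => inner ℝ (f x) (g x)) :=
  hf.bilin (innerSL ℝ) hg

lemma BM.apply {f : Pt N → G →L[ℝ] H} {g : Pt N → G} (hf : BM Ω f) (hg : BM Ω g) :
    BM Ω (fun x => f x (g x)) := hf.bilin (ContinuousLinearMap.id ℝ _) hg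

lemma bm_const (c : F) : BM Ω (fun _ => c) :=
  bm_of_le aestronglyMeasurable_const ‖c‖ fun _ _ => le_rfl

lemma bm_sum {ι : Type*} (s : Finset ι) {f : ι → Pt N → F} (h : ∀ i ∈ s, BM Ω (f i)) :
    BM Ω (fun x => ∑ i ∈ s, f i x) := by
  classical
  induction s using Finset.induction_on with
  | empty => simpa using bm_const (Ω := Ω) (0 : F)
  | insert a s ha ih =>
    simp_rw [Finset.sum_insert ha]
    exact (h a (Finset.mem_insert_self _ _)).add
      (ih fun i hi => h i (Finset.mem_insert_of_mem hi))

lemma IsLip.bm (hΩ : IsConvexPolyhedralDomain Ω) {f : Pt N → F} (hf : IsLip Ω f) : BM Ω f := by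
  obtain ⟨M, -, hM⟩ := hf.bounded hΩ.bounded
  exact bm_of_le ((hf.continuousOn.mono subset_closure).aestronglyMeasurable
    hΩ.isOpen.measurableSet) M fun x hx => hM x (subset_closure hx)

variable [FiniteDimensional ℝ F]

/-- `fderiv` is zero where the derivative does not exist, so the Lipschitz constant bounds it at
every point of the domain. -/
lemma IsLip.bm_fderiv (hΩ : IsConvexPolyhedralDomain Ω) {f : Pt N → F} (hf : IsLip Ω f) :
    BM Ω (fderiv ℝ f) := by
  have : CompleteSpace F := FiniteDimensional.complete ℝ F
  obtain ⟨K, hK⟩ := hf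
  refine bm_of_le (measurable_fderiv ℝ f).aestronglyMeasurable K fun x hx => ?_
  exact norm_fderiv_le_of_lipschitzOn ℝ (hΩ.isOpen.mem_nhds hx) (hK.mono subset_closure)

/-- Rademacher's theorem. -/
lemma IsLip.ae_differentiableAt (hΩ : IsConvexPolyhedralDomain Ω) {f : Pt N → F}
    (hf : IsLip Ω f) : ∀ᵐ x ∂(volume.restrict Ω), DifferentiableAt ℝ f x := by
  obtain ⟨K, hK⟩ := hf
  have h := (hK.mono subset_closure).ae_differentiableWithinAt_of_mem (μ := volume)
  rw [ae_restrict_iff' hΩ.isOpen.measurableSet]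
  filter_upwards [h] with x hx hxΩ
  exact (hx hxΩ).differentiableAt (hΩ.isOpen.mem_nhds hxΩ)

/-- Extension by zero preserves Lipschitz continuity if the function vanishes on the boundary. -/
lemma lipschitzWith_indicator (hΩ : IsConvexPolyhedralDomain Ω) {f : Pt N → F} (hf : IsLip Ω f)
    (h0 : ∀ x ∈ frontier Ω, f x = 0) : ∃ K : ℝ≥0, LipschitzWith K (Ω.indicator f) := by
  obtain ⟨K, hK0, hK⟩ := hf.exists_le
  have key : ∀ x ∈ Ω, ∀ y ∉ Ω, ‖f x‖ ≤ K * ‖x - y‖ := by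
    intro x hx y hy
    -- By connectedness the segment from a point inside to a point outside meets the boundary, where
    -- `f = 0`; comparing with that point bounds `‖f x‖`.
    obtain ⟨p, hp, hpf⟩ : (segment ℝ x y ∩ frontier Ω).Nonempty := by
      by_contra hne
      have hfr : ∀ q ∈ segment ℝ x y, q ∈ closure Ω → q ∈ Ω := fun q hq hc => by
        by_contra hqΩ
        exact hne ⟨q, hq, by rw [hΩ.isOpen.frontier_eq]; exact ⟨hc, hqΩ⟩⟩
      obtain ⟨q, -, h1, h2⟩ := (convex_segment x y).isPreconnected Ω (closure Ω)ᶜ hΩ.isOpen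
        isClosed_closure.isOpen_compl
        (fun q hq => (em (q ∈ closure Ω)).imp (hfr q hq) id)
        ⟨x, left_mem_segment ℝ x y, hx⟩
        ⟨y, right_mem_segment ℝ x y, fun h => hy (hfr y (right_mem_segment ℝ x y) h)⟩
      exact h2 (subset_closure h1)
    have h1 := hK x (subset_closure hx) p (frontier_subset_closure hpf)
    rw [h0 p hpf, sub_zero] at h1
    refine h1.trans ?_
    gcongr
    obtain ⟨a, b, ha, hb, hab, rfl⟩ := hp
    have : x - (a • x + b • y) = b • (x - y) := by
      rw [← eq_sub_iff_add_eq] at hab; rw [hab]; module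
    rw [this, norm_smul, Real.norm_of_nonneg hb]
    exact mul_le_of_le_one_left (norm_nonneg _) (by linarith)
  refine ⟨K.toNNReal, LipschitzWith.of_dist_le_mul fun x y => ?_⟩
  rw [dist_eq_norm, dist_eq_norm, Real.coe_toNNReal K hK0]
  by_cases hx : x ∈ Ω <;> by_cases hy : y ∈ Ω
  · simpa [hx, hy] using hK x (subset_closure hx) y (subset_closure hy)
  · simpa [hx, hy] using key x hx y hy
  · simpa [hx, hy, norm_sub_rev x y] using key y hy x hx
  · simp [hx, hy]; positivity

lemma hasCompactSupport_indicator (hΩ : IsConvexPolyhedralDomain Ω) (f : Pt N → F) :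
    HasCompactSupport (Ω.indicator f) :=
  HasCompactSupport.of_support_subset_isCompact hΩ.bounded.isCompact_closure
    ((Set.support_indicator_subset).trans subset_closure)

/-- Only boundary points are exceptional, and the boundary of a convex set is a null set. -/
lemma fderiv_indicator (hΩ : IsConvexPolyhedralDomain Ω) (f : Pt N → F) :
    ∀ᵐ x, fderiv ℝ (Ω.indicator f) x = Ω.indicator (fderiv ℝ f) x := by
  have h0 : ∀ᵐ x : Pt N, x ∉ frontier Ω :=
    compl_mem_ae_iff.2 (hΩ.convex.addHaar_frontier volume)
  filter_upwards [h0] with x hx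
  by_cases hxΩ : x ∈ Ω
  · rw [indicator_of_mem hxΩ]
    apply Filter.EventuallyEq.fderiv_eq
    filter_upwards [hΩ.isOpen.mem_nhds hxΩ] with y hy
    exact indicator_of_mem hy f
  · have hxc : x ∉ closure Ω := fun h => hx (by rw [hΩ.isOpen.frontier_eq]; exact ⟨h, hxΩ⟩)
    rw [indicator_of_notMem hxΩ]
    have : Ω.indicator f =ᶠ[nhds x] fun _ => 0 := by
      filter_upwards [isClosed_closure.isOpen_compl.mem_nhds hxc] with y hy
      exact indicator_of_notMem (fun h => hy (subset_closure h)) f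
    rw [this.fderiv_eq]; simp

/-- The divergence theorem for Lipschitz functions vanishing on the boundary. -/
lemma integral_fderiv_eq_zero (hΩ : IsConvexPolyhedralDomain Ω) {f : Pt N → ℝ} (hf : IsLip Ω f)
    (h0 : ∀ x ∈ frontier Ω, f x = 0) (e : Pt N) : ∫ x in Ω, fderiv ℝ f x e = 0 := by
  obtain ⟨K, hK⟩ := lipschitzWith_indicator hΩ hf h0
  -- Integration by parts against the constant `1`, whose Lipschitz constant is `0`; the direction
  -- is `-e` because the formula reverses it.
  have h := LipschitzWith.integral_lineDeriv_mul_eq (μ := (volume : Measure (Pt N)))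
    (C := 0) (LipschitzWith.const' (1 : ℝ)) hK (hasCompactSupport_indicator hΩ f) (-e)
  simp only [neg_neg, mul_one] at h
  have h1 : ∀ x : Pt N, lineDeriv ℝ (fun _ : Pt N => (1 : ℝ)) x (-e) = 0 := fun x => by
    simp [lineDeriv]
  simp only [h1, zero_mul, integral_zero] at h
  rw [← integral_indicator hΩ.isOpen.measurableSet, h]
  refine integral_congr_ae ?_
  filter_upwards [fderiv_indicator hΩ f, hK.ae_differentiableAt] with x hx hd
  rw [hd.lineDeriv_eq_fderiv, hx]
  by_cases hxΩ : x ∈ Ω <;> simp [hxΩ]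

/-- Integration by parts for Lipschitz functions, one of which vanishes on the boundary. -/
lemma integral_fderiv_mul (hΩ : IsConvexPolyhedralDomain Ω) {f g : Pt N → ℝ} (hf : IsLip Ω f)
    (hg : IsLip Ω g) (h0 : ∀ x ∈ frontier Ω, f x * g x = 0) (e : Pt N) :
    ∫ x in Ω, fderiv ℝ f x e * g x = - ∫ x in Ω, f x * fderiv ℝ g x e := by
  have h := integral_fderiv_eq_zero hΩ (hf.mul hΩ.bounded hg) h0 e
  have e1 : ∫ x in Ω, fderiv ℝ (fun x => f x * g x) x e
      = ∫ x in Ω, (fderiv ℝ f x e * g x + f x * fderiv ℝ g x e) := by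
    refine integral_congr_ae ?_
    filter_upwards [hf.ae_differentiableAt hΩ, hg.ae_differentiableAt hΩ] with x h1 h2
    rw [fderiv_fun_mul h1 h2]; simp; ring
  rw [e1, integral_add] at h
  · linarith
  · exact (((hf.bm_fderiv hΩ).apply (bm_const e)).mul (hg.bm hΩ)).integrable hΩ
  · exact ((hf.bm hΩ).mul ((hg.bm_fderiv hΩ).apply (bm_const e))).integrable hΩ

end BM

/-! ### Dirichlet and `L²` products, skew-symmetry of convection. -/

section Grad

variable {N : ℕ} {Ω : Set (Pt N)} {V : Type*} [NormedAddCommGroup V] [InnerProductSpace ℝ V]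
  [FiniteDimensional ℝ V]

lemma bm_gradInner (hΩ : IsConvexPolyhedralDomain Ω) {f g : Pt N → V} (hf : IsLip Ω f)
    (hg : IsLip Ω g) :
    BM Ω (fun x => ∑ i, inner ℝ (fderiv ℝ f x (unit i)) (fderiv ℝ g x (unit i))) :=
  bm_sum _ fun _ _ => ((hf.bm_fderiv hΩ).apply (bm_const _)).inner
    ((hg.bm_fderiv hΩ).apply (bm_const _))

lemma gradInner_comm (f g : Pt N → V) : gradInner Ω f g = gradInner Ω g f := by
  simp only [gradInner]
  refine integral_congr_ae (.of_forall fun x => Finset.sum_congr rfl fun _ _ => ?_)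
  exact real_inner_comm _ _

lemma gradInner_add_right (hΩ : IsConvexPolyhedralDomain Ω) {f g g' : Pt N → V} (hf : IsLip Ω f)
    (hg : IsLip Ω g) (hg' : IsLip Ω g') :
    gradInner Ω f (fun x => g x + g' x) = gradInner Ω f g + gradInner Ω f g' := by
  rw [gradInner, gradInner, gradInner, ← integral_add ((bm_gradInner hΩ hf hg).integrable hΩ)
    ((bm_gradInner hΩ hf hg').integrable hΩ)]
  refine integral_congr_ae ?_
  filter_upwards [hg.ae_differentiableAt hΩ, hg'.ae_differentiableAt hΩ] with x h1 h2
  rw [fderiv_fun_add h1 h2, ← Finset.sum_add_distrib]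
  exact Finset.sum_congr rfl fun i _ => by simp [inner_add_right]

lemma gradInner_smul_right (c : ℝ) {f g : Pt N → V} :
    gradInner Ω f (fun x => c • g x) = c * gradInner Ω f g := by
  rw [gradInner, gradInner, ← integral_const_mul]
  refine integral_congr_ae (.of_forall fun x => ?_)
  have : fderiv ℝ (fun x => c • g x) x = c • fderiv ℝ g x :=
    congrFun (fderiv_const_smul_field (f := g) c) x
  simp only [this]
  rw [Finset.mul_sum]
  exact Finset.sum_congr rfl fun i _ => by simp [inner_smul_right]

lemma gradInner_sub_right (hΩ : IsConvexPolyhedralDomain Ω) {f g g' : Pt N → V} (hf : IsLip Ω f)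
    (hg : IsLip Ω g) (hg' : IsLip Ω g') :
    gradInner Ω f (fun x => g x - g' x) = gradInner Ω f g - gradInner Ω f g' := by
  have := gradInner_add_right hΩ hf hg (hg'.const_smul (-1))
  rw [gradInner_smul_right] at this
  simpa [sub_eq_add_neg] using this

lemma gradInner_sub_left (hΩ : IsConvexPolyhedralDomain Ω) {f f' g : Pt N → V} (hf : IsLip Ω f)
    (hf' : IsLip Ω f') (hg : IsLip Ω g) :
    gradInner Ω (fun x => f x - f' x) g = gradInner Ω f g - gradInner Ω f' g := by
  rw [gradInner_comm, gradInner_sub_right hΩ hg hf hf', gradInner_comm, gradInner_comm g]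

lemma gradInner_self_nonneg (f : Pt N → V) : 0 ≤ gradInner Ω f f :=
  integral_nonneg fun _ => Finset.sum_nonneg fun _ _ => real_inner_self_nonneg

lemma l2Inner_self_nonneg (f : Pt N → V) : 0 ≤ l2Inner Ω f f :=
  integral_nonneg fun _ => real_inner_self_nonneg

lemma gradInner_congr (hΩ : IsConvexPolyhedralDomain Ω) {f f' g g' : Pt N → V}
    (h : ∀ x ∈ Ω, f x = f' x) (h' : ∀ x ∈ Ω, g x = g' x) :
    gradInner Ω f g = gradInner Ω f' g' := by
  refine setIntegral_congr_fun hΩ.isOpen.measurableSet fun x hx => ?_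
  have h1 : fderiv ℝ f x = fderiv ℝ f' x := Filter.EventuallyEq.fderiv_eq (by
    filter_upwards [hΩ.isOpen.mem_nhds hx] with y hy using h y hy)
  have h2 : fderiv ℝ g x = fderiv ℝ g' x := Filter.EventuallyEq.fderiv_eq (by
    filter_upwards [hΩ.isOpen.mem_nhds hx] with y hy using h' y hy)
  simp only [h1, h2]

lemma l2Inner_comm (f g : Pt N → V) : l2Inner Ω f g = l2Inner Ω g f := by
  simp only [l2Inner, real_inner_comm]

lemma l2Inner_sub_left (hΩ : IsConvexPolyhedralDomain Ω) {f f' g : Pt N → V} (hf : BM Ω f)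
    (hf' : BM Ω f') (hg : BM Ω g) :
    l2Inner Ω (fun x => f x - f' x) g = l2Inner Ω f g - l2Inner Ω f' g := by
  simp only [l2Inner, inner_sub_left]
  exact integral_sub ((hf.inner hg).integrable hΩ) ((hf'.inner hg).integrable hΩ)

lemma l2Inner_sub_right (hΩ : IsConvexPolyhedralDomain Ω) {f g g' : Pt N → V} (hf : BM Ω f)
    (hg : BM Ω g) (hg' : BM Ω g') :
    l2Inner Ω f (fun x => g x - g' x) = l2Inner Ω f g - l2Inner Ω f g' := by
  rw [l2Inner_comm, l2Inner_sub_left hΩ hg hg' hf, l2Inner_comm, l2Inner_comm g']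

lemma l2Inner_smul_left (c : ℝ) (f g : Pt N → V) :
    l2Inner Ω (fun x => c • f x) g = c * l2Inner Ω f g := by
  simp only [l2Inner, real_inner_smul_left, integral_const_mul]

lemma l2Inner_smul_right (c : ℝ) (f g : Pt N → V) :
    l2Inner Ω f (fun x => c • g x) = c * l2Inner Ω f g := by
  rw [l2Inner_comm, l2Inner_smul_left, l2Inner_comm]

/-- The skew-symmetry of the convective term. -/
lemma convective_skew (hΩ : IsConvexPolyhedralDomain Ω) {u v a : Pt N → Pt N} (hu : IsLip Ω u)
    (hv : IsLip Ω v) (ha : IsLip Ω a) (h0 : ∀ x ∈ frontier Ω, u x = 0) :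
    l2Inner Ω (fun x => fderiv ℝ v x (u x)) a + 1 / 2 * l2Inner Ω (fun x => divergence u x • v x) a
      = 1 / 2 * (l2Inner Ω (fun x => fderiv ℝ v x (u x)) a
        - l2Inner Ω v (fun x => fderiv ℝ a x (u x))) := by
  -- The divergence term is integrated by parts against the scalar `v · a`; boundary terms vanish
  -- with `u`. The product rule then moves half of the convective derivative onto `a`.
  set g : Pt N → ℝ := fun x => inner ℝ (v x) (a x) with hg
  have hgl : IsLip Ω g := hv.inner hΩ.bounded ha
  have hui : ∀ i, IsLip Ω (fun x => u x i) := fun i => hu.clm_comp (EuclideanSpace.proj i)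
  have h1 : ∀ i, ∫ x in Ω, fderiv ℝ (fun x => u x i) x (unit i) * g x
      = - ∫ x in Ω, u x i * fderiv ℝ g x (unit i) := fun i =>
    integral_fderiv_mul hΩ (hui i) hgl (fun x hx => by simp [h0 x hx]) (unit i)
  have h2 : l2Inner Ω (fun x => divergence u x • v x) a
      = ∑ i, ∫ x in Ω, fderiv ℝ (fun x => u x i) x (unit i) * g x := by
    rw [← integral_finsetSum]
    · refine integral_congr_ae ?_
      filter_upwards [hu.ae_differentiableAt hΩ] with x hx
      rw [real_inner_smul_left, divergence, Finset.sum_mul]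
      refine Finset.sum_congr rfl fun i _ => ?_
      have : fderiv ℝ (fun x => u x i) x = (EuclideanSpace.proj i).comp (fderiv ℝ u x) :=
        ((EuclideanSpace.proj (𝕜 := ℝ) i).hasFDerivAt.comp x hx.hasFDerivAt).fderiv
      rw [this]; rfl
    · exact fun i _ => ((((hui i).bm_fderiv hΩ).apply (bm_const _)).mul (hgl.bm hΩ)).integrable hΩ
  have h3 : ∑ i, ∫ x in Ω, u x i * fderiv ℝ g x (unit i)
      = l2Inner Ω (fun x => fderiv ℝ v x (u x)) a + l2Inner Ω v (fun x => fderiv ℝ a x (u x)) := by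
    rw [← integral_finsetSum, l2Inner, l2Inner, ← integral_add]
    · refine integral_congr_ae ?_
      filter_upwards [hv.ae_differentiableAt hΩ, ha.ae_differentiableAt hΩ] with x h1 h2
      have e1 : ∀ y, fderiv ℝ g x y
          = inner ℝ (v x) (fderiv ℝ a x y) + inner ℝ (fderiv ℝ v x y) (a x) := fun y => by
        rw [hg, fderiv_inner_apply ℝ h1 h2]
      have e2 : u x = ∑ i, u x i • unit i := by
        ext j; simp [unit, Pi.single_apply]
      have e3 : fderiv ℝ g x (u x) = ∑ i, u x i * fderiv ℝ g x (unit i) := by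
        conv_lhs => rw [e2, map_sum]
        simp
      rw [← e3, e1, add_comm]
    · exact (((hv.bm_fderiv hΩ).apply (hu.bm hΩ)).inner (ha.bm hΩ)).integrable hΩ
    · exact ((hv.bm hΩ).inner ((ha.bm_fderiv hΩ).apply (hu.bm hΩ))).integrable hΩ
    · exact fun i _ => (((hui i).bm hΩ).mul
        ((hgl.bm_fderiv hΩ).apply (bm_const _))).integrable hΩ
  rw [h2, Finset.sum_congr rfl fun i _ => h1 i, Finset.sum_neg_distrib, h3]
  ring

end Grad

/-! ### Cross products -/

section Cross

variable {N : ℕ}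

lemma inner_three (a b : Pt 3) : inner ℝ a b = a 0 * b 0 + a 1 * b 1 + a 2 * b 2 := by
  simp [PiLp.inner_apply, Fin.sum_univ_three, mul_comm]

lemma cross3_apply (a b : Pt 3) : cross3 a b 0 = a 1 * b 2 - a 2 * b 1 ∧
    cross3 a b 1 = a 2 * b 0 - a 0 * b 2 ∧ cross3 a b 2 = a 0 * b 1 - a 1 * b 0 := by
  simp [cross3, cross_apply]

/-- Antisymmetry of the triple product in its last two arguments. It identifies the coupling term of
the momentum equation, up to sign, with that of the director equation. -/
lemma inner_cross3 (a b c : Pt 3) : inner ℝ (cross3 a b) c = - inner ℝ (cross3 a c) b := by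
  obtain ⟨h0, h1, h2⟩ := cross3_apply a b
  obtain ⟨h3, h4, h5⟩ := cross3_apply a c
  rw [inner_three, inner_three, h0, h1, h2, h3, h4, h5]; ring

lemma cross3_self (a : Pt 3) : cross3 a a = 0 := by
  simp [cross3]

lemma norm_cross3_le (a b : Pt 3) : ‖cross3 a b‖ ≤ ‖a‖ * ‖b‖ := by
  obtain ⟨h0, h1, h2⟩ := cross3_apply a b
  refine abs_le_of_sq_le_sq' ?_ (by positivity) |>.2
  rw [mul_pow, ← real_inner_self_eq_norm_sq, ← real_inner_self_eq_norm_sq,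
    ← real_inner_self_eq_norm_sq, inner_three, inner_three, inner_three, h0, h1, h2]
  -- Lagrange's identity: the difference of the two sides is the square of the inner product.
  nlinarith [sq_nonneg (a 0 * b 0 + a 1 * b 1 + a 2 * b 2)]

lemma inner_toThree (hN : N = 2 ∨ N = 3) (a b : Pt N) :
    inner ℝ (toThree a) (toThree b) = inner ℝ a b := by
  rcases hN with rfl | rfl
  · rw [inner_three]; simp [toThree, PiLp.inner_apply, Fin.sum_univ_two, mul_comm]
  · rw [inner_three]; simp [toThree, PiLp.inner_apply, Fin.sum_univ_three, mul_comm]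

lemma norm_toThree (hN : N = 2 ∨ N = 3) (a : Pt N) : ‖toThree a‖ = ‖a‖ := by
  rw [@norm_eq_sqrt_real_inner, inner_toThree hN, ← norm_eq_sqrt_real_inner]

/-- The embedding into `ℝ^3` as a continuous linear map. -/
def toThreeL : Pt N →L[ℝ] Pt 3 :=
  LinearMap.toContinuousLinearMap
    { toFun := toThree
      map_add' := fun a b => by
        ext i; by_cases h : (i : ℕ) < N <;> simp [toThree, h]
      map_smul' := fun c a => by
        ext i; by_cases h : (i : ℕ) < N <;> simp [toThree, h] }

lemma norm_cross_le (hN : N = 2 ∨ N = 3) (a b : Pt N) : ‖cross a b‖ ≤ ‖a‖ * ‖b‖ := by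
  rw [← norm_toThree hN a, ← norm_toThree hN b]; exact norm_cross3_le _ _

lemma cross_self (a : Pt N) : cross a a = 0 := cross3_self _

lemma cross_zero (a : Pt N) : cross a 0 = 0 := by
  have : toThree (0 : Pt N) = 0 := toThreeL.map_zero
  simp [cross, this, cross3]

end Cross

/-! ### Normalization -/

/-- Let `c` be the cosine of the angle between `a` and `b`. The left side squared is `2 (1 - c)`,
the right side squared is `(‖a‖ - ‖b‖)² + 2 ‖a‖ ‖b‖ (1 - c)`, and `‖a‖ ‖b‖ ≥ 1`. -/
lemma norm_normalize_sub_le {V : Type*} [NormedAddCommGroup V] [InnerProductSpace ℝ V] {a b : V}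
    (ha : 1 ≤ ‖a‖) (hb : 1 ≤ ‖b‖) : ‖‖a‖⁻¹ • a - ‖b‖⁻¹ • b‖ ≤ ‖a - b‖ := by
  refine abs_le_of_sq_le_sq' ?_ (norm_nonneg _) |>.2
  have ha0 : ‖a‖ ≠ 0 := by positivity
  have hb0 : ‖b‖ ≠ 0 := by positivity
  rw [@norm_sub_sq_real, @norm_sub_sq_real, norm_smul, norm_smul, norm_inv, norm_inv, norm_norm,
    norm_norm, inv_mul_cancel₀ ha0, inv_mul_cancel₀ hb0, real_inner_smul_left,
    real_inner_smul_right]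
  set c := ‖a‖⁻¹ * (‖b‖⁻¹ * inner ℝ a b) with hc
  have h1 : inner ℝ a b = ‖a‖ * ‖b‖ * c := by rw [hc]; field_simp
  have h2 : c ≤ 1 := by
    have := real_inner_le_norm a b
    rw [h1] at this
    by_contra hcon
    push Not at hcon
    nlinarith [mul_pos (lt_of_lt_of_le one_pos ha) (lt_of_lt_of_le one_pos hb)]
  rw [h1]
  have h3 : 1 ≤ ‖a‖ * ‖b‖ := one_le_mul_of_one_le_of_one_le ha hb
  nlinarith [sq_nonneg (‖a‖ - ‖b‖), mul_nonneg (sub_nonneg.2 h2) (sub_nonneg.2 h3)]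

/-! ### Nodal interpolation and mass lumping. -/

namespace Mesh

variable {N : ℕ} {Ω : Set (Pt N)} {𝒯 : Mesh Ω}

lemma lumped_comm {V : Type*} [NormedAddCommGroup V] [InnerProductSpace ℝ V] (f g : Pt N → V) :
    𝒯.lumped f g = 𝒯.lumped g f := by simp only [lumped, real_inner_comm]

lemma lumped_neg_left {V : Type*} [NormedAddCommGroup V] [InnerProductSpace ℝ V]
    (f g : Pt N → V) : 𝒯.lumped (fun x => - f x) g = - 𝒯.lumped f g := by
  simp [lumped, inner_neg_left, Finset.sum_neg_distrib]

lemma interp_congr {V : Type*} [AddCommGroup V] [Module ℝ V] {f g : Pt N → V}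
    (h : ∀ z ∈ 𝒯.nodes, f z = g z) : 𝒯.interp f = 𝒯.interp g := by
  funext x; exact Finset.sum_congr rfl fun z hz => by rw [h z hz]

/-- The shape function is positive near its node, and every neighbourhood of a point of the closure
meets the open set `Ω` in a set of positive measure. Boundary nodes are thus included. -/
lemma integral_hat_pos (hΩ : IsConvexPolyhedralDomain Ω) {z : Pt N} (hz : z ∈ 𝒯.nodes) :
    0 < ∫ x in Ω, 𝒯.hat z x := by
  have hint := ((isLip_hat hΩ.convex (𝒯 := 𝒯) z).bm hΩ).integrable hΩ
  rw [setIntegral_pos_iff_support_of_nonneg_ae _ hint]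
  · have hc := continuousOn_hat (𝒯 := 𝒯) z
    classical
    have h1 : 0 < 𝒯.hat z z := by rw [hat_node hz]; simp
    have h2 : ∀ᶠ x in nhdsWithin z (closure Ω), 0 < 𝒯.hat z x :=
      (hc z (node_mem_closure hz)).eventually (lt_mem_nhds h1)
    obtain ⟨U, hU, hzU, hsub⟩ := mem_nhdsWithin.1 h2
    have hne : (U ∩ Ω).Nonempty := mem_closure_iff.1 (node_mem_closure hz) U hU hzU
    refine lt_of_lt_of_le ((hU.inter hΩ.isOpen).measure_pos volume hne) (measure_mono ?_)
    exact fun x hx => ⟨(hsub ⟨hx.1, subset_closure hx.2⟩ : 0 < 𝒯.hat z x).ne', hx.2⟩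
  · exact (ae_restrict_iff' hΩ.isOpen.measurableSet).2
      (.of_forall fun x hx => hat_nonneg z (subset_closure hx))

/-- Jensen's inequality: at each point the shape functions are convex weights. -/
lemma norm_interp_rpow_le {V : Type*} [NormedAddCommGroup V] [NormedSpace ℝ V] (f : Pt N → V)
    {x : Pt N} (hx : x ∈ closure Ω) {p : ℝ} (hp : 1 ≤ p) :
    ‖𝒯.interp f x‖ ^ p ≤ ∑ z ∈ 𝒯.nodes, 𝒯.hat z x * ‖f z‖ ^ p := by
  have h := Real.rpow_arith_mean_le_arith_mean_rpow 𝒯.nodes (fun z => 𝒯.hat z x)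
    (fun z => ‖f z‖) (fun z _ => hat_nonneg z hx) (sum_hat hx) (fun _ _ => norm_nonneg _) hp
  refine le_trans ?_ h
  gcongr
  refine (norm_sum_le _ _).trans (Finset.sum_le_sum fun z _ => ?_)
  rw [norm_smul, Real.norm_of_nonneg (hat_nonneg z hx)]

lemma norm_interp_le {V : Type*} [NormedAddCommGroup V] [NormedSpace ℝ V] {f : Pt N → V} {M : ℝ}
    (hf : ∀ z ∈ 𝒯.nodes, ‖f z‖ ≤ M) {x : Pt N} (hx : x ∈ closure Ω) : ‖𝒯.interp f x‖ ≤ M := by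
  have h := norm_interp_rpow_le (𝒯 := 𝒯) f hx le_rfl
  simp only [Real.rpow_one] at h
  refine h.trans ?_
  calc ∑ z ∈ 𝒯.nodes, 𝒯.hat z x * ‖f z‖ ≤ ∑ z ∈ 𝒯.nodes, 𝒯.hat z x * M :=
        Finset.sum_le_sum fun z hz => mul_le_mul_of_nonneg_left (hf z hz) (hat_nonneg z hx)
    _ = M := by rw [← Finset.sum_mul, sum_hat hx, one_mul]

lemma integral_interp_rpow_le (hΩ : IsConvexPolyhedralDomain Ω) {V : Type*} [NormedAddCommGroup V]
    [NormedSpace ℝ V] (f : Pt N → V) {p : ℝ} (hp : 1 ≤ p) :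
    ∫ x in Ω, ‖𝒯.interp f x‖ ^ p ≤ ∑ z ∈ 𝒯.nodes, ‖f z‖ ^ p * ∫ x in Ω, 𝒯.hat z x := by
  have hb : BM Ω (fun x => ∑ z ∈ 𝒯.nodes, 𝒯.hat z x * ‖f z‖ ^ p) :=
    bm_sum _ fun z _ => ((isLip_hat hΩ.convex z).bm hΩ).mul (bm_const _)
  have e : ∑ z ∈ 𝒯.nodes, ‖f z‖ ^ p * ∫ x in Ω, 𝒯.hat z x
      = ∫ x in Ω, ∑ z ∈ 𝒯.nodes, 𝒯.hat z x * ‖f z‖ ^ p := by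
    rw [integral_finsetSum]
    · exact Finset.sum_congr rfl fun z _ => by rw [integral_mul_const, mul_comm]
    · exact fun z _ => (((isLip_hat hΩ.convex z).bm hΩ).mul (bm_const _)).integrable hΩ
  rw [e]
  refine integral_mono_of_nonneg (.of_forall fun x => by positivity) (hb.integrable hΩ) ?_
  exact (ae_restrict_iff' hΩ.isOpen.measurableSet).2
    (.of_forall fun x hx => norm_interp_rpow_le f (subset_closure hx) hp)

/-- The energy identity produces the lumped norm of the dissipation; this inequality replaces it by
the `L²` norm of the interpolant. -/
lemma l2Inner_interp_le_lumped (hΩ : IsConvexPolyhedralDomain Ω) {V : Type*}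
    [NormedAddCommGroup V] [InnerProductSpace ℝ V] (f : Pt N → V) :
    l2Inner Ω (𝒯.interp f) (𝒯.interp f) ≤ 𝒯.lumped f f := by
  have h := integral_interp_rpow_le (𝒯 := 𝒯) hΩ f one_le_two
  simp only [Real.rpow_two] at h
  simpa only [l2Inner, lumped, real_inner_self_eq_norm_sq] using h

lemma lumped_self_nonneg (hΩ : IsConvexPolyhedralDomain Ω) {V : Type*}
    [NormedAddCommGroup V] [InnerProductSpace ℝ V] (f : Pt N → V) : 0 ≤ 𝒯.lumped f f :=
  Finset.sum_nonneg fun _ hz => mul_nonneg real_inner_self_nonneg (integral_hat_pos hΩ hz).le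

/-! ### Weak acuteness and nodal contractions -/

lemma gradInner_interp (hΩ : IsConvexPolyhedralDomain Ω) {V : Type*} [NormedAddCommGroup V]
    [InnerProductSpace ℝ V] [FiniteDimensional ℝ V] (f : Pt N → V) :
    gradInner Ω (𝒯.interp f) (𝒯.interp f)
      = ∑ z ∈ 𝒯.nodes, ∑ z' ∈ 𝒯.nodes, gradInner Ω (𝒯.hat z) (𝒯.hat z') * inner ℝ (f z) (f z') := by
  have hl := fun z => isLip_hat hΩ.convex (𝒯 := 𝒯) z
  have hd : ∀ᵐ x ∂(volume.restrict Ω), ∀ z ∈ 𝒯.nodes, DifferentiableAt ℝ (𝒯.hat z) x :=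
    (Filter.eventually_all_finset _).2 fun z _ => (hl z).ae_differentiableAt hΩ
  have hi : ∀ z z', IntegrableOn (fun x => (∑ i, inner ℝ (fderiv ℝ (𝒯.hat z) x (unit i))
      (fderiv ℝ (𝒯.hat z') x (unit i))) * inner ℝ (f z) (f z')) Ω := fun z z' =>
    ((bm_gradInner hΩ (hl z) (hl z')).mul (bm_const _)).integrable hΩ
  simp only [gradInner, ← integral_mul_const]
  rw [Finset.sum_congr rfl fun z _ => (integral_finsetSum _ fun z' _ => hi z z').symm,
    ← integral_finsetSum _ fun z _ => integrable_finsetSum _ fun z' _ => hi z z']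
  refine integral_congr_ae ?_
  filter_upwards [hd] with x hx
  have e : ∀ y, fderiv ℝ (𝒯.interp f) x y = ∑ z ∈ 𝒯.nodes, fderiv ℝ (𝒯.hat z) x y • f z := by
    intro y
    have : HasFDerivAt (𝒯.interp f) (∑ z ∈ 𝒯.nodes, (fderiv ℝ (𝒯.hat z) x).smulRight (f z)) x :=
      HasFDerivAt.fun_sum fun z hz => (hx z hz).hasFDerivAt.smul_const (f z)
    rw [this.fderiv, sum_apply]; rfl
  simp only [e, sum_inner, inner_sum, real_inner_smul_left, real_inner_smul_right, Finset.sum_mul]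
  rw [Finset.sum_comm]
  refine Finset.sum_congr rfl fun z _ => ?_
  rw [Finset.sum_comm]
  refine Finset.sum_congr rfl fun z' _ => Finset.sum_congr rfl fun i _ => ?_
  rw [real_inner_comm (f z')]; simp; ring

/-- The shape functions sum to the constant `1`, whose gradient is zero: the rows of the stiffness
matrix sum to zero. -/
lemma sum_gradInner_hat (hΩ : IsConvexPolyhedralDomain Ω) (z : Pt N) :
    ∑ z' ∈ 𝒯.nodes, gradInner Ω (𝒯.hat z) (𝒯.hat z') = 0 := by
  have hl := fun z => isLip_hat hΩ.convex (𝒯 := 𝒯) z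
  have h : ∀ s : Finset (Pt N), gradInner Ω (𝒯.hat z) (fun x => ∑ z' ∈ s, 𝒯.hat z' x)
      = ∑ z' ∈ s, gradInner Ω (𝒯.hat z) (𝒯.hat z') := by
    classical
    intro s
    induction s using Finset.induction_on with
    | empty => simp [gradInner]
    | insert a s ha ih =>
      simp_rw [Finset.sum_insert ha]
      rw [← ih]
      exact gradInner_add_right hΩ (hl z) (hl a) (isLip_sum _ fun i _ => hl i)
  rw [← h, gradInner_congr hΩ (fun _ _ => rfl) (g' := fun _ => (1 : ℝ))
    (fun x hx => sum_hat (subset_closure hx))]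
  simp [gradInner]

/-- Polarization writes `⟨f z, f z'⟩` through `‖f z - f z'‖²` and terms depending on one node only;
the latter cancel because rows and columns of the stiffness matrix sum to zero. -/
lemma gradInner_interp_eq (hΩ : IsConvexPolyhedralDomain Ω) {V : Type*} [NormedAddCommGroup V]
    [InnerProductSpace ℝ V] [FiniteDimensional ℝ V] (f : Pt N → V) :
    gradInner Ω (𝒯.interp f) (𝒯.interp f) = ∑ z ∈ 𝒯.nodes, ∑ z' ∈ 𝒯.nodes,
      - (gradInner Ω (𝒯.hat z) (𝒯.hat z') * ‖f z - f z'‖ ^ 2) / 2 := by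
  rw [gradInner_interp hΩ]
  have e : ∀ z z', - (gradInner Ω (𝒯.hat z) (𝒯.hat z') * ‖f z - f z'‖ ^ 2) / 2
      = gradInner Ω (𝒯.hat z) (𝒯.hat z') * inner ℝ (f z) (f z')
        - gradInner Ω (𝒯.hat z) (𝒯.hat z') * (‖f z‖ ^ 2 / 2)
        - gradInner Ω (𝒯.hat z) (𝒯.hat z') * (‖f z'‖ ^ 2 / 2) := fun z z' => by
    rw [@norm_sub_sq_real]; ring
  simp only [e, Finset.sum_sub_distrib]
  have h1 : ∑ z ∈ 𝒯.nodes, ∑ z' ∈ 𝒯.nodes,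
      gradInner Ω (𝒯.hat z) (𝒯.hat z') * (‖f z‖ ^ 2 / 2) = 0 :=
    Finset.sum_eq_zero fun z _ => by rw [← Finset.sum_mul, sum_gradInner_hat hΩ, zero_mul]
  have h2 : ∑ z ∈ 𝒯.nodes, ∑ z' ∈ 𝒯.nodes,
      gradInner Ω (𝒯.hat z) (𝒯.hat z') * (‖f z'‖ ^ 2 / 2) = 0 := by
    rw [Finset.sum_comm]
    refine Finset.sum_eq_zero fun z _ => ?_
    simp_rw [gradInner_comm _ (𝒯.hat z)]
    rw [← Finset.sum_mul, sum_gradInner_hat hΩ, zero_mul]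
  rw [h1, h2]; ring

/-- Weak acuteness makes the weights of the squared differences nonnegative for distinct nodes, and
the diagonal differences are zero, so contracting all nodal differences lowers the energy. -/
lemma gradInner_interp_le (hΩ : IsConvexPolyhedralDomain Ω) (hac : 𝒯.IsWeaklyAcute) {V : Type*}
    [NormedAddCommGroup V] [InnerProductSpace ℝ V] [FiniteDimensional ℝ V] {f g : Pt N → V}
    (h : ∀ z ∈ 𝒯.nodes, ∀ z' ∈ 𝒯.nodes, ‖f z - f z'‖ ≤ ‖g z - g z'‖) :
    gradInner Ω (𝒯.interp f) (𝒯.interp f) ≤ gradInner Ω (𝒯.interp g) (𝒯.interp g) := by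
  rw [gradInner_interp_eq hΩ, gradInner_interp_eq hΩ]
  refine Finset.sum_le_sum fun z hz => Finset.sum_le_sum fun z' hz' => ?_
  by_cases e : z = z'
  · simp [e]
  · have h1 := hac z hz z' hz' e
    have h2 : ‖f z - f z'‖ ^ 2 ≤ ‖g z - g z'‖ ^ 2 := by gcongr; exact h z hz z' hz'
    nlinarith

/-! ### One step of the scheme -/

/-- The energy identity of one time step. -/
lemma step_energy (hΩ : IsConvexPolyhedralDomain Ω) {μ k : ℝ} (hk : 0 < k)
    {v₀ v d₀ dt L : Pt N → Pt N} (hv₀ : 𝒯.MemVelocity v₀) (hv : 𝒯.MemVelocity v)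
    (hd₀ : 𝒯.MemCG d₀) (hdt : 𝒯.MemCG dt) (hdd : 𝒯.MemCG0 (fun x => dt x - d₀ x))
    (hL : 𝒯.IsDiscreteLaplacian dt L) (hmom : 𝒯.MomentumEq μ k v₀ d₀ v L v)
    (hdir : 𝒯.DirectorEq k d₀ v dt L L) :
    1 / 2 * l2Inner Ω v v + 1 / 2 * gradInner Ω dt dt + k * (μ * gradInner Ω v v)
      + k * 𝒯.lumped (fun y => cross (d₀ y) (L y)) (fun y => cross (d₀ y) (L y))
      + 1 / 2 * gradInner Ω (fun x => dt x - d₀ x) (fun x => dt x - d₀ x)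
      + k ^ 2 / 2 * l2Inner Ω (fun x => k⁻¹ • (v x - v₀ x)) (fun x => k⁻¹ • (v x - v₀ x))
    = 1 / 2 * l2Inner Ω v₀ v₀ + 1 / 2 * gradInner Ω d₀ d₀ := by
  have lv₀ := hv₀.isLip hΩ.convex
  have lv := hv.isLip hΩ.convex
  have ld₀ := hd₀.isLip hΩ.convex
  have ldt := hdt.isLip hΩ.convex
  have bv := lv.bm hΩ
  have bv₀ := lv₀.bm hΩ
  have hconv := convective_skew hΩ lv₀ lv lv hv₀.2.1
  -- Tested with the velocity itself, the two halves of the skew-symmetric form coincide and cancel.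
  rw [l2Inner_comm v, sub_self, mul_zero] at hconv
  have hcpl : l2Inner Ω (fun x => cross3 (toThree (d₀ x)) (𝒯.interp (fun y => cross (d₀ y) (L y)) x))
        (fun x => toThree (fderiv ℝ d₀ x (v x)))
      = - l2Inner Ω (fun x => cross (d₀ x) (fderiv ℝ d₀ x (v x)))
        (𝒯.interp (fun y => cross (d₀ y) (L y))) := by
    simp only [l2Inner, cross]
    rw [← integral_neg]
    exact integral_congr_ae (.of_forall fun x => inner_cross3 _ _ _)
  -- The increment vanishes on the boundary and is therefore admissible in the definition of the
  -- discrete Laplacian; this is how the time difference of the Dirichlet energy arises.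
  have hlap := hL.2 _ hdd
  rw [lumped_neg_left, lumped_comm, gradInner_sub_right hΩ ldt ldt ld₀] at hlap
  unfold MomentumEq at hmom
  unfold DirectorEq at hdir
  rw [hcpl] at hmom
  have e1 : gradInner Ω (fun x => dt x - d₀ x) (fun x => dt x - d₀ x)
      = gradInner Ω dt dt - 2 * gradInner Ω dt d₀ + gradInner Ω d₀ d₀ := by
    rw [gradInner_sub_left hΩ ldt ld₀ (ldt.sub ld₀), gradInner_sub_right hΩ ldt ldt ld₀,
      gradInner_sub_right hΩ ld₀ ldt ld₀, gradInner_comm d₀ dt]; ring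
  have e2 : l2Inner Ω (fun x => v x - v₀ x) (fun x => v x - v₀ x)
      = l2Inner Ω v v - 2 * l2Inner Ω v₀ v + l2Inner Ω v₀ v₀ := by
    rw [l2Inner_sub_left hΩ bv bv₀ (bv.sub bv₀), l2Inner_sub_right hΩ bv bv bv₀,
      l2Inner_sub_right hΩ bv₀ bv bv₀, l2Inner_comm v v₀]; ring
  rw [l2Inner_smul_left, l2Inner_smul_right, e1, e2]
  rw [l2Inner_smul_left, l2Inner_sub_left hΩ bv bv₀ bv] at hmom
  set A := l2Inner Ω v v
  set B := l2Inner Ω v₀ v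
  set C := l2Inner Ω v₀ v₀
  -- The sum of both equations, in which the coupling terms cancel. Multiplied by `k`, it becomes
  -- the claim through `2a(a - b) = a² - b² + (a - b)²`, used for the velocity and for the director
  -- gradient.
  have hsum : k⁻¹ * (A - B) + μ * gradInner Ω v v
      + 𝒯.lumped (fun y => cross (d₀ y) (L y)) (fun y => cross (d₀ y) (L y))
      + 1 / k * (gradInner Ω dt dt - gradInner Ω dt d₀) = 0 := by
    have h1 : 𝒯.lumped (fun x => dt x - d₀ x) L = -(gradInner Ω dt dt - gradInner Ω dt d₀) := by
      linarith
    rw [h1] at hdir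
    linarith
  have hk0 : k ≠ 0 := hk.ne'
  field_simp at hsum ⊢
  linarith

/-- The nodal values of the new director have norm at least one. -/
lemma one_le_norm_director (hΩ : IsConvexPolyhedralDomain Ω) {k : ℝ} (hk : 0 < k)
    {v d₀ dt L : Pt N → Pt N} {z : Pt N} (hz : z ∈ 𝒯.nodes) (hzΩ : z ∈ Ω) (hd : ‖d₀ z‖ = 1)
    (hdir : ∀ c, 𝒯.MemCG0 c → 𝒯.DirectorEq k d₀ v dt L c) :
    inner ℝ (dt z - d₀ z) (d₀ z) = 0 ∧ 1 ≤ ‖dt z‖ := by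
  classical
  -- A test function concentrated at the node `z` and parallel to `d₀ z` there: every nodal cross
  -- product vanishes, and only the lumped time difference at `z` survives.
  set g : Pt N → Pt N := fun y => if y = z then d₀ z else 0 with hg
  have hc : 𝒯.MemCG0 (𝒯.interp g) := memCG0_interp hΩ fun y _ hy => by
    have : y ≠ z := by
      rintro rfl; rw [hΩ.isOpen.frontier_eq] at hy; exact hy.2 hzΩ
    simp [hg, this]
  have hnode : ∀ y ∈ 𝒯.nodes, 𝒯.interp g y = g y := fun y hy => interp_node g hy
  have h := hdir _ hc
  have hcr : ∀ y ∈ 𝒯.nodes, cross (d₀ y) (𝒯.interp g y) = 0 := fun y hy => by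
    rw [hnode y hy]
    by_cases e : y = z
    · simp [hg, e, cross_self]
    · simp [hg, e, cross_zero]
  have h1 : 𝒯.interp (fun y => cross (d₀ y) (𝒯.interp g y)) = fun _ => 0 := by
    funext x; exact Finset.sum_eq_zero fun y hy => by simp [hcr y hy]
  have h2 : 𝒯.lumped (fun x => cross (d₀ x) (L x)) (fun x => cross (d₀ x) (𝒯.interp g x)) = 0 :=
    Finset.sum_eq_zero fun y hy => by simp [hcr y hy]
  have h3 : 𝒯.lumped (fun x => dt x - d₀ x) (𝒯.interp g)
      = inner ℝ (dt z - d₀ z) (d₀ z) * ∫ x in Ω, 𝒯.hat z x := by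
    rw [lumped, Finset.sum_eq_single z]
    · rw [hnode z hz]; simp [hg]
    · intro y hy hne; rw [hnode y hy]; simp [hg, hne]
    · exact fun h => absurd hz h
  rw [DirectorEq, h1, h2, h3] at h
  have h4 : l2Inner Ω (fun x => cross (d₀ x) (fderiv ℝ d₀ x (v x))) (fun _ => 0) = 0 := by
    simp [l2Inner]
  rw [h4, add_zero, sub_zero] at h
  have h5 : inner ℝ (dt z - d₀ z) (d₀ z) = 0 := by
    rcases mul_eq_zero.1 h with h | h
    · exact absurd h (by positivity)
    · exact (mul_eq_zero.1 h).resolve_right (integral_hat_pos hΩ hz).ne'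
  refine ⟨h5, ?_⟩
  -- Orthogonality gives `⟨dt z, d₀ z⟩ = 1`, and Cauchy–Schwarz with `‖d₀ z‖ = 1` the lower bound.
  rw [inner_sub_left, real_inner_self_eq_norm_sq, hd] at h5
  have := real_inner_le_norm (dt z) (d₀ z)
  rw [hd] at this
  linarith

end Mesh

/-! ### Propagation of the unit-length constraint and the energy law. -/

lemma norm_eq_one_of_ae {N : ℕ} {Ω : Set (Pt N)} (hΩ : IsConvexPolyhedralDomain Ω)
    {d : Pt N → Pt N} (hc : ContinuousOn d (closure Ω))
    (h : ∀ᵐ x ∂(volume.restrict Ω), ‖d x‖ = 1) {x : Pt N} (hx : x ∈ closure Ω) : ‖d x‖ = 1 := by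
  have h1 : EqOn (fun x => ‖d x‖) (fun _ => 1) Ω :=
    Measure.eqOn_open_of_ae_eq h hΩ.isOpen (hc.norm.mono subset_closure) continuousOn_const
  exact h1.of_subset_closure hc.norm continuousOn_const subset_closure le_rfl hx

namespace Mesh

variable {N : ℕ} {Ω : Set (Pt N)} {𝒯 : Mesh Ω}

/-- The properties of the discrete directors that are propagated by the scheme. -/
structure DirectorFacts (𝒯 : Mesh Ω) (d₀ dt d₁ : Pt N → Pt N) : Prop where
  memCG_old : 𝒯.MemCG d₀
  memCG : 𝒯.MemCG dt
  memCG0_diff : 𝒯.MemCG0 (fun x => dt x - d₀ x)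
  norm_old : ∀ z ∈ 𝒯.nodes, ‖d₀ z‖ = 1
  norm_new : ∀ z ∈ 𝒯.nodes, ‖d₁ z‖ = 1
  one_le : ∀ z ∈ 𝒯.nodes, 1 ≤ ‖dt z‖
  norm_diff_le : ∀ z ∈ 𝒯.nodes, ‖d₁ z - d₀ z‖ ≤ ‖dt z - d₀ z‖
  new_eq : d₁ = 𝒯.interp (fun x => ‖dt x‖⁻¹ • dt x)

/-- Induction on the time step. Besides the unit nodal length, the induction carries that `d j` is
an interpolant and equals `dInit` at the boundary nodes. The latter survives normalization because
the boundary values already have length one, and it makes increments vanish on the boundary. -/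
lemma IsSchemeSolution.directorFacts (hΩ : IsConvexPolyhedralDomain Ω) {μ k : ℝ} (hk : 0 < k)
    {vInit dInit : Pt N → Pt N} (hc : ContinuousOn dInit (closure Ω))
    (h1 : ∀ᵐ x ∂(volume.restrict Ω), ‖dInit x‖ = 1) {n : ℕ} {v dt d L : ℕ → Pt N → Pt N}
    (hs : 𝒯.IsSchemeSolution μ k vInit dInit n v dt d L) :
    ∀ j < n, 𝒯.DirectorFacts (d j) (dt (j + 1)) (d (j + 1)) := by
  have hinit : ∀ z ∈ 𝒯.nodes, ‖dInit z‖ = 1 := fun z hz =>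
    norm_eq_one_of_ae hΩ hc h1 (node_mem_closure hz)
  have hmem : ∀ j < n, 𝒯.MemCG (dt (j + 1)) := fun j hj i => by
    -- Subtracting the interpolant of `-dInit` recovers `dt (j + 1)`; the interpolant of zero
    -- changes nothing.
    have h := (((hs.director_mem j hj).1 i).sub
      ((memCG_interp (𝒯 := 𝒯) (fun _ => 0) i))).sub
        (isPiecewisePoly_interp (fun x => - dInit x i))
    refine ⟨h.1.congr fun x _ => ?_, fun T hT => ?_⟩
    · simp [interp]
    · obtain ⟨p, hp, hpe⟩ := h.2 T hT
      refine ⟨p, hp, fun x hx => ?_⟩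
      rw [← hpe x hx]; simp [interp]
  -- agreement at the boundary
  have hbd : ∀ j < n, ∀ z ∈ frontier Ω, dt (j + 1) z = 𝒯.interp dInit z := fun j hj z hz =>
    sub_eq_zero.1 ((hs.director_mem j hj).2 z hz)
  have step : ∀ j < n, (∃ f : Pt N → Pt N, d j = 𝒯.interp f) → (∀ z ∈ 𝒯.nodes, ‖d j z‖ = 1) →
      (∀ z ∈ 𝒯.nodes, z ∈ frontier Ω → d j z = dInit z) →
      𝒯.DirectorFacts (d j) (dt (j + 1)) (d (j + 1)) ∧
        (∀ z ∈ 𝒯.nodes, z ∈ frontier Ω → d (j + 1) z = dInit z) := by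
    rintro j hj ⟨f, hf⟩ hn hb
    have hcg : 𝒯.MemCG (d j) := by rw [hf]; exact memCG_interp f
    have hpair : ∀ z ∈ 𝒯.nodes, 1 ≤ ‖dt (j + 1) z‖ := by
      intro z hz
      by_cases hzΩ : z ∈ Ω
      · exact (one_le_norm_director hΩ hk hz hzΩ (hn z hz) (hs.director j hj)).2
      · have hzf : z ∈ frontier Ω := by
          rw [hΩ.isOpen.frontier_eq]; exact ⟨node_mem_closure hz, hzΩ⟩
        rw [hbd j hj z hzf, interp_node _ hz, hinit z hz]
    have hnew : ∀ z ∈ 𝒯.nodes, d (j + 1) z = ‖dt (j + 1) z‖⁻¹ • dt (j + 1) z := fun z hz => by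
      rw [hs.projection j hj, interp_node _ hz]
    refine ⟨⟨hcg, hmem j hj, ⟨(hmem j hj).sub hcg, fun x hx => ?_⟩, hn, fun z hz => ?_, hpair,
      fun z hz => ?_, hs.projection j hj⟩, fun z hz hzf => ?_⟩
    -- Both functions are interpolants on the boundary and agree at the boundary nodes, hence on the
    -- whole boundary.
    · change dt (j + 1) x - d j x = 0
      rw [hbd j hj x hx, sub_eq_zero, hf, ← sub_eq_zero]
      have : 𝒯.interp dInit x - 𝒯.interp f x = 𝒯.interp (fun y => dInit y - f y) x := by
        simp [interp, smul_sub, Finset.sum_sub_distrib]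
      rw [this]
      refine interp_frontier_eq_zero hΩ (fun z hz hzf => ?_) hx
      rw [← hb z hz hzf, hf, interp_node _ hz, sub_self]
    · rw [hnew z hz, norm_smul, norm_inv, norm_norm, inv_mul_cancel₀]
      linarith [hpair z hz]
    -- The old value has length one and is its own normalization, so the contraction property
    -- applies to the pair.
    · have := norm_normalize_sub_le (hpair z hz) (hn z hz).ge
      rw [hnew z hz]
      simpa [hn z hz] using this
    · have e : dt (j + 1) z = dInit z := by rw [hbd j hj z hzf, interp_node _ hz]
      rw [hnew z hz, e, hinit z hz]; simp
  have main : ∀ j ≤ n, (∃ f : Pt N → Pt N, d j = 𝒯.interp f) ∧ (∀ z ∈ 𝒯.nodes, ‖d j z‖ = 1) ∧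
      (∀ z ∈ 𝒯.nodes, z ∈ frontier Ω → d j z = dInit z) := by
    intro j
    induction j with
    | zero =>
      intro _
      rw [hs.initial_director]
      exact ⟨⟨_, rfl⟩, fun z hz => by rw [interp_node _ hz, hinit z hz],
        fun z hz _ => interp_node _ hz⟩
    | succ j ih =>
      intro hj
      obtain ⟨h1, h2, h3⟩ := ih (by omega)
      obtain ⟨h4, h5⟩ := step j (by omega) h1 h2 h3
      exact ⟨⟨_, h4.new_eq⟩, h4.norm_new, h5⟩
  intro j hj
  obtain ⟨h1, h2, h3⟩ := main j hj.le
  exact (step j hj h1 h2 h3).1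

lemma DirectorFacts.gradInner_le (hΩ : IsConvexPolyhedralDomain Ω) (hac : 𝒯.IsWeaklyAcute)
    {d₀ dt d₁ : Pt N → Pt N} (h : 𝒯.DirectorFacts d₀ dt d₁) :
    gradInner Ω d₁ d₁ ≤ gradInner Ω dt dt := by
  have e : gradInner Ω dt dt = gradInner Ω (𝒯.interp dt) (𝒯.interp dt) :=
    gradInner_congr hΩ (fun x hx => (h.memCG.eq_interp (subset_closure hx)).symm)
      (fun x hx => (h.memCG.eq_interp (subset_closure hx)).symm)
  rw [e, h.new_eq]
  exact gradInner_interp_le hΩ hac fun z hz z' hz' =>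
    norm_normalize_sub_le (h.one_le z hz) (h.one_le z' hz')

lemma IsSchemeSolution.memVelocity {μ k : ℝ}
    {vInit dInit : Pt N → Pt N} {n : ℕ} {v dt d L : ℕ → Pt N → Pt N}
    (hs : 𝒯.IsSchemeSolution μ k vInit dInit n v dt d L) : ∀ j ≤ n, 𝒯.MemVelocity (v j)
  | 0, _ => hs.initial_velocity.1
  | j + 1, hj => hs.velocity_mem j (by omega)

/-- The discrete energy law with the lumped norm in the dissipation. -/
lemma IsSchemeSolution.energy (hΩ : IsConvexPolyhedralDomain Ω) (hac : 𝒯.IsWeaklyAcute) {μ k : ℝ}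
    (hk : 0 < k) {vInit dInit : Pt N → Pt N} (hc : ContinuousOn dInit (closure Ω))
    (h1 : ∀ᵐ x ∂(volume.restrict Ω), ‖dInit x‖ = 1) {n : ℕ} {v dt d L : ℕ → Pt N → Pt N}
    (hs : 𝒯.IsSchemeSolution μ k vInit dInit n v dt d L) : ∀ m < n,
    1 / 2 * l2Inner Ω (v (m + 1)) (v (m + 1)) + 1 / 2 * gradInner Ω (dt (m + 1)) (dt (m + 1))
      + k * ∑ j ∈ Finset.range (m + 1), μ * gradInner Ω (v (j + 1)) (v (j + 1))
      + k * ∑ j ∈ Finset.range (m + 1), 𝒯.lumped (fun y => cross (d j y) (L (j + 1) y))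
            (fun y => cross (d j y) (L (j + 1) y))
      + 1 / 2 * ∑ j ∈ Finset.range (m + 1),
          gradInner Ω (fun x => dt (j + 1) x - d j x) (fun x => dt (j + 1) x - d j x)
      + k ^ 2 / 2 * ∑ j ∈ Finset.range (m + 1),
          l2Inner Ω (fun x => k⁻¹ • (v (j + 1) x - v j x)) (fun x => k⁻¹ • (v (j + 1) x - v j x))
    ≤ 1 / 2 * l2Inner Ω (v 0) (v 0) + 1 / 2 * gradInner Ω (d 0) (d 0) := by
  have hdf := hs.directorFacts hΩ hk hc h1
  have hst := fun j (hj : j < n) => step_energy hΩ hk (hs.memVelocity j hj.le)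
    (hs.memVelocity (j + 1) hj) (hdf j hj).memCG_old (hdf j hj).memCG (hdf j hj).memCG0_diff
    (hs.laplacian j hj) (hs.momentum j hj _ (hs.memVelocity (j + 1) hj))
    (hs.director j hj _ (hs.laplacian j hj).1)
  intro m
  induction m with
  | zero =>
    intro h0
    have := hst 0 h0
    simp only [Finset.sum_range_one, zero_add] at this ⊢
    linarith
  | succ m ih =>
    intro hm
    have h2 := ih (by omega)
    have h3 := hst (m + 1) hm
    -- The previous inequality ends with the energy of `dt (m + 1)` and the next step starts from `d
    -- (m + 1)`; weak acuteness closes this gap.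
    have h4 := (hdf m (by omega)).gradInner_le hΩ hac
    simp only [Finset.sum_range_succ _ (m + 1)]
    linarith

end Mesh

/-! ### Weighted Cauchy--Schwarz inequalities -/

section CauchySchwarz

variable {α : Type*} [MeasurableSpace α] {m : Measure α}

lemma lintegral_mul_sq_le {f g : α → ℝ≥0∞} (hf : AEMeasurable f m) (hg : AEMeasurable g m) :
    (∫⁻ a, f a * g a ∂m) ^ 2 ≤ (∫⁻ a, f a ^ 2 ∂m) * ∫⁻ a, g a ^ 2 ∂m := by
  have h := ENNReal.lintegral_mul_le_Lp_mul_Lq m Real.HolderConjugate.two_two hf hg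
  simp only [Pi.mul_apply, ENNReal.rpow_two] at h
  calc (∫⁻ a, f a * g a ∂m) ^ 2
      ≤ ((∫⁻ a, f a ^ 2 ∂m) ^ (1 / 2 : ℝ) * (∫⁻ a, g a ^ 2 ∂m) ^ (1 / 2 : ℝ)) ^ 2 := by gcongr
    _ = _ := by
      rw [mul_pow, ← ENNReal.rpow_two, ← ENNReal.rpow_two, ← ENNReal.rpow_mul, ← ENNReal.rpow_mul]
      norm_num

/-- Cauchy–Schwarz with the weight split evenly between the factors. -/
lemma lintegral_weight_sq_le {w g : α → ℝ≥0∞} (hw : AEMeasurable w m) (hg : AEMeasurable g m) :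
    (∫⁻ a, w a * g a ∂m) ^ 2 ≤ (∫⁻ a, w a ∂m) * ∫⁻ a, w a * g a ^ 2 ∂m := by
  have h := lintegral_mul_sq_le (m := m) (f := fun a => w a ^ (1 / 2 : ℝ))
    (g := fun a => w a ^ (1 / 2 : ℝ) * g a) (hw.pow_const _) ((hw.pow_const _).mul hg)
  have e : ∀ a, (w a ^ (1 / 2 : ℝ)) ^ 2 = w a := fun a => by
    rw [← ENNReal.rpow_two, ← ENNReal.rpow_mul]; norm_num
  simpa only [← mul_assoc, ← sq, mul_pow, e] using h

/-- The quadratic inequality used twice, for `g` and then for `g²`. -/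
lemma lintegral_weight_pow_four_le {w g : α → ℝ≥0∞} (hw : AEMeasurable w m)
    (hg : AEMeasurable g m) :
    (∫⁻ a, w a * g a ∂m) ^ 4 ≤ (∫⁻ a, w a ∂m) ^ 3 * ∫⁻ a, w a * g a ^ 4 ∂m := by
  calc (∫⁻ a, w a * g a ∂m) ^ 4 = ((∫⁻ a, w a * g a ∂m) ^ 2) ^ 2 := by rw [← pow_mul]
    _ ≤ ((∫⁻ a, w a ∂m) * ∫⁻ a, w a * g a ^ 2 ∂m) ^ 2 := by
      gcongr; exact lintegral_weight_sq_le hw hg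
    _ = (∫⁻ a, w a ∂m) ^ 2 * (∫⁻ a, w a * g a ^ 2 ∂m) ^ 2 := by rw [mul_pow]
    _ ≤ (∫⁻ a, w a ∂m) ^ 2 * ((∫⁻ a, w a ∂m) * ∫⁻ a, w a * (g a ^ 2) ^ 2 ∂m) := by
      gcongr; exact lintegral_weight_sq_le hw (hg.pow_const 2)
    _ = _ := by simp only [← pow_mul]; ring

lemma lintegral_sq_le {g : α → ℝ≥0∞} (hg : AEMeasurable g m) :
    (∫⁻ a, g a ∂m) ^ 2 ≤ m univ * ∫⁻ a, g a ^ 2 ∂m := by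
  simpa using lintegral_weight_sq_le (m := m) (w := fun _ => 1) aemeasurable_const hg

end CauchySchwarz

/-! ### Mollification -/

section Moll

variable {N : ℕ} {F : Type*} [NormedAddCommGroup F] [NormedSpace ℝ F]

/-- Mollification with a smooth bump function. -/
def moll (φ : ContDiffBump (0 : Pt N)) (f : Pt N → F) (x : Pt N) : F :=
  ∫ t, φ.normed volume t • f (x - t)

variable (φ : ContDiffBump (0 : Pt N))

lemma moll_eq_convolution (f : Pt N → F) :
    moll φ f = convolution (φ.normed volume) f (ContinuousLinearMap.lsmul ℝ ℝ) volume := rfl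

lemma contDiff_moll {f : Pt N → F} (hf : LocallyIntegrable f) :
    ContDiff ℝ (⊤ : ℕ∞) (moll φ f) := by
  rw [moll_eq_convolution]
  exact φ.hasCompactSupport_normed.contDiff_convolution_left _ φ.contDiff_normed hf

lemma lintegral_normed : ∫⁻ t, ENNReal.ofReal (φ.normed volume t) = 1 := by
  rw [← ofReal_integral_eq_lintegral_ofReal φ.integrable_normed
    (.of_forall fun t => φ.nonneg_normed t), φ.integral_normed, ENNReal.ofReal_one]

/-- The normalized bump is a probability density, so this is Jensen's inequality for the square. -/
lemma enorm_moll_sq_le {f : Pt N → F} (hf : AEStronglyMeasurable f) (x : Pt N) :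
    ‖moll φ f x‖ₑ ^ 2 ≤ ∫⁻ t, ENNReal.ofReal (φ.normed volume t) * ‖f (x - t)‖ₑ ^ 2 := by
  have hm : AEStronglyMeasurable (fun t => f (x - t)) :=
    hf.comp_quasiMeasurePreserving (Measure.measurePreserving_sub_left volume x).quasiMeasurePreserving
  have h1 : ‖moll φ f x‖ₑ ≤ ∫⁻ t, ENNReal.ofReal (φ.normed volume t) * ‖f (x - t)‖ₑ := by
    refine (enorm_integral_le_lintegral_enorm _).trans (le_of_eq ?_)
    refine lintegral_congr fun t => ?_
    rw [enorm_smul, Real.enorm_of_nonneg (φ.nonneg_normed t)]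
  calc ‖moll φ f x‖ₑ ^ 2 ≤ (∫⁻ t, ENNReal.ofReal (φ.normed volume t) * ‖f (x - t)‖ₑ) ^ 2 := by
        gcongr
    _ ≤ _ := lintegral_weight_sq_le (φ.continuous_normed.measurable.ennreal_ofReal.aemeasurable)
        hm.enorm
    _ = _ := by rw [lintegral_normed, one_mul]

/-- Mollification is a contraction of `L²`. -/
lemma lintegral_moll_sq_le {f : Pt N → F} (hf : AEStronglyMeasurable f) :
    ∫⁻ x, ‖moll φ f x‖ₑ ^ 2 ≤ ∫⁻ x, ‖f x‖ₑ ^ 2 := by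
  calc ∫⁻ x, ‖moll φ f x‖ₑ ^ 2
      ≤ ∫⁻ x, ∫⁻ t, ENNReal.ofReal (φ.normed volume t) * ‖f (x - t)‖ₑ ^ 2 :=
        lintegral_mono fun x => enorm_moll_sq_le φ hf x
    _ = ∫⁻ t, ∫⁻ x, ENNReal.ofReal (φ.normed volume t) * ‖f (x - t)‖ₑ ^ 2 := by
        refine lintegral_lintegral_swap ?_
        refine AEMeasurable.mul ?_ (AEMeasurable.pow_const (β := ℝ≥0∞) ?_ 2)
        · exact (φ.continuous_normed.measurable.comp measurable_snd).ennreal_ofReal.aemeasurable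
        · exact (hf.comp_quasiMeasurePreserving
            (quasiMeasurePreserving_sub_of_right_invariant volume volume)).enorm
    _ = ∫⁻ t, ENNReal.ofReal (φ.normed volume t) * ∫⁻ x, ‖f x‖ₑ ^ 2 := by
        refine lintegral_congr fun t => ?_
        rw [lintegral_const_mul' _ _ ENNReal.ofReal_ne_top]
        congr 1
        exact lintegral_sub_right_eq_self (fun x => ‖f x‖ₑ ^ 2) t
    _ = _ := by
        rw [lintegral_mul_const _ (φ.continuous_normed.measurable.ennreal_ofReal),
          lintegral_normed, one_mul]

/-- A mollification is an average over a ball of radius `φ.rOut`. The comparison point `y` is kept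
separate from the centre `x`, because later the centre is a dilated point. -/
lemma norm_moll_sub_le [CompleteSpace F] {f : Pt N → F} {x y : Pt N} {M : ℝ}
    (hi : LocallyIntegrable f) (h : ∀ t, ‖t‖ ≤ φ.rOut → ‖f (x - t) - f y‖ ≤ M) :
    ‖moll φ f x - f y‖ ≤ M := by
  have hint : Integrable (fun t => φ.normed volume t • f (x - t)) := by
    have := (φ.hasCompactSupport_normed (μ := volume)).convolutionExists_left (μ := volume)
      (ContinuousLinearMap.lsmul ℝ ℝ) φ.continuous_normed hi x
    exact this
  have e : f y = ∫ t, φ.normed volume t • f y := by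
    rw [integral_smul_const, φ.integral_normed, one_smul]
  have e2 : moll φ f x - f y = ∫ t, φ.normed volume t • (f (x - t) - f y) := by
    simp_rw [smul_sub]
    rw [integral_sub hint (φ.integrable_normed.smul_const _), ← e]; rfl
  rw [e2]
  have : M = ∫ t, φ.normed volume t * M := by
    rw [integral_mul_const, φ.integral_normed, one_mul]
  rw [this]
  refine norm_integral_le_of_norm_le (φ.integrable_normed.mul_const _) (.of_forall fun t => ?_)
  rw [norm_smul, Real.norm_of_nonneg (φ.nonneg_normed t)]
  by_cases ht : ‖t‖ ≤ φ.rOut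
  · exact mul_le_mul_of_nonneg_left (h t ht) (φ.nonneg_normed t)
  · have : φ.normed volume t = 0 := by
      rw [← Function.notMem_support, φ.support_normed_eq]
      simpa using (not_le.1 ht).le
    simp [this]

/-- The gradient of the mollification of a Lipschitz function is the mollified gradient. -/
lemma hasFDerivAt_moll_of_lipschitz [FiniteDimensional ℝ F] {K : ℝ≥0} {f : Pt N → F}
    (hf : LipschitzWith K f) (x : Pt N) :
    HasFDerivAt (moll φ f) (moll φ (fderiv ℝ f) x) x := by
  have hc : CompleteSpace F := FiniteDimensional.complete ℝ F
  -- Differentiation under the integral for Lipschitz integrands: the difference quotients are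
  -- dominated by `K` times the bump, and the integrand is differentiable for almost every `t` by
  -- Rademacher's theorem.
  refine (hasFDerivAt_integral_of_dominated_loc_of_lip (s := univ)
    (F := fun y t => φ.normed volume t • f (y - t))
    (F' := fun t => φ.normed volume t • fderiv ℝ f (x - t))
    (bound := fun t => φ.normed volume t * K) Filter.univ_mem ?_ ?_ ?_ ?_ ?_ ?_).2
  · exact .of_forall fun y => (φ.continuous_normed.smul
      (hf.continuous.comp (continuous_const.sub continuous_id))).aestronglyMeasurable
  · have : Continuous (fun t => φ.normed volume t • f (x - t)) := φ.continuous_normed.smul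
      (hf.continuous.comp (continuous_const.sub continuous_id))
    exact this.integrable_of_hasCompactSupport φ.hasCompactSupport_normed.smul_right
  · refine φ.continuous_normed.aestronglyMeasurable.smul ?_
    exact ((measurable_fderiv ℝ f).comp (measurable_const.sub measurable_id)).aestronglyMeasurable
  · refine .of_forall fun t => LipschitzOnWith.of_dist_le_mul fun y _ z _ => ?_
    rw [dist_smul₀, Real.norm_of_nonneg (φ.nonneg_normed t), Real.coe_nnabs,
      abs_of_nonneg (a := φ.normed volume t * (K : ℝ)) (mul_nonneg (φ.nonneg_normed t) K.2), mul_assoc]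
    gcongr
    · exact φ.nonneg_normed t
    · simpa using hf.dist_le_mul (y - t) (z - t)
  · exact φ.integrable_normed.mul_const _
  · have h := hf.ae_differentiableAt (μ := (volume : Measure (Pt N)))
    have h2 := (Measure.measurePreserving_sub_left (volume : Measure (Pt N)) x).quasiMeasurePreserving.ae h
    filter_upwards [h2] with t ht
    have := ht.hasFDerivAt.comp x ((hasFDerivAt_id x).sub_const t)
    exact this.const_smul _

end Moll

/-! ### A Sobolev inequality for Lipschitz functions vanishing on the boundary -/

section Sobolev6

lemma eLpNorm_restrict_of_support {α E : Type*} [MeasurableSpace α] {m : Measure α}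
    [NormedAddCommGroup E] {f : α → E} {s : Set α} (p : ℝ≥0∞) (h : Function.support f ⊆ s) :
    eLpNorm f p (m.restrict s) = eLpNorm f p m := eLpNorm_restrict_eq_of_support_subset h

lemma eLpNorm_indicator_eq {α E : Type*} [MeasurableSpace α] {m : Measure α}
    [NormedAddCommGroup E] {f : α → E} {s : Set α} (p : ℝ≥0∞) (hs : MeasurableSet s) :
    eLpNorm (s.indicator f) p m = eLpNorm f p (m.restrict s) :=
  eLpNorm_indicator_eq_eLpNorm_restrict hs

variable {N : ℕ} {Ω : Set (Pt N)}

/-- In dimension three the exponent `6` belongs to gradients in `L²`. In dimension two `L²` is the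
excluded borderline case, so the gradient is taken in `L^{3/2}`, where `2/3 - 1/2 = 1/6`, and
Hölder's inequality on the bounded set `s` leads back to `L²`. This is why the support of the
derivative also has to be controlled. -/
lemma contDiff_gns (hN : N = 2 ∨ N = 3) {s : Set (Pt N)} (hs : Bornology.IsBounded s) :
    ∃ C : ℝ≥0, ∀ u : Pt N → Pt N, ContDiff ℝ 1 u → Function.support u ⊆ s →
      Function.support (fderiv ℝ u) ⊆ s →
      eLpNorm u 6 volume ≤ C * eLpNorm (fderiv ℝ u) 2 volume := by
  rcases hN with rfl | rfl
  · have hμ : volume s ≠ ∞ := hs.measure_lt_top.ne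
    obtain ⟨p, hp⟩ : ∃ p : ℝ≥0, (p : ℝ) = 3 / 2 := ⟨⟨3 / 2, by norm_num⟩, rfl⟩
    obtain ⟨q, hq⟩ : ∃ q : ℝ≥0, (q : ℝ) = 6 := ⟨⟨6, by norm_num⟩, rfl⟩
    have e6 : (q : ℝ≥0∞) = 6 := by
      have : q = 6 := NNReal.coe_injective (by rw [hq]; norm_num)
      rw [this]; norm_num
    refine ⟨eLpNormLESNormFDerivOfLeConst (Pt 2) volume s p q *
      ((volume s) ^ (1 / 6 : ℝ)).toNNReal, fun u hu h1 h2 => ?_⟩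
    have h := eLpNorm_le_eLpNorm_fderiv_of_le (μ := volume) hu h1 (p := p) (q := q)
      (by rw [← NNReal.coe_le_coe, hp]; norm_num)
      (by
        rw [finrank_euclideanSpace_fin, ← NNReal.coe_lt_coe, hp]; norm_num)
      (by rw [finrank_euclideanSpace_fin, NNReal.coe_inv, hp, hq]; norm_num) hs
    have e : eLpNorm (fderiv ℝ u) p volume
        = eLpNorm (fderiv ℝ u) p (volume.restrict s) :=
      (eLpNorm_restrict_of_support _ h2).symm
    have hp2 : (p : ℝ≥0∞) ≤ 2 := by
      rw [show (2 : ℝ≥0∞) = ((2 : ℝ≥0) : ℝ≥0∞) by norm_num, ENNReal.coe_le_coe,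
        ← NNReal.coe_le_coe, hp]; norm_num
    have h3 := eLpNorm_le_eLpNorm_mul_rpow_measure_univ (μ := volume.restrict s)
      (f := fderiv ℝ u) hp2 (hu.continuous_fderiv one_ne_zero).aestronglyMeasurable
    rw [Measure.restrict_apply_univ, ENNReal.coe_toReal, hp] at h3
    rw [e6] at h
    refine h.trans ?_
    rw [ENNReal.coe_mul, mul_assoc]
    gcongr
    rw [e, mul_comm]
    refine h3.trans ?_
    gcongr
    · exact Measure.restrict_le_self
    · rw [ENNReal.coe_toNNReal (ENNReal.rpow_ne_top_of_nonneg (by norm_num) hμ)]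
      refine le_of_eq ?_
      congr 1
      norm_num
  · refine ⟨eLpNormLESNormFDerivOfLeConst (Pt 3) volume s 2 6, fun u hu h1 _ => ?_⟩
    exact eLpNorm_le_eLpNorm_fderiv_of_le (μ := volume) hu h1 (p := 2) (q := 6)
      (by norm_num) (by rw [finrank_euclideanSpace_fin]; norm_num)
      (by rw [finrank_euclideanSpace_fin]; push_cast; norm_num) hs

/-- The Sobolev embedding `H¹₀ ⊂ L⁶` for Lipschitz functions. -/
lemma sobolev_six (hN : N = 2 ∨ N = 3) (hΩ : IsConvexPolyhedralDomain Ω) :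
    ∃ C : ℝ≥0, ∀ v : Pt N → Pt N, IsLip Ω v → (∀ x ∈ frontier Ω, v x = 0) →
      eLpNorm v 6 (volume.restrict Ω) ≤ C * eLpNorm (fderiv ℝ v) 2 (volume.restrict Ω) := by
  -- All mollifications below have radius at most `1`, so a single bounded set contains their
  -- supports and one constant serves them all.
  obtain ⟨C, hC⟩ := contDiff_gns hN (hΩ.bounded.cthickening (δ := 1))
  refine ⟨C, fun v hv h0 => ?_⟩
  obtain ⟨K, hK⟩ := lipschitzWith_indicator hΩ hv h0
  set g := Ω.indicator v with hg
  have hgs : Function.support g ⊆ Ω := support_indicator_subset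
  have hds : Function.support (fderiv ℝ g) ⊆ closure Ω :=
    (support_fderiv_subset ℝ).trans (closure_mono hgs)
  obtain ⟨φ, hφ⟩ : ∃ φ : ℕ → ContDiffBump (0 : Pt N), ∀ n, (φ n).rOut = 1 / (n + 2) :=
    ⟨fun n => ⟨1 / (n + 2) / 2, 1 / (n + 2), by positivity, by
      have : (0 : ℝ) < 1 / (n + 2) := by positivity
      linarith⟩, fun _ => rfl⟩
  have hφ1 : ∀ n, (φ n).rOut ≤ 1 := fun n => by
    rw [hφ, div_le_one (by positivity)]; linarith [(Nat.cast_nonneg n : (0 : ℝ) ≤ n)]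
  have hsupp : ∀ n, ∀ (F : Type) [NormedAddCommGroup F] [NormedSpace ℝ F] (f : Pt N → F),
      Function.support f ⊆ closure Ω →
      Function.support (moll (φ n) f) ⊆ Metric.cthickening 1 Ω := by
    intro n F _ _ f hf x hx
    by_contra hcon
    refine hx (integral_eq_zero_of_ae (.of_forall fun t => ?_))
    by_cases ht : t ∈ Metric.ball (0 : Pt N) (φ n).rOut
    · have : f (x - t) = 0 := by
        by_contra hne
        refine hcon ?_
        rw [← Metric.cthickening_closure]
        refine Metric.mem_cthickening_of_dist_le x (x - t) 1 _ (hf hne) ?_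
        rw [dist_eq_norm, sub_sub_cancel]
        rw [mem_ball_zero_iff] at ht
        exact ht.le.trans (hφ1 n)
      simp [this]
    · have : (φ n).normed volume t = 0 := by
        rw [← Function.notMem_support, (φ n).support_normed_eq]; exact ht
      simp [this]
  have hfd : ∀ n, fderiv ℝ (moll (φ n) g) = moll (φ n) (fderiv ℝ g) := fun n =>
    funext fun x => (hasFDerivAt_moll_of_lipschitz (φ n) hK x).fderiv
  have hcd : ∀ n, ContDiff ℝ 1 (moll (φ n) g) := fun n =>
    (contDiff_moll (φ n) hK.continuous.locallyIntegrable).of_le (by exact_mod_cast le_top)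
  have hbound : ∀ n, eLpNorm (moll (φ n) g) 6 volume ≤ C * eLpNorm (fderiv ℝ g) 2 volume := by
    intro n
    refine (hC _ (hcd n) (hsupp n _ g (hgs.trans subset_closure))
      (by rw [hfd]; exact hsupp n _ _ hds)).trans ?_
    gcongr
    rw [hfd, eLpNorm_eq_lintegral_rpow_enorm_toReal two_ne_zero ENNReal.ofNat_ne_top,
      eLpNorm_eq_lintegral_rpow_enorm_toReal two_ne_zero ENNReal.ofNat_ne_top]
    simp only [ENNReal.toReal_ofNat, ENNReal.rpow_two]
    gcongr ?_ ^ _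
    exact lintegral_moll_sq_le (φ n) (measurable_fderiv ℝ g).aestronglyMeasurable
  have hlim : ∀ x, Filter.Tendsto (fun n => moll (φ n) g x) Filter.atTop (nhds (g x)) := by
    intro x
    rw [tendsto_iff_norm_sub_tendsto_zero]
    have ht : Filter.Tendsto (fun n : ℕ => (K : ℝ) * (1 / ((n + 1 : ℕ) + 1))) Filter.atTop
        (nhds 0) := by
      have := (((Filter.tendsto_add_atTop_iff_nat 1).2
        (tendsto_one_div_add_atTop_nhds_zero_nat (𝕜 := ℝ))).const_mul (K : ℝ))
      simpa using this
    refine squeeze_zero (fun _ => norm_nonneg _) (fun n => ?_) ht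
    refine norm_moll_sub_le (φ n) hK.continuous.locallyIntegrable fun t ht => ?_
    have := hK.dist_le_mul (x - t) x
    rw [dist_eq_norm, dist_eq_norm] at this
    refine this.trans ?_
    gcongr
    rw [sub_sub_cancel_left, norm_neg]
    refine ht.trans (le_of_eq ?_)
    rw [hφ]; push_cast; ring
  -- The uniform bound passes to the pointwise limit by Fatou's lemma.
  have h1 : eLpNorm g 6 volume ≤ C * eLpNorm (fderiv ℝ g) 2 volume := by
    refine (Lp.eLpNorm_lim_le_liminf_eLpNorm
      (fun n => (hcd n).continuous.aestronglyMeasurable) g (.of_forall hlim)).trans ?_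
    refine (Filter.liminf_le_liminf (.of_forall hbound)).trans ?_
    simp
  have h2 : eLpNorm g 6 volume = eLpNorm v 6 (volume.restrict Ω) :=
    eLpNorm_indicator_eq _ hΩ.isOpen.measurableSet
  have h3 : eLpNorm (fderiv ℝ g) 2 volume = eLpNorm (fderiv ℝ v) 2 (volume.restrict Ω) := by
    rw [eLpNorm_congr_ae (fderiv_indicator hΩ v)]
    exact eLpNorm_indicator_eq _ hΩ.isOpen.measurableSet
  rwa [h2, h3] at h1

end Sobolev6

/-! ### Operator and Frobenius norms, and real-valued forms of the inequalities. -/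

section OpNorm

variable {N : ℕ} {F : Type*} [NormedAddCommGroup F] [NormedSpace ℝ F]

lemma sum_smul_unit (x : Pt N) : x = ∑ i, x i • unit i := by
  ext j; simp [unit, Pi.single_apply]

/-- The operator norm is bounded by the Frobenius norm. -/
lemma opNorm_sq_le_sum (A : Pt N →L[ℝ] F) : ‖A‖ ^ 2 ≤ ∑ i, ‖A (unit i)‖ ^ 2 := by
  have h : ‖A‖ ≤ Real.sqrt (∑ i, ‖A (unit i)‖ ^ 2) := by
    refine A.opNorm_le_bound (Real.sqrt_nonneg _) fun x => ?_
    conv_lhs => rw [sum_smul_unit x, map_sum]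
    refine (norm_sum_le _ _).trans ?_
    simp only [map_smul, norm_smul]
    rw [EuclideanSpace.norm_eq, mul_comm]
    exact Real.sum_mul_le_sqrt_mul_sqrt _ _ _
  calc ‖A‖ ^ 2 ≤ Real.sqrt (∑ i, ‖A (unit i)‖ ^ 2) ^ 2 := by gcongr
    _ = _ := Real.sq_sqrt (Finset.sum_nonneg fun _ _ => sq_nonneg _)

end OpNorm

section RealForms

variable {N : ℕ} {Ω : Set (Pt N)}

lemma BM.norm {F : Type*} [NormedAddCommGroup F] {f : Pt N → F} [NormedSpace ℝ F]
    (hf : BM Ω f) : BM Ω (fun x => ‖f x‖) := by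
  obtain ⟨hm, M, -, hM⟩ := hf
  exact bm_of_le hm.norm M fun x hx => by rw [norm_norm]; exact hM x hx

lemma BM.norm_rpow {F : Type*} [NormedAddCommGroup F] [NormedSpace ℝ F] {f : Pt N → F}
    (hf : BM Ω f) {p : ℝ} (hp : 0 ≤ p) : BM Ω (fun x => ‖f x‖ ^ p) := by
  obtain ⟨hm, M, h0, hM⟩ := hf
  refine bm_of_le ((Real.continuous_rpow_const hp).comp_aestronglyMeasurable hm.norm) (M ^ p)
    fun x hx => ?_
  rw [Real.norm_of_nonneg (by positivity)]
  gcongr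
  exact hM x hx

lemma BM.norm_pow {F : Type*} [NormedAddCommGroup F] [NormedSpace ℝ F] {f : Pt N → F}
    (hf : BM Ω f) (n : ℕ) : BM Ω (fun x => ‖f x‖ ^ n) := by
  simpa using hf.norm_rpow (p := (n : ℝ)) (by positivity)

lemma integral_norm_fderiv_sq_le (hΩ : IsConvexPolyhedralDomain Ω) {V : Type*}
    [NormedAddCommGroup V] [InnerProductSpace ℝ V] [FiniteDimensional ℝ V] {f : Pt N → V}
    (hf : IsLip Ω f) : ∫ x in Ω, ‖fderiv ℝ f x‖ ^ 2 ≤ gradInner Ω f f := by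
  refine integral_mono (((hf.bm_fderiv hΩ).norm_pow 2).integrable hΩ)
    ((bm_gradInner hΩ hf hf).integrable hΩ) fun x => ?_
  simp only [real_inner_self_eq_norm_sq]
  exact opNorm_sq_le_sum _

lemma sobolev_six_real (hN : N = 2 ∨ N = 3) (hΩ : IsConvexPolyhedralDomain Ω) :
    ∃ C : ℝ, 0 < C ∧ ∀ v : Pt N → Pt N, IsLip Ω v → (∀ x ∈ frontier Ω, v x = 0) →
      (∫ x in Ω, ‖v x‖ ^ (6 : ℝ)) ^ (1 / 6 : ℝ) ≤ C * Real.sqrt (gradInner Ω v v) := by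
  obtain ⟨C, hC⟩ := sobolev_six hN hΩ
  refine ⟨C + 1, by positivity, fun v hv h0 => ?_⟩
  have h := hC v hv h0
  rw [MemLp.eLpNorm_eq_integral_rpow_norm (by norm_num) (by norm_num) ((hv.bm hΩ).memLp hΩ 6),
    MemLp.eLpNorm_eq_integral_rpow_norm (by norm_num) (by norm_num)
      ((hv.bm_fderiv hΩ).memLp hΩ 2), ← ENNReal.ofReal_coe_nnreal,
    ← ENNReal.ofReal_mul (NNReal.coe_nonneg C), ENNReal.ofReal_le_ofReal_iff (by positivity)] at h
  simp only [ENNReal.toReal_ofNat, Real.rpow_two] at h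
  rw [one_div]
  refine h.trans ?_
  have h2 := integral_norm_fderiv_sq_le hΩ hv
  have h3 : 0 ≤ ∫ x in Ω, ‖fderiv ℝ v x‖ ^ 2 := integral_nonneg fun x => by positivity
  rw [Real.sqrt_eq_rpow, one_div]
  have h4 : (∫ x in Ω, ‖fderiv ℝ v x‖ ^ 2) ^ (2 : ℝ)⁻¹ ≤ (gradInner Ω v v) ^ (2 : ℝ)⁻¹ := by
    gcongr
  have h5 : 0 ≤ (gradInner Ω v v) ^ (2 : ℝ)⁻¹ := Real.rpow_nonneg (gradInner_self_nonneg _) _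
  have h6 : (C : ℝ) * (∫ x in Ω, ‖fderiv ℝ v x‖ ^ 2) ^ (2 : ℝ)⁻¹
      ≤ C * (gradInner Ω v v) ^ (2 : ℝ)⁻¹ := by gcongr
  linarith

/-- Hölder's inequality with exponents `2, 6, 3`. -/
lemma integral_holder_two_six_three (hΩ : IsConvexPolyhedralDomain Ω) {f g h : Pt N → ℝ}
    (hf : BM Ω f) (hg : BM Ω g) (hh : BM Ω h) :
    ∫ x in Ω, ‖f x‖ * (‖g x‖ * ‖h x‖) ≤ Real.sqrt (∫ x in Ω, ‖f x‖ ^ 2) *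
      ((∫ x in Ω, ‖g x‖ ^ (6 : ℝ)) ^ (1 / 6 : ℝ) * (∫ x in Ω, ‖h x‖ ^ (3 : ℝ)) ^ (1 / 3 : ℝ)) := by
  have h1 := integral_mul_le_Lp_mul_Lq_of_nonneg (μ := volume.restrict Ω)
    Real.HolderConjugate.two_two (f := fun x => ‖f x‖) (g := fun x => ‖g x‖ * ‖h x‖)
    (.of_forall fun x => norm_nonneg _) (.of_forall fun x => by positivity)
    (hf.norm.memLp hΩ _) ((hg.norm.mul hh.norm).memLp hΩ _)
  -- Cauchy–Schwarz has separated `f` from `g h`; the exponents `3` and `3/2` are now applied to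
  -- `g²` and `h²`.
  have hc : Real.HolderConjugate 3 (3 / 2) := by
    rw [Real.holderConjugate_iff]; norm_num
  have h2 := integral_mul_le_Lp_mul_Lq_of_nonneg (μ := volume.restrict Ω) hc
    (f := fun x => ‖g x‖ ^ 2) (g := fun x => ‖h x‖ ^ 2)
    (.of_forall fun x => by positivity) (.of_forall fun x => by positivity)
    ((hg.norm_pow 2).memLp hΩ _) ((hh.norm_pow 2).memLp hΩ _)
  have e1 : ∀ x : ℝ, 0 ≤ x → (x ^ 2) ^ (3 : ℝ) = x ^ (6 : ℝ) := fun x hx => by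
    rw [← Real.rpow_two, ← Real.rpow_mul hx]; norm_num
  have e2 : ∀ x : ℝ, 0 ≤ x → (x ^ 2) ^ (3 / 2 : ℝ) = x ^ (3 : ℝ) := fun x hx => by
    rw [← Real.rpow_two, ← Real.rpow_mul hx]; norm_num
  simp only [e1 _ (norm_nonneg _), e2 _ (norm_nonneg _)] at h2
  simp only [Real.rpow_two, mul_pow] at h1
  refine h1.trans ?_
  rw [← Real.sqrt_eq_rpow]
  gcongr
  have h3 : 0 ≤ ∫ x in Ω, ‖g x‖ ^ (6 : ℝ) := integral_nonneg fun x => by positivity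
  have h4 : 0 ≤ ∫ x in Ω, ‖h x‖ ^ (3 : ℝ) := integral_nonneg fun x => by positivity
  calc (∫ x in Ω, ‖g x‖ ^ 2 * ‖h x‖ ^ 2) ^ (1 / 2 : ℝ)
      ≤ ((∫ x in Ω, ‖g x‖ ^ (6 : ℝ)) ^ (1 / 3 : ℝ)
        * (∫ x in Ω, ‖h x‖ ^ (3 : ℝ)) ^ (1 / (3 / 2) : ℝ)) ^ (1 / 2 : ℝ) := by
        gcongr
    _ = _ := by
        rw [Real.mul_rpow (by positivity) (by positivity), ← Real.rpow_mul h3,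
          ← Real.rpow_mul h4]
        norm_num

end RealForms

/-! ### Rate of change of the director. -/

namespace Mesh

variable {N : ℕ} {Ω : Set (Pt N)} {𝒯 : Mesh Ω}

/-- The nodal `ℓ^{3/2}` sum with lumped weights. -/
def lumpedSum (𝒯 : Mesh Ω) (g : Pt N → Pt N) : ℝ :=
  ∑ z ∈ 𝒯.nodes, ‖g z‖ ^ (3 / 2 : ℝ) * ∫ x in Ω, 𝒯.hat z x

lemma lumpedSum_nonneg (hΩ : IsConvexPolyhedralDomain Ω) (g : Pt N → Pt N) :
    0 ≤ 𝒯.lumpedSum g :=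
  Finset.sum_nonneg fun _ hz => mul_nonneg (by positivity) (integral_hat_pos hΩ hz).le

/-- Jensen's inequality bounds the `L^{3/2}` norm of an interpolant by its nodal sum, so that all
director estimates can be made at the nodes. -/
lemma eLpNorm_three_halves_le (hΩ : IsConvexPolyhedralDomain Ω) {k : ℝ} (hk : 0 < k)
    {f g : Pt N → Pt N} {S : ℝ} (hf : ∀ x ∈ Ω, f x = 𝒯.interp g x) (hS : 𝒯.lumpedSum g ≤ S) :
    eLpNorm (fun x => k⁻¹ • f x) (3 / 2) (volume.restrict Ω)
      ≤ ENNReal.ofReal (k⁻¹ * S ^ (2 / 3 : ℝ)) := by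
  have hlip : IsLip Ω (𝒯.interp g) := isLip_interp hΩ.convex g
  have hb : BM Ω (fun x => k⁻¹ • 𝒯.interp g x) := (hlip.const_smul _).bm hΩ
  have e : eLpNorm (fun x => k⁻¹ • f x) (3 / 2) (volume.restrict Ω)
      = eLpNorm (fun x => k⁻¹ • 𝒯.interp g x) (3 / 2) (volume.restrict Ω) := by
    refine eLpNorm_congr_ae ((ae_restrict_iff' hΩ.isOpen.measurableSet).2 (.of_forall ?_))
    intro x hx
    simp only [hf x hx]
  have hp : ((3 / 2 : ℝ≥0∞)).toReal = 3 / 2 := by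
    rw [ENNReal.toReal_div]; norm_num
  have hp0 : (3 / 2 : ℝ≥0∞) ≠ 0 := by simp
  have hpt : (3 / 2 : ℝ≥0∞) ≠ ∞ := ENNReal.div_ne_top (by norm_num) (by norm_num)
  rw [e, MemLp.eLpNorm_eq_integral_rpow_norm hp0 hpt (hb.memLp hΩ _), hp]
  refine ENNReal.ofReal_le_ofReal ?_
  have h1 : ∫ x in Ω, ‖𝒯.interp g x‖ ^ (3 / 2 : ℝ) ≤ S :=
    (integral_interp_rpow_le hΩ g (by norm_num)).trans hS
  have h0 : 0 ≤ ∫ x in Ω, ‖𝒯.interp g x‖ ^ (3 / 2 : ℝ) := integral_nonneg fun x => by positivity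
  have e2 : ∫ x in Ω, ‖k⁻¹ • 𝒯.interp g x‖ ^ (3 / 2 : ℝ)
      = (k⁻¹) ^ (3 / 2 : ℝ) * ∫ x in Ω, ‖𝒯.interp g x‖ ^ (3 / 2 : ℝ) := by
    rw [← integral_const_mul]
    refine integral_congr_ae (.of_forall fun x => ?_)
    change ‖k⁻¹ • 𝒯.interp g x‖ ^ (3 / 2 : ℝ) = _
    rw [norm_smul, Real.mul_rpow (norm_nonneg _) (norm_nonneg _),
      Real.norm_of_nonneg (inv_pos.2 hk).le]
  have hki : 0 ≤ k⁻¹ := (inv_pos.2 hk).le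
  rw [e2, Real.mul_rpow (by positivity) h0, ← Real.rpow_mul hki]
  norm_num
  gcongr

/-- The discrete time derivative of the director is controlled by the dissipation. -/
lemma director_rate_le (hN : N = 2 ∨ N = 3) (hΩ : IsConvexPolyhedralDomain Ω) :
    ∃ C : ℝ, 0 < C ∧ ∀ (𝒯 : Mesh Ω) (k : ℝ) (v d₀ dt d₁ L : Pt N → Pt N), 0 < k →
      𝒯.MemVelocity v → 𝒯.DirectorFacts d₀ dt d₁ →
      (∀ c, 𝒯.MemCG0 c → 𝒯.DirectorEq k d₀ v dt L c) →
      k⁻¹ * (𝒯.lumpedSum (fun x => dt x - d₀ x)) ^ (2 / 3 : ℝ) ≤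
        C * (Real.sqrt (gradInner Ω d₀ d₀) * Real.sqrt (gradInner Ω v v)
          + Real.sqrt (𝒯.lumped (fun y => cross (d₀ y) (L y)) (fun y => cross (d₀ y) (L y)))) := by
  obtain ⟨C, hC0, hC⟩ := sobolev_six_real hN hΩ
  set A : ℝ := (volume.real Ω) ^ (1 / 6 : ℝ) with hA
  have hA0 : 0 ≤ A := by positivity
  refine ⟨C + A, by positivity, fun 𝒯 k v d₀ dt d₁ L hk hv hd hdir => ?_⟩
  set f : Pt N → Pt N := fun x => dt x - d₀ x with hf
  set m : Pt N → ℝ := fun z => ∫ x in Ω, 𝒯.hat z x with hm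
  have hm0 : ∀ z ∈ 𝒯.nodes, 0 ≤ m z := fun z hz => (integral_hat_pos hΩ hz).le
  set S := 𝒯.lumpedSum f with hSdef
  have hS0 : 0 ≤ S := lumpedSum_nonneg hΩ f
  -- Dual to `f` for the exponents `3/2` and `3`: both `⟨f, c⟩` and `‖c‖³` equal `‖f‖^{3/2}`. Where
  -- `f` vanishes, so does `c`, whatever the value of the power.
  set c : Pt N → Pt N := fun z => ‖f z‖ ^ (-(1 / 2) : ℝ) • f z with hc
  have hcz : ∀ z, ‖c z‖ = ‖f z‖ ^ (1 / 2 : ℝ) := fun z => by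
    rcases (norm_nonneg (f z)).eq_or_lt with h | h
    · have : f z = 0 := norm_eq_zero.1 h.symm
      simp [hc, this]
    · rw [hc, norm_smul, Real.norm_of_nonneg (by positivity)]
      nth_rewrite 2 [← Real.rpow_one ‖f z‖]
      rw [← Real.rpow_add h]; norm_num
  have hfc : ∀ z, inner ℝ (f z) (c z) = ‖f z‖ ^ (3 / 2 : ℝ) := fun z => by
    rcases (norm_nonneg (f z)).eq_or_lt with h | h
    · have : f z = 0 := norm_eq_zero.1 h.symm
      simp [hc, this]
    · rw [hc, real_inner_smul_right, real_inner_self_eq_norm_sq, ← Real.rpow_two,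
        ← Real.rpow_add h]; norm_num
  have hc3 : ∀ z, ‖c z‖ ^ (3 : ℝ) = ‖f z‖ ^ (3 / 2 : ℝ) := fun z => by
    rw [hcz, ← Real.rpow_mul (norm_nonneg _)]; norm_num
  have hcg : 𝒯.MemCG0 (𝒯.interp c) := memCG0_interp hΩ fun z _ hzf => by
    have : f z = 0 := hd.memCG0_diff.2 z hzf
    simp [hc, this]
  have hnode : ∀ z ∈ 𝒯.nodes, 𝒯.interp c z = c z := fun z hz => interp_node c hz
  have h := hdir _ hcg
  unfold DirectorEq at h
  have e1 : 𝒯.lumped (fun x => dt x - d₀ x) (𝒯.interp c) = S := by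
    refine Finset.sum_congr rfl fun z hz => ?_
    rw [hnode z hz]; exact congrArg (· * m z) (hfc z)
  have e2 : 𝒯.interp (fun y => cross (d₀ y) (𝒯.interp c y))
      = 𝒯.interp (fun y => cross (d₀ y) (c y)) :=
    interp_congr fun z hz => by rw [hnode z hz]
  have e3 : 𝒯.lumped (fun x => cross (d₀ x) (L x)) (fun x => cross (d₀ x) (𝒯.interp c x))
      = 𝒯.lumped (fun x => cross (d₀ x) (L x)) (fun x => cross (d₀ x) (c x)) :=
    Finset.sum_congr rfl fun z hz => by simp only [hnode z hz]
  rw [e1, e2, e3] at h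
  -- A piecewise affine field is a convex combination of nodal values, here unit vectors.
  have hdl : ∀ x ∈ closure Ω, ‖d₀ x‖ ≤ 1 := fun x hx => by
    rw [← hd.memCG_old.eq_interp hx]
    exact norm_interp_le (fun z hz => (hd.norm_old z hz).le) hx
  -- the transport term
  set I : Pt N → Pt 3 := 𝒯.interp (fun y => cross (d₀ y) (c y)) with hI
  have ld₀ := hd.memCG_old.isLip hΩ.convex
  have lv := hv.isLip hΩ.convex
  have lI : IsLip Ω I := isLip_interp hΩ.convex _
  have hI3 : ∫ x in Ω, ‖I x‖ ^ (3 : ℝ) ≤ S := by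
    refine (integral_interp_rpow_le hΩ _ (by norm_num)).trans (Finset.sum_le_sum fun z hz => ?_)
    refine mul_le_mul_of_nonneg_right ?_ (hm0 z hz)
    rw [← hc3]
    gcongr
    refine (norm_cross_le hN _ _).trans ?_
    rw [hd.norm_old z hz, one_mul]
  have t1 : |l2Inner Ω (fun x => cross (d₀ x) (fderiv ℝ d₀ x (v x))) I|
      ≤ Real.sqrt (gradInner Ω d₀ d₀) * (C * Real.sqrt (gradInner Ω v v)) * S ^ (1 / 3 : ℝ) := by
    have hb1 : BM Ω (fun x => ‖fderiv ℝ d₀ x‖) := (ld₀.bm_fderiv hΩ).norm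
    have hb2 : BM Ω (fun x => ‖v x‖) := (lv.bm hΩ).norm
    have hb3 : BM Ω (fun x => ‖I x‖) := (lI.bm hΩ).norm
    have hh := integral_holder_two_six_three hΩ hb1 hb2 hb3
    simp only [norm_norm] at hh
    have hl : |l2Inner Ω (fun x => cross (d₀ x) (fderiv ℝ d₀ x (v x))) I|
        ≤ ∫ x in Ω, ‖fderiv ℝ d₀ x‖ * (‖v x‖ * ‖I x‖) := by
      rw [l2Inner, ← Real.norm_eq_abs]
      refine norm_integral_le_of_norm_le ((hb1.mul (hb2.mul hb3)).integrable hΩ) ?_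
      refine (ae_restrict_iff' hΩ.isOpen.measurableSet).2 (.of_forall fun x hx => ?_)
      refine (norm_inner_le_norm _ _).trans ?_
      rw [← mul_assoc]
      gcongr
      refine (norm_cross_le hN _ _).trans ?_
      calc ‖d₀ x‖ * ‖fderiv ℝ d₀ x (v x)‖ ≤ 1 * (‖fderiv ℝ d₀ x‖ * ‖v x‖) := by
            gcongr
            · exact hdl x (subset_closure hx)
            · exact (fderiv ℝ d₀ x).le_opNorm _
        _ = _ := one_mul _
    refine hl.trans (hh.trans ?_)
    rw [mul_assoc]
    have s1 : Real.sqrt (∫ x in Ω, ‖fderiv ℝ d₀ x‖ ^ 2) ≤ Real.sqrt (gradInner Ω d₀ d₀) :=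
      Real.sqrt_le_sqrt (integral_norm_fderiv_sq_le hΩ ld₀)
    have s2 := hC v lv hv.2.1
    have s3 : (∫ x in Ω, ‖I x‖ ^ (3 : ℝ)) ^ (1 / 3 : ℝ) ≤ S ^ (1 / 3 : ℝ) := by
      gcongr
    have s0 : 0 ≤ (∫ x in Ω, ‖I x‖ ^ (3 : ℝ)) ^ (1 / 3 : ℝ) := by positivity
    gcongr
  -- the elastic term
  have t2 : |𝒯.lumped (fun x => cross (d₀ x) (L x)) (fun x => cross (d₀ x) (c x))|
      ≤ Real.sqrt (𝒯.lumped (fun y => cross (d₀ y) (L y)) (fun y => cross (d₀ y) (L y)))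
        * (A * S ^ (1 / 3 : ℝ)) := by
    have hcs : |𝒯.lumped (fun x => cross (d₀ x) (L x)) (fun x => cross (d₀ x) (c x))|
        ≤ ∑ z ∈ 𝒯.nodes, (‖cross (d₀ z) (L z)‖ * Real.sqrt (m z)) * (‖c z‖ * Real.sqrt (m z)) := by
      refine (Finset.abs_sum_le_sum_abs _ _).trans (Finset.sum_le_sum fun z hz => ?_)
      rw [abs_mul, abs_of_nonneg (hm0 z hz)]
      have h1 : |inner ℝ (cross (d₀ z) (L z)) (cross (d₀ z) (c z))|
          ≤ ‖cross (d₀ z) (L z)‖ * ‖c z‖ := by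
        refine (abs_real_inner_le_norm _ _).trans ?_
        gcongr
        refine (norm_cross_le hN _ _).trans ?_
        rw [hd.norm_old z hz, one_mul]
      calc _ ≤ ‖cross (d₀ z) (L z)‖ * ‖c z‖ * m z :=
            mul_le_mul_of_nonneg_right h1 (hm0 z hz)
        _ = ‖cross (d₀ z) (L z)‖ * ‖c z‖ * (Real.sqrt (m z) * Real.sqrt (m z)) := by
            rw [Real.mul_self_sqrt (hm0 z hz)]
        _ = _ := by ring
    refine hcs.trans ((Real.sum_mul_le_sqrt_mul_sqrt _ _ _).trans ?_)
    have q1 : ∑ z ∈ 𝒯.nodes, (‖cross (d₀ z) (L z)‖ * Real.sqrt (m z)) ^ 2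
        = 𝒯.lumped (fun y => cross (d₀ y) (L y)) (fun y => cross (d₀ y) (L y)) := by
      refine Finset.sum_congr rfl fun z hz => ?_
      rw [mul_pow, Real.sq_sqrt (hm0 z hz), real_inner_self_eq_norm_sq]
    -- Hölder's inequality with exponents `3/2` and `3` for `‖c‖² m^{2/3}` and `m^{1/3}`; the
    -- weights `m` sum to the volume of `Ω`.
    have q2 : ∑ z ∈ 𝒯.nodes, (‖c z‖ * Real.sqrt (m z)) ^ 2
        ≤ S ^ (2 / 3 : ℝ) * (volume.real Ω) ^ (1 / 3 : ℝ) := by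
      have hconj : Real.HolderConjugate (3 / 2) 3 := by
        rw [Real.holderConjugate_iff]; norm_num
      have hh := Real.inner_le_Lp_mul_Lq_of_nonneg 𝒯.nodes hconj
        (f := fun z => ‖c z‖ ^ 2 * (m z) ^ (2 / 3 : ℝ)) (g := fun z => (m z) ^ (1 / 3 : ℝ))
        (fun z hz => mul_nonneg (by positivity) (Real.rpow_nonneg (hm0 z hz) _))
        (fun z hz => Real.rpow_nonneg (hm0 z hz) _)
      have r1 : ∀ z ∈ 𝒯.nodes, (‖c z‖ * Real.sqrt (m z)) ^ 2
          = ‖c z‖ ^ 2 * (m z) ^ (2 / 3 : ℝ) * (m z) ^ (1 / 3 : ℝ) := fun z hz => by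
        rw [mul_pow, Real.sq_sqrt (hm0 z hz), mul_assoc, ← Real.rpow_add_of_nonneg (hm0 z hz)
          (by norm_num) (by norm_num)]; norm_num
      have r2 : ∀ z ∈ 𝒯.nodes, (‖c z‖ ^ 2 * (m z) ^ (2 / 3 : ℝ)) ^ (3 / 2 : ℝ)
          = ‖f z‖ ^ (3 / 2 : ℝ) * m z := fun z hz => by
        rw [Real.mul_rpow (by positivity) (Real.rpow_nonneg (hm0 z hz) _),
          ← Real.rpow_mul (hm0 z hz), ← Real.rpow_two, ← Real.rpow_mul (norm_nonneg _), ← hc3]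
        norm_num
      have r3 : ∀ z ∈ 𝒯.nodes, ((m z) ^ (1 / 3 : ℝ)) ^ (3 : ℝ) = m z := fun z hz => by
        rw [← Real.rpow_mul (hm0 z hz)]; norm_num
      have r4 : ∑ z ∈ 𝒯.nodes, m z = volume.real Ω := by
        rw [hm, ← integral_finsetSum]
        · rw [setIntegral_congr_fun hΩ.isOpen.measurableSet (g := fun _ => (1 : ℝ))
            (fun x hx => sum_hat (subset_closure hx))]
          simp
        · exact fun z _ => ((isLip_hat hΩ.convex z).bm hΩ).integrable hΩ
      rw [Finset.sum_congr rfl r1]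
      refine hh.trans (le_of_eq ?_)
      rw [Finset.sum_congr rfl r2, Finset.sum_congr rfl r3, r4]
      have r5 : ∑ z ∈ 𝒯.nodes, ‖f z‖ ^ (3 / 2 : ℝ) * m z = S := rfl
      rw [r5]
      norm_num
    rw [q1]
    gcongr
    calc Real.sqrt (∑ z ∈ 𝒯.nodes, (‖c z‖ * Real.sqrt (m z)) ^ 2)
        ≤ Real.sqrt (S ^ (2 / 3 : ℝ) * (volume.real Ω) ^ (1 / 3 : ℝ)) := Real.sqrt_le_sqrt q2
      _ = A * S ^ (1 / 3 : ℝ) := by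
        rw [Real.sqrt_mul (by positivity), Real.sqrt_eq_rpow, Real.sqrt_eq_rpow,
          ← Real.rpow_mul hS0, ← Real.rpow_mul (by positivity), hA]
        norm_num
        ring
  set X := Real.sqrt (gradInner Ω d₀ d₀) * Real.sqrt (gradInner Ω v v)
  set Y := Real.sqrt (𝒯.lumped (fun y => cross (d₀ y) (L y)) (fun y => cross (d₀ y) (L y)))
  have hX : 0 ≤ X := by positivity
  have hY : 0 ≤ Y := by positivity
  have hmain : k⁻¹ * S ≤ (C + A) * (X + Y) * S ^ (1 / 3 : ℝ) := by
    have h3 : k⁻¹ * S ≤ |l2Inner Ω (fun x => cross (d₀ x) (fderiv ℝ d₀ x (v x))) I|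
        + |𝒯.lumped (fun x => cross (d₀ x) (L x)) (fun x => cross (d₀ x) (c x))| := by
      have a1 := neg_abs_le (l2Inner Ω (fun x => cross (d₀ x) (fderiv ℝ d₀ x (v x))) I)
      have a2 := le_abs_self (𝒯.lumped (fun x => cross (d₀ x) (L x))
        (fun x => cross (d₀ x) (c x)))
      rw [one_div] at h
      linarith
    have h4 : 0 ≤ S ^ (1 / 3 : ℝ) := by positivity
    have h5 : Real.sqrt (gradInner Ω d₀ d₀) * (C * Real.sqrt (gradInner Ω v v)) = C * X := by
      simp only [X]; ring
    rw [h5] at t1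
    calc k⁻¹ * S ≤ C * X * S ^ (1 / 3 : ℝ) + Y * (A * S ^ (1 / 3 : ℝ)) := by linarith
      _ = (C * X + A * Y) * S ^ (1 / 3 : ℝ) := by ring
      _ ≤ (C + A) * (X + Y) * S ^ (1 / 3 : ℝ) := by
        gcongr
        nlinarith [mul_nonneg hC0.le hY, mul_nonneg hA0 hX]
  -- For `S > 0` a factor `S^{1/3}` is divided out, which leaves the required power `S^{2/3}`.
  rcases hS0.eq_or_lt with h0 | h0
  · rw [← h0, Real.zero_rpow (by norm_num), mul_zero]; positivity
  · have h5 : S = S ^ (2 / 3 : ℝ) * S ^ (1 / 3 : ℝ) := by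
      rw [← Real.rpow_add h0]; norm_num
    have h6 : 0 < S ^ (1 / 3 : ℝ) := by positivity
    refine le_of_mul_le_mul_right ?_ h6
    calc k⁻¹ * S ^ (2 / 3 : ℝ) * S ^ (1 / 3 : ℝ) = k⁻¹ * S := by rw [mul_assoc, ← h5]
      _ ≤ _ := hmain

/-- Node by node, normalization does not increase the distance to the old unit vector. This is the
only reason why the second rate estimate follows from the first. -/
lemma DirectorFacts.lumpedSum_le (hΩ : IsConvexPolyhedralDomain Ω) {d₀ dt d₁ : Pt N → Pt N}
    (h : 𝒯.DirectorFacts d₀ dt d₁) :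
    𝒯.lumpedSum (fun x => d₁ x - d₀ x) ≤ 𝒯.lumpedSum (fun x => dt x - d₀ x) := by
  refine Finset.sum_le_sum fun z hz => mul_le_mul_of_nonneg_right ?_ (integral_hat_pos hΩ hz).le
  gcongr
  exact h.norm_diff_le z hz

end Mesh

/-! ### Homotheties and ray integrals -/

section Rays

variable {N : ℕ}

lemma measurable_enorm_of_continuous {E : Type*} [NormedAddCommGroup E] {f : Pt N → E}
    (hf : Continuous f) : Measurable (fun y => ‖f y‖ₑ) := hf.enorm.measurable

lemma hasDerivAt_ray (z e : Pt N) (s : ℝ) : HasDerivAt (fun s : ℝ => z + s • e) e s := by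
  have := ((hasDerivAt_id s).smul_const e).const_add z
  rwa [one_smul] at this

lemma lintegral_comp_homothety (z : Pt N) {s : ℝ} (hs : 0 < s) (g : Pt N → ℝ≥0∞) :
    ∫⁻ x, g (z + s • (x - z)) = ENNReal.ofReal (s ^ N)⁻¹ * ∫⁻ x, g x := by
  have h1 := lintegral_sub_right_eq_self (μ := (volume : Measure (Pt N)))
    (fun y => g (z + s • y)) z
  rw [h1]
  have h2 := lintegral_map_equiv (μ := (volume : Measure (Pt N))) (fun w => g (z + w))
    (Homeomorph.smulOfNeZero s hs.ne').toMeasurableEquiv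
  have h3 : Measure.map (Homeomorph.smulOfNeZero s hs.ne').toMeasurableEquiv
      (volume : Measure (Pt N)) = ENNReal.ofReal |(s ^ N)⁻¹| • volume := by
    have := Measure.map_addHaar_smul (volume : Measure (Pt N)) hs.ne'
    rw [finrank_euclideanSpace_fin] at this
    exact this
  rw [h3, lintegral_smul_measure, abs_of_pos (by positivity),
    lintegral_add_left_eq_self (μ := (volume : Measure (Pt N))) g z] at h2
  exact h2.symm

/-- The homothety of ratio `s` has Jacobian `s^N`. This cost is later weighed against powers of the
ray parameter. -/
lemma setLIntegral_comp_homothety_le (z : Pt N) {s : ℝ} (hs : 0 < s) {K K' : Set (Pt N)}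
    (hK : MeasurableSet K) (hK' : MeasurableSet K') (hmap : ∀ x ∈ K, z + s • (x - z) ∈ K')
    (g : Pt N → ℝ≥0∞) :
    ∫⁻ x in K, g (z + s • (x - z)) ≤ ENNReal.ofReal (s ^ N)⁻¹ * ∫⁻ x in K', g x := by
  rw [← lintegral_indicator hK, ← lintegral_indicator hK', ← lintegral_comp_homothety z hs]
  refine lintegral_mono fun x => ?_
  by_cases hx : x ∈ K
  · simp [hx, hmap x hx]
  · simp [hx]

lemma lintegral_rpow_Ioc {r : ℝ} (hr : -1 < r) :
    ∫⁻ s in Ioc (0 : ℝ) 1, ENNReal.ofReal (s ^ r) = ENNReal.ofReal (1 / (r + 1)) := by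
  have h1 : IntervalIntegrable (fun s : ℝ => s ^ r) volume 0 1 :=
    intervalIntegral.intervalIntegrable_rpow' hr
  rw [← ofReal_integral_eq_lintegral_ofReal]
  · rw [← intervalIntegral.integral_of_le zero_le_one, integral_rpow (.inl hr)]
    simp [Real.zero_rpow (by linarith : r + 1 ≠ 0)]
  · exact (intervalIntegrable_iff_integrableOn_Ioc_of_le zero_le_one).1 h1
  · exact (ae_restrict_iff' measurableSet_Ioc).2
      (.of_forall fun s hs => Real.rpow_nonneg hs.1.le r)

/-- Starshaped sets with respect to `z`. -/
def Star (z : Pt N) (K : Set (Pt N)) : Prop := ∀ x ∈ K, ∀ s ∈ Ioc (0 : ℝ) 1, z + s • (x - z) ∈ K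

/-- The remainder integrals in Taylor's formula are bounded in `L²`, in dimension at most `3`. -/
lemma lintegral_ray_sq_le (hN : N ≤ 3) {z : Pt N} {K : Set (Pt N)} (hK : MeasurableSet K)
    (hstar : Star z K) {f : Pt N → ℝ≥0∞} (hf : Measurable f) :
    ∫⁻ x in K, (∫⁻ s in Ioc (0 : ℝ) 1, ENNReal.ofReal s * f (z + s • (x - z))) ^ 2
      ≤ 4 * ∫⁻ x in K, f x ^ 2 := by
  have hm : Measurable (fun p : Pt N × ℝ => f (z + p.2 • (p.1 - z))) :=
    hf.comp (by fun_prop)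
  have hmr : ∀ r : ℝ, Measurable (fun s : ℝ => ENNReal.ofReal (s ^ r)) := fun r =>
    (measurable_id.pow_const r).ennreal_ofReal
  -- The weight `s` is split as `s^{-1/2} · s^{3/2}`. Cauchy–Schwarz leaves `s^{5/2}` in front of
  -- `f²`, the homothety costs `s^{-N}`, and for `N ≤ 3` the remaining `s^{-1/2}` is integrable. The
  -- constant `4` is the square of its integral.
  have hpt : ∀ x, (∫⁻ s in Ioc (0 : ℝ) 1, ENNReal.ofReal s * f (z + s • (x - z))) ^ 2
      ≤ 2 * ∫⁻ s in Ioc (0 : ℝ) 1, ENNReal.ofReal (s ^ (5 / 2 : ℝ)) * f (z + s • (x - z)) ^ 2 := by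
    intro x
    have h1 : Measurable (fun s : ℝ => f (z + s • (x - z))) := hf.comp (by fun_prop)
    have h := lintegral_weight_sq_le (m := volume.restrict (Ioc (0 : ℝ) 1))
      (w := fun s => ENNReal.ofReal (s ^ (-(1 / 2) : ℝ)))
      (g := fun s => ENNReal.ofReal (s ^ (3 / 2 : ℝ)) * f (z + s • (x - z)))
      (hmr _).aemeasurable ((hmr _).mul h1).aemeasurable
    rw [lintegral_rpow_Ioc (by norm_num)] at h
    have e1 : ∫⁻ s in Ioc (0 : ℝ) 1, ENNReal.ofReal (s ^ (-(1 / 2) : ℝ)) *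
        (ENNReal.ofReal (s ^ (3 / 2 : ℝ)) * f (z + s • (x - z)))
        = ∫⁻ s in Ioc (0 : ℝ) 1, ENNReal.ofReal s * f (z + s • (x - z)) := by
      refine setLIntegral_congr_fun measurableSet_Ioc fun s hs => ?_
      rw [← mul_assoc, ← ENNReal.ofReal_mul (Real.rpow_nonneg hs.1.le _), ← Real.rpow_add hs.1]
      norm_num
    have e2 : ∫⁻ s in Ioc (0 : ℝ) 1, ENNReal.ofReal (s ^ (-(1 / 2) : ℝ)) *
        (ENNReal.ofReal (s ^ (3 / 2 : ℝ)) * f (z + s • (x - z))) ^ 2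
        = ∫⁻ s in Ioc (0 : ℝ) 1, ENNReal.ofReal (s ^ (5 / 2 : ℝ)) * f (z + s • (x - z)) ^ 2 := by
      refine setLIntegral_congr_fun measurableSet_Ioc fun s hs => ?_
      rw [mul_pow, ← mul_assoc, ← ENNReal.ofReal_pow (Real.rpow_nonneg hs.1.le _),
        ← ENNReal.ofReal_mul (Real.rpow_nonneg hs.1.le _), ← Real.rpow_two, ← Real.rpow_mul hs.1.le,
        ← Real.rpow_add hs.1]
      norm_num
    rw [e1, e2] at h
    refine h.trans (le_of_eq ?_)
    norm_num
  calc ∫⁻ x in K, (∫⁻ s in Ioc (0 : ℝ) 1, ENNReal.ofReal s * f (z + s • (x - z))) ^ 2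
      ≤ ∫⁻ x in K, 2 * ∫⁻ s in Ioc (0 : ℝ) 1,
          ENNReal.ofReal (s ^ (5 / 2 : ℝ)) * f (z + s • (x - z)) ^ 2 :=
        lintegral_mono fun x => hpt x
    _ = 2 * ∫⁻ s in Ioc (0 : ℝ) 1, ∫⁻ x in K,
          ENNReal.ofReal (s ^ (5 / 2 : ℝ)) * f (z + s • (x - z)) ^ 2 := by
        rw [lintegral_const_mul' _ _ (by norm_num), lintegral_lintegral_swap]
        exact (((hmr (5 / 2)).comp measurable_snd).mul (hm.pow_const 2)).aemeasurable
    _ ≤ 2 * ∫⁻ s in Ioc (0 : ℝ) 1, ENNReal.ofReal (s ^ (-(1 / 2) : ℝ)) * ∫⁻ x in K, f x ^ 2 := by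
        gcongr 2 * ?_
        refine setLIntegral_mono' measurableSet_Ioc fun s hs => ?_
        rw [lintegral_const_mul' _ _ ENNReal.ofReal_ne_top]
        have h1 := setLIntegral_comp_homothety_le z hs.1 hK hK (fun x hx => hstar x hx s hs)
          (fun y => f y ^ 2)
        calc ENNReal.ofReal (s ^ (5 / 2 : ℝ)) * ∫⁻ x in K, f (z + s • (x - z)) ^ 2
            ≤ ENNReal.ofReal (s ^ (5 / 2 : ℝ)) * (ENNReal.ofReal (s ^ N)⁻¹ * ∫⁻ x in K, f x ^ 2) := by
              gcongr
          _ = ENNReal.ofReal (s ^ (5 / 2 : ℝ) * (s ^ N)⁻¹) * ∫⁻ x in K, f x ^ 2 := by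
              rw [← mul_assoc, ← ENNReal.ofReal_mul (Real.rpow_nonneg hs.1.le _)]
          _ ≤ _ := by
              gcongr
              rw [← Real.rpow_natCast, ← Real.rpow_neg hs.1.le, ← Real.rpow_add hs.1]
              refine Real.rpow_le_rpow_of_exponent_ge hs.1 hs.2 ?_
              have : (N : ℝ) ≤ 3 := by exact_mod_cast hN
              linarith
    _ = 4 * ∫⁻ x in K, f x ^ 2 := by
        rw [lintegral_mul_const _ (hmr _), lintegral_rpow_Ioc (by norm_num), ← mul_assoc]
        congr 1
        rw [show (1 / (-(1 / 2) + 1) : ℝ) = 2 by norm_num, ENNReal.ofReal_ofNat]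
        norm_num

lemma enorm_le_add_ray {F : Type*} [NormedAddCommGroup F] [NormedSpace ℝ F] [CompleteSpace F]
    {g : Pt N → F} (hg : ContDiff ℝ 1 g) (x y : Pt N) :
    ‖g x‖ₑ ≤ ‖g y‖ₑ + ‖y - x‖ₑ * ∫⁻ t in Ioc (0 : ℝ) 1, ‖fderiv ℝ g (x + t • (y - x))‖ₑ := by
  have hdc : Continuous (fderiv ℝ g) := hg.continuous_fderiv (by norm_num)
  have hd : ∀ s : ℝ, HasDerivAt (fun s : ℝ => g (x + s • (y - x)))
      (fderiv ℝ g (x + s • (y - x)) (y - x)) s := fun s => by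
    exact ((hg.differentiable (by norm_num)) _).hasFDerivAt.comp_hasDerivAt s
      (hasDerivAt_ray x (y - x) s)
  have hcont : Continuous (fun s : ℝ => fderiv ℝ g (x + s • (y - x)) (y - x)) :=
    (hdc.comp (by fun_prop)).clm_apply continuous_const
  have h4 := intervalIntegral.integral_eq_sub_of_hasDerivAt (a := 0) (b := 1)
    (fun s _ => hd s) (hcont.intervalIntegrable 0 1)
  have e : g x = g y + -(g (x + (1 : ℝ) • (y - x)) - g (x + (0 : ℝ) • (y - x))) := by simp
  rw [e, ← h4, intervalIntegral.integral_of_le zero_le_one]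
  refine (enorm_add_le _ _).trans ?_
  rw [enorm_neg]
  gcongr
  refine (enorm_integral_le_lintegral_enorm _).trans ?_
  rw [← lintegral_const_mul' _ _ (by simp)]
  refine lintegral_mono fun s => ?_
  refine (ContinuousLinearMap.le_opENorm _ _).trans ?_
  rw [mul_comm]

/-- Taylor's formula with second-order remainder along rays. -/
lemma enorm_taylor_le {F : Type*} [NormedAddCommGroup F] [NormedSpace ℝ F] [CompleteSpace F]
    {u : Pt N → F} (hu : ContDiff ℝ 2 u) (x z : Pt N) :
    ‖u z - (u x + fderiv ℝ u x (z - x))‖ₑ ≤ ‖x - z‖ₑ ^ 2 * ∫⁻ s in Ioc (0 : ℝ) 1,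
      ENNReal.ofReal s * ‖fderiv ℝ (fderiv ℝ u) (z + s • (x - z))‖ₑ := by
  set ℓ : ℝ → Pt N := fun s => z + s • (x - z) with hℓ
  have hℓd : ∀ s, HasDerivAt ℓ (x - z) s := fun s => hasDerivAt_ray z (x - z) s
  have hu1 : ContDiff ℝ 1 (fderiv ℝ u) := hu.fderiv_right (by norm_num)
  have h1 : ∀ s, HasDerivAt (fun s => u (ℓ s)) (fderiv ℝ u (ℓ s) (x - z)) s := fun s =>
    ((hu.differentiable (by norm_num)) (ℓ s)).hasFDerivAt.comp_hasDerivAt s (hℓd s)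
  have h2 : ∀ s, HasDerivAt (fun s => fderiv ℝ u (ℓ s) (x - z))
      (fderiv ℝ (fderiv ℝ u) (ℓ s) (x - z) (x - z)) s := fun s => by
    have := ((hu1.differentiable (by norm_num)) (ℓ s)).hasFDerivAt.comp_hasDerivAt s (hℓd s)
    exact ((ContinuousLinearMap.apply ℝ F (x - z)).hasFDerivAt).comp_hasDerivAt s this
  -- The derivative is `-s` times the second derivative along the ray. The value at `s = 1` is the
  -- Taylor polynomial at `x` evaluated at `z`, the value at `s = 0` is `u z`.
  have h3 : ∀ s, HasDerivAt (fun s => u (ℓ s) - s • fderiv ℝ u (ℓ s) (x - z))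
      (-(s • fderiv ℝ (fderiv ℝ u) (ℓ s) (x - z) (x - z))) s := fun s => by
    have := (h1 s).sub ((hasDerivAt_id s).smul (h2 s))
    rw [one_smul, add_comm, sub_add_eq_sub_sub, sub_self, zero_sub] at this
    exact this
  have hcont : Continuous (fun s => -(s • fderiv ℝ (fderiv ℝ u) (ℓ s) (x - z) (x - z))) := by
    have hc : Continuous (fderiv ℝ (fderiv ℝ u)) := hu1.continuous_fderiv (by norm_num)
    have hℓc : Continuous ℓ := by fun_prop
    exact (continuous_id.smul (((hc.comp hℓc).clm_apply continuous_const).clm_apply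
      continuous_const)).neg
  have h4 := intervalIntegral.integral_eq_sub_of_hasDerivAt (a := 0) (b := 1)
    (fun s _ => h3 s) (hcont.intervalIntegrable 0 1)
  have e : u z - (u x + fderiv ℝ u x (z - x))
      = -((u (ℓ 1) - (1 : ℝ) • fderiv ℝ u (ℓ 1) (x - z))
        - (u (ℓ 0) - (0 : ℝ) • fderiv ℝ u (ℓ 0) (x - z))) := by
    have e1 : fderiv ℝ u x (z - x) = - fderiv ℝ u x (x - z) := by rw [← map_neg, neg_sub]
    simp [hℓ, e1]; abel
  rw [e, enorm_neg, ← h4, intervalIntegral.integral_of_le zero_le_one]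
  refine (enorm_integral_le_lintegral_enorm _).trans ?_
  rw [← lintegral_const_mul' _ _ (by simp)]
  refine setLIntegral_mono' measurableSet_Ioc fun s hs => ?_
  rw [enorm_neg, enorm_smul, Real.enorm_of_nonneg hs.1.le]
  have h5 : ‖fderiv ℝ (fderiv ℝ u) (ℓ s) (x - z) (x - z)‖ₑ
      ≤ ‖fderiv ℝ (fderiv ℝ u) (ℓ s)‖ₑ * ‖x - z‖ₑ * ‖x - z‖ₑ := by
    refine (ContinuousLinearMap.le_opENorm _ _).trans ?_
    gcongr
    exact ContinuousLinearMap.le_opENorm _ _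
  calc ENNReal.ofReal s * ‖fderiv ℝ (fderiv ℝ u) (ℓ s) (x - z) (x - z)‖ₑ
      ≤ ENNReal.ofReal s * (‖fderiv ℝ (fderiv ℝ u) (ℓ s)‖ₑ * ‖x - z‖ₑ * ‖x - z‖ₑ) := by gcongr
    _ = _ := by ring

lemma ennreal_add_sq_le (a b : ℝ≥0∞) : (a + b) ^ 2 ≤ 2 * (a ^ 2 + b ^ 2) := by
  have := ENNReal.rpow_add_le_mul_rpow_add_rpow a b (p := 2) (by norm_num)
  norm_num at this
  simpa using this

lemma ennreal_add_pow_four_le (a b : ℝ≥0∞) : (a + b) ^ 4 ≤ 8 * (a ^ 4 + b ^ 4) := by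
  calc (a + b) ^ 4 = ((a + b) ^ 2) ^ 2 := by ring
    _ ≤ (2 * (a ^ 2 + b ^ 2)) ^ 2 := by gcongr; exact ennreal_add_sq_le a b
    _ = 4 * (a ^ 2 + b ^ 2) ^ 2 := by ring
    _ ≤ 4 * (2 * ((a ^ 2) ^ 2 + (b ^ 2) ^ 2)) := by gcongr; exact ennreal_add_sq_le _ _
    _ = _ := by ring

/-- The left side of the pointwise bound does not depend on `x`. Squaring and integrating over `K`
turns the bound into one by `L²` norms, with `lintegral_ray_sq_le` for the remainder. -/
lemma sq_mul_volume_le (hN : N ≤ 3) {a b f : Pt N → ℝ≥0∞} (ha : Measurable a) (hb : Measurable b)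
    (hf : Measurable f) {z : Pt N} {K : Set (Pt N)} (hK : MeasurableSet K) (hstar : Star z K)
    {c D : ℝ≥0∞} (h : ∀ x ∈ K, c ≤ (a x + D * b x) + D ^ 2 * ∫⁻ s in Ioc (0 : ℝ) 1,
      ENNReal.ofReal s * f (z + s • (x - z))) :
    c ^ 2 * volume K ≤ 16 * ((∫⁻ x in K, a x ^ 2) + D ^ 2 * (∫⁻ x in K, b x ^ 2)
      + D ^ 4 * ∫⁻ x in K, f x ^ 2) := by
  set R : Pt N → ℝ≥0∞ := fun x => ∫⁻ s in Ioc (0 : ℝ) 1, ENNReal.ofReal s * f (z + s • (x - z))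
    with hR
  have hpt : ∀ x ∈ K, c ^ 2 ≤ 4 * a x ^ 2 + 4 * D ^ 2 * b x ^ 2 + 2 * D ^ 4 * R x ^ 2 := by
    intro x hx
    calc c ^ 2 ≤ ((a x + D * b x) + D ^ 2 * R x) ^ 2 := pow_le_pow_left' (h x hx) 2
      _ ≤ 2 * ((a x + D * b x) ^ 2 + (D ^ 2 * R x) ^ 2) := ennreal_add_sq_le _ _
      _ ≤ 2 * (2 * (a x ^ 2 + (D * b x) ^ 2) + (D ^ 2 * R x) ^ 2) := by
          gcongr; exact ennreal_add_sq_le _ _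
      _ = _ := by ring
  have hmu : Measurable (fun x => 4 * a x ^ 2) := (ha.pow_const 2).const_mul _
  have hmud : Measurable (fun x => 4 * a x ^ 2 + 4 * D ^ 2 * b x ^ 2) :=
    hmu.add ((hb.pow_const 2).const_mul _)
  have hmR : Measurable R := by
    have h0 : Measurable (fun p : Pt N × ℝ => z + p.2 • (p.1 - z)) := by fun_prop
    have : Measurable (fun p : Pt N × ℝ => ENNReal.ofReal p.2 * f (z + p.2 • (p.1 - z))) :=
      (measurable_snd.ennreal_ofReal).mul (hf.comp h0)
    exact this.lintegral_prod_right'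
  calc c ^ 2 * volume K = ∫⁻ _ in K, c ^ 2 := by rw [setLIntegral_const]
    _ ≤ ∫⁻ x in K, (4 * a x ^ 2 + 4 * D ^ 2 * b x ^ 2 + 2 * D ^ 4 * R x ^ 2) :=
        setLIntegral_mono' hK hpt
    _ = 4 * (∫⁻ x in K, a x ^ 2) + 4 * D ^ 2 * (∫⁻ x in K, b x ^ 2)
          + 2 * D ^ 4 * ∫⁻ x in K, R x ^ 2 := by
        rw [lintegral_add_left hmud, lintegral_add_left hmu,
          lintegral_const_mul _ (ha.pow_const 2), lintegral_const_mul _ (hb.pow_const 2),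
          lintegral_const_mul _ (hmR.pow_const 2)]
    _ ≤ 4 * (∫⁻ x in K, a x ^ 2) + 4 * D ^ 2 * (∫⁻ x in K, b x ^ 2)
          + 2 * D ^ 4 * (4 * ∫⁻ x in K, f x ^ 2) := by
        gcongr; exact lintegral_ray_sq_le hN hK hstar hf
    _ ≤ 16 * (∫⁻ x in K, a x ^ 2) + 16 * D ^ 2 * (∫⁻ x in K, b x ^ 2)
          + 16 * D ^ 4 * ∫⁻ x in K, f x ^ 2 := by
        rw [← mul_assoc, show 2 * D ^ 4 * 4 = 8 * D ^ 4 by ring]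
        gcongr <;> norm_num
    _ = _ := by ring

/-- A pointwise bound by `H²` norms over a starshaped set. -/
lemma enorm_sq_mul_volume_le (hN : N ≤ 3) {F : Type*} [NormedAddCommGroup F] [NormedSpace ℝ F]
    [CompleteSpace F] {u : Pt N → F} (hu : ContDiff ℝ 2 u) {z : Pt N} {K : Set (Pt N)}
    (hK : MeasurableSet K) (hstar : Star z K) {D : ℝ≥0∞} (hD : ∀ x ∈ K, ‖x - z‖ₑ ≤ D) :
    ‖u z‖ₑ ^ 2 * volume K ≤ 16 * ((∫⁻ x in K, ‖u x‖ₑ ^ 2) + D ^ 2 * (∫⁻ x in K, ‖fderiv ℝ u x‖ₑ ^ 2)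
      + D ^ 4 * ∫⁻ x in K, ‖fderiv ℝ (fderiv ℝ u) x‖ₑ ^ 2) := by
  have hu1 : ContDiff ℝ 1 (fderiv ℝ u) := hu.fderiv_right (by norm_num)
  refine sq_mul_volume_le hN (measurable_enorm_of_continuous hu.continuous)
    (measurable_enorm_of_continuous hu1.continuous)
    (measurable_enorm_of_continuous (hu1.continuous_fderiv (by norm_num))) hK hstar ?_
  intro x hx
  have e : u z = (u x + fderiv ℝ u x (z - x)) + (u z - (u x + fderiv ℝ u x (z - x))) := by abel
  have h1 := enorm_taylor_le hu x z
  have h2 : ‖fderiv ℝ u x (z - x)‖ₑ ≤ D * ‖fderiv ℝ u x‖ₑ := by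
    refine (ContinuousLinearMap.le_opENorm _ _).trans ?_
    rw [mul_comm, ← enorm_neg, neg_sub]
    exact mul_le_mul' (hD x hx) le_rfl
  rw [e]
  refine (enorm_add_le _ _).trans (add_le_add ((enorm_add_le _ _).trans ?_) (h1.trans ?_))
  · exact add_le_add le_rfl h2
  · exact mul_le_mul' (pow_le_pow_left' (hD x hx) 2) le_rfl

end Rays

/-! ### The embedding `H¹ ⊂ L⁴` on bounded convex domains -/

section L4

variable {N : ℕ} {Ω : Set (Pt N)}

/-- For fixed `t` the inner integral `Φ` satisfies two bounds for `Φ²`: pointwise in `x`, of size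
`t^{-N}`, and integrated over `x`, uniformly in `t`. Their product bounds the integral of `Φ⁴` by a
multiple of `t^{-N}`, and a weight in `t` makes this integrable when `N ≤ 3`. -/
lemma lintegral_segment_pow_four_le (hN : N ≤ 3) (hΩ : IsConvexPolyhedralDomain Ω)
    {f : Pt N → ℝ≥0∞} (hf : Measurable f) :
    ∫⁻ x in Ω, (∫⁻ t in Ioc (0 : ℝ) 1, ∫⁻ y in Ω, f (x + t • (y - x))) ^ 4
      ≤ 432 * 2 ^ N * volume Ω ^ 3 * (∫⁻ x in Ω, f x ^ 2) ^ 2 := by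
  set A := ∫⁻ x in Ω, f x ^ 2 with hA
  set V := volume Ω with hV
  have hΩm := hΩ.isOpen.measurableSet
  have hmr : ∀ r : ℝ, Measurable (fun s : ℝ => ENNReal.ofReal (s ^ r)) := fun r =>
    (measurable_id.pow_const r).ennreal_ofReal
  have hseg : ∀ x ∈ Ω, ∀ y ∈ Ω, ∀ t ∈ Ioc (0 : ℝ) 1, x + t • (y - x) ∈ Ω := by
    intro x hx y hy t ht
    have := hΩ.convex hx hy (sub_nonneg.2 ht.2) ht.1.le (by ring)
    convert this using 1; module
  have hm3 : Measurable (fun p : (Pt N × ℝ) × Pt N => f (p.1.1 + p.1.2 • (p.2 - p.1.1))) := by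
    have : Measurable (fun p : (Pt N × ℝ) × Pt N => p.1.1 + p.1.2 • (p.2 - p.1.1)) := by fun_prop
    exact hf.comp this
  set Φ : Pt N → ℝ → ℝ≥0∞ := fun x t => ∫⁻ y in Ω, f (x + t • (y - x)) with hΦ
  have hΦm : Measurable (fun p : Pt N × ℝ => Φ p.1 p.2) := hm3.lintegral_prod_right'
  have hΦx : ∀ t, Measurable (fun x => Φ x t) := fun t =>
    hΦm.comp (measurable_id.prodMk measurable_const)
  -- Jensen's inequality in the second variable
  have hΦ2 : ∀ x t, Φ x t ^ 2 ≤ V * ∫⁻ y in Ω, f (x + t • (y - x)) ^ 2 := fun x t => by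
    have := lintegral_sq_le (m := volume.restrict Ω) (g := fun y => f (x + t • (y - x)))
      (hf.comp (by fun_prop)).aemeasurable
    rwa [Measure.restrict_apply_univ] at this
  have hsup : ∀ x ∈ Ω, ∀ t ∈ Ioc (0 : ℝ) 1, Φ x t ^ 2 ≤ V * (ENNReal.ofReal (t ^ N)⁻¹ * A) :=
    fun x hx t ht => (hΦ2 x t).trans (by
      gcongr
      exact setLIntegral_comp_homothety_le x ht.1 hΩm hΩm (fun y hy => hseg x hx y hy t ht)
        (fun y => f y ^ 2))
  have hdouble : ∀ t ∈ Ioc (0 : ℝ) 1,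
      ∫⁻ x in Ω, ∫⁻ y in Ω, f (x + t • (y - x)) ^ 2 ≤ 2 ^ N * V * A := by
    intro t ht
    have hc : ∀ s : ℝ, 1 / 2 ≤ s → ENNReal.ofReal (s ^ N)⁻¹ ≤ 2 ^ N := fun s hs => by
      rw [← ENNReal.ofReal_ofNat, ← ENNReal.ofReal_pow (by norm_num)]
      refine ENNReal.ofReal_le_ofReal ?_
      rw [inv_le_comm₀ (by positivity) (by positivity), ← inv_pow]
      gcongr
      linarith
    -- The map `x + t (y - x)` is a homothety of ratio `t` in `y` and of ratio `1 - t` in `x`; the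
    -- variable whose ratio is at least `1/2` is integrated first.
    by_cases h : 1 / 2 ≤ t
    · calc ∫⁻ x in Ω, ∫⁻ y in Ω, f (x + t • (y - x)) ^ 2 ≤ ∫⁻ _ in Ω, 2 ^ N * A := by
            refine setLIntegral_mono' hΩm fun x hx => ?_
            refine (setLIntegral_comp_homothety_le x ht.1 hΩm hΩm
              (fun y hy => hseg x hx y hy t ht) (fun y => f y ^ 2)).trans ?_
            gcongr
            exact hc t h
        _ = _ := by rw [setLIntegral_const]; ring
    · push Not at h
      have hmm : Measurable (fun p : Pt N × Pt N => f (p.1 + t • (p.2 - p.1)) ^ 2) :=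
        (hf.comp (by fun_prop)).pow_const 2
      rw [lintegral_lintegral_swap hmm.aemeasurable]
      calc ∫⁻ y in Ω, ∫⁻ x in Ω, f (x + t • (y - x)) ^ 2 ≤ ∫⁻ _ in Ω, 2 ^ N * A := by
            refine setLIntegral_mono' hΩm fun y hy => ?_
            have e : ∀ x : Pt N, x + t • (y - x) = y + (1 - t) • (x - y) := fun x => by module
            simp only [e]
            refine (setLIntegral_comp_homothety_le y (s := 1 - t) (by linarith) hΩm hΩm
              (fun x hx => ?_) (fun y => f y ^ 2)).trans ?_
            · exact hseg y hy x hx (1 - t) ⟨by linarith, by linarith [ht.1]⟩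
            · gcongr
              exact hc _ (by linarith)
        _ = _ := by rw [setLIntegral_const]; ring
  have hΦ4 : ∀ t ∈ Ioc (0 : ℝ) 1,
      ∫⁻ x in Ω, Φ x t ^ 4 ≤ ENNReal.ofReal (t ^ N)⁻¹ * (2 ^ N * V ^ 3 * A ^ 2) := by
    intro t ht
    calc ∫⁻ x in Ω, Φ x t ^ 4
        ≤ ∫⁻ x in Ω, (V * (ENNReal.ofReal (t ^ N)⁻¹ * A)) *
            (V * ∫⁻ y in Ω, f (x + t • (y - x)) ^ 2) := by
          refine setLIntegral_mono' hΩm fun x hx => ?_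
          calc Φ x t ^ 4 = Φ x t ^ 2 * Φ x t ^ 2 := by ring
            _ ≤ _ := mul_le_mul' (hsup x hx t ht) (hΦ2 x t)
      _ = (V * (ENNReal.ofReal (t ^ N)⁻¹ * A)) * (V * ∫⁻ x in Ω, ∫⁻ y in Ω,
            f (x + t • (y - x)) ^ 2) := by
          have hmm : Measurable (fun x : Pt N => ∫⁻ y in Ω, f (x + t • (y - x)) ^ 2) := by
            have h0 : Measurable (fun p : Pt N × Pt N => f (p.1 + t • (p.2 - p.1)) ^ 2) :=
              (hf.comp (by fun_prop)).pow_const 2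
            exact h0.lintegral_prod_right'
          rw [lintegral_const_mul _ (hmm.const_mul _), lintegral_const_mul _ hmm]
      _ ≤ (V * (ENNReal.ofReal (t ^ N)⁻¹ * A)) * (V * (2 ^ N * V * A)) := by
          gcongr; exact hdouble t ht
      _ = _ := by ring
  -- The weight `t^{-5/6}` has integral `6`, whose cube is `216`. It leaves `t^{5/2}` in front of
  -- `Φ⁴`, which against `t^{-N}` is at worst `t^{-1/2}`.
  have hpt : ∀ x, (∫⁻ t in Ioc (0 : ℝ) 1, Φ x t) ^ 4
      ≤ 216 * ∫⁻ t in Ioc (0 : ℝ) 1, ENNReal.ofReal (t ^ (5 / 2 : ℝ)) * Φ x t ^ 4 := by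
    intro x
    have h1 : Measurable (fun t => Φ x t) := hΦm.comp measurable_prodMk_left
    have h := lintegral_weight_pow_four_le (m := volume.restrict (Ioc (0 : ℝ) 1))
      (w := fun t => ENNReal.ofReal (t ^ (-(5 / 6) : ℝ)))
      (g := fun t => ENNReal.ofReal (t ^ (5 / 6 : ℝ)) * Φ x t)
      (hmr _).aemeasurable ((hmr _).mul h1).aemeasurable
    rw [lintegral_rpow_Ioc (by norm_num)] at h
    have e1 : ∫⁻ t in Ioc (0 : ℝ) 1, ENNReal.ofReal (t ^ (-(5 / 6) : ℝ)) *
        (ENNReal.ofReal (t ^ (5 / 6 : ℝ)) * Φ x t) = ∫⁻ t in Ioc (0 : ℝ) 1, Φ x t := by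
      refine setLIntegral_congr_fun measurableSet_Ioc fun s hs => ?_
      rw [← mul_assoc, ← ENNReal.ofReal_mul (Real.rpow_nonneg hs.1.le _), ← Real.rpow_add hs.1]
      norm_num
    have e2 : ∫⁻ t in Ioc (0 : ℝ) 1, ENNReal.ofReal (t ^ (-(5 / 6) : ℝ)) *
        (ENNReal.ofReal (t ^ (5 / 6 : ℝ)) * Φ x t) ^ 4
        = ∫⁻ t in Ioc (0 : ℝ) 1, ENNReal.ofReal (t ^ (5 / 2 : ℝ)) * Φ x t ^ 4 := by
      refine setLIntegral_congr_fun measurableSet_Ioc fun s hs => ?_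
      rw [mul_pow, ← mul_assoc, ← ENNReal.ofReal_pow (Real.rpow_nonneg hs.1.le _),
        ← ENNReal.ofReal_mul (Real.rpow_nonneg hs.1.le _), ← Real.rpow_natCast,
        ← Real.rpow_mul hs.1.le, ← Real.rpow_add hs.1]
      norm_num
    rw [e1, e2] at h
    refine h.trans (le_of_eq ?_)
    rw [show (1 / (-(5 / 6) + 1) : ℝ) = 6 by norm_num, ENNReal.ofReal_ofNat]
    norm_num
  calc ∫⁻ x in Ω, (∫⁻ t in Ioc (0 : ℝ) 1, Φ x t) ^ 4
      ≤ ∫⁻ x in Ω, 216 * ∫⁻ t in Ioc (0 : ℝ) 1, ENNReal.ofReal (t ^ (5 / 2 : ℝ)) * Φ x t ^ 4 :=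
        lintegral_mono fun x => hpt x
    _ = 216 * ∫⁻ t in Ioc (0 : ℝ) 1, ∫⁻ x in Ω, ENNReal.ofReal (t ^ (5 / 2 : ℝ)) * Φ x t ^ 4 := by
        rw [lintegral_const_mul' _ _ (by norm_num), lintegral_lintegral_swap]
        exact (((hmr (5 / 2)).comp measurable_snd).mul (hΦm.pow_const 4)).aemeasurable
    _ ≤ 216 * ∫⁻ t in Ioc (0 : ℝ) 1, ENNReal.ofReal (t ^ (-(1 / 2) : ℝ)) *
          (2 ^ N * V ^ 3 * A ^ 2) := by
        gcongr 216 * ?_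
        refine setLIntegral_mono' measurableSet_Ioc fun s hs => ?_
        rw [lintegral_const_mul' _ _ ENNReal.ofReal_ne_top]
        calc ENNReal.ofReal (s ^ (5 / 2 : ℝ)) * ∫⁻ x in Ω, Φ x s ^ 4
            ≤ ENNReal.ofReal (s ^ (5 / 2 : ℝ)) *
              (ENNReal.ofReal (s ^ N)⁻¹ * (2 ^ N * V ^ 3 * A ^ 2)) := by
              gcongr; exact hΦ4 s hs
          _ = ENNReal.ofReal (s ^ (5 / 2 : ℝ) * (s ^ N)⁻¹) * (2 ^ N * V ^ 3 * A ^ 2) := by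
              rw [← mul_assoc, ← ENNReal.ofReal_mul (Real.rpow_nonneg hs.1.le _)]
          _ ≤ _ := by
              gcongr
              rw [← Real.rpow_natCast, ← Real.rpow_neg hs.1.le, ← Real.rpow_add hs.1]
              refine Real.rpow_le_rpow_of_exponent_ge hs.1 hs.2 ?_
              have : (N : ℝ) ≤ 3 := by exact_mod_cast hN
              linarith
    _ = _ := by
        rw [lintegral_mul_const _ (hmr _), lintegral_rpow_Ioc (by norm_num)]
        rw [show (1 / (-(1 / 2) + 1) : ℝ) = 2 by norm_num, ENNReal.ofReal_ofNat]
        ring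

/-- `H¹ ⊂ L⁴` on a bounded convex domain, for smooth functions. -/
lemma sobolev_four (hN : N ≤ 3) (hΩ : IsConvexPolyhedralDomain Ω) :
    ∃ C : ℝ≥0∞, C ≠ ∞ ∧ ∀ (F : Type) [NormedAddCommGroup F] [NormedSpace ℝ F] [CompleteSpace F]
      (g : Pt N → F), ContDiff ℝ 1 g →
      ∫⁻ x in Ω, ‖g x‖ₑ ^ 4 ≤ C * ((∫⁻ x in Ω, ‖g x‖ₑ ^ 2) ^ 2
        + (∫⁻ x in Ω, ‖fderiv ℝ g x‖ₑ ^ 2) ^ 2) := by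
  set V := volume Ω with hV
  have hV0 : V ≠ 0 := (hΩ.isOpen.measure_pos volume hΩ.nonempty).ne'
  have hVt : V ≠ ∞ := hΩ.bounded.measure_lt_top.ne
  set D : ℝ≥0∞ := ENNReal.ofReal (Metric.diam Ω)
  have hD : ∀ x ∈ Ω, ∀ y ∈ Ω, ‖y - x‖ₑ ≤ D := fun x hx y hy => by
    rw [← ofReal_norm, ← dist_eq_norm]
    exact ENNReal.ofReal_le_ofReal (Metric.dist_le_diam_of_mem hΩ.bounded hy hx)
  have hΩm := hΩ.isOpen.measurableSet
  refine ⟨(V ^ 4)⁻¹ * (8 * (V ^ 3 + D ^ 4 * (432 * 2 ^ N * V ^ 3))), ?_, ?_⟩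
  · refine ENNReal.mul_ne_top (ENNReal.inv_ne_top.2 (pow_ne_zero _ hV0)) ?_
    have hDt : D ≠ ∞ := ENNReal.ofReal_ne_top
    finiteness
  intro F _ _ _ g hg
  set A := ∫⁻ x in Ω, ‖fderiv ℝ g x‖ₑ ^ 2 with hA
  set B := ∫⁻ x in Ω, ‖g x‖ₑ ^ 2 with hB
  have hgc := hg.continuous
  have hdc : Continuous (fderiv ℝ g) := hg.continuous_fderiv (by norm_num)
  have hfm : Measurable (fun y => ‖fderiv ℝ g y‖ₑ) := (measurable_enorm_of_continuous hdc)
  set Ψ : Pt N → ℝ≥0∞ := fun x => ∫⁻ t in Ioc (0 : ℝ) 1, ∫⁻ y in Ω,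
    ‖fderiv ℝ g (x + t • (y - x))‖ₑ with hΨ
  -- The fundamental theorem of calculus along the segments from `x`, averaged over all end points
  -- `y` in the convex domain.
  have hpt : ∀ x ∈ Ω, V * ‖g x‖ₑ ≤ (∫⁻ y in Ω, ‖g y‖ₑ) + D * Ψ x := by
    intro x hx
    have hmt : Measurable (fun p : Pt N × ℝ => ‖fderiv ℝ g (x + p.2 • (p.1 - x))‖ₑ) :=
      hfm.comp (by fun_prop)
    calc V * ‖g x‖ₑ = ∫⁻ _ in Ω, ‖g x‖ₑ := by rw [setLIntegral_const, mul_comm]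
      _ ≤ ∫⁻ y in Ω, (‖g y‖ₑ + D * ∫⁻ t in Ioc (0 : ℝ) 1, ‖fderiv ℝ g (x + t • (y - x))‖ₑ) := by
          refine setLIntegral_mono' hΩm fun y hy => (enorm_le_add_ray hg x y).trans ?_
          gcongr
          exact hD x hx y hy
      _ = (∫⁻ y in Ω, ‖g y‖ₑ) + D * Ψ x := by
          rw [lintegral_add_left (measurable_enorm_of_continuous hgc),
            lintegral_const_mul' _ _ ENNReal.ofReal_ne_top,
            lintegral_lintegral_swap hmt.aemeasurable]
  have hΨm : Measurable Ψ := by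
    have h0 : Measurable (fun p : (Pt N × ℝ) × Pt N => p.1.1 + p.1.2 • (p.2 - p.1.1)) := by fun_prop
    have h1 : Measurable (fun p : (Pt N × ℝ) × Pt N =>
      ‖fderiv ℝ g (p.1.1 + p.1.2 • (p.2 - p.1.1))‖ₑ) := hfm.comp h0
    exact (h1.lintegral_prod_right' (ν := volume.restrict Ω)).lintegral_prod_right'
  have hL1 : (∫⁻ y in Ω, ‖g y‖ₑ) ^ 2 ≤ V * B := by
    have := lintegral_sq_le (m := volume.restrict Ω) (measurable_enorm_of_continuous hgc).aemeasurable
    rwa [Measure.restrict_apply_univ] at this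
  have hmain : V ^ 4 * ∫⁻ x in Ω, ‖g x‖ₑ ^ 4
      ≤ 8 * (V ^ 3 + D ^ 4 * (432 * 2 ^ N * V ^ 3)) * (B ^ 2 + A ^ 2) := by
    calc V ^ 4 * ∫⁻ x in Ω, ‖g x‖ₑ ^ 4 = ∫⁻ x in Ω, (V * ‖g x‖ₑ) ^ 4 := by
          rw [← lintegral_const_mul' _ _ (by finiteness)]; simp only [mul_pow]
      _ ≤ ∫⁻ x in Ω, 8 * ((∫⁻ y in Ω, ‖g y‖ₑ) ^ 4 + D ^ 4 * Ψ x ^ 4) := by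
          refine setLIntegral_mono' hΩm fun x hx => ?_
          refine le_trans (by gcongr; exact hpt x hx) ((ennreal_add_pow_four_le _ _).trans ?_)
          rw [mul_pow]
      _ = 8 * ((∫⁻ y in Ω, ‖g y‖ₑ) ^ 4 * V + D ^ 4 * ∫⁻ x in Ω, Ψ x ^ 4) := by
          rw [lintegral_const_mul' _ _ (by norm_num), lintegral_add_left measurable_const,
            setLIntegral_const, lintegral_const_mul _ (hΨm.pow_const 4)]
      _ ≤ 8 * ((V * B) ^ 2 * V + D ^ 4 * (432 * 2 ^ N * V ^ 3 * A ^ 2)) := by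
          have h1 : (∫⁻ y in Ω, ‖g y‖ₑ) ^ 4 ≤ (V * B) ^ 2 := by
            calc (∫⁻ y in Ω, ‖g y‖ₑ) ^ 4 = ((∫⁻ y in Ω, ‖g y‖ₑ) ^ 2) ^ 2 := by ring
              _ ≤ _ := pow_le_pow_left' hL1 2
          have h2 : ∫⁻ x in Ω, Ψ x ^ 4 ≤ 432 * 2 ^ N * V ^ 3 * A ^ 2 :=
            lintegral_segment_pow_four_le hN hΩ hfm
          exact mul_le_mul' le_rfl (add_le_add (mul_le_mul' h1 le_rfl) (mul_le_mul' le_rfl h2))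
      _ = 8 * (V ^ 3 * B ^ 2 + D ^ 4 * (432 * 2 ^ N * V ^ 3) * A ^ 2) := by ring
      _ ≤ 8 * ((V ^ 3 + D ^ 4 * (432 * 2 ^ N * V ^ 3)) * B ^ 2
            + (V ^ 3 + D ^ 4 * (432 * 2 ^ N * V ^ 3)) * A ^ 2) := by
          gcongr
          · exact le_self_add
          · exact le_add_self
      _ = _ := by ring
  rw [mul_assoc, ← ENNReal.div_eq_inv_mul, ENNReal.le_div_iff_mul_le
    (.inl (pow_ne_zero _ hV0)) (.inl (by finiteness)), mul_comm]
  exact hmain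

end L4

/-! ### Mollification of Sobolev functions -/

section WeakMoll

lemma eLpNorm_two_sq {α E : Type*} [MeasurableSpace α] {m : Measure α} [NormedAddCommGroup E]
    (f : α → E) : eLpNorm f 2 m ^ 2 = ∫⁻ x, ‖f x‖ₑ ^ 2 ∂m := by
  rw [eLpNorm_eq_lintegral_rpow_enorm_toReal (by norm_num) (by norm_num), ← ENNReal.rpow_two,
    ← ENNReal.rpow_mul]
  simp

lemma lintegral_add_sq_le {α E : Type*} [MeasurableSpace α] {m : Measure α} [NormedAddCommGroup E]
    {f : α → E} (g : α → E) (hf : AEStronglyMeasurable f m) :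
    ∫⁻ x, ‖f x + g x‖ₑ ^ 2 ∂m ≤ 2 * ((∫⁻ x, ‖f x‖ₑ ^ 2 ∂m) + ∫⁻ x, ‖g x‖ₑ ^ 2 ∂m) := by
  rw [← lintegral_add_left' (hf.enorm.pow_const 2), ← lintegral_const_mul' _ _ (by norm_num)]
  refine lintegral_mono fun x => le_trans ?_ (ennreal_add_sq_le _ _)
  exact pow_le_pow_left' (enorm_add_le _ _) 2

lemma memLp_indicator {α E : Type*} [MeasurableSpace α] {m : Measure α} [NormedAddCommGroup E]
    {f : α → E} {s : Set α} (hs : MeasurableSet s) {p : ℝ≥0∞} (hf : MemLp f p (m.restrict s)) :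
    MemLp (s.indicator f) p m := (memLp_indicator_iff_restrict hs).2 hf

variable {N : ℕ} {F : Type*} [NormedAddCommGroup F] [NormedSpace ℝ F] {Ω : Set (Pt N)}

lemma locallyIntegrable_of_memLp {f : Pt N → F} (hf : MemLp f 2) : LocallyIntegrable f :=
  hf.locallyIntegrable (by norm_num)

lemma lintegral_indicator_sq {f : Pt N → F} (hΩ : MeasurableSet Ω) :
    ∫⁻ x, ‖Ω.indicator f x‖ₑ ^ 2 = ∫⁻ x in Ω, ‖f x‖ₑ ^ 2 := by
  rw [← lintegral_indicator hΩ]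
  refine lintegral_congr fun x => ?_
  by_cases hx : x ∈ Ω <;> simp [hx]

lemma moll_clm_apply [CompleteSpace F] (φ : ContDiffBump (0 : Pt N)) {G : Pt N → (Pt N →L[ℝ] F)}
    (hG : LocallyIntegrable G) (p e : Pt N) :
    moll φ G p e = ∫ t, φ.normed volume t • G (p - t) e := by
  have hi : Integrable (fun t => φ.normed volume t • G (p - t)) :=
    (φ.hasCompactSupport_normed (μ := volume)).convolutionExists_left (μ := volume)
      (ContinuousLinearMap.lsmul ℝ ℝ) φ.continuous_normed hG p
  rw [moll, ContinuousLinearMap.integral_apply hi]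
  rfl

lemma tsupport_comp_sub_subset {ψ : Pt N → ℝ} {R : ℝ} (h : tsupport ψ ⊆ Metric.closedBall 0 R)
    (p : Pt N) : tsupport (fun y => ψ (p - y)) ⊆ Metric.closedBall p R := by
  refine closure_minimal (fun y hy => ?_) Metric.isClosed_closedBall
  have : p - y ∈ Metric.closedBall (0 : Pt N) R := h (subset_tsupport _ hy)
  rw [mem_closedBall_zero_iff] at this
  rwa [Metric.mem_closedBall, dist_comm, dist_eq_norm]

/-- Away from the boundary the gradient of a mollification is the mollified weak gradient. -/
lemma hasFDerivAt_moll_of_weak [CompleteSpace F] (hΩ : MeasurableSet Ω)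
    (φ : ContDiffBump (0 : Pt N)) {f : Pt N → F} {G : Pt N → (Pt N →L[ℝ] F)}
    (h : HasWeakGradient Ω f G) {p : Pt N} (hp : Metric.closedBall p φ.rOut ⊆ Ω) :
    HasFDerivAt (moll φ (Ω.indicator f)) (moll φ (Ω.indicator G) p) p := by
  have hf : LocallyIntegrable (Ω.indicator f) :=
    locallyIntegrable_of_memLp (memLp_indicator hΩ h.1)
  have hG : LocallyIntegrable (Ω.indicator G) :=
    locallyIntegrable_of_memLp (memLp_indicator hΩ h.2.1)
  have hcs := φ.hasCompactSupport_normed (μ := (volume : Measure (Pt N)))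
  have hsm : ContDiff ℝ (⊤ : ℕ∞) (φ.normed (volume : Measure (Pt N))) := φ.contDiff_normed
  have h1 := hcs.hasFDerivAt_convolution_left (μ := volume) (ContinuousLinearMap.lsmul ℝ ℝ (E := F))
    (hsm.of_le (by exact_mod_cast le_top)) hf p
  have hci := (hcs.fderiv (𝕜 := ℝ)).convolutionExists_left (μ := volume)
    ((ContinuousLinearMap.lsmul ℝ ℝ (E := F)).precompL (Pt N))
    (hsm.continuous_fderiv (by norm_num)) hf p
  rw [← moll_eq_convolution] at h1
  refine h1.congr_fderiv ?_
  ext1 e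
  rw [moll_clm_apply φ hG, convolution, ContinuousLinearMap.integral_apply hci]
  simp only [ContinuousLinearMap.precompL_apply, ContinuousLinearMap.lsmul_apply]
  have ht : tsupport (φ.normed (volume : Measure (Pt N))) ⊆ Metric.closedBall 0 φ.rOut := by
    rw [φ.tsupport_normed_eq]
  -- The reflected and translated kernel is supported in the closed ball around `p`, hence in `Ω`;
  -- it may be inserted into the definition of the weak gradient, and the zero extension is not
  -- seen.
  have htest : IsTestFunction Ω (fun y => φ.normed volume (p - y)) := by
    refine ⟨hsm.comp (contDiff_const.sub contDiff_id), ?_, ?_⟩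
    · exact HasCompactSupport.intro (isCompact_closedBall p φ.rOut) fun y hy =>
        by
        by_contra h0
        exact hy (tsupport_comp_sub_subset ht p (subset_tsupport _ h0))
    · exact (tsupport_comp_sub_subset ht p).trans hp
  have hw := h.2.2 _ htest e
  have hd : ∀ y, fderiv ℝ (fun y => φ.normed volume (p - y)) y e
      = - fderiv ℝ (φ.normed (volume : Measure (Pt N))) (p - y) e := fun y => by
    have h2 : HasFDerivAt (fun y => φ.normed volume (p - y)) _ y :=
      ((hsm.differentiable (by norm_num)) (p - y)).hasFDerivAt.comp y
        ((hasFDerivAt_id y).const_sub p)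
    rw [h2.fderiv]; simp
  have e1 := integral_sub_left_eq_self (μ := (volume : Measure (Pt N)))
    (fun y => fderiv ℝ (φ.normed (volume : Measure (Pt N))) (p - y) e • Ω.indicator f y) p
  have e2 := integral_sub_left_eq_self (μ := (volume : Measure (Pt N)))
    (fun y => φ.normed volume (p - y) • Ω.indicator G y e) p
  simp only [sub_sub_cancel] at e1 e2
  rw [e1, e2]
  simp only [hd, neg_smul] at hw
  rw [integral_neg, neg_inj] at hw
  have i1 : ∫ y, fderiv ℝ (φ.normed (volume : Measure (Pt N))) (p - y) e • Ω.indicator f y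
      = ∫ y in Ω, fderiv ℝ (φ.normed (volume : Measure (Pt N))) (p - y) e • f y := by
    rw [← integral_indicator hΩ]
    congr 1 with y
    by_cases hy : y ∈ Ω <;> simp [hy]
  have i2 : ∫ y, φ.normed volume (p - y) • Ω.indicator G y e
      = ∫ y in Ω, φ.normed volume (p - y) • G y e := by
    rw [← integral_indicator hΩ]
    congr 1 with y
    by_cases hy : y ∈ Ω <;> simp [hy]
  rw [i1, i2, hw]

/-- Mollification combined with a contraction of the domain. -/
def mollDil (Ω : Set (Pt N)) (x₀ : Pt N) (δ : ℝ) (φ : ContDiffBump (0 : Pt N)) (f : Pt N → F)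
    (x : Pt N) : F := moll φ (Ω.indicator f) (x₀ + (1 - δ) • (x - x₀))

lemma contDiff_mollDil (hΩ : MeasurableSet Ω) (x₀ : Pt N) (δ : ℝ) (φ : ContDiffBump (0 : Pt N))
    {f : Pt N → F} (hf : MemLp f 2 (volume.restrict Ω)) :
    ContDiff ℝ (⊤ : ℕ∞) (mollDil Ω x₀ δ φ f) :=
  (contDiff_moll φ (locallyIntegrable_of_memLp (memLp_indicator hΩ hf))).comp
    (by fun_prop)

/-- For `δ ≤ 1/2` the contraction ratio is at least `1/2`, which bounds the Jacobian independently
of `δ`. -/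
lemma lintegral_comp_dil_le (x₀ : Pt N) {δ : ℝ} (hδ : δ ≤ 1 / 2) (g : Pt N → ℝ≥0∞) :
    ∫⁻ x, g (x₀ + (1 - δ) • (x - x₀)) ≤ 2 ^ N * ∫⁻ x, g x := by
  rw [lintegral_comp_homothety x₀ (by linarith)]
  gcongr
  rw [← ENNReal.ofReal_ofNat, ← ENNReal.ofReal_pow (by norm_num)]
  refine ENNReal.ofReal_le_ofReal ?_
  have : (1 / 2 : ℝ) ≤ 1 - δ := by linarith
  rw [inv_le_comm₀ (by positivity) (by positivity), ← inv_pow]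
  gcongr
  linarith

lemma lintegral_mollDil_sq_le (hΩ : MeasurableSet Ω) (x₀ : Pt N) {δ : ℝ} (hδ : δ ≤ 1 / 2)
    (φ : ContDiffBump (0 : Pt N)) {f : Pt N → F} (hf : MemLp f 2 (volume.restrict Ω)) :
    ∫⁻ x in Ω, ‖mollDil Ω x₀ δ φ f x‖ₑ ^ 2 ≤ 2 ^ N * ∫⁻ x in Ω, ‖f x‖ₑ ^ 2 := by
  calc ∫⁻ x in Ω, ‖mollDil Ω x₀ δ φ f x‖ₑ ^ 2
      ≤ ∫⁻ x, ‖moll φ (Ω.indicator f) (x₀ + (1 - δ) • (x - x₀))‖ₑ ^ 2 :=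
        setLIntegral_le_lintegral _ _
    _ ≤ 2 ^ N * ∫⁻ x, ‖moll φ (Ω.indicator f) x‖ₑ ^ 2 := lintegral_comp_dil_le x₀ hδ
        (fun x => ‖moll φ (Ω.indicator f) x‖ₑ ^ 2)
    _ ≤ 2 ^ N * ∫⁻ x, ‖Ω.indicator f x‖ₑ ^ 2 := by
        gcongr 2 ^ N * ?_
        exact lintegral_moll_sq_le φ (memLp_indicator hΩ hf).1
    _ = _ := by rw [lintegral_indicator_sq hΩ]

/-- The ball consists of the combinations `(1 - δ) x + δ y` with `y` in the ball around `x₀`, which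
lie in `Ω` by convexity. Contraction thus makes room for mollification at radius `r δ` without
leaving the domain. -/
lemma closedBall_dil_subset (hΩ : Convex ℝ Ω) {x₀ : Pt N} {r : ℝ}
    (hr : Metric.closedBall x₀ r ⊆ Ω) {δ : ℝ} (h0 : 0 < δ) (h1 : δ ≤ 1) {x : Pt N} (hx : x ∈ Ω) :
    Metric.closedBall (x₀ + (1 - δ) • (x - x₀)) (r * δ) ⊆ Ω := by
  intro y hy
  rw [Metric.mem_closedBall, dist_eq_norm] at hy
  set e := y - (x₀ + (1 - δ) • (x - x₀)) with he
  have hm : x₀ + δ⁻¹ • e ∈ Ω := by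
    refine hr ?_
    rw [Metric.mem_closedBall, dist_eq_norm, add_sub_cancel_left, norm_smul, norm_inv,
      Real.norm_of_nonneg h0.le, inv_mul_le_iff₀ h0]
    linarith
  have := hΩ hx hm (sub_nonneg.2 h1) h0.le (by ring)
  convert this using 1
  rw [smul_add, smul_smul, mul_inv_cancel₀ h0.ne', one_smul, he]
  module

lemma hasFDerivAt_mollDil [CompleteSpace F] (hΩ : IsConvexPolyhedralDomain Ω) {x₀ : Pt N} {r : ℝ}
    (hr : Metric.closedBall x₀ r ⊆ Ω) {δ : ℝ} (h0 : 0 < δ) (h1 : δ ≤ 1)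
    {φ : ContDiffBump (0 : Pt N)} (hφ : φ.rOut = r * δ) {f : Pt N → F} {G : Pt N → (Pt N →L[ℝ] F)}
    (h : HasWeakGradient Ω f G) {x : Pt N} (hx : x ∈ Ω) :
    HasFDerivAt (mollDil Ω x₀ δ φ f) ((1 - δ) • mollDil Ω x₀ δ φ G x) x := by
  have hb := closedBall_dil_subset hΩ.convex hr h0 h1 hx
  rw [← hφ] at hb
  have h2 := hasFDerivAt_moll_of_weak hΩ.isOpen.measurableSet φ h hb
  have h3 : HasFDerivAt (fun x : Pt N => x₀ + (1 - δ) • (x - x₀))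
      ((1 - δ) • ContinuousLinearMap.id ℝ (Pt N)) x :=
    ((((hasFDerivAt_id x).sub_const x₀).const_smul (1 - δ))).const_add x₀
  refine (h2.comp x h3).congr_fderiv ?_
  ext1 e
  simp [mollDil]

end WeakMoll

/-! ### Approximation of solenoidal `H²` fields -/

section Approx

variable {N : ℕ} {F : Type*} [NormedAddCommGroup F] [NormedSpace ℝ F] {Ω : Set (Pt N)}

lemma exists_pos_mul_le {K η : ℝ≥0∞} (hK : K ≠ ∞) (hη : η ≠ 0) :
    ∃ t : ℝ, 0 < t ∧ t ≤ 1 ∧ K * ENNReal.ofReal t ≤ η := by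
  obtain ⟨n, hn, h⟩ := ENNReal.exists_nnreal_pos_mul_lt hK hη
  refine ⟨min n 1, by positivity, min_le_right _ _, le_trans ?_ h.le⟩
  rw [mul_comm]
  gcongr
  rw [← ENNReal.ofReal_coe_nnreal]
  exact ENNReal.ofReal_le_ofReal (min_le_left _ _)

lemma moll_add (φ : ContDiffBump (0 : Pt N)) {f g : Pt N → F} (hf : LocallyIntegrable f)
    (hg : LocallyIntegrable g) (p : Pt N) :
    moll φ (fun x => f x + g x) p = moll φ f p + moll φ g p := by
  have hi : ∀ {f : Pt N → F}, LocallyIntegrable f →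
      Integrable (fun t => φ.normed volume t • f (p - t)) := fun hf =>
    (φ.hasCompactSupport_normed (μ := volume)).convolutionExists_left (μ := volume)
      (ContinuousLinearMap.lsmul ℝ ℝ) φ.continuous_normed hf p
  simp only [moll, smul_add]
  exact integral_add (hi hf) (hi hg)

/-- The function is approximated in `L²` by a continuous `g` with compact support. The operator is
bounded on `L²`, and on `g` it moves arguments by at most a multiple of `δ`, so uniform continuity
applies. -/
lemma lintegral_mollDil_sub_le [CompleteSpace F] (hΩ : IsConvexPolyhedralDomain Ω) {x₀ : Pt N}
    (hx₀ : x₀ ∈ Ω) {r : ℝ} (hr : 0 < r) {f : Pt N → F} (hf : MemLp f 2 (volume.restrict Ω))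
    {η : ℝ≥0∞} (hη : η ≠ 0) :
    ∃ δ₀ : ℝ, 0 < δ₀ ∧ ∀ δ : ℝ, 0 < δ → δ ≤ δ₀ → δ ≤ 1 / 2 → ∀ φ : ContDiffBump (0 : Pt N),
      φ.rOut = r * δ → ∫⁻ x in Ω, ‖mollDil Ω x₀ δ φ f x - f x‖ₑ ^ 2 ≤ η := by
  have hΩm := hΩ.isOpen.measurableSet
  have hVt : volume Ω ≠ ∞ := hΩ.bounded.measure_lt_top.ne
  have hf' : MemLp (Ω.indicator f) 2 := memLp_indicator hΩm hf
  obtain ⟨ε, hε0, hε1, hε⟩ := exists_pos_mul_le (K := 2 * 2 ^ N + 4 * volume Ω + 4) (η := η)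
    (by finiteness) hη
  obtain ⟨g, hgs, hfg, hgc, hgm⟩ := hf'.exists_hasCompactSupport_eLpNorm_sub_le (by norm_num)
    (ε := ENNReal.ofReal ε) (by simpa using hε0)
  have hεsq : ENNReal.ofReal ε ^ 2 ≤ ENNReal.ofReal ε := by
    rw [sq]
    exact mul_le_of_le_one_right' (by simpa using hε1)
  have hfg2 : ∫⁻ x, ‖Ω.indicator f x - g x‖ₑ ^ 2 ≤ ENNReal.ofReal ε := by
    have := pow_le_pow_left' hfg 2
    rw [eLpNorm_two_sq] at this
    exact this.trans hεsq
  obtain ⟨τ, hτ0, hτ⟩ := Metric.uniformContinuous_iff.1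
    (hgs.uniformContinuous_of_continuous hgc) ε hε0
  set D := Metric.diam Ω with hD
  have hD0 : 0 ≤ D := Metric.diam_nonneg
  refine ⟨τ / (2 * (D + r + 1)), by positivity, fun δ h0 h1 h2 φ hφ => ?_⟩
  have hLg : LocallyIntegrable g := hgc.locallyIntegrable
  have hLf : LocallyIntegrable (Ω.indicator f) := locallyIntegrable_of_memLp hf'
  have hsplit : ∀ x, mollDil Ω x₀ δ φ f x - f x
      = moll φ (fun y => Ω.indicator f y - g y) (x₀ + (1 - δ) • (x - x₀))
        + ((moll φ g (x₀ + (1 - δ) • (x - x₀)) - g x) + (g x - f x)) := fun x => by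
    have := moll_add φ (f := fun y => Ω.indicator f y - g y) (g := g) (hLf.sub hLg) hLg
      (x₀ + (1 - δ) • (x - x₀))
    simp only [sub_add_cancel] at this
    rw [mollDil, show moll φ (Ω.indicator f) = moll φ (fun x => Ω.indicator f x) from rfl, this]
    abel
  have hm1 : Continuous (moll φ (fun y => Ω.indicator f y - g y)) :=
    (contDiff_moll φ (hLf.sub hLg)).continuous
  have hS : Continuous (fun x : Pt N => x₀ + (1 - δ) • (x - x₀)) := by fun_prop
  have hm2 : Continuous (fun x => moll φ g (x₀ + (1 - δ) • (x - x₀)) - g x) :=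
    ((contDiff_moll φ hLg).continuous.comp hS).sub hgc
  have hclose : ∀ x ∈ Ω, ‖moll φ g (x₀ + (1 - δ) • (x - x₀)) - g x‖ₑ ^ 2 ≤ ENNReal.ofReal ε := by
    intro x hx
    have h3 : ‖moll φ g (x₀ + (1 - δ) • (x - x₀)) - g x‖ ≤ ε := by
      refine norm_moll_sub_le φ hLg fun t ht => ?_
      rw [← dist_eq_norm]
      refine (hτ ?_).le
      rw [dist_eq_norm]
      have e : x₀ + (1 - δ) • (x - x₀) - t - x = δ • (x₀ - x) - t := by module
      have h4 : ‖x₀ - x‖ ≤ D := by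
        rw [← dist_eq_norm]; exact Metric.dist_le_diam_of_mem hΩ.bounded hx₀ hx
      have h5 : δ * (2 * (D + r + 1)) ≤ τ := (le_div_iff₀ (by positivity)).1 h1
      rw [e]
      calc ‖δ • (x₀ - x) - t‖ ≤ ‖δ • (x₀ - x)‖ + ‖t‖ := norm_sub_le _ _
        _ ≤ δ * D + r * δ := by
          rw [norm_smul, Real.norm_of_nonneg h0.le, ← hφ]
          gcongr
        _ < τ := by nlinarith
    rw [← ofReal_norm]
    exact (pow_le_pow_left' (ENNReal.ofReal_le_ofReal h3) 2).trans hεsq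
  calc ∫⁻ x in Ω, ‖mollDil Ω x₀ δ φ f x - f x‖ₑ ^ 2
      ≤ 2 * ((∫⁻ x in Ω, ‖moll φ (fun y => Ω.indicator f y - g y) (x₀ + (1 - δ) • (x - x₀))‖ₑ ^ 2)
        + ∫⁻ x in Ω, ‖(moll φ g (x₀ + (1 - δ) • (x - x₀)) - g x) + (g x - f x)‖ₑ ^ 2) := by
        simp only [hsplit]
        exact lintegral_add_sq_le _ (hm1.comp hS).aestronglyMeasurable
    _ ≤ 2 * (2 ^ N * ENNReal.ofReal ε
        + 2 * ((∫⁻ x in Ω, ‖moll φ g (x₀ + (1 - δ) • (x - x₀)) - g x‖ₑ ^ 2)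
          + ∫⁻ x in Ω, ‖g x - f x‖ₑ ^ 2)) := by
        gcongr
        · calc _ ≤ ∫⁻ x, ‖moll φ (fun y => Ω.indicator f y - g y) (x₀ + (1 - δ) • (x - x₀))‖ₑ ^ 2 :=
                setLIntegral_le_lintegral _ _
            _ ≤ _ := lintegral_comp_dil_le x₀ h2
                (fun x => ‖moll φ (fun y => Ω.indicator f y - g y) x‖ₑ ^ 2)
            _ ≤ 2 ^ N * ENNReal.ofReal ε := by
                gcongr
                exact (lintegral_moll_sq_le φ (hf'.1.sub hgc.aestronglyMeasurable)).trans hfg2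
        · exact lintegral_add_sq_le _ hm2.aestronglyMeasurable
    _ ≤ 2 * (2 ^ N * ENNReal.ofReal ε + 2 * (ENNReal.ofReal ε * volume Ω + ENNReal.ofReal ε)) := by
        have h3 : ∫⁻ x in Ω, ‖moll φ g (x₀ + (1 - δ) • (x - x₀)) - g x‖ₑ ^ 2
            ≤ ENNReal.ofReal ε * volume Ω := by
          rw [← setLIntegral_const]
          exact setLIntegral_mono' hΩm hclose
        have h4 : ∫⁻ x in Ω, ‖g x - f x‖ₑ ^ 2 ≤ ENNReal.ofReal ε := by
          refine le_trans (le_trans (le_of_eq ?_) (setLIntegral_le_lintegral Ω _)) hfg2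
          refine setLIntegral_congr_fun hΩm fun x hx => ?_
          rw [indicator_of_mem hx, ← enorm_neg, neg_sub]
        gcongr
    _ = (2 * 2 ^ N + 4 * volume Ω + 4) * ENNReal.ofReal ε := by ring
    _ ≤ η := hε

/-- Poincaré's inequality near a boundary point, for functions vanishing outside `Ω`. -/
lemma lintegral_sq_le_near_boundary [CompleteSpace F] (hΩ : IsConvexPolyhedralDomain Ω)
    {φ : Pt N → F} (hφ : ContDiff ℝ 1 φ) (hs : tsupport φ ⊆ Ω) {z : Pt N} (hz : z ∉ Ω)
    {R : ℝ} (hR : 0 < R) :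
    ∫⁻ x in Ω ∩ Metric.closedBall z R, ‖φ x‖ₑ ^ 2
      ≤ ENNReal.ofReal R ^ 2 * ∫⁻ x in Ω ∩ Metric.closedBall z (2 * R), ‖fderiv ℝ φ x‖ₑ ^ 2 := by
  have hΩm := hΩ.isOpen.measurableSet
  -- A hyperplane through `z` that does not meet `Ω` provides a unit normal `ν`. From any point of
  -- the ball of radius `R` about `z`, a translation by `R ν` leads out of `Ω`, where `φ` is zero.
  obtain ⟨ℓ, hℓ⟩ := geometric_hahn_banach_open_point hΩ.convex hΩ.isOpen hz
  obtain ⟨x₁, hx₁⟩ := hΩ.nonempty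
  have hℓ0 : ℓ ≠ 0 := fun h => by simpa [h] using hℓ x₁ hx₁
  set a := (InnerProductSpace.toDual ℝ (Pt N)).symm ℓ with ha
  have ha' : ∀ x, ℓ x = inner ℝ a x := fun x => by simp [ha]
  have ha0 : 0 < ‖a‖ := by
    rw [norm_pos_iff]; intro h
    exact hℓ0 (by ext x; simp [ha', h])
  set ν := ‖a‖⁻¹ • a with hν
  have hν1 : ‖ν‖ = 1 := by rw [hν, norm_smul, norm_inv, norm_norm, inv_mul_cancel₀ ha0.ne']
  have hℓν : ℓ ν = ‖a‖ := by
    rw [ha', hν, inner_smul_right, real_inner_self_eq_norm_sq]; field_simp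
  have hout : ∀ x ∈ Metric.closedBall z R, x + R • ν ∉ Ω := by
    intro x hx hmem
    have h1 := hℓ _ hmem
    have h2 : |ℓ (x - z)| ≤ ‖a‖ * R := by
      rw [ha']
      refine (abs_real_inner_le_norm _ _).trans ?_
      gcongr
      rw [← dist_eq_norm]; exact hx
    rw [map_add, map_smul, hℓν, smul_eq_mul] at h1
    rw [map_sub] at h2
    have := (abs_le.1 h2).1
    linarith
  have hzero : ∀ x, x ∉ Ω → φ x = 0 := fun x hx => image_eq_zero_of_notMem_tsupport fun h => hx (hs h)
  have hdzero : ∀ x, x ∉ Ω → ‖fderiv ℝ φ x‖ₑ = 0 := fun x hx => by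
    have : fderiv ℝ φ x = 0 :=
      image_eq_zero_of_notMem_tsupport fun h => hx (hs (tsupport_fderiv_subset ℝ h))
    rw [← ofReal_norm, this, norm_zero, ENNReal.ofReal_zero]
  have hdm : Measurable (fun y => ‖fderiv ℝ φ y‖ₑ) :=
    measurable_enorm_of_continuous (hφ.continuous_fderiv (by norm_num))
  have hpt : ∀ x ∈ Ω ∩ Metric.closedBall z R, ‖φ x‖ₑ ^ 2
      ≤ ENNReal.ofReal R ^ 2 * ∫⁻ t in Ioc (0 : ℝ) 1, ‖fderiv ℝ φ (x + t • (R • ν))‖ₑ ^ 2 := by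
    rintro x ⟨-, hx⟩
    have h1 := enorm_le_add_ray hφ x (x + R • ν)
    rw [hzero _ (hout x hx), enorm_zero, zero_add, add_sub_cancel_left, enorm_smul,
      Real.enorm_of_nonneg hR.le, ← ofReal_norm ν, hν1, ENNReal.ofReal_one, mul_one] at h1
    have hm : Measurable (fun t : ℝ => ‖fderiv ℝ φ (x + t • (R • ν))‖ₑ) := by
      have h0 : Measurable (fun t : ℝ => x + t • (R • ν)) := by fun_prop
      exact hdm.comp h0
    have h2 := lintegral_sq_le (m := volume.restrict (Ioc (0 : ℝ) 1)) hm.aemeasurable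
    rw [Measure.restrict_apply_univ, Real.volume_Ioc, sub_zero, ENNReal.ofReal_one, one_mul] at h2
    calc ‖φ x‖ₑ ^ 2 ≤ (ENNReal.ofReal R * ∫⁻ t in Ioc (0 : ℝ) 1,
          ‖fderiv ℝ φ (x + t • (R • ν))‖ₑ) ^ 2 := pow_le_pow_left' h1 2
      _ ≤ _ := by rw [mul_pow]; exact mul_le_mul' le_rfl h2
  have hKm : ∀ R, MeasurableSet (Ω ∩ Metric.closedBall z R) := fun R =>
    hΩm.inter Metric.isClosed_closedBall.measurableSet
  have hmm : Measurable (fun p : Pt N × ℝ => ‖fderiv ℝ φ (p.1 + p.2 • (R • ν))‖ₑ ^ 2) := by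
    have h0 : Measurable (fun p : Pt N × ℝ => p.1 + p.2 • (R • ν)) := by fun_prop
    exact (hdm.comp h0).pow_const 2
  calc ∫⁻ x in Ω ∩ Metric.closedBall z R, ‖φ x‖ₑ ^ 2
      ≤ ∫⁻ x in Ω ∩ Metric.closedBall z R, ENNReal.ofReal R ^ 2 *
          ∫⁻ t in Ioc (0 : ℝ) 1, ‖fderiv ℝ φ (x + t • (R • ν))‖ₑ ^ 2 :=
        setLIntegral_mono' (hKm R) hpt
    _ = ENNReal.ofReal R ^ 2 * ∫⁻ t in Ioc (0 : ℝ) 1, ∫⁻ x in Ω ∩ Metric.closedBall z R,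
          ‖fderiv ℝ φ (x + t • (R • ν))‖ₑ ^ 2 := by
        rw [lintegral_const_mul' _ _ (by finiteness), lintegral_lintegral_swap hmm.aemeasurable]
    _ ≤ ENNReal.ofReal R ^ 2 * ∫⁻ _ in Ioc (0 : ℝ) 1,
          ∫⁻ x in Ω ∩ Metric.closedBall z (2 * R), ‖fderiv ℝ φ x‖ₑ ^ 2 := by
        refine mul_le_mul' le_rfl (setLIntegral_mono' measurableSet_Ioc fun t ht => ?_)
        rw [← lintegral_indicator (hKm R), ← lintegral_indicator (hKm (2 * R)),
          ← lintegral_add_right_eq_self (μ := (volume : Measure (Pt N)))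
            ((Ω ∩ Metric.closedBall z (2 * R)).indicator fun x => ‖fderiv ℝ φ x‖ₑ ^ 2)
            (t • (R • ν))]
        refine lintegral_mono fun x => ?_
        by_cases hx : x ∈ Ω ∩ Metric.closedBall z R
        · rw [indicator_of_mem hx]
          -- The translated point either lies in `Ω`, at distance at most `2R` from `z`, or outside,
          -- where the derivative vanishes.
          by_cases hx2 : x + t • (R • ν) ∈ Ω
          · rw [indicator_of_mem]
            refine ⟨hx2, ?_⟩
            rw [Metric.mem_closedBall]
            calc dist (x + t • (R • ν)) z ≤ dist (x + t • (R • ν)) x + dist x z := dist_triangle _ _ _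
              _ ≤ R + R := by
                refine add_le_add ?_ hx.2
                rw [dist_eq_norm, add_sub_cancel_left, norm_smul, norm_smul, hν1, mul_one,
                  Real.norm_of_nonneg ht.1.le, Real.norm_of_nonneg hR.le]
                nlinarith [ht.2]
              _ = 2 * R := by ring
          · rw [hdzero _ hx2, zero_pow two_ne_zero]; exact zero_le
        · rw [indicator_of_notMem hx]; exact zero_le
    _ = _ := by rw [setLIntegral_const, Real.volume_Ioc]; simp

/-- Poincaré's inequality near a boundary point. -/
lemma MemH10Sigma.exists_near_boundary (hΩ : IsConvexPolyhedralDomain Ω) {w : Pt N → Pt N}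
    (hw : MemH10Sigma Ω w) : ∃ G : Pt N → (Pt N →L[ℝ] Pt N), HasWeakGradient Ω w G ∧
      ∀ z ∉ Ω, ∀ R : ℝ, 0 < R → ∫⁻ x in Ω ∩ Metric.closedBall z R, ‖w x‖ₑ ^ 2
        ≤ 4 * ENNReal.ofReal R ^ 2 * ∫⁻ x in Ω ∩ Metric.closedBall z (2 * R), ‖G x‖ₑ ^ 2 := by
  obtain ⟨G, hG, happ⟩ := hw
  refine ⟨G, hG, fun z hz R hR => ?_⟩
  refine ENNReal.le_of_forall_pos_le_add fun η hη _ => ?_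
  obtain ⟨t, ht0, ht1, ht⟩ := exists_pos_mul_le (K := 2 + 4 * ENNReal.ofReal R ^ 2)
    (η := (η : ℝ≥0∞)) (by finiteness) (by simpa using hη.ne')
  -- The inequality is transferred from approximating test functions. Passing from `w` to `φ` and
  -- from `∇φ` to `G` costs a factor `2` each, which makes the `4`.
  obtain ⟨φ, hφ, -, h1, h2⟩ := happ (ENNReal.ofReal t) (by simpa using ht0)
  have htsq : ENNReal.ofReal t ^ 2 ≤ ENNReal.ofReal t := by
    rw [sq]; exact mul_le_of_le_one_right' (by simpa using ht1)
  have hφ1 : ContDiff ℝ 1 φ := hφ.1.of_le (by exact_mod_cast le_top)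
  have hsub : ∀ R, Ω ∩ Metric.closedBall z R ⊆ Ω := fun R => inter_subset_left
  have hle : ∀ R, volume.restrict (Ω ∩ Metric.closedBall z R) ≤ volume.restrict Ω := fun R =>
    Measure.restrict_mono (hsub R) le_rfl
  have h3 : ∫⁻ x in Ω ∩ Metric.closedBall z R, ‖w x - φ x‖ₑ ^ 2 ≤ ENNReal.ofReal t := by
    have := (pow_le_pow_left' h1.le 2).trans htsq
    rw [eLpNorm_two_sq] at this
    refine le_trans (le_trans (lintegral_mono_set (hsub R)) (le_of_eq ?_)) this
    refine lintegral_congr fun x => ?_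
    rw [← enorm_neg, neg_sub]
  have h4 : ∫⁻ x in Ω ∩ Metric.closedBall z (2 * R), ‖fderiv ℝ φ x - G x‖ₑ ^ 2
      ≤ ENNReal.ofReal t := by
    have := (pow_le_pow_left' h2.le 2).trans htsq
    rw [eLpNorm_two_sq] at this
    exact (lintegral_mono_set (hsub _)).trans this
  have h5 : ∫⁻ x in Ω ∩ Metric.closedBall z R, ‖w x‖ₑ ^ 2
      ≤ 2 * (ENNReal.ofReal t + ∫⁻ x in Ω ∩ Metric.closedBall z R, ‖φ x‖ₑ ^ 2) := by
    have := lintegral_add_sq_le (m := volume.restrict (Ω ∩ Metric.closedBall z R))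
      (f := fun x => w x - φ x) φ
      ((hG.1.1.mono_measure (hle R)).sub hφ1.continuous.aestronglyMeasurable)
    simp only [sub_add_cancel] at this
    exact this.trans (by gcongr)
  have h6 : ∫⁻ x in Ω ∩ Metric.closedBall z (2 * R), ‖fderiv ℝ φ x‖ₑ ^ 2
      ≤ 2 * (ENNReal.ofReal t + ∫⁻ x in Ω ∩ Metric.closedBall z (2 * R), ‖G x‖ₑ ^ 2) := by
    have := lintegral_add_sq_le (m := volume.restrict (Ω ∩ Metric.closedBall z (2 * R)))
      (f := fun x => fderiv ℝ φ x - G x) G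
      ((hφ1.continuous_fderiv (by norm_num)).aestronglyMeasurable.sub
        (hG.2.1.1.mono_measure (hle _)))
    simp only [sub_add_cancel] at this
    exact this.trans (by gcongr)
  calc ∫⁻ x in Ω ∩ Metric.closedBall z R, ‖w x‖ₑ ^ 2
      ≤ 2 * (ENNReal.ofReal t + ENNReal.ofReal R ^ 2 *
        (2 * (ENNReal.ofReal t + ∫⁻ x in Ω ∩ Metric.closedBall z (2 * R), ‖G x‖ₑ ^ 2))) := by
        refine h5.trans ?_
        gcongr
        exact (lintegral_sq_le_near_boundary hΩ hφ1 hφ.2.2 hz hR).trans (mul_le_mul' le_rfl h6)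
    _ = 4 * ENNReal.ofReal R ^ 2 * (∫⁻ x in Ω ∩ Metric.closedBall z (2 * R), ‖G x‖ₑ ^ 2)
        + (2 + 4 * ENNReal.ofReal R ^ 2) * ENNReal.ofReal t := by ring
    _ ≤ _ := by gcongr

end Approx

/-! ### Boundary values of smooth approximations. -/

section BoundaryValue

variable {N : ℕ} {Ω : Set (Pt N)}

/-- The image of `Ω` under the homothety with centre `z` and ratio `s`. -/
def shrink (z : Pt N) (s : ℝ) (Ω : Set (Pt N)) : Set (Pt N) := {x | z + s⁻¹ • (x - z) ∈ Ω}

lemma measurableSet_shrink (hΩ : IsConvexPolyhedralDomain Ω) (z : Pt N) (s : ℝ) :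
    MeasurableSet (shrink z s Ω) := by
  have : Measurable (fun x : Pt N => z + s⁻¹ • (x - z)) := by fun_prop
  exact this hΩ.isOpen.measurableSet

lemma volume_shrink (hΩ : IsConvexPolyhedralDomain Ω) (z : Pt N) {s : ℝ} (hs : 0 < s) :
    volume (shrink z s Ω) = ENNReal.ofReal (s ^ N) * volume Ω := by
  have h := lintegral_comp_homothety z (inv_pos.2 hs) (Ω.indicator 1)
  rw [lintegral_indicator_one hΩ.isOpen.measurableSet, inv_pow, inv_inv] at h
  rw [← h, ← lintegral_indicator_one (measurableSet_shrink hΩ z s)]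
  rfl

/-- A segment from a point of the closure of a convex open set to a point of the set stays in the
set, except possibly at its first end point. Hence `Ω` is starshaped about its boundary points. -/
lemma mem_of_closure_ray (hΩ : IsConvexPolyhedralDomain Ω) {z y : Pt N} (hz : z ∈ closure Ω)
    (hy : y ∈ Ω) {s : ℝ} (hs : s ∈ Ioc (0 : ℝ) 1) : z + s • (y - z) ∈ Ω := by
  rcases hs.2.eq_or_lt with h | h
  · simpa [h] using hy
  · have h2 := hΩ.convex.openSegment_closure_interior_subset_interior hz
      (hΩ.isOpen.interior_eq.symm ▸ hy)
    rw [hΩ.isOpen.interior_eq] at h2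
    refine h2 ⟨1 - s, s, by linarith, hs.1, by ring, by module⟩

lemma shrink_star (hΩ : IsConvexPolyhedralDomain Ω) {z : Pt N} (hz : z ∈ closure Ω) {s : ℝ} :
    Star z (shrink z s Ω) := by
  intro x hx t ht
  have := mem_of_closure_ray hΩ hz hx ht
  change z + s⁻¹ • (z + t • (x - z) - z) ∈ Ω
  convert this using 1
  module

lemma shrink_subset (hΩ : IsConvexPolyhedralDomain Ω) {z : Pt N} (hz : z ∈ closure Ω) {s : ℝ}
    (hs : s ∈ Ioc (0 : ℝ) 1) :
    shrink z s Ω ⊆ Ω ∩ Metric.closedBall z (s * Metric.diam Ω) := by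
  intro x hx
  have e : z + s • ((z + s⁻¹ • (x - z)) - z) = x := by
    rw [add_sub_cancel_left, smul_smul, mul_inv_cancel₀ hs.1.ne']; module
  refine ⟨e ▸ mem_of_closure_ray hΩ hz hx hs, ?_⟩
  rw [Metric.mem_closedBall, ← e, dist_eq_norm, add_sub_cancel_left, norm_smul,
    Real.norm_of_nonneg hs.1.le, ← dist_eq_norm]
  have := hs.1.le
  gcongr
  rw [← Metric.diam_closure]
  exact Metric.dist_le_diam_of_mem hΩ.bounded.closure (subset_closure hx) hz

/-- Smooth functions close to a field in `H¹₀` and bounded in `H²` are small on the boundary. -/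
lemma boundary_value_le (hN : N ≤ 3) (hΩ : IsConvexPolyhedralDomain Ω) :
    ∃ K : ℝ≥0∞, K ≠ ∞ ∧ ∀ (u w : Pt N → Pt N) (G : Pt N → (Pt N →L[ℝ] Pt N)) (t : ℝ),
      0 < t → t ≤ 1 → AEStronglyMeasurable w (volume.restrict Ω) →
      (∀ z ∉ Ω, ∀ R : ℝ, 0 < R → ∫⁻ x in Ω ∩ Metric.closedBall z R, ‖w x‖ₑ ^ 2
        ≤ 4 * ENNReal.ofReal R ^ 2 * ∫⁻ x in Ω ∩ Metric.closedBall z (2 * R), ‖G x‖ₑ ^ 2) →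
      ContDiff ℝ 2 u → ∫⁻ x in Ω, ‖fderiv ℝ u x‖ₑ ^ 2 ≤ 2 ^ N →
      ∫⁻ x in Ω, ‖fderiv ℝ (fderiv ℝ u) x‖ₑ ^ 2 ≤ 2 ^ N →
      ∫⁻ x in Ω, ‖u x - w x‖ₑ ^ 2 ≤ ENNReal.ofReal t ^ (2 * N + 1) →
      ∫⁻ x in Ω, ‖fderiv ℝ u x - G x‖ₑ ^ 2 ≤ ENNReal.ofReal t ^ (2 * N + 1) →
      ∀ z ∈ frontier Ω, ‖u z‖ₑ ^ 2 ≤ K * ENNReal.ofReal t := by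
  obtain ⟨C₄, hC₄, hsob⟩ := sobolev_four hN hΩ
  set V := volume Ω with hV
  have hV0 : V ≠ 0 := (hΩ.isOpen.measure_pos volume hΩ.nonempty).ne'
  have hVt : V ≠ ∞ := hΩ.bounded.measure_lt_top.ne
  set D : ℝ := Metric.diam Ω + 1 with hD
  have hD0 : 0 < D := by have := Metric.diam_nonneg (s := Ω); linarith
  set d : ℝ≥0∞ := ENNReal.ofReal D with hd
  have hdt : d ≠ ∞ := ENNReal.ofReal_ne_top
  set M : ℝ≥0∞ := C₄ * ((2 ^ N) ^ 2 + (2 ^ N) ^ 2) with hM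
  have hMt : M ≠ ∞ := by finiteness
  set b : ℝ≥0∞ := volume (Metric.ball (0 : Pt N) 1) with hb
  have hbt : b ≠ ∞ := measure_ball_lt_top.ne
  set c : ℝ≥0∞ := (2 * d) ^ N * b * M + 1 with hc
  have hct : c ≠ ∞ := by finiteness
  refine ⟨V⁻¹ * (16 * (2 + 16 * d ^ 2 + 17 * d ^ 2 * c + d ^ 4 * 2 ^ N)), by finiteness, ?_⟩
  intro u w G t ht0 ht1 hwm hnear hu h1 h2 h3 h4 z hz
  set τ := ENNReal.ofReal t with hτ
  have hτ0 : τ ≠ 0 := by simpa [hτ] using ht0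
  have hτt : τ ≠ ∞ := ENNReal.ofReal_ne_top
  have hτ1 : τ ≤ 1 := by simpa [hτ] using ht1
  have hzc : z ∈ closure Ω := hz.1
  have hzn : z ∉ Ω := by have := hz.2; rwa [hΩ.isOpen.interior_eq] at this
  -- The copy of `Ω` shrunk towards `z` has ratio `t²`, hence volume `t^{2N} |Ω|`, and lies in a
  -- ball of radius comparable to `t²`.
  have hs : t ^ 2 ∈ Ioc (0 : ℝ) 1 := ⟨by positivity, pow_le_one₀ ht0.le ht1⟩
  set K := shrink z (t ^ 2) Ω with hK
  have hu1 : ContDiff ℝ 1 (fderiv ℝ u) := hu.fderiv_right (by norm_num)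
  have hdm : Measurable (fun y => ‖fderiv ℝ u y‖ₑ) := measurable_enorm_of_continuous hu1.continuous
  set R := t ^ 2 * D with hR
  have hR0 : 0 < R := by positivity
  have hKB : K ⊆ Ω ∩ Metric.closedBall z R := by
    refine (shrink_subset hΩ hzc hs).trans (inter_subset_inter_right _ ?_)
    exact Metric.closedBall_subset_closedBall
      (mul_le_mul_of_nonneg_left (by linarith) (by positivity))
  have hofR : ENNReal.ofReal R = τ ^ 2 * d := by
    rw [hR, ENNReal.ofReal_mul (by positivity), ENNReal.ofReal_pow ht0.le]
  set B2 := Ω ∩ Metric.closedBall z (2 * R) with hB2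
  have hKB2 : K ⊆ B2 := hKB.trans (inter_subset_inter_right _
    (Metric.closedBall_subset_closedBall (by linarith)))
  have hKΩ : K ⊆ Ω := hKB.trans inter_subset_left
  have hB2Ω : B2 ⊆ Ω := inter_subset_left
  set J := ∫⁻ x in B2, ‖fderiv ℝ u x‖ₑ ^ 2 with hJ
  -- the gradient is small on small balls
  have hJ1 : J ≤ c * τ ^ N := by
    have hJ2 : J ^ 2 ≤ (c * τ ^ N) ^ 2 := by
      -- Cauchy–Schwarz against the `L⁴` bound of the gradient supplied by the second derivatives;
      -- the volume of the small ball gives the power `τ^N`.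
      have e1 := lintegral_sq_le (m := volume.restrict B2) (hdm.pow_const 2).aemeasurable
      rw [Measure.restrict_apply_univ] at e1
      have e2 : volume B2 ≤ (2 * d) ^ N * b * τ ^ (2 * N) := by
        refine (measure_mono inter_subset_right).trans (le_of_eq ?_)
        rw [Measure.addHaar_closedBall _ _ (by positivity), finrank_euclideanSpace_fin,
          ENNReal.ofReal_pow (by positivity), ENNReal.ofReal_mul (by norm_num), hofR,
          ENNReal.ofReal_ofNat, pow_mul]
        rw [show (2 * (τ ^ 2 * d)) = 2 * d * τ ^ 2 by ring, mul_pow]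
        ring
      have e3 : ∫⁻ x in B2, (‖fderiv ℝ u x‖ₑ ^ 2) ^ 2 ≤ M := by
        refine (lintegral_mono_set hB2Ω).trans ?_
        simp only [← pow_mul]
        refine (hsob _ (fderiv ℝ u) hu1).trans ?_
        rw [hM]
        gcongr
      calc J ^ 2 ≤ ((2 * d) ^ N * b * τ ^ (2 * N)) * M := e1.trans (mul_le_mul' e2 e3)
        _ ≤ c * τ ^ (2 * N) := by
          rw [hc, mul_right_comm]
          gcongr
          exact le_self_add
        _ ≤ c ^ 2 * τ ^ (2 * N) := by
          gcongr
          exact le_self_pow₀ (by rw [hc]; exact le_add_self) (by norm_num)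
        _ = _ := by rw [mul_pow, ← pow_mul, mul_comm 2 N]
    rw [← ENNReal.rpow_two, ← ENNReal.rpow_two] at hJ2
    exact (ENNReal.rpow_le_rpow_iff two_pos).1 hJ2
  have hG : ∫⁻ x in B2, ‖G x‖ₑ ^ 2 ≤ 2 * (J + τ ^ (2 * N + 1)) := by
    have := lintegral_add_sq_le (m := volume.restrict B2) (f := fderiv ℝ u)
      (fun x => G x - fderiv ℝ u x) hu1.continuous.aestronglyMeasurable
    simp only [add_sub_cancel] at this
    refine this.trans ?_
    gcongr
    refine (lintegral_mono_set hB2Ω).trans (le_trans (le_of_eq ?_) h4)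
    refine lintegral_congr fun x => ?_
    rw [← enorm_neg, neg_sub]
  have hw : ∫⁻ x in K, ‖w x‖ₑ ^ 2 ≤ 4 * (τ ^ 2 * d) ^ 2 * (2 * (J + τ ^ (2 * N + 1))) := by
    refine (lintegral_mono_set hKB).trans ((hnear z hzn R hR0).trans ?_)
    rw [hofR]
    gcongr
  have huK : ∫⁻ x in K, ‖u x‖ₑ ^ 2
      ≤ 2 * (τ ^ (2 * N + 1) + 4 * (τ ^ 2 * d) ^ 2 * (2 * (J + τ ^ (2 * N + 1)))) := by
    have := lintegral_add_sq_le (m := volume.restrict K) (f := fun x => u x - w x) w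
      (hu.continuous.aestronglyMeasurable.sub
        (hwm.mono_measure (Measure.restrict_mono hKΩ le_rfl)))
    simp only [sub_add_cancel] at this
    refine this.trans ?_
    gcongr
    exact (lintegral_mono_set hKΩ).trans h3
  have hmain := enorm_sq_mul_volume_le hN hu (measurableSet_shrink hΩ z (t ^ 2))
    (shrink_star hΩ hzc) (D := τ ^ 2 * d) (fun x hx => by
      rw [← hofR, ← ofReal_norm, ← dist_eq_norm]
      exact ENNReal.ofReal_le_ofReal (hKB hx).2)
  rw [volume_shrink hΩ z hs.1, ENNReal.ofReal_pow hs.1.le, ENNReal.ofReal_pow ht0.le, ← hτ,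
    ← hV, ← hK, ← pow_mul] at hmain
  have hdK : ∫⁻ x in K, ‖fderiv ℝ u x‖ₑ ^ 2 ≤ c * τ ^ N := (lintegral_mono_set hKB2).trans hJ1
  have hddK : ∫⁻ x in K, ‖fderiv ℝ (fderiv ℝ u) x‖ₑ ^ 2 ≤ 2 ^ N := (lintegral_mono_set hKΩ).trans h2
  have hpow : ∀ m, 2 * N + 1 ≤ m → τ ^ m ≤ τ ^ (2 * N) * τ := fun m hm => by
    rw [← pow_succ]; exact pow_le_pow_right_of_le_one' hτ1 hm
  -- Division by the volume `τ^{2N} V` has to leave one factor `τ`. The Poincaré and gradient terms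
  -- are of order `τ^{N+4}`, the second-derivative term is of order `τ^8`; both exponents are at
  -- least `2N + 1` because `N ≤ 3`.
  have hfin : ‖u z‖ₑ ^ 2 * V * τ ^ (2 * N)
      ≤ (16 * (2 + 16 * d ^ 2 + 17 * d ^ 2 * c + d ^ 4 * 2 ^ N) * τ) * τ ^ (2 * N) := by
    calc ‖u z‖ₑ ^ 2 * V * τ ^ (2 * N) = ‖u z‖ₑ ^ 2 * (τ ^ (2 * N) * V) := by ring
      _ ≤ 16 * (2 * (τ ^ (2 * N + 1) + 4 * (τ ^ 2 * d) ^ 2 * (2 * (c * τ ^ N + τ ^ (2 * N + 1))))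
          + (τ ^ 2 * d) ^ 2 * (c * τ ^ N) + (τ ^ 2 * d) ^ 4 * 2 ^ N) := by
          refine hmain.trans ?_
          refine mul_le_mul' le_rfl (add_le_add (add_le_add (huK.trans ?_)
            (mul_le_mul' le_rfl hdK)) (mul_le_mul' le_rfl hddK))
          gcongr
      _ = 16 * (2 * τ ^ (2 * N + 1) + 16 * d ^ 2 * τ ^ (2 * N + 5) + 17 * d ^ 2 * c * τ ^ (N + 4)
          + d ^ 4 * 2 ^ N * τ ^ 8) := by ring
      _ ≤ 16 * (2 * (τ ^ (2 * N) * τ) + 16 * d ^ 2 * (τ ^ (2 * N) * τ)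
          + 17 * d ^ 2 * c * (τ ^ (2 * N) * τ) + d ^ 4 * 2 ^ N * (τ ^ (2 * N) * τ)) := by
          gcongr <;> exact hpow _ (by omega)
      _ = _ := by ring
  have hτp : τ ^ (2 * N) ≠ 0 := pow_ne_zero _ hτ0
  have hfin2 := (ENNReal.mul_le_mul_iff_left hτp (by finiteness)).1 hfin
  rw [mul_assoc, ← ENNReal.div_eq_inv_mul, ENNReal.le_div_iff_mul_le (.inl hV0) (.inl hVt)]
  exact hfin2

lemma enorm_one_sub_smul_le {E : Type*} [NormedAddCommGroup E] [NormedSpace ℝ E] {δ : ℝ}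
    (h0 : 0 < δ) (h1 : δ ≤ 1 / 2) (a : E) : ‖(1 - δ) • a‖ₑ ≤ ‖a‖ₑ := by
  rw [enorm_smul]
  refine mul_le_of_le_one_left' ?_
  rw [Real.enorm_of_nonneg (by linarith)]
  exact ENNReal.ofReal_le_one.2 (by linarith)

lemma enorm_fderiv_mollDil_le {F : Type*} [NormedAddCommGroup F] [NormedSpace ℝ F] [CompleteSpace F]
    (hΩ : IsConvexPolyhedralDomain Ω) {x₀ : Pt N} {r : ℝ}
    (hr : Metric.closedBall x₀ r ⊆ Ω) {δ : ℝ} (h0 : 0 < δ) (h1 : δ ≤ 1 / 2)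
    {φ : ContDiffBump (0 : Pt N)} (hφ : φ.rOut = r * δ) {f : Pt N → F} {G : Pt N → (Pt N →L[ℝ] F)}
    (h : HasWeakGradient Ω f G) {x : Pt N} (hx : x ∈ Ω) :
    ‖fderiv ℝ (mollDil Ω x₀ δ φ f) x‖ₑ ≤ ‖mollDil Ω x₀ δ φ G x‖ₑ := by
  rw [(hasFDerivAt_mollDil hΩ hr h0 (by linarith) hφ h hx).fderiv]
  exact enorm_one_sub_smul_le h0 h1 _

lemma enorm_fderiv_congr_le {E : Type*} [NormedAddCommGroup E] [NormedSpace ℝ E] {δ : ℝ}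
    (h0 : 0 < δ) (h1 : δ ≤ 1 / 2) {f g : Pt N → E} {x : Pt N}
    (h : f =ᶠ[nhds x] fun x => (1 - δ) • g x) (hg : DifferentiableAt ℝ g x) :
    ‖fderiv ℝ f x‖ₑ ≤ ‖fderiv ℝ g x‖ₑ := by
  have h6 : fderiv ℝ (fun x => (1 - δ) • g x) x = (1 - δ) • fderiv ℝ g x :=
    fderiv_const_smul hg _
  rw [h.fderiv_eq, h6]
  exact enorm_one_sub_smul_le h0 h1 _

lemma enorm_fderiv_fderiv_mollDil_le {F : Type*} [NormedAddCommGroup F] [NormedSpace ℝ F]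
    [CompleteSpace F] (hΩ : IsConvexPolyhedralDomain Ω) {x₀ : Pt N} {r : ℝ}
    (hr : Metric.closedBall x₀ r ⊆ Ω) {δ : ℝ} (h0 : 0 < δ) (h1 : δ ≤ 1 / 2)
    {φ : ContDiffBump (0 : Pt N)} (hφ : φ.rOut = r * δ) {f : Pt N → F} {G : Pt N → (Pt N →L[ℝ] F)}
    {H : Pt N → (Pt N →L[ℝ] (Pt N →L[ℝ] F))} (h : HasWeakHessian Ω f G H) {x : Pt N} (hx : x ∈ Ω) :
    ‖fderiv ℝ (fderiv ℝ (mollDil Ω x₀ δ φ f)) x‖ₑ ≤ ‖mollDil Ω x₀ δ φ H x‖ₑ := by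
  refine (enorm_fderiv_congr_le h0 h1 (g := mollDil Ω x₀ δ φ G) ?_
    (hasFDerivAt_mollDil hΩ hr h0 (by linarith) hφ h.2 hx).differentiableAt).trans
    (enorm_fderiv_mollDil_le hΩ hr h0 h1 hφ h.2 hx)
  filter_upwards [hΩ.isOpen.mem_nhds hx] with y hy using
    (hasFDerivAt_mollDil hΩ hr h0 (by linarith) hφ h.1 hy).fderiv

/-- Smooth approximation of solenoidal `H²` fields with small boundary values. -/
lemma exists_smooth_approx (hN : N ≤ 3) (hΩ : IsConvexPolyhedralDomain Ω) {w : Pt N → Pt N}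
    {G : Pt N → (Pt N →L[ℝ] Pt N)} {H : Pt N → (Pt N →L[ℝ] (Pt N →L[ℝ] Pt N))}
    (hw : MemH10Sigma Ω w) (hH : HasWeakHessian Ω w G H)
    (h0 : ∫⁻ x in Ω, ‖w x‖ₑ ^ 2 ≤ 1) (h1 : ∫⁻ x in Ω, ‖G x‖ₑ ^ 2 ≤ 1)
    (h2 : ∫⁻ x in Ω, ‖H x‖ₑ ^ 2 ≤ 1) {ε : ℝ≥0∞} (hε : ε ≠ 0) :
    ∃ u : Pt N → Pt N, ContDiff ℝ 2 u ∧ ∫⁻ x in Ω, ‖u x - w x‖ₑ ^ 2 ≤ ε ∧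
      ∫⁻ x in Ω, ‖u x‖ₑ ^ 2 ≤ 2 ^ N ∧ ∫⁻ x in Ω, ‖fderiv ℝ u x‖ₑ ^ 2 ≤ 2 ^ N ∧
      ∫⁻ x in Ω, ‖fderiv ℝ (fderiv ℝ u) x‖ₑ ^ 2 ≤ 2 ^ N ∧
      ∀ z ∈ frontier Ω, ‖u z‖ₑ ^ 2 ≤ ε := by
  have hΩm := hΩ.isOpen.measurableSet
  -- The gradient that comes with membership in `H¹_{0,σ}` is a second representative. It is used
  -- for the boundary estimate, while `G` and `H` give the norm bounds, and the two need not be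
  -- compared.
  obtain ⟨G', hG', hnear⟩ := hw.exists_near_boundary hΩ
  obtain ⟨K, hK, hbd⟩ := boundary_value_le hN hΩ
  -- The part `K * τ ≤ ε` controls the boundary values; the added `1` gives `τ ≤ ε` for the `L²`
  -- error.
  obtain ⟨t, ht0, ht1, ht⟩ := exists_pos_mul_le (K := K + 1) (by finiteness) hε
  set τ := ENNReal.ofReal t with hτ
  have hτ0 : τ ≠ 0 := by simpa [hτ] using ht0
  have hτ1 : τ ≤ 1 := by simpa [hτ] using ht1
  set η := τ ^ (2 * N + 1) with hη
  have hη0 : η ≠ 0 := pow_ne_zero _ hτ0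
  obtain ⟨x₀, hx₀⟩ := hΩ.nonempty
  obtain ⟨r, hr0, hr⟩ := Metric.nhds_basis_closedBall.mem_iff.1 (hΩ.isOpen.mem_nhds hx₀)
  obtain ⟨δ₁, hδ₁, hc1⟩ := lintegral_mollDil_sub_le hΩ hx₀ hr0 hH.1.1 hη0
  obtain ⟨δ₂, hδ₂, hc2⟩ := lintegral_mollDil_sub_le hΩ hx₀ hr0 hG'.2.1 (η := η / 4)
    (by simpa using hη0)
  have hGfin : ∫⁻ x in Ω, ‖G' x‖ₑ ^ 2 ≠ ∞ := by
    rw [← eLpNorm_two_sq]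
    exact ENNReal.pow_ne_top hG'.2.1.2.ne
  obtain ⟨δ₃, hδ₃, -, hc3⟩ := exists_pos_mul_le (K := ∫⁻ x in Ω, ‖G' x‖ₑ ^ 2) (η := η / 4) hGfin
    (by simpa using hη0)
  set δ := min (min δ₁ δ₂) (min δ₃ (1 / 2)) with hδ
  have hδ0 : 0 < δ := by positivity
  have hl1 : δ ≤ δ₁ := (min_le_left _ _).trans (min_le_left _ _)
  have hl2 : δ ≤ δ₂ := (min_le_left _ _).trans (min_le_right _ _)
  have hl3 : δ ≤ δ₃ := (min_le_right _ _).trans (min_le_left _ _)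
  have hl4 : δ ≤ 1 / 2 := (min_le_right _ _).trans (min_le_right _ _)
  let φ : ContDiffBump (0 : Pt N) := ⟨r * δ / 2, r * δ, by positivity, by linarith [mul_pos hr0 hδ0]⟩
  have hφ : φ.rOut = r * δ := rfl
  set u := mollDil Ω x₀ δ φ w with hu
  have hen : ‖(1 - δ : ℝ)‖ₑ ≤ 1 := by
    rw [Real.enorm_of_nonneg (by linarith)]
    exact ENNReal.ofReal_le_one.2 (by linarith)
  have hsmooth : ContDiff ℝ 2 u := 
    contDiff_infty.1 (contDiff_mollDil hΩm x₀ δ φ hH.1.1) 2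
  have hb0 : ∫⁻ x in Ω, ‖u x‖ₑ ^ 2 ≤ 2 ^ N :=
    (lintegral_mollDil_sq_le hΩm x₀ hl4 φ hH.1.1).trans (mul_le_of_le_one_right' h0)
  have hb1 : ∫⁻ x in Ω, ‖fderiv ℝ u x‖ₑ ^ 2 ≤ 2 ^ N := by
    refine (setLIntegral_mono' hΩm fun x hx => ?_).trans
      ((lintegral_mollDil_sq_le hΩm x₀ hl4 φ hH.1.2.1).trans (mul_le_of_le_one_right' h1))
    exact pow_le_pow_left' (enorm_fderiv_mollDil_le hΩ hr hδ0 hl4 hφ hH.1 hx) 2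
  have hb2 : ∫⁻ x in Ω, ‖fderiv ℝ (fderiv ℝ u) x‖ₑ ^ 2 ≤ 2 ^ N := by
    refine (setLIntegral_mono' hΩm fun x hx => ?_).trans
      ((lintegral_mollDil_sq_le hΩm x₀ hl4 φ hH.2.2.1).trans (mul_le_of_le_one_right' h2))
    exact pow_le_pow_left' (enorm_fderiv_fderiv_mollDil_le hΩ hr hδ0 hl4 hφ hH hx) 2
  have hη2 : η ≤ ε := by
    refine le_trans ?_ ((mul_le_mul' le_add_self le_rfl).trans ht)
    rw [one_mul, hη]
    calc τ ^ (2 * N + 1) ≤ τ ^ 1 := pow_le_pow_right_of_le_one' hτ1 (by omega)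
      _ = τ := pow_one _
  have happ : ∫⁻ x in Ω, ‖u x - w x‖ₑ ^ 2 ≤ η := hc1 δ hδ0 hl1 hl4 φ hφ
  have happ2 : ∫⁻ x in Ω, ‖fderiv ℝ u x - G' x‖ₑ ^ 2 ≤ η := by
    -- The chain rule contributes the factor `1 - δ`; the defect `-δ G'` is the reason for the third
    -- smallness condition on `δ`.
    have e : ∀ x ∈ Ω, fderiv ℝ u x - G' x
        = (1 - δ) • (mollDil Ω x₀ δ φ G' x - G' x) + (-δ) • G' x := fun x hx => by
      rw [hu, (hasFDerivAt_mollDil hΩ hr hδ0 (by linarith) hφ hG' hx).fderiv]; module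
    have hδe : ‖(-δ : ℝ)‖ₑ ^ 2 ≤ ENNReal.ofReal δ₃ := by
      rw [enorm_neg, Real.enorm_of_nonneg hδ0.le, ← ENNReal.ofReal_pow hδ0.le]
      refine ENNReal.ofReal_le_ofReal ?_
      nlinarith
    calc ∫⁻ x in Ω, ‖fderiv ℝ u x - G' x‖ₑ ^ 2
        = ∫⁻ x in Ω, ‖(1 - δ) • (mollDil Ω x₀ δ φ G' x - G' x) + (-δ) • G' x‖ₑ ^ 2 :=
          setLIntegral_congr_fun hΩm fun x hx => by rw [e x hx]
      _ ≤ 2 * ((∫⁻ x in Ω, ‖(1 - δ) • (mollDil Ω x₀ δ φ G' x - G' x)‖ₑ ^ 2)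
          + ∫⁻ x in Ω, ‖(-δ) • G' x‖ₑ ^ 2) := by
          refine lintegral_add_sq_le _ ?_
          have hms : AEStronglyMeasurable (fun x => mollDil Ω x₀ δ φ G' x - G' x)
              (volume.restrict Ω) :=
            (contDiff_mollDil hΩm x₀ δ φ hG'.2.1).continuous.aestronglyMeasurable.sub hG'.2.1.1
          exact hms.const_smul (1 - δ)
      _ ≤ 2 * (η / 4 + η / 4) := by
          gcongr
          · refine (lintegral_mono fun x => ?_).trans (hc2 δ hδ0 hl2 hl4 φ hφ)
            rw [enorm_smul]
            exact pow_le_pow_left' (mul_le_of_le_one_left' hen) 2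
          · refine le_trans ?_ hc3
            rw [mul_comm, ← lintegral_const_mul' _ _ ENNReal.ofReal_ne_top]
            refine lintegral_mono fun x => ?_
            rw [enorm_smul, mul_pow]
            exact mul_le_mul' hδe le_rfl
      _ = η := by
          rw [← two_mul, ← mul_assoc, show (2 * 2 : ℝ≥0∞) = 4 by norm_num,
            ENNReal.mul_div_cancel (by norm_num) (by norm_num)]
  refine ⟨u, hsmooth, happ.trans hη2, hb0, hb1, hb2, fun z hz => ?_⟩
  refine (hbd u w G' t ht0 ht1 hH.1.1.1 hnear hsmooth hb1 hb2 happ happ2 z hz).trans ?_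
  exact (mul_le_mul' le_self_add le_rfl).trans ht

end BoundaryValue

namespace Mesh

variable {N : ℕ} {Ω : Set (Pt N)} {𝒯 : Mesh Ω}

/-! ### Integrals over cells -/

/-- Distinct cells share fewer than `N + 1` vertices, so their intersection lies in a proper affine
subspace. -/
lemma volume_inter_cells {T T' : Finset (Pt N)} (hT : T ∈ 𝒯.cells) (hT' : T' ∈ 𝒯.cells)
    (hne : T ≠ T') :
    volume (convexHull ℝ (T : Set (Pt N)) ∩ convexHull ℝ (T' : Set (Pt N))) = 0 := by
  classical
  refine measure_mono_null (𝒯.conforming T hT T' hT') ?_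
  refine measure_mono_null (convexHull_subset_affineSpan _) ?_
  refine Measure.addHaar_affineSubspace _ _ fun htop => ?_
  rw [← Finset.coe_inter] at htop
  have hind : AffineIndependent ℝ ((↑) : (T ∩ T' : Finset (Pt N)) → Pt N) :=
    (𝒯.indep T hT).mono (s := ((T ∩ T' : Finset (Pt N)) : Set (Pt N))) (t := (T : Set (Pt N)))
      (by simp)
  have hr : range ((↑) : (T ∩ T' : Finset (Pt N)) → Pt N) = ((T ∩ T' : Finset (Pt N)) : Set _) := by
    ext; simp
  rw [← hr, hind.affineSpan_eq_top_iff_card_eq_finrank_add_one, finrank_euclideanSpace_fin,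
    Fintype.card_coe] at htop
  have h1 : T ∩ T' = T := Finset.eq_of_subset_of_card_le Finset.inter_subset_left
    (by rw [htop, 𝒯.card_cell T hT])
  have h2 : T ∩ T' = T' := Finset.eq_of_subset_of_card_le Finset.inter_subset_right
    (by rw [htop, 𝒯.card_cell T' hT'])
  exact hne (h1.symm.trans h2)

lemma measurableSet_cell (T : Finset (Pt N)) : MeasurableSet (convexHull ℝ (T : Set (Pt N))) :=
  (isCompact_cell T).isClosed.measurableSet

lemma restrict_eq_sum_cells (hΩ : IsConvexPolyhedralDomain Ω) (𝒯 : Mesh Ω) :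
    (volume : Measure (Pt N)).restrict Ω
      = ∑ T ∈ 𝒯.cells, volume.restrict (convexHull ℝ (T : Set (Pt N))) := by
  have h1 : (volume : Measure (Pt N)).restrict Ω = volume.restrict (closure Ω) := by
    refine Measure.restrict_congr_set ?_
    refine (ae_eq_set.2 ⟨?_, ?_⟩)
    · rw [sdiff_eq_empty.2 subset_closure]; exact measure_empty
    · rw [← hΩ.isOpen.frontier_eq]; exact hΩ.convex.addHaar_frontier _
  have e : closure Ω = ⋃ T : 𝒯.cells, convexHull ℝ ((T : Finset (Pt N)) : Set (Pt N)) := by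
    rw [← 𝒯.cover]; ext; simp
  rw [h1, e, Measure.restrict_iUnion_ae, Measure.sum_fintype]
  · exact Finset.sum_coe_sort 𝒯.cells
      (fun T => (volume : Measure (Pt N)).restrict (convexHull ℝ (T : Set (Pt N))))
  · intro T T' hne
    exact volume_inter_cells T.2 T'.2 fun h => hne (Subtype.ext h)
  · exact fun T => (measurableSet_cell _).nullMeasurableSet

lemma lintegral_eq_sum_cells (hΩ : IsConvexPolyhedralDomain Ω) (𝒯 : Mesh Ω) (f : Pt N → ℝ≥0∞) :
    ∫⁻ x in Ω, f x = ∑ T ∈ 𝒯.cells, ∫⁻ x in convexHull ℝ (T : Set (Pt N)), f x := by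
  rw [restrict_eq_sum_cells hΩ 𝒯, lintegral_finsetSum_measure]

lemma integral_eq_sum_cells (hΩ : IsConvexPolyhedralDomain Ω) (𝒯 : Mesh Ω) {F : Type*}
    [NormedAddCommGroup F] [NormedSpace ℝ F] {f : Pt N → F} (hf : IntegrableOn f Ω) :
    ∫ x in Ω, f x = ∑ T ∈ 𝒯.cells, ∫ x in convexHull ℝ (T : Set (Pt N)), f x := by
  have h := hf
  rw [IntegrableOn, restrict_eq_sum_cells hΩ 𝒯, integrable_finsetSum_measure] at h
  rw [restrict_eq_sum_cells hΩ 𝒯, integral_finsetSum_measure h]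

lemma integrableOn_cell (hΩ : IsConvexPolyhedralDomain Ω) {F : Type*}
    [NormedAddCommGroup F] [NormedSpace ℝ F] {f : Pt N → F} (hf : IntegrableOn f Ω)
    {T : Finset (Pt N)} (hT : T ∈ 𝒯.cells) : IntegrableOn f (convexHull ℝ (T : Set (Pt N))) := by
  have h := hf
  rw [IntegrableOn, restrict_eq_sum_cells hΩ 𝒯, integrable_finsetSum_measure] at h
  exact h T hT

lemma ae_cell_interior {T : Finset (Pt N)} :
    ∀ᵐ x ∂(volume.restrict (convexHull ℝ (T : Set (Pt N)))),
      x ∈ interior (convexHull ℝ (T : Set (Pt N))) := by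
  rw [ae_restrict_iff' (measurableSet_cell T)]
  have h := (convex_convexHull ℝ (T : Set (Pt N))).addHaar_frontier volume
  filter_upwards [measure_eq_zero_iff_ae_notMem.1 h] with x hx hxT
  by_contra hni
  exact hx ⟨subset_closure hxT, hni⟩

/-- Derivatives of piecewise polynomials are only known in the interior of a cell, which suffices
since the boundary of the cell is a null set. -/
lemma lintegral_cell_mono {T : Finset (Pt N)} {f g : Pt N → ℝ≥0∞}
    (h : ∀ x ∈ interior (convexHull ℝ (T : Set (Pt N))), f x ≤ g x) :
    ∫⁻ x in convexHull ℝ (T : Set (Pt N)), f x ≤ ∫⁻ x in convexHull ℝ (T : Set (Pt N)), g x :=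
  lintegral_mono_ae (ae_cell_interior.mono h)

/-! ### Shape regularity -/

/-- Quasi-uniformity, in terms of the radius `r` of balls contained in the cells. -/
structure Regular (𝒯 : Mesh Ω) (ρ r : ℝ) : Prop where
  r_pos : 0 < r
  ρ_pos : 0 < ρ
  r_le : r ≤ Metric.diam Ω
  dist_le : ∀ T ∈ 𝒯.cells, ∀ x ∈ convexHull ℝ (T : Set (Pt N)),
    ∀ y ∈ convexHull ℝ (T : Set (Pt N)), dist x y ≤ 2 / ρ * r
  ball : ∀ T ∈ 𝒯.cells, ∃ c, Metric.closedBall c r ⊆ convexHull ℝ (T : Set (Pt N))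

/-- The radius of the inscribed balls becomes the mesh parameter. Cell diameters are at most `2r/ρ`,
and `r` is bounded by the diameter of the domain because a ball of this radius lies in the closure
of `Ω`. No restriction on `h` is then needed. -/
lemma IsQuasiUniform.regular (hN : 1 ≤ N) (hΩ : IsConvexPolyhedralDomain Ω) {ρ h : ℝ} (hρ : 0 < ρ)
    (hh : 0 < h) (hq : 𝒯.IsQuasiUniform ρ h) : 𝒯.Regular ρ (ρ * h * Metric.diam Ω / 2) := by
  have : Nonempty (Fin N) := ⟨⟨0, hN⟩⟩
  have hnt : Nontrivial (Pt N) := inferInstance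
  have hdiam : ∀ {K : Set (Pt N)} {c : Pt N} {r : ℝ}, 0 ≤ r → Bornology.IsBounded K →
      Metric.closedBall c r ⊆ K → 2 * r ≤ Metric.diam K := by
    intro K c r hr hK hsub
    obtain ⟨e, he⟩ := exists_norm_eq (E := Pt N) hr
    have h1 : c + e ∈ K := hsub (by simp [he])
    have h2 : c - e ∈ K := hsub (by simp [he])
    have := Metric.dist_le_diam_of_mem hK h1 h2
    rw [dist_eq_norm, add_sub_sub_cancel, ← two_smul ℝ, norm_smul, he] at this
    simpa using this
  have hD : 0 < Metric.diam Ω := by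
    obtain ⟨x₀, hx₀⟩ := hΩ.nonempty
    obtain ⟨r, hr0, hr⟩ := Metric.nhds_basis_closedBall.mem_iff.1 (hΩ.isOpen.mem_nhds hx₀)
    have := hdiam hr0.le hΩ.bounded hr
    linarith
  obtain ⟨x₀, hx₀⟩ := hΩ.nonempty
  obtain ⟨T₀, hT₀, -⟩ := 𝒯.exists_cell (subset_closure hx₀)
  obtain ⟨hd₀, c₀, hc₀⟩ := hq T₀ hT₀
  have hb₀ := (isCompact_cell T₀).isBounded
  have hr0 : 0 < ρ * h * Metric.diam Ω / 2 := by positivity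
  have h3 := hdiam hr0.le hb₀ hc₀
  refine ⟨hr0, hρ, ?_, ?_, fun T hT => (hq T hT).2⟩
  · have h4 := Metric.diam_mono (cell_subset hT₀) hΩ.bounded.closure
    rw [Metric.diam_closure] at h4
    linarith
  · intro T hT x hx y hy
    have := (Metric.dist_le_diam_of_mem (isCompact_cell T).isBounded hx hy).trans (hq T hT).1
    refine this.trans (le_of_eq ?_)
    field_simp

lemma opNorm_le_of_closedBall {F : Type*} [NormedAddCommGroup F] [NormedSpace ℝ F]
    (A : Pt N →L[ℝ] F) {r M : ℝ} (hr : 0 < r) (hM : 0 ≤ M) (h : ∀ v, ‖v‖ ≤ r → ‖A v‖ ≤ M) :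
    ‖A‖ ≤ M / r := by
  refine A.opNorm_le_bound (by positivity) fun e => ?_
  by_cases he : e = 0
  · simp [he]
  have he0 : 0 < ‖e‖ := norm_pos_iff.2 he
  have h1 := h ((r / ‖e‖) • e) (by
    rw [norm_smul, Real.norm_of_nonneg (by positivity), div_mul_cancel₀ _ he0.ne'])
  rw [map_smul, norm_smul, Real.norm_of_nonneg (by positivity)] at h1
  rw [div_mul_eq_mul_div, le_div_iff₀ hr]
  rw [div_mul_eq_mul_div, div_le_iff₀ he0] at h1
  linarith

lemma Regular.volume_cell_ge {ρ r : ℝ} (hR : 𝒯.Regular ρ r) {T : Finset (Pt N)}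
    (hT : T ∈ 𝒯.cells) : ENNReal.ofReal r ^ N * volume (Metric.ball (0 : Pt N) 1)
      ≤ volume (convexHull ℝ (T : Set (Pt N))) := by
  obtain ⟨c, hc⟩ := hR.ball T hT
  refine le_trans (le_of_eq ?_) (measure_mono hc)
  rw [Measure.addHaar_closedBall _ _ hR.r_pos.le, finrank_euclideanSpace_fin,
    ENNReal.ofReal_pow hR.r_pos.le]

/-- Barycentric coordinates have a lower bound near the centre of the inscribed ball. -/
lemma Regular.hat_ge {ρ r : ℝ} (hR : 𝒯.Regular ρ r) {T : Finset (Pt N)}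
    (hT : T ∈ 𝒯.cells) {c : Pt N} (hc : Metric.closedBall c r ⊆ convexHull ℝ (T : Set (Pt N)))
    {z : Pt N} (hz : z ∈ T) {y : Pt N} (hy : y ∈ Metric.closedBall c (r / 2)) :
    ρ / (2 * (ρ + 2)) ≤ 𝒯.hat z y := by
  classical
  have hr := hR.r_pos
  have hρ := hR.ρ_pos
  obtain ⟨c₀, A, h⟩ := 𝒯.hat_affine hT z
  set m := c₀ + A c with hm
  have hmem : ∀ v : Pt N, ‖v‖ ≤ r → c + v ∈ convexHull ℝ (T : Set (Pt N)) := fun v hv =>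
    hc (by simpa using hv)
  -- An affine function that is nonnegative at `c + v` and at `c - v` varies by at most its value
  -- `m` at the centre.
  have hA : ∀ v : Pt N, ‖v‖ ≤ r → ‖A v‖ ≤ m := by
    intro v hv
    have h1 := h _ (hmem v hv) ▸ (hat_spec hT (hmem v hv)).1 z
    have h2 := h _ (hmem (-v) (by simpa using hv)) ▸
      (hat_spec hT (hmem (-v) (by simpa using hv))).1 z
    rw [map_add] at h1 h2
    rw [map_neg] at h2
    rw [Real.norm_eq_abs, abs_le]
    constructor <;> linarith
  have hm0 : 0 ≤ m := (norm_nonneg _).trans (hA 0 (by simpa using hr.le))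
  have hAn := opNorm_le_of_closedBall A hr hm0 hA
  have hcT : c ∈ convexHull ℝ (T : Set (Pt N)) := by simpa using hmem 0 (by simpa using hr.le)
  -- The function reaches the value `1` at the vertex `z`, at distance at most `2r/ρ` from the
  -- centre, while its slope is at most `m/r`. Hence `m` cannot be small.
  have h1 : 1 ≤ m * (1 + 2 / ρ) := by
    have e := h z (vertex_mem hz)
    rw [hat_node (mem_nodes_of_mem hT hz), if_pos rfl] at e
    have e2 : A z = A c + A (z - c) := by rw [← map_add, add_sub_cancel]
    have e3 : A (z - c) ≤ m / r * (2 / ρ * r) := by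
      refine (le_abs_self _).trans ((A.le_opNorm _).trans ?_)
      have := hR.dist_le T hT z (vertex_mem hz) c hcT
      rw [dist_eq_norm] at this
      gcongr
    have e4 : m / r * (2 / ρ * r) = m * (2 / ρ) := by field_simp
    rw [e4] at e3
    linarith
  have h2 : ρ / (ρ + 2) ≤ m := by
    rw [div_le_iff₀ (by positivity)]
    have : m * (1 + 2 / ρ) * ρ = m * (ρ + 2) := by field_simp
    nlinarith
  have hyT : y ∈ convexHull ℝ (T : Set (Pt N)) :=
    hc (Metric.closedBall_subset_closedBall (by linarith) hy)
  have e : A y = A c + A (y - c) := by rw [← map_add, add_sub_cancel]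
  -- On the ball of half the radius at most half of the central value is lost.
  have e3 : -(m / 2) ≤ A (y - c) := by
    have h3 : ‖A (y - c)‖ ≤ m / r * (r / 2) := by
      refine (A.le_opNorm _).trans ?_
      rw [Metric.mem_closedBall, dist_eq_norm] at hy
      gcongr
    have e4 : m / r * (r / 2) = m / 2 := by field_simp
    rw [e4] at h3
    exact (abs_le.1 h3).1
  have e5 : ρ / (2 * (ρ + 2)) = ρ / (ρ + 2) / 2 := by field_simp
  rw [h y hyT, e, e5]
  linarith

lemma interp_affine {V : Type*} [NormedAddCommGroup V] [NormedSpace ℝ V] {T : Finset (Pt N)}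
    (hT : T ∈ 𝒯.cells) (f : Pt N → V) :
    ∃ (c : V) (Q : Pt N →L[ℝ] V), ∀ x ∈ convexHull ℝ (T : Set (Pt N)), 𝒯.interp f x = c + Q x := by
  choose c A h using fun z => 𝒯.hat_affine hT z
  refine ⟨∑ z ∈ T, c z • f z, ∑ z ∈ T, (A z).smulRight (f z), fun x hx => ?_⟩
  rw [interp_eq hT hx, sum_apply, ← Finset.sum_add_distrib]
  refine Finset.sum_congr rfl fun z _ => ?_
  rw [h z x hx, add_smul]; rfl

lemma fderiv_of_affine {V : Type*} [NormedAddCommGroup V] [NormedSpace ℝ V] {T : Finset (Pt N)}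
    {f : Pt N → V} {c : V} {Q : Pt N →L[ℝ] V}
    (h : ∀ x ∈ convexHull ℝ (T : Set (Pt N)), f x = c + Q x) {x : Pt N}
    (hx : x ∈ interior (convexHull ℝ (T : Set (Pt N)))) : fderiv ℝ f x = Q := by
  have h1 : f =ᶠ[nhds x] fun x => c + Q x := by
    filter_upwards [mem_interior_iff_mem_nhds.1 hx] with y hy using h y hy
  rw [h1.fderiv_eq]
  exact (Q.hasFDerivAt.const_add c).fderiv

end Mesh

/-! ### Nodal interpolation of smooth functions -/

lemma ennreal_sum_sq_le {ι : Type*} (s : Finset ι) (f : ι → ℝ≥0∞) :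
    (∑ i ∈ s, f i) ^ 2 ≤ (s.card : ℝ≥0∞) * ∑ i ∈ s, f i ^ 2 := by
  have h := ENNReal.inner_le_Lp_mul_Lq s (fun _ => (1 : ℝ≥0∞)) f Real.HolderConjugate.two_two
  simp only [one_mul, one_pow, Finset.sum_const, nsmul_eq_mul, mul_one,
    ENNReal.rpow_two] at h
  calc (∑ i ∈ s, f i) ^ 2
      ≤ ((s.card : ℝ≥0∞) ^ (1 / 2 : ℝ) * (∑ i ∈ s, f i ^ 2) ^ (1 / 2 : ℝ)) ^ 2 :=
        pow_le_pow_left' h 2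
    _ = _ := by
      rw [mul_pow, ← ENNReal.rpow_two, ← ENNReal.rpow_two, ← ENNReal.rpow_mul, ← ENNReal.rpow_mul]
      norm_num

lemma ennreal_sum_sq_le_sq {ι : Type*} (s : Finset ι) (f : ι → ℝ≥0∞) :
    ∑ i ∈ s, f i ^ 2 ≤ (∑ i ∈ s, f i) ^ 2 := by
  rw [sq (∑ i ∈ s, f i), Finset.sum_mul]
  refine Finset.sum_le_sum fun i hi => ?_
  rw [sq]
  exact mul_le_mul' le_rfl (Finset.single_le_sum (f := f) (fun _ _ => zero_le) hi)

lemma lintegral_sq_le_of_ray {N : ℕ} (hN : N ≤ 3) {z : Pt N} {K : Set (Pt N)} (hK : MeasurableSet K)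
    (hstar : Star z K) {f R : Pt N → ℝ≥0∞} (hf : Measurable f) {η d : ℝ≥0∞} (hd : d ≠ ∞)
    (h : ∀ x ∈ K, R x ≤ η + d ^ 2 * ∫⁻ s in Ioc (0 : ℝ) 1,
      ENNReal.ofReal s * f (z + s • (x - z))) :
    ∫⁻ x in K, R x ^ 2 ≤ 2 * (η ^ 2 * volume K + 4 * d ^ 4 * ∫⁻ x in K, f x ^ 2) := by
  have hpt : ∀ x ∈ K, R x ^ 2 ≤ 2 * η ^ 2 + 2 * d ^ 4 * (∫⁻ s in Ioc (0 : ℝ) 1,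
      ENNReal.ofReal s * f (z + s • (x - z))) ^ 2 := fun x hx => by
    refine (pow_le_pow_left' (h x hx) 2).trans ((ennreal_add_sq_le _ _).trans (le_of_eq ?_))
    ring
  refine (setLIntegral_mono' hK hpt).trans ?_
  rw [lintegral_add_left measurable_const, setLIntegral_const, lintegral_const_mul' _ _ (by finiteness)]
  refine (add_le_add le_rfl (mul_le_mul' le_rfl (lintegral_ray_sq_le hN hK hstar hf))).trans
    (le_of_eq ?_)
  ring

namespace Mesh

variable {N : ℕ} {Ω : Set (Pt N)} {𝒯 : Mesh Ω}

/-- The Taylor remainders at the vertices of a cell, in `L²` of the cell. -/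
lemma lintegral_sum_remainder_sq_le (hN : N ≤ 3) {T : Finset (Pt N)} (hT : T ∈ 𝒯.cells)
    {u p : Pt N → Pt N} (hu : ContDiff ℝ 2 u) {η d : ℝ≥0∞} (hdt : d ≠ ∞) (hp : ∀ z ∈ T, ‖p z - u z‖ₑ ≤ η)
    (hd : ∀ x ∈ convexHull ℝ (T : Set (Pt N)), ∀ z ∈ T, ‖x - z‖ₑ ≤ d) :
    ∫⁻ x in convexHull ℝ (T : Set (Pt N)),
        (∑ z ∈ T, ‖p z - (u x + fderiv ℝ u x (z - x))‖ₑ) ^ 2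
      ≤ 2 * (N + 1) ^ 2 * (η ^ 2 * volume (convexHull ℝ (T : Set (Pt N)))
        + 4 * d ^ 4 * ∫⁻ x in convexHull ℝ (T : Set (Pt N)), ‖fderiv ℝ (fderiv ℝ u) x‖ₑ ^ 2) := by
  set K := convexHull ℝ (T : Set (Pt N)) with hK
  have hKm : MeasurableSet K := measurableSet_cell T
  have hu1 : ContDiff ℝ 1 (fderiv ℝ u) := hu.fderiv_right (by norm_num)
  have hddm : Measurable (fun x => ‖fderiv ℝ (fderiv ℝ u) x‖ₑ) :=
    measurable_enorm_of_continuous (hu1.continuous_fderiv (by norm_num))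
  have hRc : ∀ z, Continuous (fun x => p z - (u x + fderiv ℝ u x (z - x))) := fun z =>
    continuous_const.sub (hu.continuous.add
      (hu1.continuous.clm_apply (continuous_const.sub continuous_id)))
  have hRm : ∀ z, Measurable (fun x => ‖p z - (u x + fderiv ℝ u x (z - x))‖ₑ) := fun z =>
    measurable_enorm_of_continuous (hRc z)
  have hone : ∀ z ∈ T, ∫⁻ x in K, ‖p z - (u x + fderiv ℝ u x (z - x))‖ₑ ^ 2
      ≤ 2 * (η ^ 2 * volume K + 4 * d ^ 4 * ∫⁻ x in K, ‖fderiv ℝ (fderiv ℝ u) x‖ₑ ^ 2) := by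
    intro z hz
    have hstar : Star z K := fun x hx s hs => by
      have := (convex_convexHull ℝ (T : Set (Pt N))) (vertex_mem hz) hx (sub_nonneg.2 hs.2) hs.1.le
        (by ring)
      convert this using 1; module
    refine lintegral_sq_le_of_ray hN hKm hstar hddm hdt fun x hx => ?_
    have e : p z - (u x + fderiv ℝ u x (z - x))
        = (p z - u z) + (u z - (u x + fderiv ℝ u x (z - x))) := by abel
    rw [e]
    exact (enorm_add_le _ _).trans (add_le_add (hp z hz) ((enorm_taylor_le hu x z).trans
      (mul_le_mul' (pow_le_pow_left' (hd x hx z hz) 2) le_rfl)))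
  have hcard : (T.card : ℝ≥0∞) = N + 1 := by rw [𝒯.card_cell T hT]; push_cast; rfl
  calc ∫⁻ x in K, (∑ z ∈ T, ‖p z - (u x + fderiv ℝ u x (z - x))‖ₑ) ^ 2
      ≤ ∫⁻ x in K, (T.card : ℝ≥0∞) * ∑ z ∈ T, ‖p z - (u x + fderiv ℝ u x (z - x))‖ₑ ^ 2 :=
        lintegral_mono fun x => ennreal_sum_sq_le _ _
    _ = (N + 1) * ∑ z ∈ T, ∫⁻ x in K, ‖p z - (u x + fderiv ℝ u x (z - x))‖ₑ ^ 2 := by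
        rw [lintegral_const_mul' _ _ (by finiteness), hcard,
          lintegral_finsetSum _ fun z _ => (hRm z).pow_const 2]
    _ ≤ (N + 1) * ∑ z ∈ T, 2 * (η ^ 2 * volume K
          + 4 * d ^ 4 * ∫⁻ x in K, ‖fderiv ℝ (fderiv ℝ u) x‖ₑ ^ 2) := by
        gcongr with z hz
        exact hone z hz
    _ = _ := by rw [Finset.sum_const, nsmul_eq_mul, hcard]; ring

/-- Interpolation reproduces the affine function `y ↦ a + A (y - x)`, whose value at `x` is `a`.
With the Taylor polynomial of `u` at `x` the right side is a sum of Taylor remainders at the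
vertices. -/
lemma norm_interp_sub_le {T : Finset (Pt N)} (hT : T ∈ 𝒯.cells) {p : Pt N → Pt N}
    {x : Pt N} (hx : x ∈ convexHull ℝ (T : Set (Pt N))) (a : Pt N) (A : Pt N →L[ℝ] Pt N) :
    ‖𝒯.interp p x - a‖ ≤ ∑ z ∈ T, ‖p z - (a + A (z - x))‖ := by
  have h := sum_hat_affine hT hx (a - A x) A
  have e : 𝒯.interp p x - a = ∑ z ∈ T, 𝒯.hat z x • (p z - (a + A (z - x))) := by
    have h2 : ∀ z, 𝒯.hat z x • (p z - (a + A (z - x)))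
        = 𝒯.hat z x • p z - 𝒯.hat z x • ((a - A x) + A z) := fun z => by
      rw [map_sub, ← smul_sub]; congr 1; abel
    rw [Finset.sum_congr rfl fun z _ => h2 z, Finset.sum_sub_distrib, h, ← interp_eq hT hx]
    abel
  rw [e]
  refine (norm_sum_le _ _).trans (Finset.sum_le_sum fun z hz => ?_)
  rw [norm_smul, Real.norm_of_nonneg ((hat_spec hT hx).1 z)]
  exact mul_le_of_le_one_left (norm_nonneg _) (hat_le_one z (cell_subset hT hx))

/-- The same reproduction of affine functions, applied to differences across the inscribed ball:
shape functions vary by at most `1` over a distance `r`. -/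
lemma norm_gradient_interp_sub_le {ρ r : ℝ} (hR : 𝒯.Regular ρ r) {T : Finset (Pt N)}
    (hT : T ∈ 𝒯.cells) {p : Pt N → Pt N} {c₀ : Pt N} {Q : Pt N →L[ℝ] Pt N}
    (hQ : ∀ x ∈ convexHull ℝ (T : Set (Pt N)), 𝒯.interp p x = c₀ + Q x)
    (x a : Pt N) (A : Pt N →L[ℝ] Pt N) :
    ‖Q - A‖ ≤ (∑ z ∈ T, ‖p z - (a + A (z - x))‖) / r := by
  obtain ⟨c, hc⟩ := hR.ball T hT
  refine opNorm_le_of_closedBall _ hR.r_pos (Finset.sum_nonneg fun _ _ => norm_nonneg _)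
    fun v hv => ?_
  have h1 : c + v ∈ convexHull ℝ (T : Set (Pt N)) := hc (by simpa using hv)
  have h0 : c ∈ convexHull ℝ (T : Set (Pt N)) := hc (by simpa using hR.r_pos.le)
  have e : (Q - A) v = ∑ z ∈ T, (𝒯.hat z (c + v) - 𝒯.hat z c) • (p z - (a + A (z - x))) := by
    have h2 : ∀ z, (𝒯.hat z (c + v) - 𝒯.hat z c) • (p z - (a + A (z - x)))
        = (𝒯.hat z (c + v) • p z - 𝒯.hat z c • p z)
          - (𝒯.hat z (c + v) • ((a - A x) + A z) - 𝒯.hat z c • ((a - A x) + A z)) := fun z => by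
      rw [map_sub]; module
    rw [Finset.sum_congr rfl fun z _ => h2 z, Finset.sum_sub_distrib, Finset.sum_sub_distrib,
      Finset.sum_sub_distrib, sum_hat_affine hT h1, sum_hat_affine hT h0, ← interp_eq hT h1,
      ← interp_eq hT h0, hQ _ h1, hQ _ h0, sub_apply, map_add, map_add]
    abel
  rw [e]
  refine (norm_sum_le _ _).trans (Finset.sum_le_sum fun z _ => ?_)
  rw [norm_smul]
  refine mul_le_of_le_one_left (norm_nonneg _) ?_
  have a1 := (hat_spec hT h1).1 z
  have a2 := (hat_spec hT h0).1 z
  have a3 := hat_le_one (𝒯 := 𝒯) z (cell_subset hT h1)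
  have a4 := hat_le_one (𝒯 := 𝒯) z (cell_subset hT h0)
  rw [Real.norm_eq_abs, abs_le]
  constructor <;> linarith

/-- Nodal interpolation of solenoidal `H²` fields, with homogeneous boundary values. -/
lemma exists_interp (hN : N ≤ 3) (hΩ : IsConvexPolyhedralDomain Ω) {ρ : ℝ} (hρ : 0 < ρ) :
    ∃ C : ℝ≥0∞, C ≠ ∞ ∧ ∀ (𝒯 : Mesh Ω) (r : ℝ), 𝒯.Regular ρ r →
      ∀ (w : Pt N → Pt N) (G : Pt N → (Pt N →L[ℝ] Pt N))
        (H : Pt N → (Pt N →L[ℝ] (Pt N →L[ℝ] Pt N))),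
      MemH10Sigma Ω w → HasWeakHessian Ω w G H → ∫⁻ x in Ω, ‖w x‖ₑ ^ 2 ≤ 1 →
      ∫⁻ x in Ω, ‖G x‖ₑ ^ 2 ≤ 1 → ∫⁻ x in Ω, ‖H x‖ₑ ^ 2 ≤ 1 →
      ∃ P : Pt N → Pt N, 𝒯.MemCG0 P ∧ (∀ x ∈ closure Ω, ‖P x‖ₑ ^ 2 ≤ C) ∧
        ∫⁻ x in Ω, ‖P x - w x‖ₑ ^ 2 ≤ C * ENNReal.ofReal r ^ 4 ∧
        ∫⁻ x in Ω, ‖fderiv ℝ P x‖ₑ ^ 4 ≤ C := by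
  classical
  obtain ⟨C₄, hC₄, hsob⟩ := sobolev_four hN hΩ
  have hΩm := hΩ.isOpen.measurableSet
  set V := volume Ω with hV
  have hV0 : V ≠ 0 := (hΩ.isOpen.measure_pos volume hΩ.nonempty).ne'
  have hVt : V ≠ ∞ := hΩ.bounded.measure_lt_top.ne
  set D : ℝ≥0∞ := ENNReal.ofReal (Metric.diam Ω) with hD
  have hDt : D ≠ ∞ := ENNReal.ofReal_ne_top
  set b : ℝ≥0∞ := volume (Metric.ball (0 : Pt N) 1) with hb
  have hb0 : b ≠ 0 := (Metric.measure_ball_pos _ _ one_pos).ne'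
  have hbt : b ≠ ∞ := measure_ball_lt_top.ne
  set e : ℝ≥0∞ := ENNReal.ofReal (2 / ρ) with he
  have het : e ≠ ∞ := ENNReal.ofReal_ne_top
  set C₁ : ℝ≥0∞ := 2 * (N + 1) ^ 2 * (1 + 4 * e ^ 4) with hC₁
  have hC₁t : C₁ ≠ ∞ := by finiteness
  -- Chosen so that `τ ^ 4 ≤ C₂ * volume T` on every cell; the surplus power `4 - N` of `r` is
  -- absorbed by the diameter of `Ω`.
  set C₂ : ℝ≥0∞ := D ^ (4 - N) * b⁻¹ with hC₂
  have hC₂t : C₂ ≠ ∞ := ENNReal.mul_ne_top (by finiteness) (ENNReal.inv_ne_top.2 hb0)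
  set M : ℝ≥0∞ := C₄ * ((2 ^ N) ^ 2 + (2 ^ N) ^ 2) with hM
  have hMt : M ≠ ∞ := by finiteness
  set Cu : ℝ≥0∞ := V⁻¹ * (16 * (2 ^ N + D ^ 2 * 2 ^ N + D ^ 4 * 2 ^ N)) with hCu
  have hCut : Cu ≠ ∞ := ENNReal.mul_ne_top (ENNReal.inv_ne_top.2 hV0) (by finiteness)
  set Ci : ℝ≥0∞ := 2 * (C₁ * (V + 2 ^ N) + 1) with hCi
  have hCit : Ci ≠ ∞ := by finiteness
  set Cg : ℝ≥0∞ := 8 * (M + C₂ * C₁ ^ 2 * (V + 2 ^ N) ^ 2) with hCg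
  have hCgt : Cg ≠ ∞ := by finiteness
  refine ⟨Cu + Ci + Cg, by finiteness, ?_⟩
  intro 𝒯 r hR w G H hw hH h0 h1 h2
  set τ := ENNReal.ofReal r with hτ
  have hτ0 : τ ≠ 0 := by simpa [hτ] using hR.r_pos
  have hτt : τ ≠ ∞ := ENNReal.ofReal_ne_top
  -- Accuracy `τ ^ 4` for squared norms matches the interpolation error of order `r²`. The boundary
  -- values of `u` are small enough to be replaced by zero at the same cost.
  obtain ⟨u, hu, huw, hu0, hu1, hu2, hub⟩ := exists_smooth_approx hN hΩ hw hH h0 h1 h2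
    (ε := τ ^ 4) (pow_ne_zero _ hτ0)
  have hud : ContDiff ℝ 1 (fderiv ℝ u) := hu.fderiv_right (by norm_num)
  set p : Pt N → Pt N := fun z => if z ∈ Ω then u z else 0 with hp
  have hP0 : 𝒯.MemCG0 (𝒯.interp p) := memCG0_interp hΩ fun z _ hz => by
    rw [hΩ.isOpen.frontier_eq] at hz
    simp [hp, hz.2]
  have hsup : ∀ z ∈ closure Ω, ‖u z‖ₑ ^ 2 ≤ Cu := by
    intro z hz
    have hm := enorm_sq_mul_volume_le hN hu hΩm (fun x hx s hs => mem_of_closure_ray hΩ hz hx hs)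
      (D := D) (fun x hx => by
        rw [← ofReal_norm, ← dist_eq_norm, hD, ← Metric.diam_closure]
        exact ENNReal.ofReal_le_ofReal
          (Metric.dist_le_diam_of_mem hΩ.bounded.closure (subset_closure hx) hz))
    rw [hCu, ← ENNReal.div_eq_inv_mul, ENNReal.le_div_iff_mul_le (.inl hV0) (.inl hVt)]
    refine hm.trans ?_
    gcongr
  have hnode : ∀ z ∈ 𝒯.nodes, ‖p z - u z‖ₑ ≤ τ ^ 2 := by
    intro z hz
    by_cases hzΩ : z ∈ Ω
    · simp [hp, hzΩ]
    · have h3 := hub z (by rw [hΩ.isOpen.frontier_eq]; exact ⟨node_mem_closure hz, hzΩ⟩)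
      simp only [hp, hzΩ, if_false, zero_sub, enorm_neg]
      rw [show τ ^ 4 = (τ ^ 2) ^ 2 by ring, ← ENNReal.rpow_two, ← ENNReal.rpow_two (τ ^ 2)] at h3
      exact (ENNReal.rpow_le_rpow_iff two_pos).1 h3
  set S : Finset (Pt N) → Pt N → ℝ≥0∞ := fun T x =>
    ∑ z ∈ T, ‖p z - (u x + fderiv ℝ u x (z - x))‖ₑ with hS
  have hSm : ∀ T, Measurable (S T) := fun T => Finset.measurable_fun_sum _ fun z _ =>
    measurable_enorm_of_continuous (continuous_const.sub (hu.continuous.add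
      (hud.continuous.clm_apply (continuous_const.sub continuous_id))))
  set m : Finset (Pt N) → ℝ≥0∞ := fun T => volume (convexHull ℝ (T : Set (Pt N)))
    + ∫⁻ x in convexHull ℝ (T : Set (Pt N)), ‖fderiv ℝ (fderiv ℝ u) x‖ₑ ^ 2 with hm
  have hmsum : ∑ T ∈ 𝒯.cells, m T ≤ V + 2 ^ N := by
    rw [hm, Finset.sum_add_distrib, ← lintegral_eq_sum_cells hΩ 𝒯]
    refine add_le_add (le_of_eq ?_) hu2
    have := lintegral_eq_sum_cells hΩ 𝒯 (fun _ => 1)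
    simpa using this.symm
  have hSint : ∀ T ∈ 𝒯.cells, ∫⁻ x in convexHull ℝ (T : Set (Pt N)), S T x ^ 2
      ≤ C₁ * τ ^ 4 * m T := by
    intro T hT
    have hl := lintegral_sum_remainder_sq_le hN hT (p := p) hu (η := τ ^ 2) (d := e * τ)
      (by finiteness)
      (fun z hz => hnode z (mem_nodes_of_mem hT hz)) (fun x hx z hz => by
        rw [← ofReal_norm, ← dist_eq_norm, he, hτ, ← ENNReal.ofReal_mul (by positivity)]
        exact ENNReal.ofReal_le_ofReal (hR.dist_le T hT x hx z (vertex_mem hz)))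
    refine hl.trans ?_
    rw [hC₁, hm]
    set v := volume (convexHull ℝ (T : Set (Pt N)))
    set J := ∫⁻ x in convexHull ℝ (T : Set (Pt N)), ‖fderiv ℝ (fderiv ℝ u) x‖ₑ ^ 2
    calc 2 * (N + 1) ^ 2 * ((τ ^ 2) ^ 2 * v + 4 * (e * τ) ^ 4 * J)
        = 2 * (N + 1) ^ 2 * τ ^ 4 * (1 * v + 4 * e ^ 4 * J) := by ring
      _ ≤ 2 * (N + 1) ^ 2 * τ ^ 4 * ((1 + 4 * e ^ 4) * v + (1 + 4 * e ^ 4) * J) := by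
          gcongr
          · exact le_self_add
          · exact le_add_self
      _ = _ := by ring
  refine ⟨𝒯.interp p, hP0, fun x hx => ?_, ?_, ?_⟩
  · refine le_trans ?_ (le_self_add.trans le_self_add : Cu ≤ Cu + Ci + Cg)
    have h3 : ‖𝒯.interp p x‖ ≤ Real.sqrt Cu.toReal := by
      refine norm_interp_le (fun z hz => ?_) hx
      refine Real.le_sqrt_of_sq_le ?_
      have h4 : ‖p z‖ₑ ^ 2 ≤ Cu := by
        by_cases hzΩ : z ∈ Ω
        · simpa [hp, hzΩ] using hsup z (node_mem_closure hz)
        · simp [hp, hzΩ]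
      rw [← ofReal_norm, ← ENNReal.ofReal_pow (norm_nonneg _)] at h4
      exact (ENNReal.ofReal_le_iff_le_toReal hCut).1 h4
    rw [← ofReal_norm, ← ENNReal.ofReal_pow (norm_nonneg _), ENNReal.ofReal_le_iff_le_toReal hCut]
    exact (Real.le_sqrt (norm_nonneg _) ENNReal.toReal_nonneg).1 h3
  · have h3 : ∫⁻ x in Ω, ‖𝒯.interp p x - u x‖ₑ ^ 2 ≤ C₁ * (V + 2 ^ N) * τ ^ 4 := by
      rw [lintegral_eq_sum_cells hΩ 𝒯]
      calc ∑ T ∈ 𝒯.cells, ∫⁻ x in convexHull ℝ (T : Set (Pt N)), ‖𝒯.interp p x - u x‖ₑ ^ 2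
          ≤ ∑ T ∈ 𝒯.cells, C₁ * τ ^ 4 * m T := by
            refine Finset.sum_le_sum fun T hT => le_trans ?_ (hSint T hT)
            refine setLIntegral_mono' (measurableSet_cell T) fun x hx => pow_le_pow_left' ?_ 2
            have := norm_interp_sub_le hT (p := p) hx (u x) (fderiv ℝ u x)
            rw [← ofReal_norm]
            refine (ENNReal.ofReal_le_ofReal this).trans (le_of_eq ?_)
            rw [ENNReal.ofReal_sum_of_nonneg fun _ _ => norm_nonneg _]
            simp only [ofReal_norm, hS]
        _ ≤ C₁ * τ ^ 4 * (V + 2 ^ N) := by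
            rw [← Finset.mul_sum]
            exact mul_le_mul' le_rfl hmsum
        _ = _ := by ring
    have hPm : AEStronglyMeasurable (fun x => 𝒯.interp p x - u x) (volume.restrict Ω) :=
      ((hP0.1.isLip hΩ.convex).bm hΩ).1.sub hu.continuous.aestronglyMeasurable
    have h4 := lintegral_add_sq_le (m := volume.restrict Ω) (fun x => u x - w x) hPm
    simp only [sub_add_sub_cancel] at h4
    calc ∫⁻ x in Ω, ‖𝒯.interp p x - w x‖ₑ ^ 2 ≤ 2 * (C₁ * (V + 2 ^ N) * τ ^ 4 + τ ^ 4) := by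
          refine h4.trans ?_
          gcongr
      _ = Ci * τ ^ 4 := by rw [hCi]; ring
      _ ≤ _ := by
          gcongr
          exact le_add_self.trans le_self_add
  · refine le_trans ?_ (le_add_self : Cg ≤ Cu + Ci + Cg)
    have hcell : ∀ T ∈ 𝒯.cells, ∫⁻ x in convexHull ℝ (T : Set (Pt N)), ‖fderiv ℝ (𝒯.interp p) x‖ₑ ^ 4
        ≤ 8 * ((∫⁻ x in convexHull ℝ (T : Set (Pt N)), ‖fderiv ℝ u x‖ₑ ^ 4)
          + C₂ * C₁ ^ 2 * m T ^ 2) := by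
      intro T hT
      obtain ⟨c₀, Q, hQ⟩ := interp_affine hT p
      set K := convexHull ℝ (T : Set (Pt N)) with hK
      set v := volume K with hv
      have hvb : τ ^ N * b ≤ v := hR.volume_cell_ge hT
      have hv0 : v ≠ 0 := fun h => by
        rw [h, nonpos_iff_eq_zero, mul_eq_zero] at hvb
        exact hvb.elim (pow_ne_zero _ hτ0) hb0
      have hvt : v ≠ ∞ := (isCompact_cell T).measure_lt_top.ne
      set a := ‖Q‖ₑ with ha
      have hdm : Measurable (fun x => ‖fderiv ℝ u x‖ₑ) :=
        measurable_enorm_of_continuous hud.continuous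
      -- The gradient of the interpolant is constant on the cell and differs from that of `u` by the
      -- remainder sum divided by `r`. Both sides are multiplied by `r` and then averaged over the
      -- cell.
      have hpt : ∀ x, a * τ ≤ τ * ‖fderiv ℝ u x‖ₑ + S T x := by
        intro x
        have h3 := norm_gradient_interp_sub_le hR hT hQ x (u x) (fderiv ℝ u x)
        have h4 : ‖Q‖ * r ≤ r * ‖fderiv ℝ u x‖
            + ∑ z ∈ T, ‖p z - (u x + fderiv ℝ u x (z - x))‖ := by
          have h5 : ‖Q‖ ≤ ‖fderiv ℝ u x‖ + ‖Q - fderiv ℝ u x‖ := by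
            have := norm_add_le (fderiv ℝ u x) (Q - fderiv ℝ u x)
            rwa [add_sub_cancel] at this
          rw [le_div_iff₀ hR.r_pos] at h3
          nlinarith [hR.r_pos]
        have h6 := ENNReal.ofReal_le_ofReal h4
        rw [ENNReal.ofReal_mul (norm_nonneg _), ofReal_norm,
          ENNReal.ofReal_add (mul_nonneg hR.r_pos.le (norm_nonneg _))
            (Finset.sum_nonneg fun _ _ => norm_nonneg _), ENNReal.ofReal_mul hR.r_pos.le,
          ofReal_norm, ENNReal.ofReal_sum_of_nonneg fun _ _ => norm_nonneg _] at h6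
        simpa only [ofReal_norm, hS] using h6
      have hint : a * τ * v ≤ τ * (∫⁻ x in K, ‖fderiv ℝ u x‖ₑ) + ∫⁻ x in K, S T x := by
        rw [hv, ← setLIntegral_const, ← lintegral_const_mul _ hdm,
          ← lintegral_add_left (hdm.const_mul _)]
        exact lintegral_mono hpt
      have i1 : (∫⁻ x in K, ‖fderiv ℝ u x‖ₑ) ^ 4 ≤ v ^ 3 * ∫⁻ x in K, ‖fderiv ℝ u x‖ₑ ^ 4 := by
        have := lintegral_weight_pow_four_le (m := volume.restrict K) (w := fun _ => 1)
          aemeasurable_const hdm.aemeasurable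
        simpa using this
      have i2 : (∫⁻ x in K, S T x) ^ 4 ≤ v ^ 2 * (C₁ * τ ^ 4 * m T) ^ 2 := by
        have := lintegral_sq_le (m := volume.restrict K) (hSm T).aemeasurable
        rw [Measure.restrict_apply_univ] at this
        calc (∫⁻ x in K, S T x) ^ 4 = ((∫⁻ x in K, S T x) ^ 2) ^ 2 := by ring
          _ ≤ (v * (C₁ * τ ^ 4 * m T)) ^ 2 :=
            pow_le_pow_left' (this.trans (mul_le_mul' le_rfl (hSint T hT))) 2
          _ = _ := by ring
      have hτ4 : τ ^ 4 ≤ C₂ * v := by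
        calc τ ^ 4 = τ ^ (4 - N) * τ ^ N := by rw [← pow_add]; congr 1; omega
          _ = τ ^ (4 - N) * (b⁻¹ * (τ ^ N * b)) := by
              rw [mul_comm (τ ^ N) b, ← mul_assoc b⁻¹, ENNReal.inv_mul_cancel hb0 hbt, one_mul]
          _ ≤ D ^ (4 - N) * (b⁻¹ * v) := by
              gcongr
              exact ENNReal.ofReal_le_ofReal hR.r_le
          _ = _ := by rw [hC₂]; ring
      have hmain : a ^ 4 * v * (τ ^ 4 * v ^ 3)
          ≤ 8 * ((∫⁻ x in K, ‖fderiv ℝ u x‖ₑ ^ 4) + C₂ * C₁ ^ 2 * m T ^ 2) * (τ ^ 4 * v ^ 3) := by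
        calc a ^ 4 * v * (τ ^ 4 * v ^ 3) = (a * τ * v) ^ 4 := by ring
          _ ≤ (τ * (∫⁻ x in K, ‖fderiv ℝ u x‖ₑ) + ∫⁻ x in K, S T x) ^ 4 := pow_le_pow_left' hint 4
          _ ≤ 8 * ((τ * (∫⁻ x in K, ‖fderiv ℝ u x‖ₑ)) ^ 4 + (∫⁻ x in K, S T x) ^ 4) :=
              ennreal_add_pow_four_le _ _
          _ ≤ 8 * (τ ^ 4 * (v ^ 3 * ∫⁻ x in K, ‖fderiv ℝ u x‖ₑ ^ 4)
              + v ^ 2 * (C₁ * τ ^ 4 * m T) ^ 2) := by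
              rw [mul_pow]; gcongr
          _ = 8 * (τ ^ 4 * (v ^ 3 * ∫⁻ x in K, ‖fderiv ℝ u x‖ₑ ^ 4)
              + τ ^ 4 * (v ^ 2 * C₁ ^ 2 * m T ^ 2) * τ ^ 4) := by ring
          _ ≤ 8 * (τ ^ 4 * (v ^ 3 * ∫⁻ x in K, ‖fderiv ℝ u x‖ₑ ^ 4)
              + τ ^ 4 * (v ^ 2 * C₁ ^ 2 * m T ^ 2) * (C₂ * v)) := by gcongr
          _ = _ := by ring
      have hfin := (ENNReal.mul_le_mul_iff_left (mul_ne_zero (pow_ne_zero 4 hτ0)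
        (pow_ne_zero 3 hv0)) (by finiteness)).1 hmain
      refine le_trans ?_ hfin
      calc ∫⁻ x in K, ‖fderiv ℝ (𝒯.interp p) x‖ₑ ^ 4 ≤ ∫⁻ _ in K, a ^ 4 :=
            lintegral_cell_mono fun x hx => by rw [fderiv_of_affine hQ hx]
        _ = a ^ 4 * v := by rw [setLIntegral_const]
    rw [lintegral_eq_sum_cells hΩ 𝒯]
    calc _ ≤ ∑ T ∈ 𝒯.cells, 8 * ((∫⁻ x in convexHull ℝ (T : Set (Pt N)), ‖fderiv ℝ u x‖ₑ ^ 4)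
          + C₂ * C₁ ^ 2 * m T ^ 2) := Finset.sum_le_sum hcell
      _ = 8 * ((∫⁻ x in Ω, ‖fderiv ℝ u x‖ₑ ^ 4) + C₂ * C₁ ^ 2 * ∑ T ∈ 𝒯.cells, m T ^ 2) := by
          rw [← Finset.mul_sum, Finset.sum_add_distrib, ← Finset.mul_sum,
            ← lintegral_eq_sum_cells hΩ 𝒯]
      _ ≤ 8 * (M + C₂ * C₁ ^ 2 * (V + 2 ^ N) ^ 2) := by
          have h3 : ∫⁻ x in Ω, ‖fderiv ℝ u x‖ₑ ^ 4 ≤ M := by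
            refine (hsob _ (fderiv ℝ u) hud).trans ?_
            rw [hM]
            gcongr
          -- Squares of nonnegative numbers sum to at most the square of their sum, so the
          -- fourth-power bound over all cells needs only the sum of the `m T`.
          have h4 : ∑ T ∈ 𝒯.cells, m T ^ 2 ≤ (V + 2 ^ N) ^ 2 :=
            (ennreal_sum_sq_le_sq _ _).trans (pow_le_pow_left' hmsum 2)
          gcongr

end Mesh

namespace Mesh

variable {N : ℕ} {Ω : Set (Pt N)} {𝒯 : Mesh Ω}

/-! ### Algebra of piecewise polynomials -/

lemma IsPiecewisePoly.mono {r s : ℕ} (hrs : r ≤ s) {q : Pt N → ℝ} (h : 𝒯.IsPiecewisePoly r q) :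
    𝒯.IsPiecewisePoly s q :=
  ⟨h.1, fun T hT => by
    obtain ⟨p, hp, e⟩ := h.2 T hT
    exact ⟨p, hp.trans hrs, e⟩⟩

lemma IsPiecewisePoly.add {r : ℕ} {q q' : Pt N → ℝ} (h : 𝒯.IsPiecewisePoly r q)
    (h' : 𝒯.IsPiecewisePoly r q') : 𝒯.IsPiecewisePoly r (fun x => q x + q' x) :=
  ⟨h.1.add h'.1, fun T hT => by
    obtain ⟨p, hp, e⟩ := h.2 T hT
    obtain ⟨p', hp', e'⟩ := h'.2 T hT
    exact ⟨p + p', (MvPolynomial.totalDegree_add _ _).trans (max_le hp hp'), fun x hx => by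
      change q x + q' x = _
      rw [map_add, e x hx, e' x hx]⟩⟩

lemma IsPiecewisePoly.mul {r s : ℕ} {q q' : Pt N → ℝ} (h : 𝒯.IsPiecewisePoly r q)
    (h' : 𝒯.IsPiecewisePoly s q') : 𝒯.IsPiecewisePoly (r + s) (fun x => q x * q' x) :=
  ⟨h.1.mul h'.1, fun T hT => by
    obtain ⟨p, hp, e⟩ := h.2 T hT
    obtain ⟨p', hp', e'⟩ := h'.2 T hT
    exact ⟨p * p', (MvPolynomial.totalDegree_mul _ _).trans (add_le_add hp hp'), fun x hx => by
      change q x * q' x = _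
      rw [map_mul, e x hx, e' x hx]⟩⟩

lemma isPiecewisePoly_const (r : ℕ) (c : ℝ) : 𝒯.IsPiecewisePoly r (fun _ => c) :=
  ⟨continuousOn_const, fun _ _ => ⟨MvPolynomial.C c, by simp, fun x _ => by simp⟩⟩

lemma IsPiecewisePoly.const_mul {r : ℕ} (c : ℝ) {q : Pt N → ℝ} (h : 𝒯.IsPiecewisePoly r q) :
    𝒯.IsPiecewisePoly r (fun x => c * q x) := by
  simpa using (isPiecewisePoly_const (𝒯 := 𝒯) 0 c).mul h

lemma isPiecewisePoly_sum {ι : Type*} {r : ℕ} (s : Finset ι) {q : ι → Pt N → ℝ}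
    (h : ∀ i ∈ s, 𝒯.IsPiecewisePoly r (q i)) : 𝒯.IsPiecewisePoly r (fun x => ∑ i ∈ s, q i x) := by
  classical
  induction s using Finset.induction_on with
  | empty => simpa using isPiecewisePoly_const (𝒯 := 𝒯) r 0
  | insert a s ha ih =>
    simp_rw [Finset.sum_insert ha]
    exact (h a (Finset.mem_insert_self _ _)).add
      (ih fun i hi => h i (Finset.mem_insert_of_mem hi))

/-- Vector fields with piecewise quadratic components. -/
def IsQuadratic (𝒯 : Mesh Ω) (b : Pt N → Pt N) : Prop := ∀ i, 𝒯.IsPiecewisePoly 2 (fun x => b x i)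

lemma IsQuadratic.isLip (hconv : Convex ℝ Ω) {b : Pt N → Pt N} (h : 𝒯.IsQuadratic b) : IsLip Ω b :=
  isLip_of_components fun i => (h i).isLip hconv le_rfl

lemma IsQuadratic.add {a b : Pt N → Pt N} (ha : 𝒯.IsQuadratic a) (hb : 𝒯.IsQuadratic b) :
    𝒯.IsQuadratic (fun x => a x + b x) := fun i => (ha i).add (hb i)

lemma IsQuadratic.const_smul (c : ℝ) {b : Pt N → Pt N} (hb : 𝒯.IsQuadratic b) :
    𝒯.IsQuadratic (fun x => c • b x) := fun i => (hb i).const_mul c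

lemma IsQuadratic.exists_form {b : Pt N → Pt N} (h : 𝒯.IsQuadratic b) {T : Finset (Pt N)}
    (hT : T ∈ 𝒯.cells) : ∃ (c : Pt N) (A : Pt N →L[ℝ] Pt N) (B : Pt N →L[ℝ] Pt N →L[ℝ] Pt N),
      ∀ x ∈ convexHull ℝ (T : Set (Pt N)), b x = c + A x + B x x := by
  choose p hp e using fun i => (h i).2 T hT
  choose c A B hcAB using fun i => eval_quadratic (hp i)
  refine ⟨∑ i, c i • unit i, ∑ i, (A i).smulRight (unit i),
    ∑ i, (ContinuousLinearMap.smulRightL ℝ (Pt N) (Pt N)).flip (unit i) ∘L B i, fun x hx => ?_⟩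
  rw [sum_smul_unit (b x), sum_apply, sum_apply, sum_apply, ← Finset.sum_add_distrib,
    ← Finset.sum_add_distrib]
  refine Finset.sum_congr rfl fun i _ => ?_
  have e1 : b x i = _ := e i x hx
  rw [e1, hcAB i x, add_smul, add_smul]
  rfl

/-! ### Inverse estimates for quadratic polynomials -/

section Quadratic

variable {K : Set (Pt N)} {b : Pt N → Pt N} {c : Pt N} {A : Pt N →L[ℝ] Pt N}
  {B : Pt N →L[ℝ] Pt N →L[ℝ] Pt N}

/-- Extrapolation of a quadratic from the parameters `0`, `1/4`, `1/2` to `1`. All nodes lie in the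
first half of the segment, so as functions of `x` they are homotheties with centre `y` and ratio at
least `1/2`. -/
lemma quadratic_extrapolate (hK : Convex ℝ K) (hb : ∀ x ∈ K, b x = c + A x + B x x) {x y : Pt N}
    (hx : x ∈ K) (hy : y ∈ K) :
    b y = (3 : ℝ) • b x - (8 : ℝ) • b (x + (1 / 4 : ℝ) • (y - x))
      + (6 : ℝ) • b (x + (1 / 2 : ℝ) • (y - x)) := by
  have hm : ∀ t : ℝ, 0 ≤ t → t ≤ 1 → x + t • (y - x) ∈ K := fun t h0 h1 => by
    have := hK hx hy (sub_nonneg.2 h1) h0 (by ring)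
    convert this using 1; module
  obtain ⟨e, rfl⟩ : ∃ e, y = x + e := ⟨y - x, by abel⟩
  rw [hb _ hy, hb _ hx, hb _ (hm _ (by norm_num) (by norm_num)),
    hb _ (hm _ (by norm_num) (by norm_num))]
  simp only [add_sub_cancel_left, map_add, map_smul, add_apply,
    smul_apply]
  module

/-- The one-sided three-point difference formula, exact for quadratics; the left side is the
derivative at `x` in direction `y - x`. -/
lemma quadratic_derivative (hK : Convex ℝ K) (hb : ∀ x ∈ K, b x = c + A x + B x x) {x y : Pt N}
    (hx : x ∈ K) (hy : y ∈ K) :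
    A (y - x) + B x (y - x) + B (y - x) x
      = (4 : ℝ) • b (x + (1 / 2 : ℝ) • (y - x)) - (3 : ℝ) • b x - b y := by
  have hm : x + (1 / 2 : ℝ) • (y - x) ∈ K := by
    have := hK hx hy (a := 1 / 2) (b := 1 / 2) (by norm_num) (by norm_num) (by norm_num)
    convert this using 1; module
  obtain ⟨e, rfl⟩ : ∃ e, y = x + e := ⟨y - x, by abel⟩
  rw [hb _ hy, hb _ hx, hb _ hm]
  simp only [add_sub_cancel_left, map_add, map_smul, add_apply,
    smul_apply]
  module

/-- The extrapolation formula is squared and averaged over `x` in `K` with `y` fixed. The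
homotheties cost at most `2 ^ N`, and `400 = 36 + 256 + 108` is the sum of the coefficients. No
reference element is involved. -/
lemma quadratic_sup_le (hKm : MeasurableSet K) (hK : Convex ℝ K)
    (hb : ∀ x ∈ K, b x = c + A x + B x x) {y : Pt N} (hy : y ∈ K) :
    ‖b y‖ₑ ^ 2 * volume K ≤ 400 * 2 ^ N * ∫⁻ x in K, ‖b x‖ₑ ^ 2 := by
  set q : Pt N → Pt N := fun x => c + A x + B x x with hq
  have hqc : Continuous q := by fun_prop
  have hqm : Measurable (fun x => ‖q x‖ₑ ^ 2) := (measurable_enorm_of_continuous hqc).pow_const 2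
  have hm : ∀ t : ℝ, 0 ≤ t → t ≤ 1 → ∀ x ∈ K, x + t • (y - x) ∈ K := fun t h0 h1 x hx => by
    have := hK hx hy (sub_nonneg.2 h1) h0 (by ring)
    convert this using 1; module
  have hI : ∀ t : ℝ, 0 ≤ t → t ≤ 1 / 2 →
      ∫⁻ x in K, ‖q (x + t • (y - x))‖ₑ ^ 2 ≤ 2 ^ N * ∫⁻ x in K, ‖q x‖ₑ ^ 2 := by
    intro t h0 h1
    have e : ∀ x : Pt N, x + t • (y - x) = y + (1 - t) • (x - y) := fun x => by module
    simp only [e]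
    refine (setLIntegral_comp_homothety_le y (s := 1 - t) (by linarith) hKm hKm
      (fun x hx => e x ▸ hm t h0 (by linarith) x hx) (fun x => ‖q x‖ₑ ^ 2)).trans ?_
    gcongr
    rw [← ENNReal.ofReal_ofNat, ← ENNReal.ofReal_pow (by norm_num)]
    refine ENNReal.ofReal_le_ofReal ?_
    have : (1 / 2 : ℝ) ≤ 1 - t := by linarith
    rw [inv_le_comm₀ (by positivity) (by positivity), ← inv_pow]
    gcongr
    linarith
  have hpt : ∀ x ∈ K, ‖b y‖ₑ ^ 2 ≤ 36 * ‖q (x + (0 : ℝ) • (y - x))‖ₑ ^ 2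
      + (256 * ‖q (x + (1 / 4 : ℝ) • (y - x))‖ₑ ^ 2
        + 108 * ‖q (x + (1 / 2 : ℝ) • (y - x))‖ₑ ^ 2) := by
    intro x hx
    have e := quadratic_extrapolate hK hb hx hy
    rw [hb x hx, hb _ (hm _ (by norm_num) (by norm_num) x hx),
      hb _ (hm _ (by norm_num) (by norm_num) x hx)] at e
    have h1 : ‖b y‖ ^ 2 ≤ 36 * ‖q (x + (0 : ℝ) • (y - x))‖ ^ 2
        + (256 * ‖q (x + (1 / 4 : ℝ) • (y - x))‖ ^ 2
          + 108 * ‖q (x + (1 / 2 : ℝ) • (y - x))‖ ^ 2) := by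
      rw [zero_smul, add_zero, e]
      have h2 : ‖(3 : ℝ) • q x - (8 : ℝ) • q (x + (1 / 4 : ℝ) • (y - x))
          + (6 : ℝ) • q (x + (1 / 2 : ℝ) • (y - x))‖ ≤ 3 * ‖q x‖
            + 8 * ‖q (x + (1 / 4 : ℝ) • (y - x))‖ + 6 * ‖q (x + (1 / 2 : ℝ) • (y - x))‖ := by
        refine (norm_add_le _ _).trans (add_le_add ((norm_sub_le _ _).trans ?_) ?_)
        · simp [norm_smul]
        · simp [norm_smul]
      refine (pow_le_pow_left₀ (norm_nonneg _) h2 2).trans ?_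
      nlinarith [sq_nonneg (3 * ‖q x‖ - 8 * ‖q (x + (1 / 4 : ℝ) • (y - x))‖),
        sq_nonneg (3 * ‖q x‖ - 6 * ‖q (x + (1 / 2 : ℝ) • (y - x))‖),
        sq_nonneg (8 * ‖q (x + (1 / 4 : ℝ) • (y - x))‖ - 6 * ‖q (x + (1 / 2 : ℝ) • (y - x))‖),
        sq_nonneg ‖q x‖, sq_nonneg ‖q (x + (1 / 4 : ℝ) • (y - x))‖]
    have h3 := ENNReal.ofReal_le_ofReal h1
    rw [ENNReal.ofReal_add (by positivity) (by positivity),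
      ENNReal.ofReal_add (by positivity) (by positivity), ENNReal.ofReal_mul (by norm_num),
      ENNReal.ofReal_mul (by norm_num), ENNReal.ofReal_mul (by norm_num)] at h3
    simpa only [ENNReal.ofReal_pow (norm_nonneg _), ofReal_norm, ENNReal.ofReal_ofNat] using h3
  have hmt : ∀ t : ℝ, Measurable (fun x => ‖q (x + t • (y - x))‖ₑ ^ 2) := fun t => by
    have : Measurable (fun x : Pt N => x + t • (y - x)) := by fun_prop
    exact hqm.comp this
  have hqb : ∫⁻ x in K, ‖b x‖ₑ ^ 2 = ∫⁻ x in K, ‖q x‖ₑ ^ 2 :=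
    setLIntegral_congr_fun hKm fun x hx => by rw [hb x hx]
  rw [hqb]
  calc ‖b y‖ₑ ^ 2 * volume K = ∫⁻ _ in K, ‖b y‖ₑ ^ 2 := by rw [setLIntegral_const]
    _ ≤ ∫⁻ x in K, (36 * ‖q (x + (0 : ℝ) • (y - x))‖ₑ ^ 2
      + (256 * ‖q (x + (1 / 4 : ℝ) • (y - x))‖ₑ ^ 2
        + 108 * ‖q (x + (1 / 2 : ℝ) • (y - x))‖ₑ ^ 2)) := setLIntegral_mono' hKm hpt
    _ = 36 * (∫⁻ x in K, ‖q (x + (0 : ℝ) • (y - x))‖ₑ ^ 2)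
      + (256 * (∫⁻ x in K, ‖q (x + (1 / 4 : ℝ) • (y - x))‖ₑ ^ 2)
        + 108 * (∫⁻ x in K, ‖q (x + (1 / 2 : ℝ) • (y - x))‖ₑ ^ 2)) := by
        rw [lintegral_add_left ((hmt _).const_mul _), lintegral_add_left ((hmt _).const_mul _),
          lintegral_const_mul _ (hmt _), lintegral_const_mul _ (hmt _),
          lintegral_const_mul _ (hmt _)]
    _ ≤ 36 * (2 ^ N * ∫⁻ x in K, ‖q x‖ₑ ^ 2) + (256 * (2 ^ N * ∫⁻ x in K, ‖q x‖ₑ ^ 2)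
        + 108 * (2 ^ N * ∫⁻ x in K, ‖q x‖ₑ ^ 2)) :=
        add_le_add (mul_le_mul' le_rfl (hI 0 le_rfl (by norm_num)))
          (add_le_add (mul_le_mul' le_rfl (hI _ (by norm_num) (by norm_num)))
            (mul_le_mul' le_rfl (hI _ (by norm_num) (by norm_num))))
    _ = 400 * 2 ^ N * ∫⁻ x in K, ‖q x‖ₑ ^ 2 := by ring

lemma fderiv_of_quadratic (hb : ∀ x ∈ K, b x = c + A x + B x x) {x : Pt N} (hx : x ∈ interior K)
    (e : Pt N) : fderiv ℝ b x e = A e + B x e + B e x := by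
  have h1 : b =ᶠ[nhds x] fun x => c + A x + B x x := by
    filter_upwards [mem_interior_iff_mem_nhds.1 hx] with y hy using hb y hy
  have h2 : HasFDerivAt (fun x => c + A x + B x x) _ x :=
    (A.hasFDerivAt.const_add c).add (B.hasFDerivAt.clm_apply (hasFDerivAt_id x))
  rw [h1.fderiv_eq, h2.fderiv]
  simp [add_assoc]

/-- The difference formula bounds derivatives in directions `y - x` with `y` in `K` by `8M`. Every
vector of length at most `r` is a difference of two such directions, with end points in the
inscribed ball. -/
lemma norm_fderiv_quadratic_le (hK : Convex ℝ K) (hb : ∀ x ∈ K, b x = c + A x + B x x) {M r : ℝ}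
    (hr : 0 < r) (hM : ∀ x ∈ K, ‖b x‖ ≤ M) {x₀ : Pt N} (hx₀ : Metric.closedBall x₀ r ⊆ K)
    {x : Pt N} (hx : x ∈ interior K) : ‖fderiv ℝ b x‖ ≤ 16 * M / r := by
  have hxK := interior_subset hx
  have hM0 : 0 ≤ M := (norm_nonneg _).trans (hM x hxK)
  have hy : ∀ y ∈ K, ‖fderiv ℝ b x (y - x)‖ ≤ 8 * M := by
    intro y hy
    rw [fderiv_of_quadratic hb hx, quadratic_derivative hK hb hxK hy]
    have hm : x + (1 / 2 : ℝ) • (y - x) ∈ K := by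
      have := hK hxK hy (a := 1 / 2) (b := 1 / 2) (by norm_num) (by norm_num) (by norm_num)
      convert this using 1; module
    refine (norm_sub_le _ _).trans ((add_le_add (norm_sub_le _ _) le_rfl).trans ?_)
    rw [norm_smul, norm_smul]
    norm_num
    linarith [hM _ hm, hM x hxK, hM y hy]
  refine opNorm_le_of_closedBall _ hr (by positivity) fun v hv => ?_
  have h1 := hy (x₀ + v) (hx₀ (by simpa using hv))
  have h2 := hy x₀ (hx₀ (by simpa using hr.le))
  have e : v = (x₀ + v - x) - (x₀ - x) := by abel
  rw [e, map_sub]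
  refine (norm_sub_le _ _).trans ?_
  linarith

end Quadratic

/-- Inverse estimates for piecewise quadratic fields that are small in `L²`. -/
lemma inverse_estimates (hN : N ≤ 3) (hΩ : IsConvexPolyhedralDomain Ω) :
    ∃ C : ℝ≥0∞, C ≠ ∞ ∧ ∀ (𝒯 : Mesh Ω) (ρ r : ℝ), 𝒯.Regular ρ r → ∀ (b : Pt N → Pt N) (K : ℝ≥0∞),
      𝒯.IsQuadratic b → ∫⁻ x in Ω, ‖b x‖ₑ ^ 2 ≤ K * ENNReal.ofReal r ^ 4 →
      (∀ x ∈ closure Ω, ‖b x‖ₑ ^ 2 ≤ C * K) ∧ ∫⁻ x in Ω, ‖fderiv ℝ b x‖ₑ ^ 4 ≤ C * K ^ 2 := by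
  set D : ℝ≥0∞ := ENNReal.ofReal (Metric.diam Ω) with hD
  set β : ℝ≥0∞ := volume (Metric.ball (0 : Pt N) 1) with hβ
  have hβ0 : β ≠ 0 := (Metric.measure_ball_pos _ _ one_pos).ne'
  have hβt : β ≠ ∞ := measure_ball_lt_top.ne
  set C₂ : ℝ≥0∞ := D ^ (4 - N) * β⁻¹ with hC₂
  have hC₂t : C₂ ≠ ∞ := ENNReal.mul_ne_top (by finiteness) (ENNReal.inv_ne_top.2 hβ0)
  set C₀ : ℝ≥0∞ := 400 * 2 ^ N with hC₀
  have hC₀t : C₀ ≠ ∞ := by finiteness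
  refine ⟨C₀ * C₂ + C₂ * 16 ^ 4 * C₀ ^ 2, by finiteness, ?_⟩
  intro 𝒯 ρ r hR b K hb hK
  set τ := ENNReal.ofReal r with hτ
  have hτ0 : τ ≠ 0 := by simpa [hτ] using hR.r_pos
  have hτt : τ ≠ ∞ := ENNReal.ofReal_ne_top
  have hvol : ∀ T ∈ 𝒯.cells, τ ^ 4 ≤ C₂ * volume (convexHull ℝ (T : Set (Pt N))) := by
    intro T hT
    have h := hR.volume_cell_ge hT
    calc τ ^ 4 = τ ^ (4 - N) * τ ^ N := by rw [← pow_add]; congr 1; omega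
      _ = τ ^ (4 - N) * (β⁻¹ * (τ ^ N * β)) := by
          rw [mul_comm (τ ^ N) β, ← mul_assoc β⁻¹, ENNReal.inv_mul_cancel hβ0 hβt, one_mul]
      _ ≤ D ^ (4 - N) * (β⁻¹ * volume (convexHull ℝ (T : Set (Pt N)))) := by
          gcongr
          exact ENNReal.ofReal_le_ofReal hR.r_le
      _ = _ := by rw [hC₂]; ring
  have hsup : ∀ T ∈ 𝒯.cells, ∀ y ∈ convexHull ℝ (T : Set (Pt N)),
      ‖b y‖ₑ ^ 2 * τ ^ 4 ≤ C₂ * (C₀ * ∫⁻ x in convexHull ℝ (T : Set (Pt N)), ‖b x‖ₑ ^ 2) := by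
    intro T hT y hy
    obtain ⟨c, A, B, hq⟩ := hb.exists_form hT
    have h := quadratic_sup_le (measurableSet_cell T) (convex_convexHull ℝ _) hq hy
    calc ‖b y‖ₑ ^ 2 * τ ^ 4 ≤ ‖b y‖ₑ ^ 2 * (C₂ * volume (convexHull ℝ (T : Set (Pt N)))) :=
          mul_le_mul' le_rfl (hvol T hT)
      _ = C₂ * (‖b y‖ₑ ^ 2 * volume (convexHull ℝ (T : Set (Pt N)))) := by ring
      _ ≤ _ := mul_le_mul' le_rfl h
  refine ⟨fun y hy => ?_, ?_⟩
  · obtain ⟨T, hT, hyT⟩ := 𝒯.exists_cell hy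
    have h1 : ∫⁻ x in convexHull ℝ (T : Set (Pt N)), ‖b x‖ₑ ^ 2 ≤ K * τ ^ 4 := by
      refine le_trans ?_ hK
      rw [lintegral_eq_sum_cells hΩ 𝒯]
      exact Finset.single_le_sum
        (f := fun T : Finset (Pt N) => ∫⁻ x in convexHull ℝ (T : Set (Pt N)), ‖b x‖ₑ ^ 2)
        (fun _ _ => zero_le) hT
    have h2 : ‖b y‖ₑ ^ 2 * τ ^ 4 ≤ (C₀ * C₂ * K) * τ ^ 4 := by
      refine (hsup T hT y hyT).trans ((mul_le_mul' le_rfl (mul_le_mul' le_rfl h1)).trans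
        (le_of_eq ?_))
      ring
    have h3 := (ENNReal.mul_le_mul_iff_left (pow_ne_zero 4 hτ0) (by finiteness)).1 h2
    exact h3.trans (mul_le_mul' le_self_add le_rfl)
  · have hcell : ∀ T ∈ 𝒯.cells,
        (∫⁻ x in convexHull ℝ (T : Set (Pt N)), ‖fderiv ℝ b x‖ₑ ^ 4) * τ ^ 8
          ≤ C₂ * 16 ^ 4 * C₀ ^ 2 * (∫⁻ x in convexHull ℝ (T : Set (Pt N)), ‖b x‖ₑ ^ 2) ^ 2 := by
      intro T hT
      obtain ⟨c, A, B, hq⟩ := hb.exists_form hT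
      obtain ⟨x₀, hx₀⟩ := hR.ball T hT
      set Q := convexHull ℝ (T : Set (Pt N)) with hQ
      have hQc : Convex ℝ Q := convex_convexHull ℝ _
      have hcont : ContinuousOn b Q :=
        (hb.isLip hΩ.convex).continuousOn.mono (cell_subset hT)
      have hne : Q.Nonempty := ⟨x₀, hx₀ (by simpa using hR.r_pos.le)⟩
      -- The maximum over the cell is attained, so it may be used in the derivative estimate and
      -- bounded by the `L²` norm in turn.
      obtain ⟨y₀, hy₀, hmax⟩ := (isCompact_cell T).exists_isMaxOn hne hcont.norm
      set m := ‖b y₀‖ₑ with hm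
      have hmv := quadratic_sup_le (measurableSet_cell T) hQc hq hy₀
      rw [← hm, ← hQ, ← hC₀] at hmv
      have hd : ∀ x ∈ interior Q, ‖fderiv ℝ b x‖ₑ * τ ≤ 16 * m := by
        intro x hx
        have h := norm_fderiv_quadratic_le hQc hq hR.r_pos (fun x hx => hmax hx) hx₀ hx
        rw [le_div_iff₀ hR.r_pos] at h
        have h2 := ENNReal.ofReal_le_ofReal h
        rwa [ENNReal.ofReal_mul (norm_nonneg _), ENNReal.ofReal_mul (by norm_num), ofReal_norm,
          ofReal_norm, ENNReal.ofReal_ofNat] at h2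
      have hi : (∫⁻ x in Q, ‖fderiv ℝ b x‖ₑ ^ 4) * τ ^ 4 ≤ (16 * m) ^ 4 * volume Q := by
        rw [← setLIntegral_const, ← lintegral_mul_const' _ _ (by finiteness)]
        refine lintegral_cell_mono fun x hx => ?_
        rw [← mul_pow]
        exact pow_le_pow_left' (hd x hx) 4
      calc (∫⁻ x in Q, ‖fderiv ℝ b x‖ₑ ^ 4) * τ ^ 8
          = (∫⁻ x in Q, ‖fderiv ℝ b x‖ₑ ^ 4) * τ ^ 4 * τ ^ 4 := by ring
        _ ≤ ((16 * m) ^ 4 * volume Q) * (C₂ * volume Q) := mul_le_mul' hi (hvol T hT)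
        _ = C₂ * 16 ^ 4 * (m ^ 2 * volume Q) ^ 2 := by ring
        _ ≤ C₂ * 16 ^ 4 * (C₀ * ∫⁻ x in Q, ‖b x‖ₑ ^ 2) ^ 2 :=
            mul_le_mul' le_rfl (pow_le_pow_left' hmv 2)
        _ = _ := by ring
    have hsum : (∫⁻ x in Ω, ‖fderiv ℝ b x‖ₑ ^ 4) * τ ^ 8 ≤ (C₂ * 16 ^ 4 * C₀ ^ 2 * K ^ 2) * τ ^ 8 := by
      rw [lintegral_eq_sum_cells hΩ 𝒯, Finset.sum_mul]
      refine (Finset.sum_le_sum hcell).trans ?_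
      rw [← Finset.mul_sum]
      calc _ ≤ C₂ * 16 ^ 4 * C₀ ^ 2 * (∑ T ∈ 𝒯.cells,
            ∫⁻ x in convexHull ℝ (T : Set (Pt N)), ‖b x‖ₑ ^ 2) ^ 2 :=
            mul_le_mul' le_rfl (ennreal_sum_sq_le_sq _ _)
        _ ≤ C₂ * 16 ^ 4 * C₀ ^ 2 * (K * τ ^ 4) ^ 2 := by
            rw [← lintegral_eq_sum_cells hΩ 𝒯]
            exact mul_le_mul' le_rfl (pow_le_pow_left' hK 2)
        _ = _ := by ring
    have h3 := (ENNReal.mul_le_mul_iff_left (pow_ne_zero 8 hτ0) (by finiteness)).1 hsum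
    exact h3.trans (mul_le_mul' le_add_self le_rfl)

end Mesh

/-! ### Duality of the divergence and the gradient -/

section Duality

variable {N : ℕ} {Ω : Set (Pt N)}

/-- Discrete incompressibility becomes orthogonality to gradients of discrete pressures. In this
form it makes sense for `w` as well, which has only a weak gradient. -/
lemma integral_divergence_mul (hΩ : IsConvexPolyhedralDomain Ω) {u : Pt N → Pt N} {q : Pt N → ℝ}
    (hu : IsLip Ω u) (hq : IsLip Ω q) (h0 : ∀ x ∈ frontier Ω, u x = 0) :
    ∫ x in Ω, divergence u x * q x = - ∫ x in Ω, fderiv ℝ q x (u x) := by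
  have hui : ∀ i, IsLip Ω (fun x => u x i) := fun i => hu.clm_comp (EuclideanSpace.proj i)
  have h1 : ∀ i, ∫ x in Ω, fderiv ℝ (fun x => u x i) x (unit i) * q x
      = - ∫ x in Ω, u x i * fderiv ℝ q x (unit i) := fun i =>
    integral_fderiv_mul hΩ (hui i) hq (fun x hx => by simp [h0 x hx]) (unit i)
  have h2 : ∫ x in Ω, divergence u x * q x
      = ∑ i, ∫ x in Ω, fderiv ℝ (fun x => u x i) x (unit i) * q x := by
    rw [← integral_finsetSum]
    · refine integral_congr_ae ?_
      filter_upwards [hu.ae_differentiableAt hΩ] with x hx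
      rw [divergence, Finset.sum_mul]
      refine Finset.sum_congr rfl fun i _ => ?_
      have : fderiv ℝ (fun x => u x i) x = (EuclideanSpace.proj i).comp (fderiv ℝ u x) :=
        ((EuclideanSpace.proj (𝕜 := ℝ) i).hasFDerivAt.comp x hx.hasFDerivAt).fderiv
      rw [this]; rfl
    · exact fun i _ => ((((hui i).bm_fderiv hΩ).apply (bm_const _)).mul (hq.bm hΩ)).integrable hΩ
  have h3 : ∑ i, ∫ x in Ω, u x i * fderiv ℝ q x (unit i) = ∫ x in Ω, fderiv ℝ q x (u x) := by
    rw [← integral_finsetSum]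
    · refine integral_congr_ae (.of_forall fun x => ?_)
      change _ = fderiv ℝ q x (u x)
      conv_rhs => rw [sum_smul_unit (u x), map_sum]
      simp
    · exact fun i _ => (((hui i).bm hΩ).mul ((hq.bm_fderiv hΩ).apply (bm_const _))).integrable hΩ
  rw [h2, Finset.sum_congr rfl fun i _ => h1 i, Finset.sum_neg_distrib, h3]

/-- Functions in `H¹_{0,σ}` are orthogonal to gradients. -/
lemma MemH10Sigma.integral_fderiv_eq_zero (hΩ : IsConvexPolyhedralDomain Ω) {w : Pt N → Pt N}
    (hw : MemH10Sigma Ω w) {q : Pt N → ℝ} (hq : IsLip Ω q) :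
    ∫ x in Ω, fderiv ℝ q x (w x) = 0 := by
  obtain ⟨G, hG, happ⟩ := hw
  have : IsFiniteMeasure (volume.restrict Ω) :=
    ⟨by rw [Measure.restrict_apply_univ]; exact hΩ.bounded.measure_lt_top⟩
  have hqb := hq.bm_fderiv hΩ
  obtain ⟨hm, M, hM0, hM⟩ := hqb
  set V : ℝ≥0∞ := volume Ω ^ (1 / 2 : ℝ) with hV
  have hVtop : V ≠ ∞ := ENNReal.rpow_ne_top_of_nonneg (by norm_num) hΩ.bounded.measure_lt_top.ne
  rw [← enorm_eq_zero]
  refine le_antisymm (le_of_forall_gt fun η hη => ?_) zero_le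
  have hMV : ENNReal.ofReal M * V ≠ ∞ := ENNReal.mul_ne_top ENNReal.ofReal_ne_top hVtop
  obtain ⟨ε, hε0, hε⟩ : ∃ ε : ℝ≥0∞, 0 < ε ∧ ENNReal.ofReal M * V * ε < η := by
    obtain ⟨η', h0, h1⟩ := exists_between hη
    obtain ⟨t, ht0, -, ht⟩ := exists_pos_mul_le hMV h0.ne'
    exact ⟨ENNReal.ofReal t, ENNReal.ofReal_pos.2 ht0, ht.trans_lt h1⟩
  obtain ⟨φ, ⟨hφs, hφc, hφt⟩, hdiv, hφ, -⟩ := happ ε hε0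
  have hφlip : IsLip Ω φ := by
    obtain ⟨K, hK⟩ := hφs.lipschitzWith_of_hasCompactSupport hφc (by simp)
    exact ⟨K, hK.lipschitzOnWith⟩
  have hφ0 : ∀ x ∈ frontier Ω, φ x = 0 := fun x hx => by
    refine image_eq_zero_of_notMem_tsupport fun h => ?_
    rw [hΩ.isOpen.frontier_eq] at hx
    exact hx.2 (hφt h)
  have h1 : ∫ x in Ω, fderiv ℝ q x (φ x) = 0 := by
    have := integral_divergence_mul hΩ hφlip hq hφ0
    simp only [hdiv, zero_mul, integral_zero] at this
    linarith
  have hwi : Integrable (fun x => fderiv ℝ q x (w x)) (volume.restrict Ω) := by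
    refine Integrable.mono' ((hG.1.integrable one_le_two).norm.const_mul M)
      (ContinuousLinearMap.aestronglyMeasurable_comp₂ (ContinuousLinearMap.id ℝ _) hm hG.1.1) ?_
    filter_upwards [ae_restrict_mem hΩ.isOpen.measurableSet] with x hx
    exact (ContinuousLinearMap.le_opNorm _ _).trans (by gcongr; exact hM x hx)
  have hφi : Integrable (fun x => fderiv ℝ q x (φ x)) (volume.restrict Ω) :=
    ((hq.bm_fderiv hΩ).apply (hφlip.bm hΩ)).integrable hΩ
  -- The identity holds for solenoidal test functions; the gradient of `q` is bounded, so the error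
  -- is controlled by the `L¹` distance from `φ` to `w`.
  have h2 : ∫ x in Ω, fderiv ℝ q x (w x) = - ∫ x in Ω, fderiv ℝ q x (φ x - w x) := by
    simp only [map_sub]
    rw [integral_sub hφi hwi, h1]; ring
  rw [h2, enorm_neg]
  refine lt_of_le_of_lt ?_ hε
  refine (enorm_integral_le_lintegral_enorm _).trans ?_
  have h3 : eLpNorm (fun x => φ x - w x) 1 (volume.restrict Ω) ≤ ε * V := by
    refine (eLpNorm_le_eLpNorm_mul_rpow_measure_univ one_le_two
      ((hφlip.bm hΩ).1.sub hG.1.1)).trans ?_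
    rw [Measure.restrict_apply_univ]
    refine mul_le_mul' hφ.le (le_of_eq ?_)
    rw [hV]; congr 1; norm_num
  rw [eLpNorm_one_eq_lintegral_enorm] at h3
  calc ∫⁻ x in Ω, ‖fderiv ℝ q x (φ x - w x)‖ₑ
      ≤ ∫⁻ x in Ω, ENNReal.ofReal M * ‖φ x - w x‖ₑ := by
        refine setLIntegral_mono_ae' hΩ.isOpen.measurableSet (.of_forall fun x hx => ?_)
        refine ((fderiv ℝ q x).le_opENorm _).trans ?_
        gcongr
        rw [← ofReal_norm]
        exact ENNReal.ofReal_le_ofReal (hM x hx)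
    _ = ENNReal.ofReal M * ∫⁻ x in Ω, ‖φ x - w x‖ₑ :=
        lintegral_const_mul' _ _ ENNReal.ofReal_ne_top
    _ ≤ ENNReal.ofReal M * (ε * V) := mul_le_mul' le_rfl h3
    _ = _ := by ring

end Duality

/-! ### Edge bubbles and the correction of the discrete divergence. -/

namespace Mesh

variable {N : ℕ} {Ω : Set (Pt N)} {𝒯 : Mesh Ω}

lemma hat_mul_hat_mem {p z x : Pt N} {T : Finset (Pt N)} (hT : T ∈ 𝒯.cells)
    (hx : x ∈ convexHull ℝ (T : Set (Pt N))) (h : 𝒯.hat p x * 𝒯.hat z x ≠ 0) : p ∈ T ∧ z ∈ T := by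
  have hs := hat_spec hT hx
  constructor <;> by_contra hn <;> exact h (by simp [hs.2.1 _ hn])

/-- On the support of an edge bubble, the derivative of an affine function along the edge is the
difference of the values at its end points. -/
lemma hat_mul_hat_mul_fderiv (hΩ : IsConvexPolyhedralDomain Ω) {q : Pt N → ℝ}
    (hq : 𝒯.IsPiecewisePoly 1 q) (p z : Pt N) :
    ∀ᵐ x ∂(volume.restrict Ω), 𝒯.hat p x * 𝒯.hat z x * fderiv ℝ q x (z - p)
      = 𝒯.hat p x * 𝒯.hat z x * (q z - q p) := by
  rw [restrict_eq_sum_cells hΩ 𝒯, ae_finsetSum_measure_iff]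
  intro T hT
  filter_upwards [ae_cell_interior (T := T)] with x hx
  by_cases h : 𝒯.hat p x * 𝒯.hat z x = 0
  · rw [h, zero_mul, zero_mul]
  obtain ⟨hp, hz⟩ := hat_mul_hat_mem hT (interior_subset hx) h
  obtain ⟨P, hP, e⟩ := hq.2 T hT
  obtain ⟨c, A, hA⟩ := eval_affine hP
  have e' : ∀ x ∈ convexHull ℝ (T : Set (Pt N)), q x = c + A x := fun x hx => by rw [e x hx, hA]
  rw [fderiv_of_affine e' hx, e' z (vertex_mem hz), e' p (vertex_mem hp), map_sub]
  ring

open Classical in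
/-- A combination of edge bubbles, the edges of a cell `T` emanating from the vertex `p T`. -/
def bubble (𝒯 : Mesh Ω) (p : Finset (Pt N) → Pt N) (α : Finset (Pt N) → Pt N → ℝ) (x : Pt N) :
    Pt N :=
  ∑ T ∈ 𝒯.cells, ∑ z ∈ T.erase (p T), (α T z * (𝒯.hat (p T) x * 𝒯.hat z x)) • (z - p T)

variable {p : Finset (Pt N) → Pt N} {α : Finset (Pt N) → Pt N → ℝ}

lemma isQuadratic_bubble : 𝒯.IsQuadratic (𝒯.bubble p α) := fun i => by
  have e : (fun x => 𝒯.bubble p α x i) = fun x => ∑ T ∈ 𝒯.cells, ∑ z ∈ T.erase (p T),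
      (α T z * (z - p T) i) * (𝒯.hat (p T) x * 𝒯.hat z x) := by
    funext x
    simp only [bubble, WithLp.ofLp_sum, Finset.sum_apply, PiLp.smul_apply, smul_eq_mul]
    refine Finset.sum_congr rfl fun T _ => Finset.sum_congr rfl fun z _ => by ring
  rw [e]
  exact isPiecewisePoly_sum _ fun T _ => isPiecewisePoly_sum _ fun z _ =>
    ((isPiecewisePoly_hat _).mul (isPiecewisePoly_hat _)).const_mul _

/-- Every summand contains the shape function of the interior node `p T`. This is where it matters
that each cell has a vertex inside the domain. -/
lemma bubble_frontier (hΩ : IsConvexPolyhedralDomain Ω) (hp : ∀ T ∈ 𝒯.cells, p T ∈ Ω) {x : Pt N}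
    (hx : x ∈ frontier Ω) : 𝒯.bubble p α x = 0 :=
  Finset.sum_eq_zero fun T hT => Finset.sum_eq_zero fun z _ => by
    rw [hat_eq_zero_of_frontier hΩ hx (hp T hT)]; simp

lemma bm_hat_mul_hat (hΩ : IsConvexPolyhedralDomain Ω) (p z : Pt N) :
    BM Ω (fun x => 𝒯.hat p x * 𝒯.hat z x) :=
  ((isLip_hat hΩ.convex p).bm hΩ).mul ((isLip_hat hΩ.convex z).bm hΩ)

-- A bubble pairs with a gradient only through the difference of `q` along its edge, also on the
-- neighbouring cells that share the edge. The pairing is therefore diagonal in these differences.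
open Classical in
lemma integral_fderiv_bubble (hΩ : IsConvexPolyhedralDomain Ω) {q : Pt N → ℝ}
    (hq : 𝒯.IsPiecewisePoly 1 q) :
    ∫ x in Ω, fderiv ℝ q x (𝒯.bubble p α x) = ∑ T ∈ 𝒯.cells, ∑ z ∈ T.erase (p T),
      α T z * (∫ x in Ω, 𝒯.hat (p T) x * 𝒯.hat z x) * (q z - q (p T)) := by
  have hlip := hq.isLip hΩ.convex one_le_two
  have hb : ∀ p z : Pt N, BM Ω (fun x => 𝒯.hat p x * 𝒯.hat z x * fderiv ℝ q x (z - p)) :=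
    fun p z => (bm_hat_mul_hat hΩ p z).mul ((hlip.bm_fderiv hΩ).apply (bm_const _))
  have e : ∀ x, fderiv ℝ q x (𝒯.bubble p α x) = ∑ T ∈ 𝒯.cells, ∑ z ∈ T.erase (p T),
      α T z * (𝒯.hat (p T) x * 𝒯.hat z x * fderiv ℝ q x (z - p T)) := fun x => by
    simp only [bubble, map_sum, map_smul, smul_eq_mul, mul_assoc]
  simp_rw [e]
  rw [integral_finsetSum _ fun T _ => integrable_finsetSum _ fun z _ =>
    ((hb _ _).integrable hΩ).const_mul _]
  refine Finset.sum_congr rfl fun T _ => ?_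
  rw [integral_finsetSum _ fun z _ => ((hb _ _).integrable hΩ).const_mul _]
  refine Finset.sum_congr rfl fun z _ => ?_
  rw [integral_const_mul, integral_congr_ae (hat_mul_hat_mul_fderiv hΩ hq (p T) z),
    integral_mul_const]
  ring

open Classical in
/-- The gradient of a piecewise affine function, tested with an arbitrary vector field. -/
lemma integral_fderiv_affine (hΩ : IsConvexPolyhedralDomain Ω) {A : Finset (Pt N) → Pt N → Pt N →L[ℝ] ℝ}
    {c : Finset (Pt N) → Pt N → ℝ} (hA : ∀ T ∈ 𝒯.cells, ∀ z, ∀ x ∈ convexHull ℝ (T : Set (Pt N)),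
      𝒯.hat z x = c T z + A T z x) {q : Pt N → ℝ}
    (hq : 𝒯.IsPiecewisePoly 1 q) {e : Pt N → Pt N} (he : IntegrableOn e Ω) :
    ∫ x in Ω, fderiv ℝ q x (e x) = ∑ T ∈ 𝒯.cells, ∑ z ∈ T.erase (p T),
      (∫ x in convexHull ℝ (T : Set (Pt N)), A T z (e x)) * (q z - q (p T)) := by
  have hlip := hq.isLip hΩ.convex one_le_two
  obtain ⟨hm, M, -, hM⟩ := hlip.bm_fderiv hΩ
  have hint : IntegrableOn (fun x => fderiv ℝ q x (e x)) Ω := by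
    refine Integrable.mono' (he.norm.const_mul M)
      (ContinuousLinearMap.aestronglyMeasurable_comp₂ (ContinuousLinearMap.id ℝ _) hm he.1) ?_
    filter_upwards [ae_restrict_mem hΩ.isOpen.measurableSet] with x hx
    exact (ContinuousLinearMap.le_opNorm _ _).trans (by gcongr; exact hM x hx)
  rw [integral_eq_sum_cells hΩ 𝒯 hint]
  refine Finset.sum_congr rfl fun T hT => ?_
  have heT := integrableOn_cell hΩ he hT
  -- Since the shape functions sum to one, `q` is expressed on the cell by its differences along the
  -- edges leaving `p T`, the same quantities that appear for the bubbles.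
  have e1 : ∀ x ∈ convexHull ℝ (T : Set (Pt N)),
      q x = (q (p T) + ∑ z ∈ T, c T z * (q z - q (p T)))
        + (∑ z ∈ T, (q z - q (p T)) • A T z) x := fun x hx => by
    rw [← hq.eq_interp (cell_subset hT hx), interp_eq hT hx]
    have h1 : q (p T) = ∑ z ∈ T, 𝒯.hat z x * q (p T) := by
      rw [← Finset.sum_mul, (hat_spec hT hx).2.2.1, one_mul]
    have h2 : ∑ z ∈ T, 𝒯.hat z x * (q z - q (p T)) = ∑ z ∈ T, c T z * (q z - q (p T))
        + (∑ z ∈ T, (q z - q (p T)) • A T z) x := by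
      rw [sum_apply, ← Finset.sum_add_distrib]
      refine Finset.sum_congr rfl fun z _ => ?_
      rw [hA T hT z x hx, smul_apply, smul_eq_mul]; ring
    rw [add_assoc, ← h2]
    simp only [mul_sub, Finset.sum_sub_distrib, smul_eq_mul]
    rw [← h1]; ring
  have e2 : ∫ x in convexHull ℝ (T : Set (Pt N)), fderiv ℝ q x (e x)
      = ∫ x in convexHull ℝ (T : Set (Pt N)), ∑ z ∈ T, A T z (e x) * (q z - q (p T)) := by
    refine integral_congr_ae ?_
    filter_upwards [ae_cell_interior (T := T)] with x hx
    rw [fderiv_of_affine e1 hx, sum_apply]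
    refine Finset.sum_congr rfl fun z _ => ?_
    rw [smul_apply, smul_eq_mul, mul_comm]
  rw [e2, integral_finsetSum _ fun z _ => ((A T z).integrable_comp heT).mul_const _,
    ← Finset.sum_erase _ (a := p T) (by simp)]
  exact Finset.sum_congr rfl fun z _ => integral_mul_const _ _

end Mesh

/-- Averaging over balls of radius `R` is bounded in `L²`. -/
lemma lintegral_sq_lintegral_closedBall_le {N : ℕ} {Ω : Set (Pt N)} {g : Pt N → ℝ≥0∞}
    (hg : AEMeasurable g (volume.restrict Ω)) (R : ℝ) :
    ∫⁻ x in Ω, (∫⁻ y in Ω, (Metric.closedBall x R).indicator 1 y * g y) ^ 2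
      ≤ volume (Metric.closedBall (0 : Pt N) R) ^ 2 * ∫⁻ x in Ω, g x ^ 2 := by
  set V := volume (Metric.closedBall (0 : Pt N) R) with hV
  have hvol : ∀ x : Pt N, ∫⁻ y in Ω, (Metric.closedBall x R).indicator (1 : Pt N → ℝ≥0∞) y ≤ V :=
    fun x => by
      rw [lintegral_indicator_one Metric.isClosed_closedBall.measurableSet,
        Measure.restrict_apply Metric.isClosed_closedBall.measurableSet, hV,
        ← Measure.addHaar_closedBall_center volume x]
      exact measure_mono inter_subset_left
  have hsymm : ∀ x y : Pt N, (Metric.closedBall x R).indicator (1 : Pt N → ℝ≥0∞) y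
      = (Metric.closedBall y R).indicator 1 x := fun x y => by
    by_cases h : y ∈ Metric.closedBall x R
    · rw [indicator_of_mem h, indicator_of_mem (Metric.mem_closedBall_comm.1 h)]; rfl
    · rw [indicator_of_notMem h, indicator_of_notMem fun h' => h (Metric.mem_closedBall_comm.1 h')]
  have hS : MeasurableSet {z : Pt N × Pt N | dist z.2 z.1 ≤ R} :=
    (isClosed_le (by fun_prop) continuous_const).measurableSet
  calc ∫⁻ x in Ω, (∫⁻ y in Ω, (Metric.closedBall x R).indicator 1 y * g y) ^ 2
      ≤ ∫⁻ x in Ω, V * ∫⁻ y in Ω, (Metric.closedBall x R).indicator 1 y * g y ^ 2 := by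
        refine lintegral_mono fun x => ?_
        -- Schur's test: the kernel is a symmetric indicator whose integral in either variable is at
        -- most the volume of the ball.
        refine (lintegral_weight_sq_le ?_ hg).trans (mul_le_mul' (hvol x) le_rfl)
        exact (measurable_one.indicator Metric.isClosed_closedBall.measurableSet).aemeasurable
    _ ≤ V * ∫⁻ x in Ω, ∫⁻ y in Ω, (Metric.closedBall x R).indicator 1 y * g y ^ 2 := by
        rw [lintegral_const_mul' _ _ measure_closedBall_lt_top.ne]
    _ = V * ∫⁻ y in Ω, ∫⁻ x in Ω, (Metric.closedBall x R).indicator 1 y * g y ^ 2 := by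
        rw [lintegral_lintegral_swap]
        have h1 : AEMeasurable (fun z : Pt N × Pt N => g z.2 ^ 2)
            ((volume.restrict Ω).prod (volume.restrict Ω)) :=
          (hg.pow_const 2).comp_snd
        refine AEMeasurable.mul ?_ h1
        exact (measurable_one.indicator hS).aemeasurable
    _ ≤ V * ∫⁻ y in Ω, V * g y ^ 2 := by
        refine mul_le_mul' le_rfl (lintegral_mono fun y => ?_)
        simp_rw [hsymm _ y]
        rw [lintegral_mul_const _
          (measurable_one.indicator Metric.isClosed_closedBall.measurableSet)]
        exact mul_le_mul' (hvol y) le_rfl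
    _ = V ^ 2 * ∫⁻ x in Ω, g x ^ 2 := by
        rw [lintegral_const_mul' _ _ measure_closedBall_lt_top.ne]; ring

namespace Mesh

variable {N : ℕ} {Ω : Set (Pt N)} {𝒯 : Mesh Ω} {ρ r : ℝ}

lemma Regular.norm_gradient_hat_le (hR : 𝒯.Regular ρ r) {T : Finset (Pt N)} (hT : T ∈ 𝒯.cells)
    {z : Pt N} {c : ℝ} {A : Pt N →L[ℝ] ℝ}
    (hA : ∀ x ∈ convexHull ℝ (T : Set (Pt N)), 𝒯.hat z x = c + A x) : ‖A‖ ≤ 1 / r := by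
  obtain ⟨y, hy⟩ := hR.ball T hT
  refine opNorm_le_of_closedBall A hR.r_pos zero_le_one fun v hv => ?_
  have h1 : y + v ∈ convexHull ℝ (T : Set (Pt N)) := hy (by simpa using hv)
  have h2 : y ∈ convexHull ℝ (T : Set (Pt N)) := hy (by simpa using hR.r_pos.le)
  have e : A v = 𝒯.hat z (y + v) - 𝒯.hat z y := by rw [hA _ h1, hA _ h2, map_add]; ring
  have := hat_le_one (𝒯 := 𝒯) z (cell_subset hT h1)
  have := hat_le_one (𝒯 := 𝒯) z (cell_subset hT h2)
  have := (hat_spec hT h1).1 z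
  have := (hat_spec hT h2).1 z
  rw [e, Real.norm_eq_abs, abs_le]
  constructor <;> linarith

/-- Both factors are bounded below on half of the inscribed ball of one cell, and the product is
nonnegative elsewhere. -/
lemma Regular.integral_hat_mul_hat_ge (hΩ : IsConvexPolyhedralDomain Ω) (hR : 𝒯.Regular ρ r)
    {T : Finset (Pt N)} (hT : T ∈ 𝒯.cells) {p z : Pt N} (hp : p ∈ T) (hz : z ∈ T) :
    (ρ / (2 * (ρ + 2))) ^ 2 * ((r / 2) ^ N * volume.real (Metric.ball (0 : Pt N) 1))
      ≤ ∫ x in Ω, 𝒯.hat p x * 𝒯.hat z x := by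
  have hρ := hR.ρ_pos
  have hint := (bm_hat_mul_hat (𝒯 := 𝒯) hΩ p z).integrable hΩ
  have hintT := integrableOn_cell hΩ hint hT
  have h0 : ∀ T ∈ 𝒯.cells, ∀ x ∈ convexHull ℝ (T : Set (Pt N)), 0 ≤ 𝒯.hat p x * 𝒯.hat z x :=
    fun T hT x hx => mul_nonneg ((hat_spec hT hx).1 p) ((hat_spec hT hx).1 z)
  obtain ⟨c, hc⟩ := hR.ball T hT
  have hsub : Metric.closedBall c (r / 2) ⊆ convexHull ℝ (T : Set (Pt N)) :=
    (Metric.closedBall_subset_closedBall (by linarith [hR.r_pos])).trans hc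
  have hvol : volume.real (Metric.closedBall c (r / 2))
      = (r / 2) ^ N * volume.real (Metric.ball (0 : Pt N) 1) := by
    rw [Measure.real, Measure.addHaar_closedBall _ _ (by linarith [hR.r_pos]),
      finrank_euclideanSpace_fin, ENNReal.toReal_mul,
      ENNReal.toReal_ofReal (pow_nonneg (by linarith [hR.r_pos]) _)]
    rfl
  rw [integral_eq_sum_cells hΩ 𝒯 hint, ← hvol]
  refine le_trans ?_ (Finset.single_le_sum
    (f := fun T : Finset (Pt N) => ∫ x in convexHull ℝ (T : Set (Pt N)), 𝒯.hat p x * 𝒯.hat z x)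
    (fun T hT => setIntegral_nonneg (measurableSet_cell T) (h0 T hT)) hT)
  refine le_trans ?_ (setIntegral_mono_set hintT
    ((ae_restrict_iff' (measurableSet_cell T)).2 (.of_forall (h0 T hT)))
    (LE.le.eventuallyLE hsub))
  refine setIntegral_ge_of_const_le_real Metric.isClosed_closedBall.measurableSet
    measure_closedBall_lt_top.ne (fun x hx => ?_) (hintT.mono_set hsub)
  rw [sq]
  have h1 := hR.hat_ge hT hc hp hx
  have h2 := hR.hat_ge hT hc hz hx
  have h3 : 0 ≤ ρ / (2 * (ρ + 2)) := by positivity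
  exact mul_le_mul h1 h2 h3 (h3.trans h1)

/-- The bubbles of `T` are felt at `x` only if a cell containing `x` has the vertex `p T`; then `T`
lies within distance `4r/ρ` of `x`. Each cell contributes `N` edges. The bound avoids counting the
cells around a vertex. -/
lemma Regular.enorm_bubble_le (hΩ : IsConvexPolyhedralDomain Ω) (hR : 𝒯.Regular ρ r)
    {p : Finset (Pt N) → Pt N} {α : Finset (Pt N) → Pt N → ℝ} (hp : ∀ T ∈ 𝒯.cells, p T ∈ T)
    {K : ℝ≥0∞} {g : Pt N → ℝ≥0∞} (hα : ∀ T ∈ 𝒯.cells, ∀ z ∈ T,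
      ‖α T z‖ₑ * ‖z - p T‖ₑ ≤ K * ∫⁻ x in convexHull ℝ (T : Set (Pt N)), g x)
    {x : Pt N} (hx : x ∈ Ω) :
    ‖𝒯.bubble p α x‖ₑ
      ≤ N * K * ∫⁻ y in Ω, (Metric.closedBall x (4 / ρ * r)).indicator 1 y * g y := by
  classical
  have hxc := subset_closure hx
  rw [lintegral_eq_sum_cells hΩ 𝒯, Finset.mul_sum]
  refine (enorm_sum_le _ _).trans (Finset.sum_le_sum fun T hT => ?_)
  by_cases h0 : 𝒯.hat (p T) x = 0
  · refine le_trans (le_of_eq ?_) zero_le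
    simp [h0]
  have hball : convexHull ℝ (T : Set (Pt N)) ⊆ Metric.closedBall x (4 / ρ * r) := fun y hy => by
    obtain ⟨S, hS, hxS⟩ := 𝒯.exists_cell hxc
    have hpS : p T ∈ S := by
      by_contra hn
      exact h0 ((hat_spec hS hxS).2.1 _ hn)
    have h1 := hR.dist_le T hT y hy (p T) (vertex_mem (hp T hT))
    have h2 := hR.dist_le S hS (p T) (vertex_mem hpS) x hxS
    refine (dist_triangle y (p T) x).trans ((add_le_add h1 h2).trans (le_of_eq ?_))
    ring
  have e : ∫⁻ y in convexHull ℝ (T : Set (Pt N)),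
      (Metric.closedBall x (4 / ρ * r)).indicator 1 y * g y
      = ∫⁻ y in convexHull ℝ (T : Set (Pt N)), g y :=
    setLIntegral_congr_fun (measurableSet_cell T) fun y hy => by simp [hball hy]
  have hcard : ((T.erase (p T)).card : ℝ≥0∞) = N := by
    rw [Finset.card_erase_of_mem (hp T hT), 𝒯.card_cell T hT, Nat.add_sub_cancel]
  rw [e]
  refine (enorm_sum_le _ _).trans ?_
  rw [mul_assoc, ← hcard, ← nsmul_eq_mul]
  refine Finset.sum_le_card_nsmul _ _ _ fun z hz => ?_
  refine le_trans ?_ (hα T hT z (Finset.mem_of_mem_erase hz))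
  rw [enorm_smul, enorm_mul, mul_assoc]
  refine mul_le_mul' le_rfl (mul_le_of_le_one_left' ?_)
  rw [← ofReal_norm, ← ENNReal.ofReal_one, norm_mul,
    Real.norm_of_nonneg (hat_nonneg _ hxc), Real.norm_of_nonneg (hat_nonneg _ hxc)]
  exact ENNReal.ofReal_le_ofReal (mul_le_one₀ (hat_le_one _ hxc) (hat_nonneg _ hxc)
    (hat_le_one _ hxc))

/-- A quadratic correction with the same integrals against gradients of piecewise affine functions
as a given vector field. -/
lemma exists_quadratic_correction (hΩ : IsConvexPolyhedralDomain Ω) (hρ : 0 < ρ) :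
    ∃ C : ℝ≥0∞, C ≠ ∞ ∧ ∀ (𝒯 : Mesh Ω) (r : ℝ), 𝒯.Regular ρ r → ∀ e : Pt N → Pt N,
      MemLp e 2 (volume.restrict Ω) → ∃ b : Pt N → Pt N, 𝒯.IsQuadratic b ∧
        (∀ x ∈ frontier Ω, b x = 0) ∧
        (∀ q, 𝒯.IsPiecewisePoly 1 q →
          ∫ x in Ω, fderiv ℝ q x (b x) = ∫ x in Ω, fderiv ℝ q x (e x)) ∧
        ∫⁻ x in Ω, ‖b x‖ₑ ^ 2 ≤ C * ∫⁻ x in Ω, ‖e x‖ₑ ^ 2 := by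
  classical
  set κ : ℝ := ρ / (2 * (ρ + 2)) with hκ
  have hκ0 : 0 < κ := by positivity
  set β : ℝ := volume.real (Metric.ball (0 : Pt N) 1) with hβ
  have hβ0 : 0 < β := ENNReal.toReal_pos (Metric.measure_ball_pos _ _ one_pos).ne'
    measure_ball_lt_top.ne
  refine ⟨(N * ENNReal.ofReal (2 / ρ * (κ ^ 2)⁻¹ * (8 / ρ) ^ N)) ^ 2, by finiteness,
    fun 𝒯 r hR e he => ?_⟩
  have hr := hR.r_pos
  have : IsFiniteMeasure (volume.restrict Ω) :=
    ⟨by rw [Measure.restrict_apply_univ]; exact hΩ.bounded.measure_lt_top⟩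
  have hei : IntegrableOn e Ω := he.integrable one_le_two
  choose! p hp hpΩ using 𝒯.interior_node
  have hex : ∀ T ∈ 𝒯.cells, ∃ (c : Pt N → ℝ) (A : Pt N → Pt N →L[ℝ] ℝ), ∀ z,
      ∀ x ∈ convexHull ℝ (T : Set (Pt N)), 𝒯.hat z x = c z + A z x := fun T hT => by
    choose c A hA using fun z => 𝒯.hat_affine hT z
    exact ⟨c, A, hA⟩
  choose! c A hA using hex
  set m : Finset (Pt N) → Pt N → ℝ := fun T z => ∫ x in Ω, 𝒯.hat (p T) x * 𝒯.hat z x with hm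
  set m₀ : ℝ := κ ^ 2 * ((r / 2) ^ N * β) with hm₀
  have hm₀0 : 0 < m₀ := by positivity
  have hmge : ∀ T ∈ 𝒯.cells, ∀ z ∈ T, m₀ ≤ m T z := fun T hT z hz =>
    hR.integral_hat_mul_hat_ge hΩ hT (hp T hT) hz
  -- The coefficients are read off by comparing the two expansions in the differences `q z - q (p
  -- T)`; no linear system has to be solved.
  set α : Finset (Pt N) → Pt N → ℝ := fun T z =>
    (∫ x in convexHull ℝ (T : Set (Pt N)), A T z (e x)) / m T z with hα
  refine ⟨𝒯.bubble p α, isQuadratic_bubble, fun x hx => bubble_frontier hΩ hpΩ hx,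
    fun q hq => ?_, ?_⟩
  · rw [integral_fderiv_bubble hΩ hq, integral_fderiv_affine hΩ hA hq hei]
    refine Finset.sum_congr rfl fun T hT => Finset.sum_congr rfl fun z hz => ?_
    rw [div_mul_cancel₀]
    exact (hm₀0.trans_le (hmge T hT z (Finset.mem_of_mem_erase hz))).ne'
  set K : ℝ≥0∞ := ENNReal.ofReal (1 / r * m₀⁻¹ * (2 / ρ * r)) with hK
  have hαle : ∀ T ∈ 𝒯.cells, ∀ z ∈ T, ‖α T z‖ₑ * ‖z - p T‖ₑ
      ≤ K * ∫⁻ x in convexHull ℝ (T : Set (Pt N)), ‖e x‖ₑ := by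
    intro T hT z hz
    have h1 : ‖∫ x in convexHull ℝ (T : Set (Pt N)), A T z (e x)‖ₑ
        ≤ ENNReal.ofReal (1 / r) * ∫⁻ x in convexHull ℝ (T : Set (Pt N)), ‖e x‖ₑ := by
      refine (enorm_integral_le_lintegral_enorm _).trans ?_
      rw [← lintegral_const_mul' _ _ ENNReal.ofReal_ne_top]
      refine lintegral_mono fun x => ((A T z).le_opENorm _).trans (mul_le_mul' ?_ le_rfl)
      rw [← ofReal_norm]
      exact ENNReal.ofReal_le_ofReal (hR.norm_gradient_hat_le hT (hA T hT z))
    have h2 : ‖(m T z)⁻¹‖ₑ ≤ ENNReal.ofReal m₀⁻¹ := by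
      have := hmge T hT z hz
      rw [← ofReal_norm, Real.norm_of_nonneg (inv_nonneg.2 (hm₀0.le.trans this))]
      exact ENNReal.ofReal_le_ofReal (inv_anti₀ hm₀0 this)
    have h3 : ‖z - p T‖ₑ ≤ ENNReal.ofReal (2 / ρ * r) := by
      rw [← ofReal_norm, ← dist_eq_norm]
      exact ENNReal.ofReal_le_ofReal
        (hR.dist_le T hT z (vertex_mem hz) _ (vertex_mem (hp T hT)))
    rw [hα]
    simp only
    rw [div_eq_mul_inv, enorm_mul, hK, ENNReal.ofReal_mul (by positivity),
      ENNReal.ofReal_mul (by positivity)]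
    calc _ ≤ ENNReal.ofReal (1 / r) * (∫⁻ x in convexHull ℝ (T : Set (Pt N)), ‖e x‖ₑ)
          * ENNReal.ofReal m₀⁻¹ * ENNReal.ofReal (2 / ρ * r) := by gcongr
      _ = _ := by ring
  -- The powers of `r` cancel: gradients contribute `1/r`, edges `r`, the bubble masses `r^{-N}` and
  -- the averaging ball `r^N`.
  have hKV : K * volume (Metric.closedBall (0 : Pt N) (4 / ρ * r))
      = ENNReal.ofReal (2 / ρ * (κ ^ 2)⁻¹ * (8 / ρ) ^ N) := by
    have e1 : volume (Metric.ball (0 : Pt N) 1) = ENNReal.ofReal β :=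
      (ENNReal.ofReal_toReal measure_ball_lt_top.ne).symm
    rw [Measure.addHaar_closedBall _ _ (by positivity), finrank_euclideanSpace_fin, e1, hK,
      ← ENNReal.ofReal_mul (by positivity), ← ENNReal.ofReal_mul (by positivity)]
    congr 1
    rw [hm₀]
    simp only [mul_pow, div_pow]
    have h8 : (8 : ℝ) ^ N = 4 ^ N * 2 ^ N := by rw [← mul_pow]; norm_num
    rw [h8]
    field_simp
  calc ∫⁻ x in Ω, ‖𝒯.bubble p α x‖ₑ ^ 2
      ≤ ∫⁻ x in Ω, (N * K) ^ 2
        * (∫⁻ y in Ω, (Metric.closedBall x (4 / ρ * r)).indicator 1 y * ‖e y‖ₑ) ^ 2 := by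
        refine setLIntegral_mono_ae' hΩ.isOpen.measurableSet (.of_forall fun x hx => ?_)
        rw [← mul_pow]
        exact pow_le_pow_left' (hR.enorm_bubble_le hΩ hp hαle hx) 2
    _ = (N * K) ^ 2 * ∫⁻ x in Ω,
        (∫⁻ y in Ω, (Metric.closedBall x (4 / ρ * r)).indicator 1 y * ‖e y‖ₑ) ^ 2 :=
        lintegral_const_mul' _ _ (by finiteness)
    _ ≤ (N * K) ^ 2 * (volume (Metric.closedBall (0 : Pt N) (4 / ρ * r)) ^ 2
        * ∫⁻ x in Ω, ‖e x‖ₑ ^ 2) :=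
        mul_le_mul' le_rfl (lintegral_sq_lintegral_closedBall_le he.1.enorm _)
    _ = _ := by rw [← hKV]; ring

end Mesh

/-! ### The `L²` inner product and the `H²` norm. -/

section L2

variable {N : ℕ} {Ω : Set (Pt N)}

lemma lintegral_enorm_sq_eq {α E : Type*} [MeasurableSpace α] {m : Measure α}
    [NormedAddCommGroup E] {f : α → E} (hf : MemLp f 2 m) :
    ∫⁻ x, ‖f x‖ₑ ^ 2 ∂m = ENNReal.ofReal (∫ x, ‖f x‖ ^ 2 ∂m) := by
  rw [ofReal_integral_eq_lintegral_ofReal hf.norm.integrable_sq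
    (.of_forall fun x => by positivity)]
  refine lintegral_congr fun x => ?_
  rw [ENNReal.ofReal_pow (norm_nonneg _), ofReal_norm]

lemma memLp_apply_const {F : Type*} [NormedAddCommGroup F] [NormedSpace ℝ F]
    {α : Type*} [MeasurableSpace α] {m : Measure α} {G : α → Pt N →L[ℝ] F}
    (hG : MemLp G 2 m) (e : Pt N) : MemLp (fun x => G x e) 2 m :=
  (ContinuousLinearMap.apply ℝ F e).comp_memLp' hG

lemma integral_opNorm_sq_le {F : Type*} [NormedAddCommGroup F] [NormedSpace ℝ F]
    {α : Type*} [MeasurableSpace α] {m : Measure α} {G : α → Pt N →L[ℝ] F} (hG : MemLp G 2 m) :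
    ∫ x, ‖G x‖ ^ 2 ∂m ≤ ∑ i, ∫ x, ‖G x (unit i)‖ ^ 2 ∂m := by
  rw [← integral_finsetSum _ fun i _ => (memLp_apply_const hG (unit i)).norm.integrable_sq]
  exact integral_mono hG.norm.integrable_sq
    (integrable_finsetSum _ fun i _ => (memLp_apply_const hG (unit i)).norm.integrable_sq)
    fun x => opNorm_sq_le_sum _

/-- The `H²` norm is made of Frobenius norms, which dominate the operator norms used in the
approximation results. -/
lemma lintegral_sq_le_one_of_h2Norm_le {F : Type*} [NormedAddCommGroup F] [NormedSpace ℝ F]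
    {w : Pt N → F} {G : Pt N → (Pt N →L[ℝ] F)} {H : Pt N → (Pt N →L[ℝ] (Pt N →L[ℝ] F))}
    (hw : HasWeakHessian Ω w G H) (h : h2Norm Ω w G H ≤ 1) :
    ∫⁻ x in Ω, ‖w x‖ₑ ^ 2 ≤ 1 ∧ ∫⁻ x in Ω, ‖G x‖ₑ ^ 2 ≤ 1 ∧ ∫⁻ x in Ω, ‖H x‖ₑ ^ 2 ≤ 1 := by
  obtain ⟨⟨hw2, hG2, -⟩, -, hH2, -⟩ := hw
  have a1 : 0 ≤ ∫ x in Ω, ‖w x‖ ^ 2 := integral_nonneg fun x => by positivity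
  have a2 : 0 ≤ ∑ i, ∫ x in Ω, ‖G x (unit i)‖ ^ 2 :=
    Finset.sum_nonneg fun i _ => integral_nonneg fun x => by positivity
  have a3 : 0 ≤ ∑ i, ∑ j, ∫ x in Ω, ‖H x (unit i) (unit j)‖ ^ 2 :=
    Finset.sum_nonneg fun i _ => Finset.sum_nonneg fun j _ =>
      integral_nonneg fun x => by positivity
  rw [h2Norm, Real.sqrt_le_one] at h
  have b2 := integral_opNorm_sq_le hG2
  have b3 : ∫ x in Ω, ‖H x‖ ^ 2 ≤ ∑ i, ∑ j, ∫ x in Ω, ‖H x (unit i) (unit j)‖ ^ 2 :=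
    (integral_opNorm_sq_le hH2).trans (Finset.sum_le_sum fun i _ =>
      integral_opNorm_sq_le (memLp_apply_const hH2 (unit i)))
  rw [lintegral_enorm_sq_eq hw2, lintegral_enorm_sq_eq hG2, lintegral_enorm_sq_eq hH2]
  refine ⟨?_, ?_, ?_⟩ <;> rw [ENNReal.ofReal_le_one] <;> linarith

variable {V : Type*} [NormedAddCommGroup V] [InnerProductSpace ℝ V]

lemma l2Inner_eq_inner_toLp {f g : Pt N → V} (hf : MemLp f 2 (volume.restrict Ω))
    (hg : MemLp g 2 (volume.restrict Ω)) :
    l2Inner Ω f g = inner ℝ (hf.toLp f) (hg.toLp g) := by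
  rw [L2.inner_def]
  refine integral_congr_ae ?_
  filter_upwards [hf.coeFn_toLp, hg.coeFn_toLp] with x h1 h2
  rw [h1, h2]

lemma integrable_inner_of_memLp {f g : Pt N → V} (hf : MemLp f 2 (volume.restrict Ω))
    (hg : MemLp g 2 (volume.restrict Ω)) :
    Integrable (fun x => (inner ℝ (f x) (g x) : ℝ)) (volume.restrict Ω) := by
  refine (L2.integrable_inner (𝕜 := ℝ) (hf.toLp f) (hg.toLp g)).congr ?_
  filter_upwards [hf.coeFn_toLp, hg.coeFn_toLp] with x h1 h2
  rw [h1, h2]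

lemma l2Inner_sq_le {f g : Pt N → V} (hf : MemLp f 2 (volume.restrict Ω))
    (hg : MemLp g 2 (volume.restrict Ω)) :
    l2Inner Ω f g ^ 2 ≤ l2Inner Ω f f * l2Inner Ω g g := by
  rw [l2Inner_eq_inner_toLp hf hg, l2Inner_eq_inner_toLp hf hf, l2Inner_eq_inner_toLp hg hg, sq]
  exact real_inner_mul_inner_self_le _ _

lemma lintegral_enorm_sq_eq_l2Inner {f : Pt N → V} (hf : MemLp f 2 (volume.restrict Ω)) :
    ∫⁻ x in Ω, ‖f x‖ₑ ^ 2 = ENNReal.ofReal (l2Inner Ω f f) := by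
  rw [lintegral_enorm_sq_eq hf, l2Inner]
  simp only [real_inner_self_eq_norm_sq]

/-- The `L²` projection onto a line. -/
lemma exists_projection_line {f g : Pt N → V} (hf : MemLp f 2 (volume.restrict Ω))
    (hg : MemLp g 2 (volume.restrict Ω)) : ∃ s : ℝ, s * l2Inner Ω f f = l2Inner Ω f g ∧
      ∫⁻ x in Ω, ‖s • f x‖ₑ ^ 2 ≤ ∫⁻ x in Ω, ‖g x‖ₑ ^ 2 := by
  have hcs := l2Inner_sq_le hf hg
  have h0 : 0 ≤ l2Inner Ω f f := integral_nonneg fun _ => real_inner_self_nonneg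
  rcases h0.eq_or_lt with h | h
  · refine ⟨0, ?_, by simp⟩
    rw [← h, zero_mul] at hcs
    rw [zero_mul]
    exact (pow_eq_zero_iff two_ne_zero).1 (le_antisymm hcs (sq_nonneg _)) |>.symm
  · refine ⟨l2Inner Ω f g / l2Inner Ω f f, div_mul_cancel₀ _ h.ne', ?_⟩
    have e1 := lintegral_enorm_sq_eq_l2Inner (hf.const_smul (l2Inner Ω f g / l2Inner Ω f f))
    simp only [Pi.smul_apply] at e1
    rw [lintegral_enorm_sq_eq_l2Inner hg, e1]
    refine ENNReal.ofReal_le_ofReal ?_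
    have e : l2Inner Ω (fun x => (l2Inner Ω f g / l2Inner Ω f f) • f x)
        (fun x => (l2Inner Ω f g / l2Inner Ω f f) • f x) = l2Inner Ω f g ^ 2 / l2Inner Ω f f := by
      have e2 : ∀ s : ℝ, l2Inner Ω (fun x => s • f x) (fun x => s • f x) = s * (s * l2Inner Ω f f) :=
        fun s => by
          simp only [l2Inner, real_inner_smul_left, real_inner_smul_right, integral_const_mul]
      rw [e2]; field_simp
    change l2Inner Ω (fun x => (l2Inner Ω f g / l2Inner Ω f f) • f x)
        (fun x => (l2Inner Ω f g / l2Inner Ω f f) • f x) ≤ _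
    rw [e, div_le_iff₀ h]
    linarith

end L2

/-! ### The discrete test function. -/

namespace Mesh

variable {N : ℕ} {Ω : Set (Pt N)} {𝒯 : Mesh Ω}

/-- A discretely divergence-free test function which represents the action of `w` on `f` and is
stable in `L^∞` and `W^{1,4}`. -/
lemma exists_test_function (hN : N ≤ 3) (hΩ : IsConvexPolyhedralDomain Ω) {ρ : ℝ} (hρ : 0 < ρ) :
    ∃ C : ℝ≥0∞, C ≠ ∞ ∧ ∀ (𝒯 : Mesh Ω) (r : ℝ), 𝒯.Regular ρ r →
      ∀ (f w : Pt N → Pt N) (G : Pt N → (Pt N →L[ℝ] Pt N))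
        (H : Pt N → (Pt N →L[ℝ] (Pt N →L[ℝ] Pt N))),
      𝒯.MemVelocity f → MemH10Sigma Ω w → HasWeakHessian Ω w G H → h2Norm Ω w G H ≤ 1 →
      ∃ a : Pt N → Pt N, 𝒯.MemVelocity a ∧ l2Inner Ω f a = l2Inner Ω f w ∧
        (∀ x ∈ closure Ω, ‖a x‖ₑ ^ 2 ≤ C) ∧ ∫⁻ x in Ω, ‖fderiv ℝ a x‖ₑ ^ 4 ≤ C := by
  obtain ⟨C₁, hC₁, hP⟩ := exists_interp hN hΩ hρ
  obtain ⟨C₂, hC₂, hcorr⟩ := exists_quadratic_correction hΩ hρ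
  obtain ⟨C₃, hC₃, hinv⟩ := inverse_estimates hN hΩ
  set K : ℝ≥0∞ := 2 * (C₂ * C₁ + 2 * (C₁ + C₂ * C₁)) with hK
  have hKtop : K ≠ ∞ := by finiteness
  refine ⟨2 * (C₁ + C₃ * K) + 8 * (C₁ + C₃ * K ^ 2), by finiteness,
    fun 𝒯 r hR f w G H hf hw hWH hn => ?_⟩
  obtain ⟨n0, n1, n2⟩ := lintegral_sq_le_one_of_h2Norm_le hWH hn
  obtain ⟨P, hPcg, hPsup, hPw, hDP⟩ := hP 𝒯 r hR w G H hw hWH n0 n1 n2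
  have lP := hPcg.1.isLip hΩ.convex
  have lf := hf.isLip hΩ.convex
  have hwL := hWH.1.1
  have hPL := (lP.bm hΩ).memLp hΩ 2
  have hfL := (lf.bm hΩ).memLp hΩ 2
  set e : Pt N → Pt N := fun x => w x - P x with he
  have heL : MemLp e 2 (volume.restrict Ω) := hwL.sub hPL
  -- The bubble correction is made for the error `w - P`, so that `P + b₀` has the same integrals
  -- against pressure gradients as `w`.
  obtain ⟨b₀, hb₀q, hb₀0, hb₀d, hb₀n⟩ := hcorr 𝒯 r hR e heL
  have lb₀ := hb₀q.isLip hΩ.convex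
  have hb₀L := (lb₀.bm hΩ).memLp hΩ 2
  set τ := ENNReal.ofReal r with hτ
  have en : ∫⁻ x in Ω, ‖e x‖ₑ ^ 2 ≤ C₁ * τ ^ 4 := by
    refine le_trans (le_of_eq (lintegral_congr fun x => ?_)) hPw
    rw [he, enorm_sub_rev]
  have b₀n : ∫⁻ x in Ω, ‖b₀ x‖ₑ ^ 2 ≤ C₂ * C₁ * τ ^ 4 :=
    hb₀n.trans (by rw [mul_assoc]; exact mul_le_mul' le_rfl en)
  set g : Pt N → Pt N := fun x => e x - b₀ x with hg
  have hgL : MemLp g 2 (volume.restrict Ω) := heL.sub hb₀L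
  have gn : ∫⁻ x in Ω, ‖g x‖ₑ ^ 2 ≤ 2 * (C₁ + C₂ * C₁) * τ ^ 4 := by
    have h1 := lintegral_add_sq_le (fun x => -b₀ x) heL.1
    simp only [enorm_neg, ← sub_eq_add_neg] at h1
    refine h1.trans ?_
    rw [mul_assoc, add_mul]
    gcongr
  -- One scalar condition is left, the pairing with `f`. Adding a multiple of `f` keeps the
  -- divergence constraint, and the multiple, being the projection of a small remainder onto the
  -- line of `f`, is as small as the remainder however large `f` is.
  obtain ⟨s, hs, hsn⟩ := exists_projection_line hfL hgL
  set b : Pt N → Pt N := fun x => b₀ x + s • f x with hb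
  have hbq : 𝒯.IsQuadratic b := hb₀q.add (IsQuadratic.const_smul s hf.1)
  have lb := hbq.isLip hΩ.convex
  have bn : ∫⁻ x in Ω, ‖b x‖ₑ ^ 2 ≤ K * τ ^ 4 := by
    refine (lintegral_add_sq_le (fun x => s • f x) hb₀L.1).trans ?_
    rw [hK, mul_assoc, add_mul]
    gcongr
    exact hsn.trans gn
  obtain ⟨bsup, bD⟩ := hinv 𝒯 ρ r hR b K hbq bn
  set a : Pt N → Pt N := fun x => P x + b x with ha
  have haq : 𝒯.IsQuadratic a := IsQuadratic.add (fun i => (hPcg.1 i).mono one_le_two) hbq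
  have la := haq.isLip hΩ.convex
  have ha0 : ∀ x ∈ frontier Ω, a x = 0 := fun x hx => by
    simp only [ha, hb, hPcg.2 x hx, hb₀0 x hx, hf.2.1 x hx, smul_zero, add_zero]
  refine ⟨a, ⟨haq, ha0, fun q hq => ?_⟩, ?_, fun x hx => ?_, ?_⟩
  · have lq := hq.1.isLip hΩ.convex one_le_two
    have hDb := lq.bm_fderiv hΩ
    have hwi : Integrable (fun x => fderiv ℝ q x (w x)) (volume.restrict Ω) := by
      obtain ⟨hm, M, -, hM⟩ := hDb
      have : IsFiniteMeasure (volume.restrict Ω) :=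
        ⟨by rw [Measure.restrict_apply_univ]; exact hΩ.bounded.measure_lt_top⟩
      refine Integrable.mono' ((hwL.integrable one_le_two).norm.const_mul M)
        (ContinuousLinearMap.aestronglyMeasurable_comp₂ (ContinuousLinearMap.id ℝ _) hm hwL.1) ?_
      filter_upwards [ae_restrict_mem hΩ.isOpen.measurableSet] with x hx
      exact (ContinuousLinearMap.le_opNorm _ _).trans (by gcongr; exact hM x hx)
    have hi : ∀ {u : Pt N → Pt N}, IsLip Ω u →
        Integrable (fun x => fderiv ℝ q x (u x)) (volume.restrict Ω) := fun lu =>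
      (hDb.apply (lu.bm hΩ)).integrable hΩ
    have e1 : ∫ x in Ω, fderiv ℝ q x (f x) = 0 := by
      have := hf.2.2 q hq
      rw [integral_divergence_mul hΩ lf lq hf.2.1] at this
      linarith
    -- By construction of `b₀` the sum of the contributions of `P` and `b₀` is that of `w`, which
    -- vanishes because `w` is a limit of solenoidal test functions.
    have e2 : ∫ x in Ω, fderiv ℝ q x (b₀ x)
        = (∫ x in Ω, fderiv ℝ q x (w x)) - ∫ x in Ω, fderiv ℝ q x (P x) := by
      rw [hb₀d q hq.1, ← integral_sub hwi (hi lP)]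
      simp only [he, map_sub]
    have e3 : ∫ x in Ω, fderiv ℝ q x (a x) = (∫ x in Ω, fderiv ℝ q x (P x))
        + ((∫ x in Ω, fderiv ℝ q x (b₀ x)) + s * ∫ x in Ω, fderiv ℝ q x (f x)) := by
      simp only [ha, hb, map_add, map_smul, smul_eq_mul]
      have h2 : Integrable (fun x => fderiv ℝ q x (b₀ x) + s * fderiv ℝ q x (f x))
        (volume.restrict Ω) := (hi lb₀).add ((hi lf).const_mul s)
      rw [integral_add (hi lP) h2, integral_add (hi lb₀) ((hi lf).const_mul s), integral_const_mul]
    rw [integral_divergence_mul hΩ la lq ha0, e3, e2, e1, hw.integral_fderiv_eq_zero hΩ lq]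
    ring
  · have hi : ∀ {u : Pt N → Pt N}, MemLp u 2 (volume.restrict Ω) →
        Integrable (fun x => (inner ℝ (f x) (u x) : ℝ)) (volume.restrict Ω) := fun hu =>
      integrable_inner_of_memLp hfL hu
    have e1 : l2Inner Ω f g = l2Inner Ω f w - l2Inner Ω f P - l2Inner Ω f b₀ := by
      simp only [l2Inner, hg, he, inner_sub_right]
      have h2 : Integrable (fun x => (inner ℝ (f x) (w x) : ℝ) - inner ℝ (f x) (P x))
        (volume.restrict Ω) := (hi hwL).sub (hi hPL)
      rw [integral_sub h2 (hi hb₀L), integral_sub (hi hwL) (hi hPL)]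
    have e2 : l2Inner Ω f a = l2Inner Ω f P + (l2Inner Ω f b₀ + s * l2Inner Ω f f) := by
      simp only [l2Inner, ha, hb, inner_add_right, inner_smul_right]
      have h2 : Integrable (fun x => (inner ℝ (f x) (b₀ x) : ℝ) + s * inner ℝ (f x) (f x))
        (volume.restrict Ω) := (hi hb₀L).add ((hi hfL).const_mul s)
      rw [integral_add (hi hPL) h2, integral_add (hi hb₀L) ((hi hfL).const_mul s), integral_const_mul]
    rw [e2, hs, e1]; ring
  · refine le_trans ?_ le_self_add
    calc ‖a x‖ₑ ^ 2 ≤ (‖P x‖ₑ + ‖b x‖ₑ) ^ 2 := pow_le_pow_left' (enorm_add_le _ _) 2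
      _ ≤ 2 * (‖P x‖ₑ ^ 2 + ‖b x‖ₑ ^ 2) := ennreal_add_sq_le _ _
      _ ≤ _ := by gcongr; exacts [hPsup x hx, bsup x hx]
  · refine le_trans ?_ le_add_self
    calc ∫⁻ x in Ω, ‖fderiv ℝ a x‖ₑ ^ 4
        ≤ ∫⁻ x in Ω, 8 * (‖fderiv ℝ P x‖ₑ ^ 4 + ‖fderiv ℝ b x‖ₑ ^ 4) := by
          refine lintegral_mono_ae ?_
          filter_upwards [lP.ae_differentiableAt hΩ, lb.ae_differentiableAt hΩ] with x h1 h2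
          rw [ha, fderiv_fun_add h1 h2]
          exact (pow_le_pow_left' (enorm_add_le (fderiv ℝ P x) (fderiv ℝ b x)) 4).trans (ennreal_add_pow_four_le _ _)
      _ = 8 * ((∫⁻ x in Ω, ‖fderiv ℝ P x‖ₑ ^ 4) + ∫⁻ x in Ω, ‖fderiv ℝ b x‖ₑ ^ 4) := by
          rw [lintegral_const_mul' _ _ (by norm_num),
            lintegral_add_left' ((lP.bm_fderiv hΩ).1.enorm.pow_const 4)]
      _ ≤ _ := by gcongr

end Mesh

/-! ### Rate of change of the velocity. -/

section Holder

variable {N : ℕ} {Ω : Set (Pt N)} {F : Type*} [NormedAddCommGroup F] [NormedSpace ℝ F]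
  {G : Type*} [NormedAddCommGroup G] [NormedSpace ℝ G]

lemma integral_norm_mul_norm_le (hΩ : IsConvexPolyhedralDomain Ω) {f : Pt N → F} {g : Pt N → G}
    (hf : BM Ω f) (hg : BM Ω g) : ∫ x in Ω, ‖f x‖ * ‖g x‖
      ≤ Real.sqrt (∫ x in Ω, ‖f x‖ ^ 2) * Real.sqrt (∫ x in Ω, ‖g x‖ ^ 2) := by
  have h := l2Inner_sq_le (hf.norm.memLp hΩ 2) (hg.norm.memLp hΩ 2)
  have e : ∀ a b : ℝ, inner ℝ a b = a * b := fun a b => mul_comm _ _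
  simp only [l2Inner, e, ← sq] at h
  rw [← Real.sqrt_mul (integral_nonneg fun x => by positivity)]
  exact (le_abs_self _).trans (Real.abs_le_sqrt h)

lemma abs_integral_le_of_abs_le (hΩ : IsConvexPolyhedralDomain Ω) {f g : Pt N → ℝ} (hg : BM Ω g)
    (h : ∀ x ∈ Ω, |f x| ≤ g x) : |∫ x in Ω, f x| ≤ ∫ x in Ω, g x := by
  rw [← Real.norm_eq_abs]
  exact norm_integral_le_of_norm_le (hg.integrable hΩ)
    ((ae_restrict_iff' hΩ.isOpen.measurableSet).2 (.of_forall h))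

/-- The numerical inequality `t³ ≤ 1 + t⁴` trades the `L⁴` bound of the test gradient for the `L³`
bound required by Hölder's inequality. -/
lemma integral_norm_rpow_three_le (hΩ : IsConvexPolyhedralDomain Ω) {f : Pt N → F} (hf : BM Ω f)
    {C : ℝ≥0∞} (hC : C ≠ ∞) (h : ∫⁻ x in Ω, ‖f x‖ₑ ^ 4 ≤ C) :
    ∫ x in Ω, ‖f x‖ ^ (3 : ℝ) ≤ volume.real Ω + C.toReal := by
  have hi := (hf.norm_pow 4).integrable hΩ
  have h4 : ∫ x in Ω, ‖f x‖ ^ 4 ≤ C.toReal := by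
    refine (ENNReal.ofReal_le_iff_le_toReal hC).1 (le_trans (le_of_eq ?_) h)
    rw [ofReal_integral_eq_lintegral_ofReal hi (.of_forall fun x => by positivity)]
    exact lintegral_congr fun x => by rw [ENNReal.ofReal_pow (norm_nonneg _), ofReal_norm]
  have h1 : ∫ x in Ω, (1 + ‖f x‖ ^ 4) = volume.real Ω + ∫ x in Ω, ‖f x‖ ^ 4 := by
    rw [integral_add ((bm_const (1 : ℝ)).integrable hΩ) hi]; simp
  calc ∫ x in Ω, ‖f x‖ ^ (3 : ℝ) ≤ ∫ x in Ω, (1 + ‖f x‖ ^ 4) := by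
        refine integral_mono ((hf.norm_rpow (by norm_num)).integrable hΩ)
          (((bm_const (1 : ℝ)).integrable hΩ).add hi) fun x => ?_
        have h0 := norm_nonneg (f x)
        have e : ‖f x‖ ^ (3 : ℝ) = ‖f x‖ ^ 3 := by exact_mod_cast Real.rpow_natCast _ 3
        simp only [e]
        nlinarith [sq_nonneg (‖f x‖ ^ 2 - ‖f x‖), sq_nonneg (‖f x‖ - 1), sq_nonneg (‖f x‖ ^ 2),
          mul_nonneg h0 h0, sq_nonneg (‖f x‖ ^ 2 - 1)]
    _ ≤ _ := by rw [h1]; linarith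

end Holder

namespace Mesh

variable {N : ℕ} {Ω : Set (Pt N)} {𝒯 : Mesh Ω}

/-- The discrete time derivative must itself lie in `V_h`, since the test function is corrected by a
multiple of it. -/
lemma MemVelocity.smul_sub (hΩ : IsConvexPolyhedralDomain Ω) {v v' : Pt N → Pt N}
    (hv : 𝒯.MemVelocity v) (hv' : 𝒯.MemVelocity v') (c : ℝ) :
    𝒯.MemVelocity (fun x => c • (v x - v' x)) := by
  have lv := hv.isLip hΩ.convex
  have lv' := hv'.isLip hΩ.convex
  have h0 : ∀ x ∈ frontier Ω, c • (v x - v' x) = 0 := fun x hx => by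
    rw [hv.2.1 x hx, hv'.2.1 x hx, sub_zero, smul_zero]
  refine ⟨IsQuadratic.const_smul c fun i => (hv.1 i).sub (hv'.1 i), h0, fun q hq => ?_⟩
  have lq := hq.1.isLip hΩ.convex one_le_two
  have h1 := hv.2.2 q hq
  have h2 := hv'.2.2 q hq
  rw [integral_divergence_mul hΩ lv lq hv.2.1] at h1
  rw [integral_divergence_mul hΩ lv' lq hv'.2.1] at h2
  rw [integral_divergence_mul hΩ ((lv.sub lv').const_smul c) lq h0]
  simp only [map_smul, map_sub, smul_eq_mul]
  rw [integral_const_mul, integral_sub (((lq.bm_fderiv hΩ).apply (lv.bm hΩ)).integrable hΩ)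
    (((lq.bm_fderiv hΩ).apply (lv'.bm hΩ)).integrable hΩ), neg_eq_zero.1 h1, neg_eq_zero.1 h2]
  simp

set_option maxHeartbeats 1600000 in
/-- The discrete time derivative of the velocity is controlled by the dissipation. -/
lemma velocity_rate_le (hN : N = 2 ∨ N = 3) (hΩ : IsConvexPolyhedralDomain Ω) {μ ρ : ℝ} (hμ : 0 < μ)
    (hρ : 0 < ρ) : ∃ C : ℝ, 0 < C ∧ ∀ (𝒯 : Mesh Ω) (r k : ℝ) (v₀ d₀ v L : Pt N → Pt N),
      𝒯.Regular ρ r → 𝒯.MemVelocity v₀ → 𝒯.MemVelocity v → 𝒯.MemCG d₀ →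
      (∀ z ∈ 𝒯.nodes, ‖d₀ z‖ = 1) → (∀ a, 𝒯.MemVelocity a → 𝒯.MomentumEq μ k v₀ d₀ v L a) →
      dualH2Norm Ω (fun x => k⁻¹ • (v x - v₀ x)) ≤ ENNReal.ofReal
        (C * ((1 + Real.sqrt (l2Inner Ω v₀ v₀) + Real.sqrt (gradInner Ω d₀ d₀))
          * (Real.sqrt (gradInner Ω v v) + Real.sqrt (𝒯.lumped (fun y => cross (d₀ y) (L y))
            (fun y => cross (d₀ y) (L y)))))) := by
  obtain ⟨S, hS0, hS⟩ := sobolev_six_real hN hΩ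
  obtain ⟨C, hC, htest⟩ := exists_test_function (by omega) hΩ hρ
  set M : ℝ := Real.sqrt C.toReal with hM
  set D : ℝ := (volume.real Ω + C.toReal) ^ (1 / 3 : ℝ) with hD
  set A : ℝ := (volume.real Ω) ^ (1 / 6 : ℝ) with hA
  have hM0 : 0 ≤ M := Real.sqrt_nonneg _
  have hD0 : 0 ≤ D := by positivity
  have hA0 : 0 ≤ A := by positivity
  refine ⟨μ * (N * (A * D)) + M + S * D + 1, by positivity,
    fun 𝒯 r k v₀ d₀ v L hR hv₀ hv hd₀ hd₀1 hmom => ?_⟩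
  refine iSup_le fun w => iSup_le fun G => iSup_le fun H => iSup_le fun hw =>
    ENNReal.ofReal_le_ofReal ?_
  obtain ⟨a, ha, haw, hasup, haD⟩ :=
    htest 𝒯 r hR _ w G H (hv.smul_sub hΩ hv₀ k⁻¹) hw.1 hw.2.1 hw.2.2
  have lv := hv.isLip hΩ.convex
  have lv₀ := hv₀.isLip hΩ.convex
  have la := ha.isLip hΩ.convex
  have ld := hd₀.isLip hΩ.convex
  set I : Pt N → Pt 3 := 𝒯.interp (fun y => cross (d₀ y) (L y)) with hI
  have lI : IsLip Ω I := isLip_interp hΩ.convex _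
  set g := Real.sqrt (gradInner Ω v v) with hg
  set l := Real.sqrt (𝒯.lumped (fun y => cross (d₀ y) (L y)) (fun y => cross (d₀ y) (L y))) with hl
  set e := Real.sqrt (l2Inner Ω v₀ v₀) with he
  set E := Real.sqrt (gradInner Ω d₀ d₀) with hE
  have hg0 : 0 ≤ g := Real.sqrt_nonneg _
  have hl0 : 0 ≤ l := Real.sqrt_nonneg _
  have he0 : 0 ≤ e := Real.sqrt_nonneg _
  have hE0 : 0 ≤ E := Real.sqrt_nonneg _
  have aM : ∀ x ∈ Ω, ‖a x‖ ≤ M := fun x hx => by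
    refine Real.le_sqrt_of_sq_le ?_
    refine (ENNReal.ofReal_le_iff_le_toReal hC).1 ?_
    rw [ENNReal.ofReal_pow (norm_nonneg _), ofReal_norm]
    exact hasup x (subset_closure hx)
  have aD : (∫ x in Ω, ‖fderiv ℝ a x‖ ^ (3 : ℝ)) ^ (1 / 3 : ℝ) ≤ D :=
    Real.rpow_le_rpow (integral_nonneg fun x => by positivity)
      (integral_norm_rpow_three_le hΩ (la.bm_fderiv hΩ) hC haD) (by norm_num)
  have bDv := (lv.bm_fderiv hΩ).norm
  have bDa := (la.bm_fderiv hΩ).norm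
  have bDd := (ld.bm_fderiv hΩ).norm
  have bv := (lv.bm hΩ).norm
  have bv₀ := (lv₀.bm hΩ).norm
  have bI := (lI.bm hΩ).norm
  have sDv : Real.sqrt (∫ x in Ω, ‖fderiv ℝ v x‖ ^ 2) ≤ g :=
    Real.sqrt_le_sqrt (integral_norm_fderiv_sq_le hΩ lv)
  have sDd : Real.sqrt (∫ x in Ω, ‖fderiv ℝ d₀ x‖ ^ 2) ≤ E :=
    Real.sqrt_le_sqrt (integral_norm_fderiv_sq_le hΩ ld)
  have sv₀ : Real.sqrt (∫ x in Ω, ‖v₀ x‖ ^ 2) = e := by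
    rw [he, l2Inner]; simp only [real_inner_self_eq_norm_sq]
  have sI : Real.sqrt (∫ x in Ω, ‖I x‖ ^ 2) ≤ l := by
    have := l2Inner_interp_le_lumped (𝒯 := 𝒯) hΩ (fun y => cross (d₀ y) (L y))
    rw [l2Inner] at this
    simp only [real_inner_self_eq_norm_sq] at this
    exact Real.sqrt_le_sqrt this
  -- viscosity
  have t1 : |gradInner Ω v a| ≤ N * (g * (A * D)) := by
    -- With the constant `1` as the `L⁶` factor; this gives the power `A` of the volume.
    have hh := integral_holder_two_six_three hΩ bDv (bm_const (1 : ℝ)) bDa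
    simp only [norm_norm, norm_one, Real.one_rpow, one_mul] at hh
    have h1 : (∫ x in Ω, (1 : ℝ)) = volume.real Ω := by simp
    rw [h1] at hh
    have h2 : |gradInner Ω v a| ≤ ∫ x in Ω, N * (‖fderiv ℝ v x‖ * ‖fderiv ℝ a x‖) := by
      refine abs_integral_le_of_abs_le hΩ ((bDv.mul bDa).const_smul (N : ℝ)) fun x _ => ?_
      refine (Finset.abs_sum_le_sum_abs _ _).trans ?_
      have hu : ∀ i : Fin N, ‖(unit i : Pt N)‖ = 1 := fun i => by simp [unit]
      have : ∀ i ∈ Finset.univ, |inner ℝ (fderiv ℝ v x (unit i)) (fderiv ℝ a x (unit i))|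
          ≤ ‖fderiv ℝ v x‖ * ‖fderiv ℝ a x‖ := fun i _ => by
        refine (abs_real_inner_le_norm _ _).trans ?_
        gcongr
        · simpa [hu i] using (fderiv ℝ v x).le_opNorm (unit i)
        · simpa [hu i] using (fderiv ℝ a x).le_opNorm (unit i)
      refine (Finset.sum_le_card_nsmul _ _ _ this).trans (le_of_eq ?_)
      simp
    rw [integral_const_mul] at h2
    refine h2.trans ?_
    gcongr
    refine hh.trans ?_
    gcongr
  -- convection
  have t2 : |l2Inner Ω (fun x => fderiv ℝ v x (v₀ x)) a| ≤ M * (g * e) := by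
    have h2 : |l2Inner Ω (fun x => fderiv ℝ v x (v₀ x)) a|
        ≤ ∫ x in Ω, M * (‖fderiv ℝ v x‖ * ‖v₀ x‖) := by
      refine abs_integral_le_of_abs_le hΩ ((bDv.mul bv₀).const_smul M) fun x hx => ?_
      refine (abs_real_inner_le_norm _ _).trans ?_
      rw [mul_comm M]
      exact mul_le_mul ((fderiv ℝ v x).le_opNorm _) (aM x hx) (norm_nonneg _) (by positivity)
    rw [integral_const_mul] at h2
    refine h2.trans ?_
    gcongr
    refine (integral_norm_mul_norm_le hΩ (lv.bm_fderiv hΩ) (lv₀.bm hΩ)).trans ?_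
    rw [sv₀]
    gcongr
  have t3 : |l2Inner Ω v (fun x => fderiv ℝ a x (v₀ x))| ≤ e * (S * g * D) := by
    -- The only term where the test gradient meets two velocities: `v₀` is taken in `L²` from the
    -- energy, `v` in `L⁶` from the dissipation.
    have hh := integral_holder_two_six_three hΩ bv₀ bv bDa
    simp only [norm_norm] at hh
    have h2 : |l2Inner Ω v (fun x => fderiv ℝ a x (v₀ x))|
        ≤ ∫ x in Ω, ‖v₀ x‖ * (‖v x‖ * ‖fderiv ℝ a x‖) := by
      refine abs_integral_le_of_abs_le hΩ (bv₀.mul (bv.mul bDa)) fun x _ => ?_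
      refine (abs_real_inner_le_norm _ _).trans ?_
      calc ‖v x‖ * ‖fderiv ℝ a x (v₀ x)‖ ≤ ‖v x‖ * (‖fderiv ℝ a x‖ * ‖v₀ x‖) := by
            gcongr; exact (fderiv ℝ a x).le_opNorm _
        _ = _ := by ring
    refine h2.trans (hh.trans ?_)
    rw [sv₀]
    have := hS v lv hv.2.1
    gcongr
  -- elastic stress
  have t4 : |l2Inner Ω (fun x => cross3 (toThree (d₀ x)) (I x))
      (fun x => toThree (fderiv ℝ d₀ x (a x)))| ≤ M * (l * E) := by
    have h2 : |l2Inner Ω (fun x => cross3 (toThree (d₀ x)) (I x))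
        (fun x => toThree (fderiv ℝ d₀ x (a x)))|
        ≤ ∫ x in Ω, M * (‖I x‖ * ‖fderiv ℝ d₀ x‖) := by
      refine abs_integral_le_of_abs_le hΩ ((bI.mul bDd).const_smul M) fun x hx => ?_
      refine (abs_real_inner_le_norm _ _).trans ?_
      have hd1 : ‖d₀ x‖ ≤ 1 := by
        rw [← hd₀.eq_interp (subset_closure hx)]
        exact norm_interp_le (fun z hz => (hd₀1 z hz).le) (subset_closure hx)
      have h3 : ‖cross3 (toThree (d₀ x)) (I x)‖ ≤ ‖I x‖ := by
        refine (norm_cross3_le _ _).trans ?_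
        rw [norm_toThree hN]
        exact mul_le_of_le_one_left (norm_nonneg _) hd1
      have h4 : ‖toThree (fderiv ℝ d₀ x (a x))‖ ≤ ‖fderiv ℝ d₀ x‖ * M := by
        rw [norm_toThree hN]
        exact ((fderiv ℝ d₀ x).le_opNorm _).trans (by gcongr; exact aM x hx)
      calc _ ≤ ‖I x‖ * (‖fderiv ℝ d₀ x‖ * M) := by gcongr
        _ = _ := by ring
    rw [integral_const_mul] at h2
    refine h2.trans ?_
    gcongr
    exact (integral_norm_mul_norm_le hΩ (lI.bm hΩ) (ld.bm_fderiv hΩ)).trans (by gcongr)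
  have hm := hmom a ha
  unfold MomentumEq at hm
  -- The skew-symmetric form is essential: it removes the divergence of `v₀`, for which the energy
  -- gives no bound uniform in time.
  have hskew := convective_skew hΩ lv₀ lv la hv₀.2.1
  set T1 := gradInner Ω v a
  set T2 := l2Inner Ω (fun x => fderiv ℝ v x (v₀ x)) a
  set T3 := l2Inner Ω v (fun x => fderiv ℝ a x (v₀ x))
  set T4 := l2Inner Ω (fun x => cross3 (toThree (d₀ x)) (I x))
      (fun x => toThree (fderiv ℝ d₀ x (a x))) with hT4
  have hf : (∫ x in Ω, inner ℝ (k⁻¹ • (v x - v₀ x)) (w x))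
      = - (μ * T1) - 1 / 2 * (T2 - T3) + T4 := by
    change l2Inner Ω (fun x => k⁻¹ • (v x - v₀ x)) w = _
    rw [← haw]
    linarith
  have habs : |∫ x in Ω, inner ℝ (k⁻¹ • (v x - v₀ x)) (w x)|
      ≤ μ * (N * (g * (A * D))) + (M * (g * e) + e * (S * g * D)) + M * (l * E) := by
    rw [hf]
    have h1 : |μ * T1| ≤ μ * (N * (g * (A * D))) := by
      rw [abs_mul, abs_of_pos hμ]; gcongr
    rw [abs_le] at t2 t3 t4 h1 ⊢
    have p1 : 0 ≤ M * (g * e) := by positivity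
    have p2 : 0 ≤ e * (S * g * D) := by positivity
    constructor <;> linarith [t2.1, t2.2, t3.1, t3.2, t4.1, t4.2, h1.1, h1.2]
  refine habs.trans ?_
  -- Each product contains exactly one dissipation factor, `g` or `l`, and otherwise only energies
  -- bounded in time. The square of the bound is therefore summable in time.
  have q0 : g * (1 + e) + l * E ≤ (1 + e + E) * (g + l) := by
    nlinarith [mul_nonneg hg0 hE0, mul_nonneg hl0 he0]
  have q1 : g ≤ (1 + e + E) * (g + l) := by
    nlinarith [mul_nonneg hg0 hE0, mul_nonneg hl0 he0, mul_nonneg hg0 he0, mul_nonneg hl0 hE0]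
  have q2 : g * e + l * E ≤ (1 + e + E) * (g + l) := by linarith
  have q3 : g * e ≤ (1 + e + E) * (g + l) := by linarith [mul_nonneg hl0 hE0]
  set Q := (1 + e + E) * (g + l)
  have r1 : μ * (N * (A * D)) * g ≤ μ * (N * (A * D)) * Q :=
    mul_le_mul_of_nonneg_left q1 (by positivity)
  have r2 : M * (g * e + l * E) ≤ M * Q := mul_le_mul_of_nonneg_left q2 hM0
  have r3 : S * D * (g * e) ≤ S * D * Q := mul_le_mul_of_nonneg_left q3 (by positivity)
  have r4 : 0 ≤ Q := by positivity
  linarith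

end Mesh

/-! ### Summation in time. -/

lemma ofReal_mul_sum_sq_le {k A W : ℝ} (hk : 0 < k) (hA : 0 ≤ A) {n : ℕ} {F : ℕ → ℝ≥0∞}
    {X B : ℕ → ℝ} (hX : ∀ j < n, 0 ≤ X j) (hF : ∀ j < n, F j ≤ ENNReal.ofReal (X j))
    (hXB : ∀ j < n, X j ^ 2 ≤ A * B j) (hB : k * ∑ j ∈ Finset.range n, B j ≤ W) :
    ENNReal.ofReal k * ∑ j ∈ Finset.range n, F j ^ 2 ≤ ENNReal.ofReal (A * W) := by
  have h1 : ∑ j ∈ Finset.range n, F j ^ 2 ≤ ENNReal.ofReal (∑ j ∈ Finset.range n, X j ^ 2) := by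
    rw [ENNReal.ofReal_sum_of_nonneg fun j _ => sq_nonneg _]
    refine Finset.sum_le_sum fun j hj => ?_
    have hj' := Finset.mem_range.1 hj
    rw [ENNReal.ofReal_pow (hX j hj')]
    exact pow_le_pow_left' (hF j hj') 2
  refine (mul_le_mul' le_rfl h1).trans ?_
  rw [← ENNReal.ofReal_mul hk.le]
  refine ENNReal.ofReal_le_ofReal ?_
  have h2 : ∑ j ∈ Finset.range n, X j ^ 2 ≤ A * ∑ j ∈ Finset.range n, B j := by
    rw [Finset.mul_sum]
    exact Finset.sum_le_sum fun j hj => hXB j (Finset.mem_range.1 hj)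
  calc k * ∑ j ∈ Finset.range n, X j ^ 2 ≤ k * (A * ∑ j ∈ Finset.range n, B j) := by gcongr
    _ = A * (k * ∑ j ∈ Finset.range n, B j) := by ring
    _ ≤ A * W := by gcongr

namespace Mesh

variable {N : ℕ} {Ω : Set (Pt N)} {𝒯 : Mesh Ω}

/-- Energy bounds at the beginning of every time step, and the bound of the total dissipation. -/
lemma IsSchemeSolution.bounds (hΩ : IsConvexPolyhedralDomain Ω) (hac : 𝒯.IsWeaklyAcute) {μ k : ℝ}
    (hμ : 0 < μ) (hk : 0 < k) {vInit dInit : Pt N → Pt N} (hc : ContinuousOn dInit (closure Ω))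
    (h1 : ∀ᵐ x ∂(volume.restrict Ω), ‖dInit x‖ = 1) {n : ℕ} {v dt d L : ℕ → Pt N → Pt N}
    (hs : 𝒯.IsSchemeSolution μ k vInit dInit n v dt d L) {E : ℝ} (hE0 : 0 ≤ E)
    (hE : 1 / 2 * l2Inner Ω (v 0) (v 0) + 1 / 2 * gradInner Ω (d 0) (d 0) ≤ E) :
    (∀ j < n, l2Inner Ω (v j) (v j) ≤ 2 * E ∧ gradInner Ω (d j) (d j) ≤ 2 * E) ∧
      k * ∑ j ∈ Finset.range n, (gradInner Ω (v (j + 1)) (v (j + 1))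
        + 𝒯.lumped (fun y => cross (d j y) (L (j + 1) y)) (fun y => cross (d j y) (L (j + 1) y)))
      ≤ E / μ + E := by
  have hen := hs.energy hΩ hac hk hc h1
  have p0 : ∀ f : Pt N → Pt N, 0 ≤ l2Inner Ω f f := l2Inner_self_nonneg
  have p1 : ∀ f : Pt N → Pt N, 0 ≤ gradInner Ω f f := gradInner_self_nonneg
  have p2 : ∀ m : ℕ, 0 ≤ k * ∑ j ∈ Finset.range m, μ * gradInner Ω (v (j + 1)) (v (j + 1)) :=
    fun m => mul_nonneg hk.le (Finset.sum_nonneg fun j _ => mul_nonneg hμ.le (p1 _))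
  have p3 : ∀ m : ℕ, 0 ≤ k * ∑ j ∈ Finset.range m,
      𝒯.lumped (fun y => cross (d j y) (L (j + 1) y)) (fun y => cross (d j y) (L (j + 1) y)) :=
    fun m => mul_nonneg hk.le (Finset.sum_nonneg fun j _ => lumped_self_nonneg hΩ _)
  have p4 : ∀ m : ℕ, 0 ≤ 1 / 2 * ∑ j ∈ Finset.range m,
      gradInner Ω (fun x => dt (j + 1) x - d j x) (fun x => dt (j + 1) x - d j x) :=
    fun m => mul_nonneg (by norm_num) (Finset.sum_nonneg fun j _ => p1 _)
  have p5 : ∀ m : ℕ, 0 ≤ k ^ 2 / 2 * ∑ j ∈ Finset.range m,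
      l2Inner Ω (fun x => k⁻¹ • (v (j + 1) x - v j x)) (fun x => k⁻¹ • (v (j + 1) x - v j x)) :=
    fun m => mul_nonneg (by positivity) (Finset.sum_nonneg fun j _ => p0 _)
  refine ⟨fun j hj => ?_, ?_⟩
  · cases j with
    | zero => constructor <;> linarith [p0 (v 0), p1 (d 0)]
    | succ m =>
      -- The energy law controls `dt (m + 1)`; the bound for `d (m + 1)` follows since normalization
      -- lowers the Dirichlet energy.
      have hm := hen m (by omega)
      have hgr := (hs.directorFacts hΩ hk hc h1 m (by omega)).gradInner_le hΩ hac
      have := p0 (v (m + 1))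
      have := p1 (dt (m + 1))
      constructor <;> linarith [p2 (m + 1), p3 (m + 1), p4 (m + 1), p5 (m + 1)]
  · cases n with
    | zero => simp; positivity
    | succ m =>
      have hm := hen m (by omega)
      have q0 := p0 (v (m + 1))
      have q1 := p1 (dt (m + 1))
      rw [Finset.sum_add_distrib, mul_add]
      refine add_le_add ?_ ?_
      -- The viscosity multiplies the velocity gradient in the energy law, which explains the
      -- summand `E / μ`.
      · rw [le_div_iff₀ hμ]
        rw [← Finset.mul_sum] at hm
        have := p2 (m + 1)
        rw [← Finset.mul_sum] at this
        linarith [p3 (m + 1), p4 (m + 1), p5 (m + 1)]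
      · linarith [p2 (m + 1), p4 (m + 1), p5 (m + 1)]

end Mesh

end NematicFEM

end

/-! ### Assembly of the estimates. -/

theorem lemma3p5 {N : ℕ} (hN : N = 2 ∨ N = 3) (Ω : Set (Pt N)) (hΩ : IsConvexPolyhedralDomain Ω)
    (μ : ℝ) (hμ : 0 < μ) (ρ : ℝ) (hρ : 0 < ρ) (E₀ : ℝ) :
    ∃ C : ℝ, 0 < C ∧
      ∀ (k h : ℝ), 0 < k → 0 < h →
      ∀ 𝒯 : Mesh Ω, 𝒯.IsQuasiUniform ρ h → 𝒯.IsWeaklyAcute →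
      ∀ vInit dInit : Pt N → Pt N, MemH10Sigma Ω vInit → MemH2 Ω dInit →
        ContinuousOn dInit (closure Ω) → (∀ᵐ x ∂(volume.restrict Ω), ‖dInit x‖ = 1) →
      ∀ (n : ℕ) (v dt d L : ℕ → Pt N → Pt N), 1 ≤ n →
        𝒯.IsSchemeSolution μ k vInit dInit n v dt d L →
        1 / 2 * l2Inner Ω (v 0) (v 0) + 1 / 2 * gradInner Ω (d 0) (d 0) ≤ E₀ →
        -- discrete energy-dissipation inequality
        (1 / 2 * l2Inner Ω (v n) (v n) + 1 / 2 * gradInner Ω (dt n) (dt n)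
            + k * ∑ j ∈ Finset.range n, μ * gradInner Ω (v (j + 1)) (v (j + 1))
            + k * ∑ j ∈ Finset.range n,
                l2Inner Ω (𝒯.interp (fun y => cross (d j y) (L (j + 1) y)))
                  (𝒯.interp (fun y => cross (d j y) (L (j + 1) y)))
            + 1 / 2 * ∑ j ∈ Finset.range n,
                gradInner Ω (fun x => dt (j + 1) x - d j x) (fun x => dt (j + 1) x - d j x)
            + k ^ 2 / 2 * ∑ j ∈ Finset.range n,
                l2Inner Ω (fun x => k⁻¹ • (v (j + 1) x - v j x))
                  (fun x => k⁻¹ • (v (j + 1) x - v j x))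
          ≤ 1 / 2 * l2Inner Ω (v 0) (v 0) + 1 / 2 * gradInner Ω (d 0) (d 0)) ∧
        -- the normalization does not increase the Dirichlet energy
        gradInner Ω (d n) (d n) ≤ gradInner Ω (dt n) (dt n) ∧
        -- nodal unit-norm constraint
        (∀ z ∈ 𝒯.nodes, ‖d n z‖ = 1) ∧
        -- bounds of the discrete time derivatives
        ENNReal.ofReal k * ∑ j ∈ Finset.range n,
            eLpNorm (fun x => k⁻¹ • (dt (j + 1) x - d j x)) (3 / 2) (volume.restrict Ω) ^ 2
          ≤ ENNReal.ofReal C ∧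
        ENNReal.ofReal k * ∑ j ∈ Finset.range n,
            eLpNorm (fun x => k⁻¹ • (d (j + 1) x - d j x)) (3 / 2) (volume.restrict Ω) ^ 2
          ≤ ENNReal.ofReal C ∧
        ENNReal.ofReal k * ∑ j ∈ Finset.range n,
            dualH2Norm Ω (fun x => k⁻¹ • (v (j + 1) x - v j x)) ^ 2
          ≤ ENNReal.ofReal C := by
  obtain ⟨C₁, hC₁, hdir⟩ := Mesh.director_rate_le hN hΩ
  obtain ⟨C₂, hC₂, hvel⟩ := Mesh.velocity_rate_le hN hΩ hμ hρ
  -- A nonnegative bound is needed to form the constants, and `E₀` may be negative.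
  set E : ℝ := max E₀ 0 with hE
  have hE0 : 0 ≤ E := le_max_right _ _
  set R : ℝ := Real.sqrt (2 * E) with hR
  have hR0 : 0 ≤ R := Real.sqrt_nonneg _
  -- The factors for which the squared rates are at most `A₁ (g j + l j)` and `A₂ (g j + l j)`, by
  -- `(x + y)² ≤ 2 (x² + y²)`; the total of `k (g j + l j)` is at most `E / μ + E`.
  set A₁ : ℝ := 2 * C₁ ^ 2 * (R ^ 2 + 1) with hA₁
  set A₂ : ℝ := 2 * C₂ ^ 2 * (1 + R + R) ^ 2 with hA₂
  have hA₁0 : 0 ≤ A₁ := by positivity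
  have hA₂0 : 0 ≤ A₂ := by positivity
  have hW : 0 ≤ E / μ + E := by positivity
  refine ⟨A₁ * (E / μ + E) + A₂ * (E / μ + E) + 1, by positivity, ?_⟩
  intro k h hk hh 𝒯 hq hac vInit dInit _ _ hc h1 n v dt d L hn hs hE₀
  have hreg := hq.regular (by omega) hΩ hρ hh
  have hfacts := hs.directorFacts hΩ hk hc h1
  obtain ⟨hb, hsum⟩ := hs.bounds hΩ hac hμ hk hc h1 hE0 (hE₀.trans (le_max_left _ _))
  obtain ⟨m, rfl⟩ : ∃ m, n = m + 1 := ⟨n - 1, by omega⟩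
  set g : ℕ → ℝ := fun j => gradInner Ω (v (j + 1)) (v (j + 1)) with hg
  set l : ℕ → ℝ := fun j => 𝒯.lumped (fun y => cross (d j y) (L (j + 1) y))
    (fun y => cross (d j y) (L (j + 1) y)) with hl
  have hg0 : ∀ j, 0 ≤ g j := fun j => gradInner_self_nonneg _
  have hl0 : ∀ j, 0 ≤ l j := fun j => Mesh.lumped_self_nonneg hΩ _
  have hrate : ∀ j < m + 1, k⁻¹ * (𝒯.lumpedSum (fun x => dt (j + 1) x - d j x)) ^ (2 / 3 : ℝ)
      ≤ C₁ * (R * Real.sqrt (g j) + Real.sqrt (l j)) := fun j hj => by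
    refine (hdir 𝒯 k (v (j + 1)) (d j) (dt (j + 1)) (d (j + 1)) (L (j + 1)) hk
      (hs.velocity_mem j hj) (hfacts j hj) (hs.director j hj)).trans ?_
    gcongr
    exact Real.sqrt_le_sqrt (hb j hj).2
  have hX0 : ∀ j < m + 1, 0 ≤ C₁ * (R * Real.sqrt (g j) + Real.sqrt (l j)) := fun j _ => by
    positivity
  have hX : ∀ j < m + 1, (C₁ * (R * Real.sqrt (g j) + Real.sqrt (l j))) ^ 2
      ≤ A₁ * (g j + l j) := fun j _ => by
    have e1 := Real.sq_sqrt (hg0 j)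
    have e2 := Real.sq_sqrt (hl0 j)
    have e3 : (R * Real.sqrt (g j) + Real.sqrt (l j)) ^ 2 ≤ 2 * (R ^ 2 + 1) * (g j + l j) := by
      have := sq_nonneg (R * Real.sqrt (g j) - Real.sqrt (l j))
      have p1 := mul_nonneg (sq_nonneg R) (hl0 j)
      have e4 : (R * Real.sqrt (g j)) ^ 2 = R ^ 2 * g j := by rw [mul_pow, e1]
      nlinarith [hg0 j]
    calc _ = C₁ ^ 2 * (R * Real.sqrt (g j) + Real.sqrt (l j)) ^ 2 := mul_pow _ _ _
      _ ≤ C₁ ^ 2 * (2 * (R ^ 2 + 1) * (g j + l j)) := by gcongr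
      _ = _ := by rw [hA₁]; ring
  have hLp : ∀ j < m + 1, ∀ f : Pt N → Pt N, (∀ x ∈ Ω, f x = 𝒯.interp f x) →
      𝒯.lumpedSum f ≤ 𝒯.lumpedSum (fun x => dt (j + 1) x - d j x) →
      eLpNorm (fun x => k⁻¹ • f x) (3 / 2) (volume.restrict Ω)
        ≤ ENNReal.ofReal (C₁ * (R * Real.sqrt (g j) + Real.sqrt (l j))) := fun j hj f hf hle =>
    (Mesh.eLpNorm_three_halves_le hΩ hk hf hle).trans (ENNReal.ofReal_le_ofReal (hrate j hj))
  have hAW₁ : A₁ * (E / μ + E) ≤ A₁ * (E / μ + E) + A₂ * (E / μ + E) + 1 := by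
    linarith [mul_nonneg hA₂0 hW]
  have hAW₂ : A₂ * (E / μ + E) ≤ A₁ * (E / μ + E) + A₂ * (E / μ + E) + 1 := by
    linarith [mul_nonneg hA₁0 hW]
  refine ⟨?_, (hfacts m (by omega)).gradInner_le hΩ hac, (hfacts m (by omega)).norm_new,
    ?_, ?_, ?_⟩
  -- The energy law holds with the lumped dissipation, which dominates the `L²` norm of the
  -- interpolant.
  · refine le_trans ?_ (hs.energy hΩ hac hk hc h1 m (by omega))
    gcongr with j _
    exact Mesh.l2Inner_interp_le_lumped hΩ _
  · refine (ofReal_mul_sum_sq_le hk hA₁0 hX0 (fun j hj => ?_) hX hsum).trans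
      (ENNReal.ofReal_le_ofReal hAW₁)
    exact hLp j hj _ (fun x hx => (((hfacts j hj).memCG0_diff.1).eq_interp
      (subset_closure hx)).symm) le_rfl
  · refine (ofReal_mul_sum_sq_le hk hA₁0 hX0 (fun j hj => ?_) hX hsum).trans
      (ENNReal.ofReal_le_ofReal hAW₁)
    have hcg : 𝒯.MemCG (d (j + 1)) := by rw [(hfacts j hj).new_eq]; exact Mesh.memCG_interp _
    exact hLp j hj _ (fun x hx => ((hcg.sub (hfacts j hj).memCG_old).eq_interp
      (subset_closure hx)).symm) ((hfacts j hj).lumpedSum_le hΩ)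
  · refine (ofReal_mul_sum_sq_le hk hA₂0
      (X := fun j => C₂ * ((1 + R + R) * (Real.sqrt (g j) + Real.sqrt (l j))))
      (fun j _ => by positivity) (fun j hj => ?_) (fun j _ => ?_) hsum).trans
      (ENNReal.ofReal_le_ofReal hAW₂)
    · refine (hvel 𝒯 _ k (v j) (d j) (v (j + 1)) (L (j + 1)) hreg (hs.memVelocity j hj.le)
        (hs.velocity_mem j hj) (hfacts j hj).memCG_old (hfacts j hj).norm_old
        (hs.momentum j hj)).trans (ENNReal.ofReal_le_ofReal ?_)
      have b1 : Real.sqrt (l2Inner Ω (v j) (v j)) ≤ R := Real.sqrt_le_sqrt (hb j hj).1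
      have b2 : Real.sqrt (gradInner Ω (d j) (d j)) ≤ R := Real.sqrt_le_sqrt (hb j hj).2
      gcongr
    · have e1 := Real.sq_sqrt (hg0 j)
      have e2 := Real.sq_sqrt (hl0 j)
      have e3 : (Real.sqrt (g j) + Real.sqrt (l j)) ^ 2 ≤ 2 * (g j + l j) := by
        have := sq_nonneg (Real.sqrt (g j) - Real.sqrt (l j))
        nlinarith
      calc (C₂ * ((1 + R + R) * (Real.sqrt (g j) + Real.sqrt (l j)))) ^ 2
          = C₂ ^ 2 * (1 + R + R) ^ 2 * (Real.sqrt (g j) + Real.sqrt (l j)) ^ 2 := by ring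
        _ ≤ C₂ ^ 2 * (1 + R + R) ^ 2 * (2 * (g j + l j)) := by gcongr
        _ = _ := by rw [hA₂]; ring
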